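/- **Setting.** Let $1\le k<d$ and let $\mathrm{St}(k,d)=\{U\in\mathbb R^{d\times k}:U^\top U=I_k\}$, with the Frobenius inner product on $\mathbb R^{d\times k}$. Fix $\hat U\in\mathrm{St}(k,d)$, let $T=\{\xi:\hat U^\top\xi+\xi^\top\hat U=0\}$ be the tangent space at $\hat U$ and $N=T^\perp=\{\hat US:S=S^\top\}$ the normal space. Let $\pi(W)=W(W^\top W)^{-1/2}$ be the polar projection. Let $\phi:T\to\mathrm{St}(k,d)$ be a second-order retraction at $\hat U$, i.e. a smooth map with $\phi(\xi)=\hat U+\xi-\tfrac12\hat U\xi^\top\xi+O(\|\xi\|^3)$ as $\xi\to0$; assume that for some $\sigma>0$ the push-forward of $\mathcal N(0,\sigma^2 I_T)$ under $\phi$ has finite Kullback–Leibler divergence with respect to the uniform distribution (normalised Riemannian volume) on $\mathrm{St}(k,d)$. For a positive definite covariance operator $\Sigma_T$ on $T$ and a positive semidefinite one $\Sigma_N$ on $N$, put $\Sigma_A=\Sigma_T\oplus\Sigma_N$, and let $q_{\mathrm{tang}}$ be the push-forward of $\mathcal N(0,\Sigma_T)$ under $\phi$ and $q_{\mathrm{proj}}$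 the push-forward of $\mathcal N(\hat U,\Sigma_A)$ under $\pi$. For $\xi\in T$ and $\nu=\hat US\in N$ put $$\Delta(\xi,\nu)=-\xi S+\tfrac12\hat U\big(\hat U^\top\xi S-S\hat U^\top\xi\big),$$ and, with independent $\xi_T\sim\mathcal N(0,\Sigma_T)$ and $\xi_N\sim\mathcal N(0,\Sigma_N)$, $$\mathcal E(\Sigma_T,\Sigma_N)=\tfrac14\,\mathbb E\Big[\operatorname{tr}\big((\Sigma_T^{-1}\operatorname{Cov}(\Delta(\xi_T,\xi_N)\mid\xi_T))^2\big)\Big].$$ For $a>0$ and $M\in\mathbb R$ let $\mathcal L_{a,M}$ be the set of all $C^3$ functions $\ell:\mathbb R^{d\times k}\to\mathbb R$ such that $\ell(V)\ge\ell(\hat U)+a\|V-\hat U\|^2$ and $\|D^j\ell(V)\|\le M$ ($j=1,2,3$) for all $V\in\mathrm{St}(k,d)$. For $\ell\in\mathcal L_{a,M}$ and $\varepsilon>0$ let $p_{\mathrm{post}}$ be the distribution on $\mathrm{St}(k,d)$ with density proportional to $e^{-\ell/\varepsilon}$ with respect to the uniform distribution; $\hat U$ is its unique mode (MAP point), it is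 highly concentrated for small $\varepsilon$, and its negative log-density has a nondegenerate quadratic approximation at $\hat U$. **Theorem.** 1. $\Delta(\xi,\nu)\in T$, and $\pi(\hat U+\xi+\nu)=\hat U+\xi-\tfrac12\hat U\xi^\top\xi+\Delta(\xi,\nu)+O(\|(\xi,\nu)\|^3)$ as $(\xi,\nu)\to0$ in $T\times N$. 2. For all $\Sigma_T$ positive definite and $\Sigma_N$ positive semidefinite: $\operatorname{Var}\langle v,\xi_T+\Delta(\xi_T,\xi_N)\rangle\ge\operatorname{Var}\langle v,\xi_T\rangle$ for every $v\in T$, with strict inequality for some $v$ if $\Sigma_N\ne0$; moreover $\mathcal E(\Sigma_T,\Sigma_N)\ge0$, with equality if and only if $\Sigma_N=0$. 3. For all $a>0$ and $M$ there are constants $C,\delta>0$ (depending only on $k,d,\hat U,\phi,a,M$) such that for all $\ell\in\mathcal L_{a,M}$ and $\varepsilon>0$, with $\Sigma_T$ the inverse of the Riemannian Hessian of $-\log p_{\mathrm{post}}$ at $\hat U$, and for every positive semidefinite $\Sigma_N$, if $\|\Sigma_A\|\le\delta$ then $\mathrm{KL}(q_{\mathrm{tang}}\|p_{\mathrm{post}})<\infty$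 and $$\mathrm{KL}(q_{\mathrm{tang}}\|p_{\mathrm{post}})\le\mathrm{KL}(q_{\mathrm{proj}}\|p_{\mathrm{post}})-\mathcal E(\Sigma_T,\Sigma_N)+C\|\Sigma_A\|^{3/2};$$ if $\Sigma_N=0$, so that $\mathcal E=0$, then also $\mathrm{KL}(q_{\mathrm{proj}}\|p_{\mathrm{post}})\le\mathrm{KL}(q_{\mathrm{tang}}\|p_{\mathrm{post}})+C\|\Sigma_A\|^{3/2}$, i.e. equality holds up to the error term. -/

import Mathlib

open MeasureTheory ProbabilityTheory InformationTheory Matrix Asymptotics Topology Filter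
open scoped MatrixOrder ContDiff RealInnerProductSpace ENNReal

namespace StiefelKL

/-- The space `ℝ^{d×k}` of `d × k` real matrices with its Euclidean (Frobenius) inner product. -/
abbrev MatSpace (d k : ℕ) : Type := EuclideanSpace ℝ (Fin d × Fin k)

/-- Reading an element of `MatSpace d k` as a matrix. -/
def mat {d k : ℕ} : MatSpace d k ≃ₗ[ℝ] Matrix (Fin d) (Fin k) ℝ :=
  (WithLp.linearEquiv 2 ℝ (Fin d × Fin k → ℝ)).trans
    ((LinearEquiv.curry ℝ ℝ (Fin d) (Fin k)).trans (Matrix.ofLinearEquiv ℝ))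

@[simp] lemma mat_apply {d k : ℕ} (W : MatSpace d k) (i : Fin d) (j : Fin k) :
    mat W i j = W (i, j) := rfl

/-- The inner product of `MatSpace d k` is `tr (AᵀB)`. -/
lemma inner_eq_trace {d k : ℕ} (A B : MatSpace d k) :
    ⟪A, B⟫ = ((mat A)ᵀ * mat B).trace := by
  simp only [PiLp.inner_apply, Matrix.trace, Matrix.diag, Matrix.mul_apply, transpose_apply,
    mat_apply, Fintype.sum_prod_type]
  rw [Finset.sum_comm]
  simp [mul_comm]

/-- The Stiefel manifold `St(k,d)`: `d × k` matrices with orthonormal columns. -/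
def stiefel (d k : ℕ) : Set (MatSpace d k) := {U | (mat U)ᵀ * mat U = 1}

/-- The tangent space `T_U St(k,d) = {ξ : Uᵀξ + ξᵀU = 0}`. -/
def tangent {d k : ℕ} (U : MatSpace d k) : Submodule ℝ (MatSpace d k) where
  carrier := {ξ | (mat U)ᵀ * mat ξ + (mat ξ)ᵀ * mat U = 0}
  add_mem' := by
    intro a b ha hb
    simp only [Set.mem_ofPred_eq, map_add, Matrix.mul_add, transpose_add, Matrix.add_mul] at *
    rw [add_add_add_comm, ha, hb, add_zero]
  zero_mem' := by simp
  smul_mem' := by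
    intro c a ha
    simp only [Set.mem_ofPred_eq, map_smul, Matrix.mul_smul, transpose_smul, Matrix.smul_mul] at *
    rw [← smul_add, ha, smul_zero]

lemma mem_tangent {d k : ℕ} {U ξ : MatSpace d k} :
    ξ ∈ tangent U ↔ (mat U)ᵀ * mat ξ + (mat ξ)ᵀ * mat U = 0 := Iff.rfl

/-- The normal space `N_U St(k,d)`, the orthogonal complement of the tangent space. -/
noncomputable abbrev normal {d k : ℕ} (U : MatSpace d k) : Submodule ℝ (MatSpace d k) := (tangent U)ᗮ

/-- The symmetric matrix `S` of a normal vector `ν = U S`. -/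
def symPart {d k : ℕ} (U ν : MatSpace d k) : Matrix (Fin k) (Fin k) ℝ := (mat U)ᵀ * mat ν

lemma symPart_isSymm {d k : ℕ} {U : MatSpace d k} (hU : U ∈ stiefel d k) (ν : normal U) :
    (symPart U ν)ᵀ = symPart U ν := by
  set S := symPart U ν with hS
  have hU' : (mat U)ᵀ * mat U = 1 := hU
  set K : Matrix (Fin k) (Fin k) ℝ := S - Sᵀ with hK
  have hKt : Kᵀ = -K := by simp [hK]
  have hmem : mat.symm (mat U * K) ∈ tangent U := by
    rw [mem_tangent, LinearEquiv.apply_symm_apply, transpose_mul, ← Matrix.mul_assoc, hU',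
      Matrix.mul_assoc, hU', hKt]
    simp
  have h0 := (Submodule.mem_orthogonal _ _).1 ν.2 _ hmem
  rw [inner_eq_trace, LinearEquiv.apply_symm_apply, transpose_mul, Matrix.mul_assoc] at h0
  change (Kᵀ * S).trace = 0 at h0
  have h1 : (Kᵀ * Sᵀ).trace = -(Kᵀ * S).trace := by
    rw [← transpose_mul, Matrix.trace_transpose, Matrix.trace_mul_comm]
    rw [hKt]; simp
  have h2 : (Kᵀ * K).trace = 0 := by
    rw [show Kᵀ * K = Kᵀ * S - Kᵀ * Sᵀ by rw [hK, Matrix.mul_sub], Matrix.trace_sub, h1, h0]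
    simp
  have h3 : K = 0 := by
    rw [← conjTranspose_eq_transpose_of_trivial] at h2
    exact Matrix.trace_conjTranspose_mul_self_eq_zero_iff.1 h2
  exact (sub_eq_zero.1 h3).symm

/-- The polar projection `π(W) = W (WᵀW)^{-1/2}` (and `0` where `W` is rank deficient). -/
noncomputable def polar {d k : ℕ} (W : MatSpace d k) : MatSpace d k :=
  mat.symm (mat W * CFC.sqrt (((mat W)ᵀ * mat W)⁻¹))

/-- The second-order Taylor polynomial `U + ξ - ½ U ξᵀ ξ` of the exponential map at `U`. -/
noncomputable def secondOrder {d k : ℕ} (U ξ : MatSpace d k) : MatSpace d k :=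
  U + ξ - (1 / 2 : ℝ) • mat.symm (mat U * ((mat ξ)ᵀ * mat ξ))

/-- A smooth map `T_U St(k,d) → St(k,d)` agreeing with the exponential map at `U` to second
order. -/
structure IsSecondOrderRetraction {d k : ℕ} (U : MatSpace d k)
    (φ : tangent U → MatSpace d k) : Prop where
  smooth : ContDiff ℝ ∞ φ
  mem_stiefel : ∀ ξ, φ ξ ∈ stiefel d k
  expansion : (fun ξ : tangent U => φ ξ - secondOrder U ξ) =O[𝓝 0] fun ξ => ‖ξ‖ ^ 3

/-- `Δ(ξ,ν) = -ξS + ½ U (UᵀξS - S Uᵀξ)` where `ν = U S`, as a matrix. -/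
noncomputable def deltaMat {d k : ℕ} (U ξ ν : MatSpace d k) : Matrix (Fin d) (Fin k) ℝ :=
  -(mat ξ * symPart U ν) + (1 / 2 : ℝ) • (mat U *
    ((mat U)ᵀ * mat ξ * symPart U ν - symPart U ν * ((mat U)ᵀ * mat ξ)))

/-- `Δ(ξ,ν)` is a tangent vector. -/
lemma deltaMat_mem {d k : ℕ} {U : MatSpace d k} (hU : U ∈ stiefel d k) (ξ : tangent U)
    (ν : normal U) : mat.symm (deltaMat U ξ ν) ∈ tangent U := by
  have hU' : (mat U)ᵀ * mat U = 1 := hU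
  have hS := symPart_isSymm hU ν
  have hξ : (mat U)ᵀ * mat (ξ : MatSpace d k) + (mat (ξ : MatSpace d k))ᵀ * mat U = 0 := ξ.2
  set S := symPart U (ν : MatSpace d k) with hSdef
  set K := (mat U)ᵀ * mat (ξ : MatSpace d k) with hK
  have hKt : Kᵀ = -K := by
    rw [hK, transpose_mul, transpose_transpose]
    exact eq_neg_of_add_eq_zero_right hξ
  have key : (mat U)ᵀ * deltaMat U ξ ν = -(1 / 2 : ℝ) • (K * S + S * K) := by
    have e : (mat U)ᵀ * (mat U * (K * S - S * K)) = K * S - S * K := by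
      rw [← Matrix.mul_assoc, hU', Matrix.one_mul]
    have e2 : (mat U)ᵀ * (mat (ξ : MatSpace d k) * S) = K * S := by
      rw [← Matrix.mul_assoc]
    change (mat U)ᵀ * (-(mat (ξ : MatSpace d k) * S) +
      (1 / 2 : ℝ) • (mat U * (K * S - S * K))) = _
    rw [Matrix.mul_add, Matrix.mul_neg, Matrix.mul_smul, e, e2]
    module
  have hflip : (deltaMat U ξ ν)ᵀ * mat U = ((mat U)ᵀ * deltaMat U ξ ν)ᵀ := by
    rw [transpose_mul, transpose_transpose]
  rw [mem_tangent, LinearEquiv.apply_symm_apply, hflip, key, transpose_smul, transpose_add,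
    transpose_mul K S, transpose_mul S K, hKt, hS, Matrix.mul_neg, Matrix.neg_mul]
  module

/-- For fixed `ξ ∈ T_U`, the linear map `ν ↦ Δ(ξ,ν)` from the normal to the tangent space. -/
noncomputable def delta {d k : ℕ} {U : MatSpace d k} (hU : U ∈ stiefel d k) (ξ : tangent U) :
    normal U →L[ℝ] tangent U :=
  LinearMap.toContinuousLinearMap
    { toFun := fun ν => ⟨mat.symm (deltaMat U ξ ν), deltaMat_mem hU ξ ν⟩
      map_add' := by
        intro a b
        apply Subtype.ext
        simp only [Submodule.coe_add, ← map_add]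
        congr 1
        simp only [deltaMat, symPart, map_add, Matrix.mul_add, Matrix.add_mul,
          Matrix.mul_sub]
        module
      map_smul' := by
        intro c a
        apply Subtype.ext
        simp only [Submodule.coe_smul, ← map_smul, RingHom.id_apply]
        congr 1
        simp only [deltaMat, symPart, map_smul, Matrix.mul_smul,
          Matrix.smul_mul, Matrix.mul_sub]
        module }

section Gaussian

variable {F : Type*} [NormedAddCommGroup F] [InnerProductSpace ℝ F] [FiniteDimensional ℝ F]
  [MeasurableSpace F] [BorelSpace F]

/-- The centred Gaussian measure `N(0, A)` on a Euclidean space `F` with covariance operator `A`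
(a positive operator, possibly degenerate). -/
noncomputable def gaussian (A : F →L[ℝ] F) : Measure F :=
  (multivariateGaussian 0 (LinearMap.toMatrix (stdOrthonormalBasis ℝ F).toBasis
    (stdOrthonormalBasis ℝ F).toBasis (A : F →ₗ[ℝ] F))).map (stdOrthonormalBasis ℝ F).repr.symm

end Gaussian

/-- The block operator `Σ_T ⊕ Σ_N` on `ℝ^{d×k} = T_U ⊕ N_U`. -/
noncomputable def ambientCov {d k : ℕ} {U : MatSpace d k} (covT : tangent U →L[ℝ] tangent U)
    (covN : normal U →L[ℝ] normal U) : MatSpace d k →L[ℝ] MatSpace d k :=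
  (tangent U).subtypeL ∘L covT ∘L (tangent U).orthogonalProjectionOnto +
    (normal U).subtypeL ∘L covN ∘L (normal U).orthogonalProjectionOnto

/-- `q_tang`: the push-forward of `N(0, Σ_T)` on `T_U` under `φ`. -/
noncomputable def qTang {d k : ℕ} {U : MatSpace d k} (φ : tangent U → MatSpace d k)
    (covT : tangent U →L[ℝ] tangent U) : Measure (MatSpace d k) :=
  (gaussian covT).map φ

/-- `q_proj`: the polar projection of the ambient Gaussian `N(U, Σ_T ⊕ Σ_N)`. -/
noncomputable def qProj {d k : ℕ} (U : MatSpace d k) (covT : tangent U →L[ℝ] tangent U)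
    (covN : normal U →L[ℝ] normal U) : Measure (MatSpace d k) :=
  (gaussian (ambientCov covT covN)).map fun ζ => polar (U + ζ)

/-- The uniform distribution on `St(k,d)`, i.e. the normalised Riemannian volume, equivalently the
unique probability measure on `St(k,d)` invariant under `U ↦ Q U`, `Q` orthogonal. It is realised
as the law of the polar factor of a matrix with independent standard normal entries. -/
noncomputable def uniformStiefel (d k : ℕ) : Measure (MatSpace d k) :=
  (stdGaussian (MatSpace d k)).map polar

/-- The posterior on `St(k,d)` with density proportional to `exp (-ℓ(V)/ε)` with respect to the
uniform distribution. -/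
noncomputable def posterior {d k : ℕ} (ℓ : MatSpace d k → ℝ) (ε : ℝ) : Measure (MatSpace d k) :=
  (uniformStiefel d k).tilted fun V => -(ℓ V) / ε

/-- The Riemannian Hessian at `U` of the restriction of `ℓ` to `St(k,d)`, as a bilinear form:
`D²ℓ(U)[ξ,η] + Dℓ(U)[II(ξ,η)]`, with second fundamental form `II(ξ,η) = -½ U (ξᵀη + ηᵀξ)`. -/
noncomputable def riemHess {d k : ℕ} (ℓ : MatSpace d k → ℝ) (U ξ η : MatSpace d k) : ℝ :=
  iteratedFDeriv ℝ 2 ℓ U ![ξ, η] -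
    fderiv ℝ ℓ U ((1 / 2 : ℝ) • mat.symm (mat U * ((mat ξ)ᵀ * mat η + (mat η)ᵀ * mat ξ)))

/-- `Σ_T` is the inverse of the Riemannian Hessian at `U` of `-log p = ℓ/ε + const`. -/
def IsInverseHessian {d k : ℕ} (ℓ : MatSpace d k → ℝ) (ε : ℝ) (U : MatSpace d k)
    (covT : tangent U →L[ℝ] tangent U) : Prop :=
  ∀ ξ η : tangent U, riemHess ℓ U (covT ξ) η / ε = ⟪ξ, η⟫

/-- Potentials of concentrated posteriors with mode `U`: `C³`, with quadratic growth (constant `a`)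
away from `U` on `St(k,d)` and with derivatives of orders 1, 2, 3 bounded by `M` on `St(k,d)`. In
particular `U` is the unique minimiser (the MAP point) and is nondegenerate. -/
structure IsConcentratedPotential {d k : ℕ} (a M : ℝ) (U : MatSpace d k)
    (ℓ : MatSpace d k → ℝ) : Prop where
  contDiff : ContDiff ℝ 3 ℓ
  growth : ∀ V ∈ stiefel d k, ℓ U + a * ‖V - U‖ ^ 2 ≤ ℓ V
  bound : ∀ V ∈ stiefel d k, ∀ j ∈ Finset.Icc 1 3, ‖iteratedFDeriv ℝ j ℓ V‖ ≤ M

/-- The conditional covariance operator `Cov(Δ | ξ_T = ξ)` on `T_U`, where `Δ = Δ(ξ, ξ_N)` and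
`ξ_N ∼ N(0, Σ_N)` is independent of `ξ_T`. -/
noncomputable def condCov {d k : ℕ} {U : MatSpace d k} (hU : U ∈ stiefel d k)
    (covN : normal U →L[ℝ] normal U) (ξ : tangent U) : tangent U →L[ℝ] tangent U :=
  delta hU ξ ∘L covN ∘L ContinuousLinearMap.adjoint (delta hU ξ)

/-- The penalty `E(Σ_T,Σ_N) = ¼ 𝔼[tr((H Cov(Δ | ξ_T))²)]`, `H = Σ_T⁻¹`, `ξ_T ∼ N(0,Σ_T)`. -/
noncomputable def penalty {d k : ℕ} {U : MatSpace d k} (hU : U ∈ stiefel d k)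
    (covT : tangent U →L[ℝ] tangent U) (covN : normal U →L[ℝ] normal U) : ℝ :=
  (1 / 4) * ∫ ξ, LinearMap.trace ℝ (tangent U)
    (((ContinuousLinearMap.inverse covT ∘L condCov hU covN ξ) ^ 2 : tangent U →L[ℝ] tangent U) :
      tangent U →ₗ[ℝ] tangent U) ∂(gaussian covT)

/-- The tangential part `ξ_T` of an ambient perturbation `ζ`. -/
noncomputable def tanPart {d k : ℕ} (U ζ : MatSpace d k) : tangent U :=
  (tangent U).orthogonalProjectionOnto ζ

/-- The tangential coordinate `ξ_T + Δ(ξ_T, ξ_N)`, to second order, of the projected sample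
`π(U + ζ)`, where `ζ = ξ_T + ξ_N`. -/
noncomputable def projCoord {d k : ℕ} {U : MatSpace d k} (hU : U ∈ stiefel d k)
    (ζ : MatSpace d k) : tangent U :=
  tanPart U ζ + delta hU (tanPart U ζ) ((normal U).orthogonalProjectionOnto ζ)

end StiefelKL

/-!
# Tangential versus projected Gaussian approximations on the Stiefel manifold

Write `π` for the polar projection, `φ` for the retraction, `σ² = ‖Σ_T ⊕ Σ_N‖`, and let `p` be the
posterior at temperature `ε`; the Hessian bounds force `ε = O(σ²)`.

*Expansion.* The Gram matrix of `W = U + ξ + US` is `(1 + S + E)²` up to third order, with the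
explicit `E` of `gram_eq`. Square roots of positive definite matrices depend smoothly on the matrix
(inverse function theorem for `R ↦ R²`, whose derivative is the injective Lyapunov operator), so
the polar factor is `W (1 + S + E)⁻¹` up to third order (`polar_expansion`). The error is even
`O(‖ξ‖ max(‖ξ‖,‖ν‖)²)`, because `π(U + ν) = U`.

*Variance.* Given `ξ_T`, the discrepancy `Δ(ξ_T, ξ_N)` is a centred Gaussian with covariance
`Δ_ξ Σ_N Δ_ξ*`, which adds to the variance. Since `k < d`, there are tangent vectors `w uᵀ` with
`Uᵀw = 0`, and `Δ(w uᵀ, US) = -w (Su)ᵀ`; hence `Δ(·, ν) = 0` only for `ν = 0` (`exists_delta_ne_zero`).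
This gives the strict inequalities and the equality case, the penalty being the mean of
`¼ ‖Σ_T^{-1/2} Cov(Δ | ξ_T) Σ_T^{-1/2}‖²` (`exists_penalty_eq`).

*Divergences.* The penalty is of order `‖Σ_N‖² = O(σ⁴)`, hence below the error `C σ³`
(`exists_penalty_le`). It therefore suffices to show `KL(q_tang ‖ p) ≤ KL(q ‖ p) + C σ³`, where `q`
is the law of a map `G(ξ, ν)` of the two Gaussian variables that agrees with `φ(ξ + b(ξ, ν))` up to
third order, with `b` odd in `ν` and bounded by `‖ξ‖ ‖ν‖` (`exists_klDiv_qTang_le_klDiv_map`). For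
`G(ξ, ν) = π(U + ξ + ν)` and `b = Δ` this is the main inequality. If `Σ_N = 0`, then `q_proj` is
itself the law of the retraction `ξ ↦ π(U + ξ)`, so the reverse inequality is the same statement
with the roles of `φ` and `π` exchanged, with `b = 0`.

With `u = ε^{1/6}` put `B = {‖x‖ < u²}`, a ball which contains all but a superpolynomially small
part of the Gaussian mass. On `B` the retracted Gaussian has a density `exp F` with respect to `p`:
the change of variables in polar coordinates (`exists_lintegral_image`) gives the Jacobian of `φ`,
and `Σ_T⁻¹` cancels the quadratic part of the potential, so that `F` is a constant plus the cubic
error of the potential divided by `ε`, minus the logarithm of the Jacobian. Then, with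
`I = ∫_B F dN(0, Σ_T)`:

* `KL(q_tang ‖ p) ≤ I + O(ε²)` (`exists_klDiv_qTang_le`). The mass outside `B` is controlled by
  domination with a fixed Gaussian, whose image has finite divergence from the uniform
  distribution by assumption.
* `KL(q ‖ p) ≥ I - C σ³` (`exists_le_klDiv`). This is the Donsker-Varadhan inequality with the test
  function `F ∘ φ⁻¹` cut off outside `φ(B)`. By the expansion, `φ⁻¹(G(ξ, ν)) = ξ + b(ξ, ν)` up to
  third order, and in the resulting expansion of `F` the term linear in `b` has mean zero, because
  it is odd in `ν`.

For the reverse inequality `ξ ↦ π(U + ξ)` has to satisfy the assumption of finite divergence as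
well. Its inverse is Lipschitz with a constant of polynomial growth (`norm_sub_le_polar_sub`), so
its Jacobian is bounded below by an inverse polynomial and the pushed-forward Gaussian has a
bounded density (`klDiv_polar_ne_top`).
-/

/-! ### Gaussian measures with a covariance operator -/

namespace StiefelKL

section Gaussian

variable {F : Type*} [NormedAddCommGroup F] [InnerProductSpace ℝ F] [FiniteDimensional ℝ F]
  [MeasurableSpace F] [BorelSpace F]

/-- A Gaussian measure is the image of the standard one under a symmetric square root of its
covariance. -/
lemma exists_sqrt_gaussian {A : F →L[ℝ] F} (hA : A.IsPositive) :
    ∃ B : F →L[ℝ] F, (∀ x y, ⟪B x, y⟫ = ⟪x, B y⟫) ∧ B ∘L B = A ∧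
      gaussian A = (stdGaussian F).map B := by
  classical
  set b := stdOrthonormalBasis ℝ F
  set e := b.repr
  set m := LinearMap.toMatrix b.toBasis b.toBasis (A : F →ₗ[ℝ] F)
  have hm : m.PosSemidef :=
    (LinearMap.posSemidef_toMatrix_iff b).2 hA.toLinearMap
  set R := toEuclideanCLM (𝕜 := ℝ) (CFC.sqrt m)
  have hR : ∀ x y, ⟪R x, y⟫ = ⟪x, R y⟫ := fun x y => by
    have h : IsSelfAdjoint R := (CFC.sqrt_nonneg m).isSelfAdjoint.map _
    rw [← ContinuousLinearMap.adjoint_inner_right, h.adjoint_eq]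
  have hRR : R ∘L R = toEuclideanCLM (𝕜 := ℝ) m := by
    rw [← ContinuousLinearMap.mul_def, ← map_mul, CFC.sqrt_mul_sqrt_self _ hm.nonneg]
  refine ⟨(e.symm.toContinuousLinearEquiv : _ →L[ℝ] F) ∘L R ∘L
    (e.toContinuousLinearEquiv : F →L[ℝ] _), ?_, ?_, ?_⟩
  · intro x y
    simp only [ContinuousLinearMap.comp_apply, ContinuousLinearEquiv.coe_coe,
      LinearIsometryEquiv.coe_toContinuousLinearEquiv]
    rw [← e.inner_map_map, e.apply_symm_apply, hR, ← e.inner_map_map x, e.apply_symm_apply]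
  · ext x
    have h1 : R (R (e x)) = e (A x) := by
      rw [← ContinuousLinearMap.comp_apply, hRR]
      ext i
      have := congrFun (LinearMap.toMatrix_mulVec_repr b.toBasis b.toBasis (A : F →ₗ[ℝ] F) x) i
      rw [ofLp_toEuclideanCLM]
      simp only [ContinuousLinearMap.coe_coe] at this
      exact this
    simp [h1]
  · have h2 : stdGaussian F = (stdGaussian (EuclideanSpace ℝ (Fin (Module.finrank ℝ F)))).map e.symm :=
      (stdGaussian_map e.symm).symm
    rw [h2, Measure.map_map (by fun_prop) (by fun_prop), gaussian, multivariateGaussian,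
      Measure.map_map (by fun_prop) (by fun_prop)]
    congr 1
    ext x
    simp [e, b, R, m]

instance isProbabilityMeasure_gaussian (A : F →L[ℝ] F) : IsProbabilityMeasure (gaussian A) := by
  unfold gaussian
  exact Measure.isProbabilityMeasure_map (by fun_prop)

lemma charFun_gaussian {A : F →L[ℝ] F} (hA : A.IsPositive) (t : F) :
    charFun (gaussian A) t = Complex.exp (-(⟪t, A t⟫ : ℝ) / 2) := by
  obtain ⟨B, hB, rfl, h⟩ := exists_sqrt_gaussian hA
  have h1 : charFun (gaussian (B ∘L B)) t = charFun (stdGaussian F) (B t) := by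
    rw [h, charFun_apply, charFun_apply, integral_map (by fun_prop)
      (Measurable.aestronglyMeasurable (by fun_prop))]
    simp_rw [hB]
  rw [h1, charFun_stdGaussian]
  congr 2
  rw [ContinuousLinearMap.comp_apply, ← hB, real_inner_self_eq_norm_sq]
  push_cast; ring

/-- All moments of a Gaussian measure scale like powers of the operator norm of its covariance. -/
lemma gaussian_moment (m : ℕ) : ∃ C : ℝ, 0 < C ∧ ∀ A : F →L[ℝ] F, A.IsPositive →
    Integrable (fun x => ‖x‖ ^ m) (gaussian A) ∧
      ∫ x, ‖x‖ ^ m ∂(gaussian A) ≤ C * √‖A‖ ^ m := by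
  have hint : Integrable (fun x : F => ‖x‖ ^ m) (stdGaussian F) := by
    rcases Nat.eq_zero_or_pos m with rfl | hm
    · simp
    have := (IsGaussian.memLp_id (stdGaussian F) (m : ℝ≥0∞) (by simp)).integrable_norm_pow hm.ne'
    simpa using this
  refine ⟨∫ x, ‖x‖ ^ m ∂(stdGaussian F) + 1, by positivity, fun A hA => ?_⟩
  obtain ⟨B, hB, hBB, h⟩ := exists_sqrt_gaussian hA
  have hn : ‖B‖ = √‖A‖ := by
    have hs : ContinuousLinearMap.adjoint B = B := by
      refine ContinuousLinearMap.ext fun x => ext_inner_right ℝ fun y => ?_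
      rw [ContinuousLinearMap.adjoint_inner_left, hB]
    have := ContinuousLinearMap.norm_adjoint_comp_self B
    rw [hs, hBB] at this
    rw [this, Real.sqrt_mul_self (norm_nonneg _)]
  have hle : ∀ x, ‖B x‖ ^ m ≤ √‖A‖ ^ m * ‖x‖ ^ m := fun x => by
    rw [← mul_pow, ← hn]; gcongr; exact B.le_opNorm x
  have hmeas : AEStronglyMeasurable (fun x : F => ‖x‖ ^ m) ((stdGaussian F).map B) :=
    Continuous.aestronglyMeasurable (by fun_prop)
  have hi2 : Integrable (fun x => ‖B x‖ ^ m) (stdGaussian F) := by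
    refine (hint.const_mul (√‖A‖ ^ m)).mono' (Continuous.aestronglyMeasurable (by fun_prop))
      (Eventually.of_forall fun x => ?_)
    rw [Real.norm_of_nonneg (by positivity)]; exact hle x
  rw [h]
  refine ⟨(integrable_map_measure hmeas (by fun_prop)).2 hi2, ?_⟩
  rw [integral_map (by fun_prop) hmeas]
  calc ∫ x, ‖B x‖ ^ m ∂(stdGaussian F) ≤ ∫ x, √‖A‖ ^ m * ‖x‖ ^ m ∂(stdGaussian F) :=
        integral_mono hi2 (hint.const_mul _) hle
    _ = (∫ x, ‖x‖ ^ m ∂(stdGaussian F)) * √‖A‖ ^ m := by rw [integral_const_mul]; ring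
    _ ≤ _ := by gcongr; linarith

lemma gaussian_map_neg {A : F →L[ℝ] F} (hA : A.IsPositive) :
    (gaussian A).map (fun x => -x) = gaussian A := by
  have : IsProbabilityMeasure ((gaussian A).map (fun x => -x)) :=
    Measure.isProbabilityMeasure_map (by fun_prop)
  refine Measure.ext_of_charFun (funext fun t => ?_)
  rw [charFun_gaussian hA, charFun_apply, integral_map (by fun_prop)
      (Measurable.aestronglyMeasurable (by fun_prop))]
  have : ∀ x : F, (⟪-x, t⟫ : ℝ) = ⟪x, -t⟫ := fun x => by simp
  simp_rw [this]
  rw [← charFun_apply, charFun_gaussian hA]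
  simp

/-- The density of the standard Gaussian measure. -/
lemma stdGaussian_eq_withDensity : ∃ c : ℝ, 0 < c ∧ stdGaussian F =
    volume.withDensity fun x => ENNReal.ofReal (c * Real.exp (-‖x‖ ^ 2 / 2)) := by
  set n := Module.finrank ℝ F
  set I : ℝ := (Real.pi / (1 / 2)) ^ ((n : ℝ) / 2) with hI
  have hIpos : 0 < I := by positivity
  have hint : ∫ x : F, Real.exp (-(1 / 2) * ‖x‖ ^ 2) = I :=
    GaussianFourier.integral_rexp_neg_mul_sq_norm (by norm_num)
  have hint' : Integrable (fun x : F => Real.exp (-(1 / 2) * ‖x‖ ^ 2)) := by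
    by_contra hcon
    rw [integral_undef hcon] at hint
    exact hIpos.ne hint
  have hfun : ∀ x : F, I⁻¹ * Real.exp (-‖x‖ ^ 2 / 2) =
      I⁻¹ * Real.exp (-(1 / 2) * ‖x‖ ^ 2) := fun x => by congr 2; ring
  have hprob : IsProbabilityMeasure ((volume : Measure F).withDensity
      fun x => ENNReal.ofReal (I⁻¹ * Real.exp (-‖x‖ ^ 2 / 2))) := by
    refine ⟨?_⟩
    simp_rw [hfun]
    rw [withDensity_apply _ .univ, Measure.restrict_univ, ← ofReal_integral_eq_lintegral_ofReal (hint'.const_mul _)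
      (Eventually.of_forall fun x => by positivity), integral_const_mul, hint,
      inv_mul_cancel₀ hIpos.ne', ENNReal.ofReal_one]
  refine ⟨I⁻¹, by positivity, Measure.ext_of_charFun (funext fun t => ?_)⟩
  rw [charFun_stdGaussian, charFun_apply,
    integral_withDensity_eq_integral_toReal_smul (by fun_prop) (by simp)]
  have h1 := GaussianFourier.integral_cexp_neg_mul_sq_norm_add (V := F) (b := 1 / 2)
    (by norm_num) Complex.I t
  have h2 : ∀ x : F, (ENNReal.ofReal (I⁻¹ * Real.exp (-‖x‖ ^ 2 / 2))).toReal •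
      Complex.exp ((⟪x, t⟫ : ℝ) * Complex.I) =
      (I⁻¹ : ℂ) * Complex.exp (-(1 / 2) * (‖x‖ : ℂ) ^ 2 + Complex.I * (⟪t, x⟫ : ℝ)) := fun x => by
    rw [ENNReal.toReal_ofReal (by positivity), hfun, Complex.exp_add, Complex.real_smul,
      real_inner_comm]
    push_cast
    ring_nf
  simp_rw [h2]
  rw [integral_const_mul, h1]
  have h3 : ((Real.pi : ℂ) / (1 / 2)) ^ ((n : ℂ) / 2) = (I : ℂ) := by
    rw [hI, Complex.ofReal_cpow (by positivity)]
    push_cast; rfl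
  rw [h3, ← mul_assoc, inv_mul_cancel₀ (by exact_mod_cast hIpos.ne'), one_mul, Complex.I_sq]
  congr 1; ring

/-- The density of a nondegenerate Gaussian measure; `q` is the quadratic form of the inverse of the
covariance operator. -/
lemma gaussian_eq_withDensity {A : F →L[ℝ] F} (hA : A.IsPositive) (hinj : Function.Injective A)
    {q : F → ℝ} (hq : Continuous q) (hqA : ∀ x, q (A x) = ⟪x, A x⟫) :
    ∃ c : ℝ, 0 < c ∧ gaussian A =
      volume.withDensity fun x => ENNReal.ofReal (c * Real.exp (-q x / 2)) := by
  obtain ⟨B, hB, hBB, h⟩ := exists_sqrt_gaussian hA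
  have hBinj : Function.Injective B := fun x y hxy => hinj (by
    rw [← hBB]; simp [hxy])
  have hBsurj : Function.Surjective B :=
    (LinearMap.injective_iff_surjective (f := (B : F →ₗ[ℝ] F))).1 hBinj
  have hqB : ∀ x, q (B x) = ‖x‖ ^ 2 := fun x => by
    obtain ⟨y, rfl⟩ := hBsurj x
    rw [show B (B y) = A y by rw [← hBB]; rfl, hqA, ← hBB, ContinuousLinearMap.comp_apply, ← hB,
      real_inner_self_eq_norm_sq]
  have hdet : LinearMap.det (B : F →ₗ[ℝ] F) ≠ 0 :=
    (LinearEquiv.isUnit_det' (LinearEquiv.ofBijective (B : F →ₗ[ℝ] F) ⟨hBinj, hBsurj⟩)).ne_zero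
  obtain ⟨c, hc, hstd⟩ := stdGaussian_eq_withDensity (F := F)
  set D := |(LinearMap.det (B : F →ₗ[ℝ] F))⁻¹| with hD
  have hDpos : 0 < D := abs_pos.2 (inv_ne_zero hdet)
  have hmapvol := Measure.map_linearMap_addHaar_eq_smul_addHaar (volume : Measure F) hdet
  refine ⟨c * D, by positivity, Measure.ext_of_lintegral _ fun g hg => ?_⟩
  rw [h, lintegral_map hg (by fun_prop), hstd,
    lintegral_withDensity_eq_lintegral_mul _ (by fun_prop) (by fun_prop),
    lintegral_withDensity_eq_lintegral_mul _ (by fun_prop) (by fun_prop)]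
  have h1 : ∫⁻ x : F, ENNReal.ofReal (c * Real.exp (-q (B x) / 2)) * g (B x) =
      ∫⁻ y, ENNReal.ofReal (c * Real.exp (-q y / 2)) * g y
        ∂((volume : Measure F).map (B : F →ₗ[ℝ] F)) := by
    rw [lintegral_map (by fun_prop) (by exact B.continuous.measurable)]
    rfl
  simp only [Pi.mul_apply]
  simp_rw [hqB] at h1
  rw [h1, hmapvol, lintegral_smul_measure, smul_eq_mul, ← lintegral_const_mul _ (by fun_prop)]
  refine lintegral_congr fun y => ?_
  rw [← mul_assoc, ← ENNReal.ofReal_mul hDpos.le]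
  congr 2; ring

end Gaussian

end StiefelKL

/-! ### The polar factor and its smoothness -/

namespace StiefelKL

section Sqrt

variable {k : ℕ}

/-- A positive definite matrix has a positive definite square root. -/
lemma exists_posDef_sq {A : Matrix (Fin k) (Fin k) ℝ} (hA : A.PosDef) :
    ∃ R : Matrix (Fin k) (Fin k) ℝ, R.PosDef ∧ R * R = A := by
  have h2 := CFC.sqrt_mul_sqrt_self A hA.posSemidef.nonneg
  refine ⟨CFC.sqrt A, ?_, h2⟩
  have h1 : (CFC.sqrt A).PosSemidef := (CFC.sqrt_nonneg A).posSemidef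
  rw [h1.posDef_iff_det_ne_zero]
  intro h0
  apply hA.det_pos.ne'
  rw [← h2, Matrix.det_mul, h0, zero_mul]

lemma posDef_transpose {R : Matrix (Fin k) (Fin k) ℝ} (hR : R.PosDef) : Rᵀ = R := by
  have := hR.isHermitian.eq
  rwa [conjTranspose_eq_transpose_of_trivial] at this

lemma posDef_inv_mul {R : Matrix (Fin k) (Fin k) ℝ} (hR : R.PosDef) : R⁻¹ * R = 1 :=
  Matrix.nonsing_inv_mul _ hR.det_pos.ne'.isUnit

lemma posDef_mul_inv {R : Matrix (Fin k) (Fin k) ℝ} (hR : R.PosDef) : R * R⁻¹ = 1 :=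
  Matrix.mul_nonsing_inv _ hR.det_pos.ne'.isUnit

lemma posDef_gram {m : ℕ} {W : Matrix (Fin m) (Fin k) ℝ} (h : (Wᵀ * W).det ≠ 0) :
    (Wᵀ * W).PosDef := by
  have h1 : (Wᵀ * W).PosSemidef := by
    rw [← conjTranspose_eq_transpose_of_trivial]
    exact Matrix.posSemidef_conjTranspose_mul_self W
  exact h1.posDef_iff_det_ne_zero.2 h

/-- The Lyapunov operator `X ↦ R X + X R` of a positive definite matrix is injective. -/
lemma lyapunov_injective {R X : Matrix (Fin k) (Fin k) ℝ} (hR : R.PosDef)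
    (h : R * X + X * R = 0) : X = 0 := by
  obtain ⟨B, hB, hBB⟩ := exists_posDef_sq hR
  have hBt := posDef_transpose hB
  have h1 : ((B * X)ᵀ * (B * X)).trace + ((X * B) * (X * B)ᵀ).trace = 0 := by
    have : ((B * X)ᵀ * (B * X)).trace + ((X * B) * (X * B)ᵀ).trace =
        (Xᵀ * (R * X + X * R)).trace := by
      rw [Matrix.mul_add, Matrix.trace_add, transpose_mul, transpose_mul, hBt]
      congr 1
      · simp only [← hBB, Matrix.mul_assoc]
      · rw [Matrix.trace_mul_comm Xᵀ]
        simp only [← hBB, Matrix.mul_assoc]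
    rw [this, h]; simp
  have h2 : 0 ≤ ((B * X)ᵀ * (B * X)).trace := by
    rw [← conjTranspose_eq_transpose_of_trivial]
    exact (Matrix.posSemidef_conjTranspose_mul_self _).trace_nonneg
  have h3 : 0 ≤ ((X * B) * (X * B)ᵀ).trace := by
    rw [← conjTranspose_eq_transpose_of_trivial]
    exact (Matrix.posSemidef_self_mul_conjTranspose _).trace_nonneg
  have h4 : ((B * X)ᵀ * (B * X)).trace = 0 := by linarith
  rw [← conjTranspose_eq_transpose_of_trivial,
    Matrix.trace_conjTranspose_mul_self_eq_zero_iff] at h4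
  calc X = B⁻¹ * (B * X) := by rw [← Matrix.mul_assoc, posDef_inv_mul hB, Matrix.one_mul]
    _ = 0 := by rw [h4, Matrix.mul_zero]

end Sqrt

section Polar

variable {d k : ℕ}

/-- The polar factor is characterised by the polar decomposition. -/
lemma polar_eq {V W : MatSpace d k} {R : Matrix (Fin k) (Fin k) ℝ} (hV : V ∈ stiefel d k)
    (hR : R.PosDef) (h : mat W = mat V * R) : polar W = V := by
  have hV' : (mat V)ᵀ * mat V = 1 := hV
  have h1 : (mat W)ᵀ * mat W = R * R := by
    rw [h, transpose_mul, posDef_transpose hR, Matrix.mul_assoc, ← Matrix.mul_assoc _ _ R, hV',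
      Matrix.one_mul]
  have h2 : CFC.sqrt (((mat W)ᵀ * mat W)⁻¹) = R⁻¹ := by
    refine CFC.sqrt_unique ?_ hR.inv.posSemidef.nonneg
    rw [h1, Matrix.mul_inv_rev]
  rw [polar, h2, h, Matrix.mul_assoc, posDef_mul_inv hR, Matrix.mul_one,
    LinearEquiv.symm_apply_apply]

/-- The polar factor in terms of a positive definite square root of `WᵀW`. -/
lemma polar_of_sq {W : MatSpace d k} {R : Matrix (Fin k) (Fin k) ℝ} (hR : R.PosDef)
    (h : R * R = (mat W)ᵀ * mat W) :
    polar W = mat.symm (mat W * R⁻¹) ∧ polar W ∈ stiefel d k ∧ mat W = mat (polar W) * R := by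
  have hst : mat.symm (mat W * R⁻¹) ∈ stiefel d k := by
    change (mat (mat.symm (mat W * R⁻¹)))ᵀ * mat (mat.symm (mat W * R⁻¹)) = 1
    rw [LinearEquiv.apply_symm_apply, transpose_mul, posDef_transpose hR.inv, Matrix.mul_assoc,
      ← Matrix.mul_assoc _ (mat W), ← h, Matrix.mul_assoc R, posDef_mul_inv hR, Matrix.mul_one,
      posDef_inv_mul hR]
  have he : mat W = mat (mat.symm (mat W * R⁻¹)) * R := by
    rw [LinearEquiv.apply_symm_apply, Matrix.mul_assoc, posDef_inv_mul hR, Matrix.mul_one]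
  have hp := polar_eq hst hR he
  exact ⟨hp, hp ▸ hst, hp ▸ he⟩

lemma exists_polar_decomp {W : MatSpace d k} (hW : ((mat W)ᵀ * mat W).det ≠ 0) :
    ∃ R : Matrix (Fin k) (Fin k) ℝ, R.PosDef ∧ R * R = (mat W)ᵀ * mat W ∧
      polar W ∈ stiefel d k ∧ mat W = mat (polar W) * R := by
  obtain ⟨R, hR, h⟩ := exists_posDef_sq (posDef_gram hW)
  exact ⟨R, hR, h, (polar_of_sq hR h).2⟩

lemma polar_of_mem {V : MatSpace d k} (hV : V ∈ stiefel d k) : polar V = V :=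
  polar_eq hV Matrix.PosDef.one (by rw [Matrix.mul_one])

end Polar

open scoped Matrix.Norms.Frobenius

section SmoothSqrt

variable {k : ℕ}

/-- Near a positive definite matrix `R * R`, the square root of symmetric matrices is given by a
smooth map, a local inverse of `X ↦ X * X`. -/
lemma exists_smooth_symm_sqrt {R : Matrix (Fin k) (Fin k) ℝ} (hR : R.PosDef) :
    ∃ g : Matrix (Fin k) (Fin k) ℝ → Matrix (Fin k) (Fin k) ℝ,
      ContDiffAt ℝ ∞ g (R * R) ∧ g (R * R) = R ∧ (∀ᶠ X in 𝓝 R, g (X * X) = X) ∧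
      (∀ᶠ A in 𝓝 (R * R), Aᵀ = A → (g A)ᵀ = g A ∧ g A * g A = A) := by
  set f : Matrix (Fin k) (Fin k) ℝ → Matrix (Fin k) (Fin k) ℝ := fun X => X * X
  have hf : ContDiff ℝ ∞ f := contDiff_id.mul contDiff_id
  let L : Matrix (Fin k) (Fin k) ℝ →ₗ[ℝ] Matrix (Fin k) (Fin k) ℝ :=
    LinearMap.mulLeft ℝ R + LinearMap.mulRight ℝ R
  have hL : Function.Injective L := by
    rw [← LinearMap.ker_eq_bot, LinearMap.ker_eq_bot']
    intro X hX
    exact lyapunov_injective hR (by simpa [L] using hX)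
  let e : Matrix (Fin k) (Fin k) ℝ ≃L[ℝ] Matrix (Fin k) (Fin k) ℝ :=
    (LinearEquiv.ofInjectiveEndo L hL).toContinuousLinearEquiv
  have hd : HasFDerivAt f (e : Matrix (Fin k) (Fin k) ℝ →L[ℝ] Matrix (Fin k) (Fin k) ℝ) R := by
    have := (hasFDerivAt_id (𝕜 := ℝ) R).mul' (hasFDerivAt_id R)
    refine this.congr_fderiv ?_
    ext1 X
    change R * X + X * R = L X
    simp [L]
  have hd' : HasStrictFDerivAt f (e : Matrix (Fin k) (Fin k) ℝ →L[ℝ] _) R :=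
    hf.contDiffAt.hasStrictFDerivAt' hd (by simp)
  set g := hf.contDiffAt.localInverse hd (by simp)
  have hgR : g (R * R) = R := hf.contDiffAt.localInverse_apply_image hd (by simp)
  have hgs : ContDiffAt ℝ ∞ g (R * R) := hf.contDiffAt.to_localInverse hd (by simp)
  have hleft : ∀ᶠ X in 𝓝 R, g (f X) = X := hd'.eventually_left_inverse
  have hright : ∀ᶠ A in 𝓝 (R * R), f (g A) = A := hd'.eventually_right_inverse
  have htend : Tendsto (fun A => (g A)ᵀ) (𝓝 (R * R)) (𝓝 R) := by
    have : Tendsto (fun A => (g A)ᵀ) (𝓝 (R * R)) (𝓝 (g (R * R))ᵀ) :=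
      (continuous_id.matrix_transpose.continuousAt).comp hgs.continuousAt
    rwa [hgR, posDef_transpose hR] at this
  refine ⟨g, hgs, hgR, hleft, ?_⟩
  filter_upwards [hright, htend.eventually hleft] with A h1 h2 hA
  refine ⟨?_, h1⟩
  rw [← h2]
  congr 1
  change (g A)ᵀ * (g A)ᵀ = A
  rw [← transpose_mul]
  exact (congrArg transpose h1).trans hA

lemma eventually_posDef {R : Matrix (Fin k) (Fin k) ℝ} (hR : R.PosDef) :
    ∀ᶠ X in 𝓝 R, Xᵀ = X → X.PosDef := by
  obtain ⟨B, hB, rfl⟩ := exists_posDef_sq hR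
  obtain ⟨g, -, -, -, hg⟩ := exists_smooth_symm_sqrt hB
  have hdet : ∀ᶠ X in 𝓝 (B * B), X.det ≠ 0 :=
    (continuous_id.matrix_det.continuousAt).eventually_ne hR.det_pos.ne'
  filter_upwards [hg, hdet] with X h1 h2 hX
  obtain ⟨h3, h4⟩ := h1 hX
  have h5 : (g X)ᵀ * g X = X := by rw [h3, h4]
  rw [← h5] at h2 ⊢
  exact posDef_gram h2

/-- Near a positive definite matrix, the positive definite square root of symmetric matrices is
given by a smooth map. -/
lemma exists_smooth_sqrt {R : Matrix (Fin k) (Fin k) ℝ} (hR : R.PosDef) :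
    ∃ g : Matrix (Fin k) (Fin k) ℝ → Matrix (Fin k) (Fin k) ℝ,
      ContDiffAt ℝ ∞ g (R * R) ∧ g (R * R) = R ∧ (∀ᶠ X in 𝓝 R, g (X * X) = X) ∧
      (∀ᶠ A in 𝓝 (R * R), Aᵀ = A → (g A).PosDef ∧ g A * g A = A) := by
  obtain ⟨g, h1, h2, h3, h4⟩ := exists_smooth_symm_sqrt hR
  refine ⟨g, h1, h2, h3, ?_⟩
  have h5 : Tendsto g (𝓝 (R * R)) (𝓝 R) := by
    have := h1.continuousAt.tendsto
    rwa [h2] at this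
  filter_upwards [h4, h5.eventually (eventually_posDef hR)] with A h6 h7 hA
  exact ⟨h7 (h6 hA).1, (h6 hA).2⟩

end SmoothSqrt

section PolarSmooth

variable {d k : ℕ}

lemma norm_mat (W : MatSpace d k) : ‖mat W‖ = ‖W‖ := by
  rw [Matrix.frobenius_norm_def, EuclideanSpace.norm_eq, Real.sqrt_eq_rpow, Fintype.sum_prod_type]
  simp

/-- `mat` as a linear isometry onto matrices with the Frobenius norm. -/
noncomputable def matIso : MatSpace d k ≃ₗᵢ[ℝ] Matrix (Fin d) (Fin k) ℝ := ⟨mat, norm_mat⟩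


lemma contDiff_mat {n : ℕ∞ω} : ContDiff ℝ n (mat : MatSpace d k → Matrix (Fin d) (Fin k) ℝ) :=
  (matIso (d := d) (k := k)).contDiff

lemma contDiff_mat_symm {n : ℕ∞ω} :
    ContDiff ℝ n (mat.symm : Matrix (Fin d) (Fin k) ℝ → MatSpace d k) :=
  (matIso (d := d) (k := k)).symm.contDiff

lemma isBoundedBilinearMap_matrix_mul {l m n : ℕ} : IsBoundedBilinearMap ℝ
    fun p : Matrix (Fin l) (Fin m) ℝ × Matrix (Fin m) (Fin n) ℝ => p.1 * p.2 where
  add_left := fun _ _ _ => Matrix.add_mul _ _ _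
  smul_left := fun _ _ _ => Matrix.smul_mul _ _ _
  add_right := fun _ _ _ => Matrix.mul_add _ _ _
  smul_right := fun _ _ _ => Matrix.mul_smul _ _ _
  bound := ⟨1, one_pos, fun A B => by rw [one_mul]; exact Matrix.frobenius_norm_mul A B⟩

lemma contDiff_transpose {l m : ℕ} {n : ℕ∞ω} :
    ContDiff ℝ n (transpose : Matrix (Fin l) (Fin m) ℝ → Matrix (Fin m) (Fin l) ℝ) :=
  (LinearMap.toContinuousLinearMap
    (Matrix.transposeLinearEquiv (Fin l) (Fin m) ℝ ℝ).toLinearMap).contDiff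

lemma contDiff_gram {n : ℕ∞ω} :
    ContDiff ℝ n fun W : MatSpace d k => (mat W)ᵀ * mat W :=
  isBoundedBilinearMap_matrix_mul.contDiff.comp
    ((contDiff_transpose.comp contDiff_mat).prodMk contDiff_mat)

lemma contDiffAt_matrix_inv {n : ℕ∞ω} {R : Matrix (Fin k) (Fin k) ℝ} (hR : R.PosDef) :
    ContDiffAt ℝ n (fun A : Matrix (Fin k) (Fin k) ℝ => A⁻¹) R := by
  obtain ⟨u, rfl⟩ := hR.isUnit
  have := contDiffAt_ringInverse ℝ (n := n) u
  simpa only [Matrix.nonsing_inv_eq_ringInverse] using this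

/-- Near a matrix of full rank the polar factor and the positive definite factor of the polar
decomposition depend smoothly on the matrix. -/
lemma exists_smooth_polar {W₀ : MatSpace d k} (hW : ((mat W₀)ᵀ * mat W₀).det ≠ 0) :
    ContDiffAt ℝ ∞ polar W₀ ∧ ∃ P : MatSpace d k → Matrix (Fin k) (Fin k) ℝ,
      ContDiffAt ℝ ∞ P W₀ ∧ ∀ᶠ W in 𝓝 W₀, (P W).PosDef ∧ P W * P W = (mat W)ᵀ * mat W ∧
        polar W ∈ stiefel d k ∧ mat W = mat (polar W) * P W := by
  obtain ⟨R, hR, hRR, hp⟩ := exists_polar_decomp hW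
  obtain ⟨g, h1, h2, -, h4⟩ := exists_smooth_sqrt hR
  rw [hRR] at h1 h2 h4
  have hP : ContDiffAt ℝ ∞ (fun W : MatSpace d k => g ((mat W)ᵀ * mat W)) W₀ :=
    h1.comp W₀ contDiff_gram.contDiffAt
  have hev : ∀ᶠ W : MatSpace d k in 𝓝 W₀, (g ((mat W)ᵀ * mat W)).PosDef ∧
      g ((mat W)ᵀ * mat W) * g ((mat W)ᵀ * mat W) = (mat W)ᵀ * mat W := by
    have hc : ContinuousAt (fun W : MatSpace d k => (mat W)ᵀ * mat W) W₀ :=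
      (contDiff_gram (n := 0)).continuous.continuousAt
    filter_upwards [hc.eventually h4] with W hW
    exact hW (by rw [transpose_mul, transpose_transpose])
  refine ⟨?_, _, hP, hev.mono fun W hW => ⟨hW.1, hW.2, (polar_of_sq hW.1 hW.2).2⟩⟩
  have heq : polar =ᶠ[𝓝 W₀] fun W : MatSpace d k =>
      mat.symm (mat W * (g ((mat W)ᵀ * mat W))⁻¹) :=
    hev.mono fun W hW => (polar_of_sq hW.1 hW.2).1
  refine ContDiffAt.congr_of_eventuallyEq ?_ heq
  refine contDiff_mat_symm.contDiffAt.comp W₀ ?_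
  refine (isBoundedBilinearMap_matrix_mul (n := k)).contDiff.contDiffAt.comp W₀
    (contDiff_mat.contDiffAt.prodMk ?_)
  refine ContDiffAt.comp W₀ (g := fun A : Matrix (Fin k) (Fin k) ℝ => A⁻¹) ?_ hP
  rw [h2]
  exact contDiffAt_matrix_inv hR

end PolarSmooth

end StiefelKL

/-! ### Second-order expansion of the polar projection -/

namespace StiefelKL
open scoped Matrix.Norms.Frobenius

section Expansion

variable {d k : ℕ}

/-- Normal vectors are of the form `U S`. -/
lemma mat_normal {U : MatSpace d k} (hU : U ∈ stiefel d k) (ν : normal U) :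
    mat (ν : MatSpace d k) = mat U * symPart U (ν : MatSpace d k) := by
  have hU' : (mat U)ᵀ * mat U = 1 := hU
  set A := mat (ν : MatSpace d k) - mat U * symPart U (ν : MatSpace d k) with hA
  have hUA : (mat U)ᵀ * A = 0 := by
    rw [hA, Matrix.mul_sub, ← Matrix.mul_assoc, hU', Matrix.one_mul, symPart, sub_self]
  have hAt : mat.symm A ∈ tangent U := by
    rw [mem_tangent, LinearEquiv.apply_symm_apply, hUA, zero_add]
    rw [← transpose_transpose (mat U), ← transpose_mul, hUA, transpose_zero]
  have h0 := (Submodule.mem_orthogonal _ _).1 ν.2 _ hAt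
  rw [inner_eq_trace, LinearEquiv.apply_symm_apply] at h0
  have h1 : (Aᵀ * A).trace = 0 := by
    conv_lhs => enter [1, 2]; rw [hA]
    rw [Matrix.mul_sub, Matrix.trace_sub, h0, ← Matrix.mul_assoc,
      show Aᵀ * mat U = ((mat U)ᵀ * A)ᵀ by rw [transpose_mul, transpose_transpose], hUA]
    simp
  rw [← conjTranspose_eq_transpose_of_trivial,
    Matrix.trace_conjTranspose_mul_self_eq_zero_iff] at h1
  exact sub_eq_zero.1 h1

lemma norm_transpose {l m : ℕ} (A : Matrix (Fin l) (Fin m) ℝ) : ‖Aᵀ‖ = ‖A‖ :=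
  Matrix.frobenius_norm_transpose A

/-- With `E = ½ (XᵀX + [S, K])` and `K = UᵀX`, the matrix `1 + S + E` is a square root of `WᵀW`,
`W = U + X + U S`, up to errors with a factor `E`. -/
lemma gram_eq {U X : Matrix (Fin d) (Fin k) ℝ} {S : Matrix (Fin k) (Fin k) ℝ}
    (hU : Uᵀ * U = 1) (hX : Uᵀ * X + Xᵀ * U = 0) (hS : Sᵀ = S)
    {E : Matrix (Fin k) (Fin k) ℝ}
    (hE : (2 : ℝ) • E = Xᵀ * X + (S * (Uᵀ * X) - Uᵀ * X * S)) :
    (1 + S + E) * (1 + S + E) - (U + X + U * S)ᵀ * (U + X + U * S) = S * E + E * S + E * E := by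
  have hXU : Xᵀ * U = -(Uᵀ * X) := eq_neg_of_add_eq_zero_right hX
  have h1 : (U + X + U * S)ᵀ * (U + X + U * S) =
      (1 + S) * (1 + S) + (Xᵀ * X + (S * (Uᵀ * X) - Uᵀ * X * S)) := by
    rw [transpose_add, transpose_add, transpose_mul, hS]
    simp only [Matrix.add_mul, Matrix.mul_add]
    rw [Matrix.mul_assoc S Uᵀ U, Matrix.mul_assoc S Uᵀ X, ← Matrix.mul_assoc Uᵀ U S,
      ← Matrix.mul_assoc Xᵀ U S, Matrix.mul_assoc S Uᵀ (U * S), ← Matrix.mul_assoc Uᵀ U S, hU, hXU]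
    simp only [Matrix.one_mul, Matrix.mul_one, Matrix.neg_mul]
    abel
  rw [h1, ← hE, two_smul]
  noncomm_ring

/-- The remainder of the polar decomposition `W ≈ Y (1 + S + E)` of `W = U + X + U S`. -/
lemma residual_eq {U X : Matrix (Fin d) (Fin k) ℝ} {S E : Matrix (Fin k) (Fin k) ℝ} :
    (U + X + U * S) - (U + X - X * S - U * E) * (1 + S + E) =
      U * (E * (S + E)) - X * (E - S * S - S * E) := by
  simp only [Matrix.mul_add, Matrix.add_mul, Matrix.mul_sub, Matrix.sub_mul, Matrix.mul_one,
    Matrix.mul_assoc]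
  abel

lemma norm_symPart_le {U : MatSpace d k} (ν : MatSpace d k) : ‖symPart U ν‖ ≤ ‖U‖ * ‖ν‖ := by
  refine (Matrix.frobenius_norm_mul _ _).trans ?_
  rw [norm_transpose, norm_mat, norm_mat]

lemma det_gram_of_mem {V : MatSpace d k} (hV : V ∈ stiefel d k) :
    ((mat V)ᵀ * mat V).det ≠ 0 := by
  have : (mat V)ᵀ * mat V = 1 := hV
  simp [this]

/-- Norm bounds for the terms in the expansion of the polar decomposition; `x` stands for `‖ξ‖` and
`t` for `‖(ξ, ν)‖`. -/
lemma expansion_bounds {U X : Matrix (Fin d) (Fin k) ℝ} {S E : Matrix (Fin k) (Fin k) ℝ}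
    (hU : Uᵀ * U = 1) (hX : Uᵀ * X + Xᵀ * U = 0) (hS : Sᵀ = S)
    (h2E : (2 : ℝ) • E = Xᵀ * X + (S * (Uᵀ * X) - Uᵀ * X * S)) {x t u e : ℝ} (hu : 0 ≤ u)
    (he : e = 1 + u ^ 2) (hx0 : 0 ≤ x) (nU : ‖U‖ = u)
    (nX : ‖X‖ = x) (nS : ‖S‖ ≤ u * t) (hxt : x ≤ t) (ht1 : t ≤ 1) :
    ‖(1 + S + E) * (1 + S + E) - (U + X + U * S)ᵀ * (U + X + U * S)‖ ≤
      e * (2 * u + e) * (x * t ^ 2) ∧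
    ‖(U + X + U * S) - (U + X - X * S - U * E) * (1 + S + E)‖ ≤
      (u * (e * (u + e)) + (e + u * u + u * e)) * (x * t ^ 2) ∧
    ‖U + X - X * S - U * E‖ ≤ 1 + u + u + u * e := by
  have ht0 : 0 ≤ t := hx0.trans hxt
  have hmul := fun (A B : Matrix (Fin k) (Fin k) ℝ) => Matrix.frobenius_norm_mul A B
  have nK : ‖Uᵀ * X‖ ≤ u * x := by
    refine (Matrix.frobenius_norm_mul _ _).trans ?_
    rw [norm_transpose, nU, nX]
  -- `E` contains a factor `ξ` in every term, hence `x * t` rather than `t ^ 2`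
  have nE : ‖E‖ ≤ e * (x * t) := by
    have h1 : ‖(2 : ℝ) • E‖ ≤ x * x + (u * t * (u * x) + u * x * (u * t)) := by
      rw [h2E]
      refine (norm_add_le _ _).trans (add_le_add ?_ ((norm_sub_le _ _).trans (add_le_add ?_ ?_)))
      · refine (Matrix.frobenius_norm_mul _ _).trans ?_
        rw [norm_transpose, nX]
      · exact (hmul _ _).trans (by gcongr)
      · exact (hmul _ _).trans (by gcongr)
    rw [norm_smul, Real.norm_two] at h1
    have : x * x ≤ x * t := by gcongr
    have h3 : 0 ≤ x * t := mul_nonneg hx0 ht0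
    rw [he]
    linarith
  have he0 : 0 ≤ e := he ▸ by positivity
  have nE' : ‖E‖ ≤ e * t := nE.trans (by
    have : x * t ≤ 1 * t := by gcongr; exact hxt.trans ht1
    gcongr; linarith)
  have nS' : ‖S‖ ≤ u := nS.trans (mul_le_of_le_one_right hu ht1)
  have nE'' : ‖E‖ ≤ e := nE'.trans (mul_le_of_le_one_right he0 ht1)
  have nSE : ‖S * E‖ ≤ (u * t) * (e * (x * t)) := (hmul _ _).trans (by gcongr)
  have nES : ‖E * S‖ ≤ (e * (x * t)) * (u * t) := (hmul _ _).trans (by gcongr)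
  have nEE : ‖E * E‖ ≤ (e * (x * t)) * (e * t) := (hmul _ _).trans (by gcongr)
  refine ⟨?_, ?_, ?_⟩
  · rw [gram_eq hU hX hS h2E]
    calc _ ≤ ‖S * E‖ + ‖E * S‖ + ‖E * E‖ := norm_add₃_le
      _ ≤ (u * t) * (e * (x * t)) + (e * (x * t)) * (u * t) + (e * (x * t)) * (e * t) := by
        gcongr
      _ = _ := by ring
  · rw [residual_eq]
    have a1 : ‖U * (E * (S + E))‖ ≤ u * ((e * (x * t)) * (u * t + e * t)) := by
      refine (Matrix.frobenius_norm_mul _ _).trans ?_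
      rw [nU]; gcongr
      refine (hmul _ _).trans ?_
      gcongr
      exact (norm_add_le _ _).trans (add_le_add nS nE')
    have a2 : ‖X * (E - S * S - S * E)‖ ≤
        x * (e * t * t + u * t * (u * t) + (u * t) * (e * t)) := by
      refine (Matrix.frobenius_norm_mul _ _).trans ?_
      rw [nX]
      gcongr
      refine (norm_sub_le _ _).trans (add_le_add ((norm_sub_le _ _).trans (add_le_add ?_ ?_)) ?_)
      · refine nE.trans ?_
        rw [mul_assoc]; gcongr
      · exact (hmul _ _).trans (by gcongr)
      · exact (hmul _ _).trans (by gcongr)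
    refine (norm_sub_le _ _).trans ((add_le_add a1 a2).trans (le_of_eq ?_))
    ring
  · refine (norm_sub_le _ _).trans (add_le_add ((norm_sub_le _ _).trans (add_le_add
      ((norm_add_le _ _).trans ?_) ?_)) ?_)
    · rw [nU, nX]; linarith
    · refine (Matrix.frobenius_norm_mul _ _).trans ?_
      rw [nX]
      calc x * ‖S‖ ≤ 1 * u := by gcongr; linarith
        _ = u := one_mul u
    · refine (Matrix.frobenius_norm_mul _ _).trans ?_
      rw [nU]; gcongr

/-- The polar projection of `U + ξ + ν` is given by its second-order expansion up to an error
which vanishes for `ξ = 0`. -/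
lemma polar_expansion {U : MatSpace d k} (hU : U ∈ stiefel d k) :
    ∃ C ρ : ℝ, 0 < C ∧ 0 < ρ ∧ ∀ (ξ : tangent U) (ν : normal U), ‖ξ‖ ≤ ρ → ‖ν‖ ≤ ρ →
      polar (U + (ξ : MatSpace d k) + (ν : MatSpace d k)) ∈ stiefel d k ∧
      ‖polar (U + (ξ : MatSpace d k) + (ν : MatSpace d k)) -
          (secondOrder U ξ + (delta hU ξ ν : MatSpace d k))‖ ≤
        C * (‖ξ‖ * max ‖ξ‖ ‖ν‖ ^ 2) := by
  have hU' : (mat U)ᵀ * mat U = 1 := hU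
  obtain ⟨g, hg1, hg2, hg3, hg4⟩ := exists_smooth_sqrt (Matrix.PosDef.one (n := Fin k) (R := ℝ))
  rw [Matrix.one_mul] at hg1 hg2 hg4
  obtain ⟨L, s, hs, hL⟩ := (hg1.of_le (m := 1) (by norm_cast)).exists_lipschitzOnWith
  -- smallness conditions on the matrices entering the expansion
  have hinv : ∀ᶠ R : Matrix (Fin k) (Fin k) ℝ in 𝓝 1, ‖R⁻¹‖ < ‖(1 : Matrix (Fin k) (Fin k) ℝ)‖ + 1 := by
    have hc : ContinuousAt (fun R : Matrix (Fin k) (Fin k) ℝ => ‖R⁻¹‖) 1 :=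
      (contDiffAt_matrix_inv (n := 0) Matrix.PosDef.one).continuousAt.norm
    refine hc.eventually_lt continuousAt_const ?_
    simp
  have hginv : ∀ᶠ A in 𝓝 (1 : Matrix (Fin k) (Fin k) ℝ),
      ‖(g A)⁻¹‖ < ‖(1 : Matrix (Fin k) (Fin k) ℝ)‖ + 1 := by
    have := hg1.continuousAt.tendsto
    rw [hg2] at this
    exact this.eventually hinv
  let Eo : tangent U × normal U → Matrix (Fin k) (Fin k) ℝ := fun z => (1 / 2 : ℝ) •
    ((mat (z.1 : MatSpace d k))ᵀ * mat (z.1 : MatSpace d k) +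
      (symPart U z.2 * ((mat U)ᵀ * mat (z.1 : MatSpace d k)) -
        (mat U)ᵀ * mat (z.1 : MatSpace d k) * symPart U z.2))
  let Qo : tangent U × normal U → Matrix (Fin k) (Fin k) ℝ := fun z => 1 + symPart U z.2 + Eo z
  let Ao : tangent U × normal U → Matrix (Fin k) (Fin k) ℝ := fun z =>
    (mat (U + (z.1 : MatSpace d k) + (z.2 : MatSpace d k)))ᵀ *
      mat (U + (z.1 : MatSpace d k) + (z.2 : MatSpace d k))
  have hcm : Continuous (mat : MatSpace d k → _) := (contDiff_mat (n := 0)).continuous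
  have hcS : Continuous fun z : tangent U × normal U => symPart U (z.2 : MatSpace d k) :=
    continuous_const.matrix_mul (hcm.comp (by fun_prop))
  have hc1 : Continuous fun z : tangent U × normal U => mat (z.1 : MatSpace d k) :=
    hcm.comp (by fun_prop)
  have hcE : Continuous Eo := by
    refine (Continuous.add ?_ (Continuous.sub ?_ ?_)).const_smul (1 / 2 : ℝ)
    · exact hc1.matrix_transpose.matrix_mul hc1
    · exact hcS.matrix_mul (continuous_const.matrix_mul hc1)
    · exact (continuous_const.matrix_mul hc1).matrix_mul hcS
  have hcQ : Continuous Qo := (continuous_const.add hcS).add hcE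
  have hcA : Continuous Ao := by
    have : Continuous fun z : tangent U × normal U =>
        mat (U + (z.1 : MatSpace d k) + (z.2 : MatSpace d k)) :=
      hcm.comp (by fun_prop)
    exact this.matrix_transpose.matrix_mul this
  have hE0 : Eo 0 = 0 := by simp [Eo]
  have hQ0 : Qo 0 = 1 := by simp [Qo, hE0, symPart]
  have hA0 : Ao 0 = 1 := by simp [Ao, hU']
  have tQ : Tendsto Qo (𝓝 0) (𝓝 1) := hQ0 ▸ hcQ.continuousAt.tendsto
  have tQQ : Tendsto (fun z => Qo z * Qo z) (𝓝 0) (𝓝 1) := by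
    simpa using tQ.mul tQ
  have tA : Tendsto Ao (𝓝 0) (𝓝 1) := hA0 ▸ hcA.continuousAt.tendsto
  obtain ⟨ρ, hρ, hball⟩ := Metric.eventually_nhds_iff_ball.1
    ((tQ.eventually hg3).and ((tQQ.eventually hs).and ((tA.eventually hs).and
      ((tA.eventually hg4).and (tA.eventually hginv)))))
  set u := ‖U‖
  set N := ‖(1 : Matrix (Fin k) (Fin k) ℝ)‖ + 1
  set e := 1 + u ^ 2
  have hu : 0 ≤ u := norm_nonneg _
  have hN : 0 < N := by positivity
  set C1 := e * (2 * u + e) with hC1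
  set C2 := (u * (e * (u + e)) + (e + u * u + u * e)) with hC2
  set C3 := 1 + u + u + u * e with hC3
  refine ⟨(C2 + C3 * (L * C1)) * N + 1, min (ρ / 2) 1, by positivity, by positivity, ?_⟩
  intro ξ ν hξ hν
  have hz : ((ξ, ν) : tangent U × normal U) ∈ Metric.ball 0 ρ := by
    rw [mem_ball_zero_iff, Prod.norm_def]
    exact (max_le (hξ.trans (min_le_left _ _)) (hν.trans (min_le_left _ _))).trans_lt (by linarith)
  obtain ⟨k1, k2, k3, k4, k5⟩ := hball _ hz
  obtain ⟨k6, k7⟩ := k4 (by rw [transpose_mul, transpose_transpose])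
  set X := mat (ξ : MatSpace d k) with hX
  set S := symPart U (ν : MatSpace d k) with hS
  set E := Eo (ξ, ν) with hE
  set A := Ao (ξ, ν) with hA
  set Q := Qo (ξ, ν) with hQ
  set R := g A with hR
  obtain ⟨-, p2, p3⟩ := polar_of_sq k6 k7
  change mat (U + (ξ : MatSpace d k) + (ν : MatSpace d k)) =
    mat (polar (U + (ξ : MatSpace d k) + (ν : MatSpace d k))) * R at p3
  refine ⟨p2, ?_⟩
  have hW : mat (U + (ξ : MatSpace d k) + (ν : MatSpace d k)) = mat U + X + mat U * S := by
    rw [map_add, map_add, mat_normal hU ν]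
  have h2E : (2 : ℝ) • E = Xᵀ * X + (S * ((mat U)ᵀ * X) - (mat U)ᵀ * X * S) := by
    rw [hE]; simp only [Eo]; rw [smul_smul]; norm_num
    rfl
  set Y := mat U + X - X * S - mat U * E with hY
  have hYmat : mat (secondOrder U ξ + (delta hU ξ ν : MatSpace d k)) = Y := by
    have : (delta hU ξ ν : MatSpace d k) = mat.symm (deltaMat U ξ ν) := rfl
    rw [this, map_add, LinearEquiv.apply_symm_apply, secondOrder, map_sub, map_add, map_smul,
      LinearEquiv.apply_symm_apply, deltaMat, hY]
    have : E = (1 / 2 : ℝ) • (Xᵀ * X + (S * ((mat U)ᵀ * X) - (mat U)ᵀ * X * S)) := by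
      rw [← h2E, smul_smul]; norm_num
    rw [this, Matrix.mul_smul, Matrix.mul_add, Matrix.mul_sub, Matrix.mul_sub]
    simp only [← hX, ← hS]
    module
  set x := ‖ξ‖
  set t := max ‖ξ‖ ‖ν‖
  have hx0 : 0 ≤ x := norm_nonneg _
  have nS : ‖S‖ ≤ u * t := (norm_symPart_le _).trans (by
    gcongr; exact le_max_right _ _)
  obtain ⟨dQA', dWQ', nY⟩ := expansion_bounds hU' ξ.2 (symPart_isSymm hU ν) h2E hu rfl hx0
    (norm_mat _) (norm_mat _) nS (le_max_left _ _)
    (max_le (hξ.trans (min_le_right _ _)) (hν.trans (min_le_right _ _)))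
  have dQA : ‖Q * Q - A‖ ≤ C1 * (x * t ^ 2) := by
    rw [hA]; simp only [Ao]; rw [hW]
    exact dQA'
  have dWQ : ‖mat U + X + mat U * S - Y * Q‖ ≤ C2 * (x * t ^ 2) := dWQ'
  have dRQ : ‖Q - R‖ ≤ L * C1 * (x * t ^ 2) := by
    have h1 := hL.norm_sub_le k2 k3
    rw [k1] at h1
    refine h1.trans ?_
    rw [mul_assoc]
    gcongr
  change ‖Y‖ ≤ C3 at nY
  -- `π(W) - Y = (W - Y R) R⁻¹`, where `R` is the exact square root of `WᵀW`
  have hfin : mat (polar (U + (ξ : MatSpace d k) + (ν : MatSpace d k)) -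
      (secondOrder U ξ + (delta hU ξ ν : MatSpace d k))) =
      ((mat U + X + mat U * S - Y * Q) + Y * (Q - R)) * R⁻¹ := by
    rw [map_sub, hYmat]
    have h1 : (mat U + X + mat U * S - Y * Q) + Y * (Q - R) =
        (mat (polar (U + (ξ : MatSpace d k) + (ν : MatSpace d k))) - Y) * R := by
      rw [Matrix.sub_mul _ Y, Matrix.mul_sub Y, ← hW, p3]
      abel
    rw [h1, Matrix.mul_assoc, posDef_mul_inv k6, Matrix.mul_one]
  rw [← norm_mat, hfin]
  refine (Matrix.frobenius_norm_mul _ _).trans ?_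
  have h1 : ‖(mat U + X + mat U * S - Y * Q) + Y * (Q - R)‖ ≤
      (C2 + C3 * (L * C1)) * (x * t ^ 2) := by
    refine (norm_add_le _ _).trans ((add_le_add dWQ ((Matrix.frobenius_norm_mul _ _).trans
      (mul_le_mul nY dRQ (norm_nonneg _) (by positivity)))).trans (le_of_eq ?_))
    ring
  calc _ ≤ (C2 + C3 * (L * C1)) * (x * t ^ 2) * N := by gcongr
    _ ≤ _ := by
      have := mul_nonneg hx0 (sq_nonneg t)
      linarith

/-- The second-order expansion of the polar projection. -/
lemma polar_isBigO {U : MatSpace d k} (hU : U ∈ stiefel d k) :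
    (fun z : tangent U × normal U =>
        polar (U + (z.1 : MatSpace d k) + (z.2 : MatSpace d k)) -
          (secondOrder U z.1 + (delta hU z.1 z.2 : MatSpace d k)))
      =O[𝓝 0] fun z => ‖z‖ ^ 3 := by
  obtain ⟨C, ρ, hC, hρ, h⟩ := polar_expansion hU
  refine IsBigO.of_bound C ?_
  filter_upwards [Metric.closedBall_mem_nhds _ hρ] with z hz
  rw [mem_closedBall_zero_iff] at hz
  refine (h z.1 z.2 ((norm_fst_le z).trans hz) ((norm_snd_le z).trans hz)).2.trans ?_
  rw [Real.norm_of_nonneg (by positivity), ← Prod.norm_def]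
  have : ‖z.1‖ * ‖z‖ ^ 2 ≤ ‖z‖ ^ 3 := by
    rw [pow_succ' _ 2]; gcongr; exact norm_fst_le z
  gcongr

end Expansion

end StiefelKL

/-! ### Nondegenerate Gaussians, the ambient covariance and the discrepancy -/

namespace StiefelKL

lemma exists_equiv_of_injective {F : Type*} [NormedAddCommGroup F] [InnerProductSpace ℝ F]
    [FiniteDimensional ℝ F] {A : F →L[ℝ] F} (hA : Function.Injective A) :
    ∃ Q : F ≃L[ℝ] F, (Q : F →L[ℝ] F) = A :=
  ⟨(LinearEquiv.ofInjectiveEndo (A : F →ₗ[ℝ] F) hA).toContinuousLinearEquiv, by ext; rfl⟩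

lemma continuous_of_sub_bound {E G : Type*} [NormedAddCommGroup E] [NormedAddCommGroup G]
    {f : E → G} (hf : ∀ x y, f (x - y) = f x - f y) {c : ℝ} (hc : ∀ x, ‖f x‖ ≤ c * ‖x‖) :
    Continuous f := by
  refine (LipschitzWith.of_dist_le_mul (K := c.toNNReal) fun x y => ?_).continuous
  rw [dist_eq_norm, dist_eq_norm, ← hf]
  exact (hc _).trans (by gcongr; exact Real.le_coe_toNNReal c)

section Gaussian

variable {F : Type*} [NormedAddCommGroup F] [InnerProductSpace ℝ F] [FiniteDimensional ℝ F]
  [MeasurableSpace F] [BorelSpace F]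

/-- A nondegenerate Gaussian measure has a positive density. -/
lemma volume_absolutelyContinuous_gaussian {A : F →L[ℝ] F} (hA : A.IsPositive)
    (hinj : Function.Injective A) : (volume : Measure F) ≪ gaussian A := by
  obtain ⟨Q, hQ⟩ := exists_equiv_of_injective hinj
  obtain ⟨c, hc, h⟩ := gaussian_eq_withDensity hA hinj (q := fun y => ⟪Q.symm y, y⟫)
    (by fun_prop) (fun x => by rw [← hQ]; simp)
  rw [h]
  refine withDensity_absolutelyContinuous' (by fun_prop) (Eventually.of_forall fun x => ?_)
  simp only [ne_eq, ENNReal.ofReal_eq_zero, not_le]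
  positivity

lemma isOpenPosMeasure_gaussian {A : F →L[ℝ] F} (hA : A.IsPositive)
    (hinj : Function.Injective A) : (gaussian A).IsOpenPosMeasure :=
  (volume_absolutelyContinuous_gaussian hA hinj).isOpenPosMeasure

lemma gaussian_second_moment {A : F →L[ℝ] F} (hA : A.IsPositive) (w : F) :
    ∫ x, ⟪w, x⟫ ^ 2 ∂(gaussian A) = ⟪w, A w⟫ := by
  obtain ⟨B, hB, rfl, h⟩ := exists_sqrt_gaussian hA
  rw [h, integral_map (by fun_prop) (Continuous.aestronglyMeasurable (by fun_prop))]
  have h1 := variance_dual_stdGaussian (innerSL ℝ (B w))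
  rw [variance_eq_integral (by fun_prop), integral_strongDual_stdGaussian] at h1
  rw [innerSL_apply_norm, ← real_inner_self_eq_norm_sq, hB] at h1
  rw [ContinuousLinearMap.comp_apply, ← h1]
  simp [hB]

end Gaussian

section Product

variable {E F : Type*} [NormedAddCommGroup E] [InnerProductSpace ℝ E] [FiniteDimensional ℝ E]
  [MeasurableSpace E] [BorelSpace E] [NormedAddCommGroup F] [InnerProductSpace ℝ F]
  [FiniteDimensional ℝ F] [MeasurableSpace F] [BorelSpace F]

lemma gaussian_prod_moment (i j : ℕ) : ∃ C : ℝ, 0 < C ∧ ∀ (A : E →L[ℝ] E) (B : F →L[ℝ] F),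
    A.IsPositive → B.IsPositive →
    Integrable (fun z : E × F => ‖z.1‖ ^ i * ‖z.2‖ ^ j) ((gaussian A).prod (gaussian B)) ∧
      ∫ z, ‖z.1‖ ^ i * ‖z.2‖ ^ j ∂((gaussian A).prod (gaussian B)) ≤
        C * (√‖A‖ ^ i * √‖B‖ ^ j) := by
  obtain ⟨C, hC, h⟩ := gaussian_moment (F := E) i
  obtain ⟨D, hD, h'⟩ := gaussian_moment (F := F) j
  refine ⟨C * D, by positivity, fun A B hA hB => ⟨(h A hA).1.mul_prod (h' B hB).1, ?_⟩⟩
  rw [integral_prod_mul (f := fun x : E => ‖x‖ ^ i) (g := fun y : F => ‖y‖ ^ j)]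
  calc _ ≤ (C * √‖A‖ ^ i) * (D * √‖B‖ ^ j) :=
        mul_le_mul (h A hA).2 (h' B hB).2 (integral_nonneg fun x => by positivity) (by positivity)
    _ = _ := by ring

/-- Functions which are odd in the second variable have mean zero. -/
lemma integral_prod_odd {A : E →L[ℝ] E} {B : F →L[ℝ] F} (hB : B.IsPositive)
    {f : E × F → ℝ} (hf : ∀ x y, f (x, -y) = -f (x, y)) :
    ∫ z, f z ∂((gaussian A).prod (gaussian B)) = 0 := by
  have h1 : ((gaussian A).prod (gaussian B)).map (Prod.map id fun y => -y) =
      (gaussian A).prod (gaussian B) := by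
    rw [← Measure.map_prod_map _ _ measurable_id measurable_neg, Measure.map_id,
      gaussian_map_neg hB]
  have h2 : MeasurableEmbedding (Prod.map id fun y => -y : E × F → E × F) :=
    ((MeasurableEquiv.refl E).prodCongr (MeasurableEquiv.neg F)).measurableEmbedding
  have h3 : ∫ z, f z ∂((gaussian A).prod (gaussian B)) =
      -∫ z, f z ∂((gaussian A).prod (gaussian B)) := by
    conv_lhs => rw [← h1, h2.integral_map]
    rw [← integral_neg]
    exact integral_congr_ae (Eventually.of_forall fun z => hf z.1 z.2)
  linarith

end Product

section Ambient

variable {d k : ℕ} {U : MatSpace d k}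

lemma inner_ambientCov (covT : tangent U →L[ℝ] tangent U) (covN : normal U →L[ℝ] normal U)
    (x y : MatSpace d k) : ⟪x, ambientCov covT covN y⟫ =
      ⟪(tangent U).orthogonalProjectionOnto x, covT ((tangent U).orthogonalProjectionOnto y)⟫ +
      ⟪(normal U).orthogonalProjectionOnto x, covN ((normal U).orthogonalProjectionOnto y)⟫ := by
  rw [ambientCov, _root_.add_apply, inner_add_right]
  simp only [ContinuousLinearMap.comp_apply, Submodule.subtypeL_apply]
  rw [Submodule.inner_orthogonalProjectionOnto_eq_of_mem_right,
    Submodule.inner_orthogonalProjectionOnto_eq_of_mem_right]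

lemma ambientCov_isPositive {covT : tangent U →L[ℝ] tangent U}
    {covN : normal U →L[ℝ] normal U} (hT : covT.IsPositive) (hN : covN.IsPositive) :
    (ambientCov covT covN).IsPositive := by
  refine ⟨fun x y => ?_, fun x => ?_⟩
  · change ⟪ambientCov covT covN x, y⟫ = ⟪x, ambientCov covT covN y⟫
    rw [real_inner_comm, inner_ambientCov, inner_ambientCov]
    congr 1
    · rw [real_inner_comm]; exact hT.isSymmetric _ _
    · rw [real_inner_comm]; exact hN.isSymmetric _ _
  · rw [ContinuousLinearMap.reApplyInnerSelf_apply, real_inner_comm, inner_ambientCov]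
    exact add_nonneg (hT.inner_nonneg_right _) (hN.inner_nonneg_right _)

/-- Under the ambient Gaussian measure the tangential and normal parts are independent. -/
lemma gaussian_ambientCov {covT : tangent U →L[ℝ] tangent U}
    {covN : normal U →L[ℝ] normal U} (hT : covT.IsPositive) (hN : covN.IsPositive) :
    gaussian (ambientCov covT covN) = ((gaussian covT).prod (gaussian covN)).map
      fun z => (z.1 : MatSpace d k) + (z.2 : MatSpace d k) := by
  have hm : Measurable fun z : tangent U × normal U =>
    (z.1 : MatSpace d k) + (z.2 : MatSpace d k) := by fun_prop
  have := Measure.isProbabilityMeasure_map hm.aemeasurable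
    (μ := (gaussian covT).prod (gaussian covN))
  refine Measure.ext_of_charFun (funext fun t => ?_)
  rw [charFun_gaussian (ambientCov_isPositive hT hN), charFun_apply,
    integral_map hm.aemeasurable (Measurable.aestronglyMeasurable (by fun_prop))]
  have h1 : ∀ z : tangent U × normal U,
      Complex.exp ((⟪(z.1 : MatSpace d k) + (z.2 : MatSpace d k), t⟫ : ℝ) * Complex.I) =
      Complex.exp ((⟪z.1, (tangent U).orthogonalProjectionOnto t⟫ : ℝ) * Complex.I) *
      Complex.exp ((⟪z.2, (normal U).orthogonalProjectionOnto t⟫ : ℝ) * Complex.I) := fun z => by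
    rw [← Complex.exp_add, inner_add_left,
      ← Submodule.inner_orthogonalProjectionOnto_eq_of_mem_left,
      ← Submodule.inner_orthogonalProjectionOnto_eq_of_mem_left]
    push_cast; ring_nf
  simp_rw [h1]
  rw [integral_prod_mul (f := fun x : tangent U => Complex.exp
      ((⟪x, (tangent U).orthogonalProjectionOnto t⟫ : ℝ) * Complex.I))
      (g := fun x : normal U => Complex.exp
      ((⟪x, (normal U).orthogonalProjectionOnto t⟫ : ℝ) * Complex.I)),
    ← charFun_apply, ← charFun_apply, charFun_gaussian hT, charFun_gaussian hN,
    ← Complex.exp_add, inner_ambientCov]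
  congr 1
  push_cast; ring

lemma norm_covT_le (covT : tangent U →L[ℝ] tangent U) (covN : normal U →L[ℝ] normal U) :
    ‖covT‖ ≤ ‖ambientCov covT covN‖ := by
  refine ContinuousLinearMap.opNorm_le_bound _ (norm_nonneg _) fun x => ?_
  have h1 : ambientCov covT covN x = (covT x : MatSpace d k) := by
    simp [ambientCov, Submodule.orthogonalProjectionOnto_orthogonal_apply_eq_zero]
  change ‖((covT x : _) : MatSpace d k)‖ ≤ _
  rw [← h1]
  exact (ambientCov covT covN).le_opNorm _

lemma norm_covN_le (covT : tangent U →L[ℝ] tangent U) (covN : normal U →L[ℝ] normal U) :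
    ‖covN‖ ≤ ‖ambientCov covT covN‖ := by
  refine ContinuousLinearMap.opNorm_le_bound _ (norm_nonneg _) fun x => ?_
  have h1 : ambientCov covT covN x = (covN x : MatSpace d k) := by
    have : (tangent U).orthogonalProjectionOnto (x : MatSpace d k) = 0 :=
      Submodule.orthogonalProjectionOnto_eq_zero_iff.2 x.2
    simp [ambientCov, this]
  change ‖((covN x : _) : MatSpace d k)‖ ≤ _
  rw [← h1]
  exact (ambientCov covT covN).le_opNorm _

lemma tanPart_add (ξ : tangent U) (ν : normal U) :
    tanPart U ((ξ : MatSpace d k) + (ν : MatSpace d k)) = ξ := by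
  have : (tangent U).orthogonalProjectionOnto (ν : MatSpace d k) = 0 :=
    Submodule.orthogonalProjectionOnto_eq_zero_iff.2 ν.2
  simp [tanPart, this]

lemma normalPart_add (ξ : tangent U) (ν : normal U) :
    (normal U).orthogonalProjectionOnto ((ξ : MatSpace d k) + (ν : MatSpace d k)) = ν := by
  simp [Submodule.orthogonalProjectionOnto_orthogonal_apply_eq_zero]

lemma coe_delta (hU : U ∈ stiefel d k) (ξ : tangent U) (ν : normal U) :
    (delta hU ξ ν : MatSpace d k) = mat.symm (deltaMat U ξ ν) := rfl

lemma delta_sub (hU : U ∈ stiefel d k) (ξ η : tangent U) :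
    delta hU (ξ - η) = delta hU ξ - delta hU η := by
  ext1 ν
  apply Subtype.ext
  rw [_root_.sub_apply, Submodule.coe_sub, coe_delta, coe_delta, coe_delta, ← map_sub]
  congr 1
  simp only [deltaMat, Submodule.coe_sub, map_sub, Matrix.mul_sub, Matrix.sub_mul]
  module

open scoped Matrix.Norms.Frobenius in
lemma exists_norm_delta_le (hU : U ∈ stiefel d k) :
    ∃ c : ℝ, 0 ≤ c ∧ ∀ ξ : tangent U, ‖delta hU ξ‖ ≤ c * ‖ξ‖ := by
  refine ⟨‖U‖ + ‖U‖ ^ 3, by positivity, fun ξ => ContinuousLinearMap.opNorm_le_bound _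
    (by positivity) fun ν => ?_⟩
  change ‖(delta hU ξ ν : MatSpace d k)‖ ≤ _
  have nS := norm_symPart_le (U := U) (ν : MatSpace d k)
  have nX : ‖mat (ξ : MatSpace d k)‖ = ‖ξ‖ := norm_mat _
  have nK : ‖(mat U)ᵀ * mat (ξ : MatSpace d k)‖ ≤ ‖U‖ * ‖ξ‖ :=
    (Matrix.frobenius_norm_mul _ _).trans (by rw [norm_transpose, norm_mat, nX])
  rw [coe_delta, ← norm_mat, LinearEquiv.apply_symm_apply, deltaMat]
  set S := symPart U (ν : MatSpace d k)
  set K := (mat U)ᵀ * mat (ξ : MatSpace d k)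
  change ‖S‖ ≤ ‖U‖ * ‖ν‖ at nS
  have h1 : ‖mat (ξ : MatSpace d k) * S‖ ≤ ‖ξ‖ * (‖U‖ * ‖ν‖) :=
    (Matrix.frobenius_norm_mul _ _).trans (by rw [nX]; gcongr)
  have h2 : ‖K * S - S * K‖ ≤ (‖U‖ * ‖ξ‖) * (‖U‖ * ‖ν‖) + (‖U‖ * ‖ν‖) * (‖U‖ * ‖ξ‖) :=
    (norm_sub_le _ _).trans (add_le_add
      ((Matrix.frobenius_norm_mul _ _).trans (by gcongr))
      ((Matrix.frobenius_norm_mul _ _).trans (by gcongr)))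
  have h3 : ‖mat U * (K * S - S * K)‖ ≤
      ‖U‖ * ((‖U‖ * ‖ξ‖) * (‖U‖ * ‖ν‖) + (‖U‖ * ‖ν‖) * (‖U‖ * ‖ξ‖)) :=
    (Matrix.frobenius_norm_mul _ _).trans (by rw [norm_mat]; gcongr)
  refine (norm_add_le _ _).trans ?_
  rw [norm_neg, norm_smul, Real.norm_of_nonneg (by norm_num)]
  calc _ ≤ ‖ξ‖ * (‖U‖ * ‖ν‖) +
        1 / 2 * (‖U‖ * ((‖U‖ * ‖ξ‖) * (‖U‖ * ‖ν‖) + (‖U‖ * ‖ν‖) * (‖U‖ * ‖ξ‖))) := by gcongr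
    _ = _ := by ring

lemma continuous_delta (hU : U ∈ stiefel d k) : Continuous fun ξ => delta hU ξ := by
  obtain ⟨c, hc0, hc⟩ := exists_norm_delta_le hU
  refine continuous_of_sub_bound (E := tangent U) (G := normal U →L[ℝ] tangent U) (delta_sub hU)
    (c := c) hc

lemma exists_orthogonal_vector (hkd : k < d) (U : MatSpace d k) :
    ∃ w : Fin d → ℝ, w ≠ 0 ∧ (mat U)ᵀ *ᵥ w = 0 := by
  have h1 : (Matrix.toLin' (mat U)ᵀ).ker ≠ ⊥ := LinearMap.ker_ne_bot_of_finrank_lt (by simpa)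
  obtain ⟨w, hw, hw0⟩ := (Submodule.ne_bot_iff _).1 h1
  exact ⟨w, hw0, by simpa using hw⟩

/-- Tangent vectors of the form `w uᵀ`, with `w` orthogonal to the columns of `U`. -/
lemma vecMulVec_mem_tangent {U : MatSpace d k} {w : Fin d → ℝ} (hw : (mat U)ᵀ *ᵥ w = 0)
    (u : Fin k → ℝ) : mat.symm (vecMulVec w u) ∈ tangent U := by
  rw [mem_tangent, LinearEquiv.apply_symm_apply, Matrix.mul_vecMulVec, hw,
    ← transpose_transpose (mat U), ← transpose_mul, Matrix.mul_vecMulVec, hw]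
  simp

lemma vecMulVec_ne_zero_of_ne_zero {m n : Type*} {w : m → ℝ} {u : n → ℝ} (hw : w ≠ 0) (hu : u ≠ 0) :
    vecMulVec w u ≠ 0 := by
  obtain ⟨i, hi⟩ := Function.ne_iff.1 hw
  obtain ⟨j, hj⟩ := Function.ne_iff.1 hu
  intro h
  have := congrFun (congrFun h i) j
  simp only [vecMulVec_apply, Matrix.zero_apply, mul_eq_zero] at this
  exact this.elim hi hj

/-- The discrepancy `Δ(·, ν)` detects every nonzero normal vector `ν`, because `k < d` leaves a
direction orthogonal to the columns of `U`. -/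
lemma exists_delta_ne_zero (hkd : k < d) (hU : U ∈ stiefel d k) {ν : normal U} (hν : ν ≠ 0) :
    ∃ ξ : tangent U, delta hU ξ ν ≠ 0 := by
  obtain ⟨w, hw0, hw⟩ := exists_orthogonal_vector hkd U
  set S := symPart U (ν : MatSpace d k) with hS
  have hS0 : S ≠ 0 := fun h => hν (Subtype.ext (mat.injective (by
    rw [mat_normal hU, ← hS, h]; simp)))
  have : ∃ u, u ᵥ* S ≠ 0 := by
    by_contra! hcon
    exact hS0 (Matrix.ext_of_single_vecMul fun i => by rw [hcon, Matrix.vecMul_zero])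
  obtain ⟨u, hu⟩ := this
  refine ⟨⟨_, vecMulVec_mem_tangent hw u⟩, fun h => ?_⟩
  have h1 : mat.symm (deltaMat U (mat.symm (vecMulVec w u)) ν) = 0 := congrArg Subtype.val h
  rw [LinearEquiv.map_eq_zero_iff, deltaMat, LinearEquiv.apply_symm_apply, Matrix.mul_vecMulVec,
    hw, ← hS, Matrix.vecMulVec_mul] at h1
  simp only [Matrix.zero_vecMulVec, Matrix.zero_mul, Matrix.mul_zero, sub_zero, smul_zero,
    add_zero, neg_eq_zero] at h1
  exact vecMulVec_ne_zero_of_ne_zero hw0 hu h1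

lemma tangent_nontrivial (hk : 0 < k) (hkd : k < d) (U : MatSpace d k) :
    Nontrivial (tangent U) := by
  obtain ⟨w, hw0, hw⟩ := exists_orthogonal_vector hkd U
  have hu : (fun _ : Fin k => (1 : ℝ)) ≠ 0 := fun h => one_ne_zero (congrFun h ⟨0, hk⟩)
  refine ⟨⟨⟨_, vecMulVec_mem_tangent hw (fun _ => 1)⟩, 0, fun h => ?_⟩⟩
  have h1 : mat.symm (vecMulVec w fun _ : Fin k => (1 : ℝ)) = 0 := congrArg Subtype.val h
  rw [LinearEquiv.map_eq_zero_iff] at h1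
  exact vecMulVec_ne_zero_of_ne_zero hw0 hu h1

lemma inner_condCov (hU : U ∈ stiefel d k) (covN : normal U →L[ℝ] normal U) (ξ v w : tangent U) :
    ⟪v, condCov hU covN ξ w⟫ = ⟪ContinuousLinearMap.adjoint (delta hU ξ) v,
      covN (ContinuousLinearMap.adjoint (delta hU ξ) w)⟫ := by
  rw [condCov, ContinuousLinearMap.comp_apply, ContinuousLinearMap.comp_apply,
    ContinuousLinearMap.adjoint_inner_left]

lemma continuous_condCov (hU : U ∈ stiefel d k) (covN : normal U →L[ℝ] normal U) :
    Continuous fun ξ => condCov hU covN ξ := by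
  have h1 : Continuous fun ξ => ContinuousLinearMap.adjoint (delta hU ξ) :=
    ContinuousLinearMap.adjoint.continuous.comp (continuous_delta hU)
  exact (continuous_delta hU).clm_comp (continuous_const.clm_comp h1)

lemma norm_condCov_le (hU : U ∈ stiefel d k) {c : ℝ} (hc : ∀ ξ : tangent U, ‖delta hU ξ‖ ≤ c * ‖ξ‖)
    (covN : normal U →L[ℝ] normal U) (ξ : tangent U) :
    ‖condCov hU covN ξ‖ ≤ c ^ 2 * ‖covN‖ * ‖ξ‖ ^ 2 := by
  have h1 := hc ξ
  calc ‖condCov hU covN ξ‖ ≤ ‖delta hU ξ‖ * (‖covN‖ * ‖delta hU ξ‖) := by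
        refine (ContinuousLinearMap.opNorm_comp_le _ _).trans ?_
        gcongr
        refine (ContinuousLinearMap.opNorm_comp_le _ _).trans ?_
        rw [LinearIsometryEquiv.norm_map]
    _ ≤ (c * ‖ξ‖) * (‖covN‖ * (c * ‖ξ‖)) := by
        gcongr
        exact (ContinuousLinearMap.opNorm_nonneg _).trans h1
    _ = _ := by ring

/-- The conditional covariance of the discrepancy determines whether `Σ_N` vanishes; this is behind
both equality cases. -/
lemma eq_zero_of_inner_condCov (hkd : k < d) (hU : U ∈ stiefel d k)
    {covN : normal U →L[ℝ] normal U} (hN : covN.IsPositive)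
    (h : ∀ ξ v, ⟪v, condCov hU covN ξ v⟫ = 0) : covN = 0 := by
  by_contra hcon
  obtain ⟨ν, hν⟩ := ContinuousLinearMap.exists_ne_zero hcon
  obtain ⟨ξ, hξ⟩ := exists_delta_ne_zero hkd hU hν
  obtain ⟨B, hB, rfl, -⟩ := exists_sqrt_gaussian hN
  have h1 : ∀ v, B (ContinuousLinearMap.adjoint (delta hU ξ) v) = 0 := fun v => by
    have := h ξ v
    rwa [inner_condCov, ContinuousLinearMap.comp_apply, ← hB, inner_self_eq_zero] at this
  apply hξ
  refine ext_inner_left ℝ fun v => ?_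
  rw [← ContinuousLinearMap.adjoint_inner_left, ContinuousLinearMap.comp_apply, ← hB, h1]
  simp

end Ambient

end StiefelKL

/-! ### Variance inflation and the penalty -/

namespace StiefelKL

variable {d k : ℕ} {U : MatSpace d k}

/-- For a symmetric square root `G` of the inverse covariance, `tr ((G² C)²)` is the squared
Frobenius norm of `G C G`. -/
lemma penalty_integrand_eq {F : Type*} [NormedAddCommGroup F] [InnerProductSpace ℝ F]
    [FiniteDimensional ℝ F] {ι : Type*} [Fintype ι] (b : OrthonormalBasis ι ℝ F)
    {G C : F →L[ℝ] F} (hG : ∀ x y, ⟪G x, y⟫ = ⟪x, G y⟫) (hC : ∀ x y, ⟪C x, y⟫ = ⟪x, C y⟫) :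
    LinearMap.trace ℝ F ((((G ∘L G) ∘L C) ^ 2 : F →L[ℝ] F) : F →ₗ[ℝ] F) =
      ∑ i, ‖G (C (G (b i)))‖ ^ 2 := by
  set K : F →L[ℝ] F := G ∘L C ∘L G
  have h1 : LinearMap.trace ℝ F ((((G ∘L G) ∘L C) ^ 2 : F →L[ℝ] F) : F →ₗ[ℝ] F) =
      LinearMap.trace ℝ F ((K : F →ₗ[ℝ] F) * (K : F →ₗ[ℝ] F)) := by
    have e1 : ((((G ∘L G) ∘L C) ^ 2 : F →L[ℝ] F) : F →ₗ[ℝ] F) =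
        (G : F →ₗ[ℝ] F) * ((G ∘L C ∘L G ∘L G ∘L C : F →L[ℝ] F) : F →ₗ[ℝ] F) := by
      ext x; simp [sq]
    have e2 : (K : F →ₗ[ℝ] F) * (K : F →ₗ[ℝ] F) =
        ((G ∘L C ∘L G ∘L G ∘L C : F →L[ℝ] F) : F →ₗ[ℝ] F) * (G : F →ₗ[ℝ] F) := by
      ext x; simp [K]
    rw [e1, e2, LinearMap.trace_mul_comm]
  rw [h1, LinearMap.trace_eq_sum_inner _ b]
  refine Finset.sum_congr rfl fun i _ => ?_
  rw [Module.End.mul_apply, ← real_inner_self_eq_norm_sq]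
  change ⟪b i, G (C (G (G (C (G (b i))))))⟫ = _
  rw [← hG, ← hC, ← hG]

section Variance

variable {covT : tangent U →L[ℝ] tangent U} {covN : normal U →L[ℝ] normal U}

/-- Conditionally on `ξ`, the discrepancy is centred; hence it only adds to the variance. -/
lemma variance_projCoord (hU : U ∈ stiefel d k) (hT : covT.IsPositive) (hN : covN.IsPositive)
    (v : tangent U) :
    Integrable (fun ξ => ⟪v, condCov hU covN ξ v⟫) (gaussian covT) ∧
    Var[fun ζ => ⟪v, projCoord hU ζ⟫; gaussian (ambientCov covT covN)] =
      Var[fun ζ => ⟪v, tanPart U ζ⟫; gaussian (ambientCov covT covN)] +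
        ∫ ξ, ⟪v, condCov hU covN ξ v⟫ ∂(gaussian covT) := by
  obtain ⟨c, hc0, hc⟩ := exists_norm_delta_le hU
  set μ := (gaussian covT).prod (gaussian covN) with hμ
  have hcd : Continuous fun z : tangent U × normal U => delta hU z.1 z.2 :=
    ((continuous_delta hU).comp continuous_fst).clm_apply continuous_snd
  let X : tangent U × normal U → ℝ := fun z => ⟪v, z.1⟫
  let Y : tangent U × normal U → ℝ := fun z => ⟪v, delta hU z.1 z.2⟫
  have hXc : Continuous X := by fun_prop
  have hYc : Continuous Y := continuous_const.inner hcd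
  have hXb : ∀ z, |X z| ≤ ‖v‖ * ‖z.1‖ := fun z => abs_real_inner_le_norm _ _
  have hYb : ∀ z, |Y z| ≤ ‖v‖ * (c * ‖z.1‖ * ‖z.2‖) := fun z =>
    (abs_real_inner_le_norm _ _).trans (by
      gcongr
      exact ((delta hU z.1).le_opNorm z.2).trans (by gcongr; exact hc _))
  have hX2 : MemLp X 2 μ := by
    rw [memLp_two_iff_integrable_sq hXc.aestronglyMeasurable]
    have := ((gaussian_prod_moment 2 0).choose_spec.2 covT covN hT hN).1
    refine (this.const_mul (‖v‖ ^ 2)).mono' (hXc.pow 2).aestronglyMeasurable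
      (Eventually.of_forall fun z => ?_)
    rw [Real.norm_of_nonneg (sq_nonneg _), ← sq_abs]
    calc |X z| ^ 2 ≤ (‖v‖ * ‖z.1‖) ^ 2 := by gcongr; exact hXb z
      _ = _ := by ring
  have hY2 : MemLp Y 2 μ := by
    rw [memLp_two_iff_integrable_sq hYc.aestronglyMeasurable]
    have := ((gaussian_prod_moment 2 2).choose_spec.2 covT covN hT hN).1
    refine (this.const_mul ((‖v‖ * c) ^ 2)).mono' (hYc.pow 2).aestronglyMeasurable
      (Eventually.of_forall fun z => ?_)
    rw [Real.norm_of_nonneg (sq_nonneg _), ← sq_abs]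
    calc |Y z| ^ 2 ≤ (‖v‖ * (c * ‖z.1‖ * ‖z.2‖)) ^ 2 := by gcongr; exact hYb z
      _ = _ := by ring
  have hm : Measurable fun z : tangent U × normal U =>
    (z.1 : MatSpace d k) + (z.2 : MatSpace d k) := by fun_prop
  have hct : Continuous (tanPart U) := (tangent U).orthogonalProjectionOnto.continuous
  have hcp : Continuous (projCoord hU) :=
    hct.add (((continuous_delta hU).comp hct).clm_apply
      (normal U).orthogonalProjectionOnto.continuous)
  have e1 : Var[fun ζ => ⟪v, tanPart U ζ⟫; gaussian (ambientCov covT covN)] = Var[X; μ] := by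
    rw [gaussian_ambientCov hT hN, variance_map (Continuous.aemeasurable
      (continuous_const.inner hct)) hm.aemeasurable]
    congr 1
    ext z
    simp only [Function.comp_apply, tanPart_add, X]
  have e2 : Var[fun ζ => ⟪v, projCoord hU ζ⟫; gaussian (ambientCov covT covN)] =
      Var[fun z => X z + Y z; μ] := by
    rw [gaussian_ambientCov hT hN, variance_map (Continuous.aemeasurable
      (continuous_const.inner hcp)) hm.aemeasurable]
    congr 1
    ext z
    simp only [Function.comp_apply, projCoord, tanPart_add, normalPart_add, X, Y, inner_add_right]
  -- the mean of `Y` and its covariance with `X` vanish by oddness in `ν`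
  have hodd : ∀ x y, Y (x, -y) = -Y (x, y) := fun x y => by simp [Y]
  have hY0 : ∫ z, Y z ∂μ = 0 := integral_prod_odd hN hodd
  have hXY0 : ∫ z, X z * Y z ∂μ = 0 := integral_prod_odd hN fun x y => by
    rw [hodd]; simp [X]
  have hXY : Integrable (fun z => X z * Y z) μ := hX2.integrable_mul hY2
  have hYY : ∫ z, Y z ^ 2 ∂μ = ∫ ξ, ⟪v, condCov hU covN ξ v⟫ ∂(gaussian covT) := by
    rw [hμ, integral_prod _ hY2.integrable_sq]
    refine integral_congr_ae (Eventually.of_forall fun ξ => ?_)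
    change ∫ y, ⟪v, delta hU ξ y⟫ ^ 2 ∂(gaussian covN) = ⟪v, condCov hU covN ξ v⟫
    rw [inner_condCov, ← gaussian_second_moment hN]
    simp_rw [ContinuousLinearMap.adjoint_inner_left]
  have hint : Integrable (fun ξ => ⟪v, condCov hU covN ξ v⟫) (gaussian covT) := by
    refine ((((gaussian_moment 2).choose_spec.2 covT hT).1).const_mul
      (‖v‖ ^ 2 * (c ^ 2 * ‖covN‖))).mono' ?_ (Eventually.of_forall fun ξ => ?_)
    · exact (continuous_const.inner ((continuous_condCov hU covN).clm_apply
        continuous_const)).aestronglyMeasurable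
    · refine (norm_inner_le_norm _ _).trans ?_
      calc ‖v‖ * ‖condCov hU covN ξ v‖ ≤ ‖v‖ * ((c ^ 2 * ‖covN‖ * ‖ξ‖ ^ 2) * ‖v‖) := by
            gcongr
            exact ((condCov hU covN ξ).le_opNorm v).trans
              (by gcongr; exact norm_condCov_le hU hc covN ξ)
        _ = _ := by ring
  refine ⟨hint, ?_⟩
  have hX1 : Integrable X μ := hX2.integrable (by norm_num)
  have hY1 : Integrable Y μ := hY2.integrable (by norm_num)
  rw [e1, e2, variance_eq_sub hX2, variance_eq_sub (X := fun z => X z + Y z) (hX2.add hY2), ← hYY]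
  have h1 : ∫ z, ((fun z => X z + Y z) ^ 2) z ∂μ =
      ∫ z, (X ^ 2) z ∂μ + ∫ z, Y z ^ 2 ∂μ := by
    have : ∀ z, ((fun z => X z + Y z) ^ 2) z = (X z ^ 2 + 2 * (X z * Y z)) + Y z ^ 2 := fun z => by
      simp only [Pi.pow_apply]; ring
    simp_rw [this]
    have hs : Integrable (fun z => X z ^ 2 + 2 * (X z * Y z)) μ :=
      hX2.integrable_sq.add (hXY.const_mul 2)
    rw [integral_add hs hY2.integrable_sq,
      integral_add hX2.integrable_sq (hXY.const_mul 2), integral_const_mul, hXY0, mul_zero,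
      add_zero]
    rfl
  rw [h1, integral_add hX1 hY1, hY0, add_zero]
  ring

lemma inner_condCov_nonneg (hU : U ∈ stiefel d k) (hN : covN.IsPositive) (ξ v : tangent U) :
    0 ≤ ⟪v, condCov hU covN ξ v⟫ := by
  rw [inner_condCov]
  exact hN.inner_nonneg_right _

lemma variance_le (hU : U ∈ stiefel d k) (hT : covT.IsPositive) (hN : covN.IsPositive)
    (v : tangent U) :
    Var[fun ζ => ⟪v, tanPart U ζ⟫; gaussian (ambientCov covT covN)] ≤
      Var[fun ζ => ⟪v, projCoord hU ζ⟫; gaussian (ambientCov covT covN)] := by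
  rw [(variance_projCoord hU hT hN v).2]
  exact le_add_of_nonneg_right (integral_nonneg fun ξ => inner_condCov_nonneg hU hN ξ v)

lemma exists_variance_lt (hkd : k < d) (hU : U ∈ stiefel d k) (hT : covT.IsPositive)
    (hinj : Function.Injective covT) (hN : covN.IsPositive) (hN0 : covN ≠ 0) :
    ∃ v : tangent U, Var[fun ζ => ⟪v, tanPart U ζ⟫; gaussian (ambientCov covT covN)] <
      Var[fun ζ => ⟪v, projCoord hU ζ⟫; gaussian (ambientCov covT covN)] := by
  by_contra! hcon
  refine hN0 (eq_zero_of_inner_condCov hkd hU hN fun ξ v => ?_)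
  obtain ⟨h1, h2⟩ := variance_projCoord hU hT hN v
  have h3 : ∫ ξ, ⟪v, condCov hU covN ξ v⟫ ∂(gaussian covT) = 0 :=
    le_antisymm (by have := hcon v; linarith)
      (integral_nonneg fun ξ => inner_condCov_nonneg hU hN ξ v)
  rw [integral_eq_zero_iff_of_nonneg (fun ξ => inner_condCov_nonneg hU hN ξ v) h1] at h3
  have := isOpenPosMeasure_gaussian hT hinj
  exact congrFun ((Continuous.ae_eq_iff_eq (gaussian covT) (continuous_const.inner
    ((continuous_condCov hU covN).clm_apply continuous_const)) continuous_zero).1 h3) ξ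

end Variance

section Penalty

variable {covT : tangent U →L[ℝ] tangent U} {covN : normal U →L[ℝ] normal U}

lemma isPositive_inverse (hT : covT.IsPositive) (hinj : Function.Injective covT) :
    (ContinuousLinearMap.inverse covT).IsPositive := by
  obtain ⟨Q, rfl⟩ := exists_equiv_of_injective hinj
  rw [ContinuousLinearMap.inverse_equiv]
  have hs : ∀ x y, ⟪Q x, y⟫ = ⟪x, Q y⟫ := hT.isSymmetric
  refine ⟨fun x y => ?_, fun x => ?_⟩
  · change ⟪Q.symm x, y⟫ = ⟪x, Q.symm y⟫
    conv_lhs => rw [← Q.apply_symm_apply y, ← hs, Q.apply_symm_apply]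
  · rw [ContinuousLinearMap.reApplyInnerSelf_apply]
    change 0 ≤ ⟪Q.symm x, x⟫
    conv_rhs => rw [← Q.apply_symm_apply x, Q.symm_apply_apply]
    exact hT.inner_nonneg_right _

/-- The penalty is the mean of the squared Frobenius norm of `Σ_T^{-1/2} Cov(Δ | ξ) Σ_T^{-1/2}`. -/
lemma exists_penalty_eq (hU : U ∈ stiefel d k) (hT : covT.IsPositive)
    (hinj : Function.Injective covT) (hN : covN.IsPositive) :
    ∃ G : tangent U →L[ℝ] tangent U, (∀ x y, ⟪G x, y⟫ = ⟪x, G y⟫) ∧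
      G ∘L G = ContinuousLinearMap.inverse covT ∧
      penalty hU covT covN = (1 / 4) * ∫ ξ, ∑ i,
        ‖G (condCov hU covN ξ (G (stdOrthonormalBasis ℝ (tangent U) i)))‖ ^ 2 ∂(gaussian covT) := by
  obtain ⟨G, hG, hGG, -⟩ := exists_sqrt_gaussian (isPositive_inverse hT hinj)
  refine ⟨G, hG, hGG, ?_⟩
  rw [penalty, ← hGG]
  congr 2
  ext ξ
  refine penalty_integrand_eq (stdOrthonormalBasis ℝ (tangent U)) hG fun x y => ?_
  rw [real_inner_comm, inner_condCov, inner_condCov, real_inner_comm]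
  exact hN.isSymmetric _ _

lemma penalty_nonneg (hU : U ∈ stiefel d k) (hT : covT.IsPositive)
    (hinj : Function.Injective covT) (hN : covN.IsPositive) : 0 ≤ penalty hU covT covN := by
  obtain ⟨G, -, -, h⟩ := exists_penalty_eq hU hT hinj hN
  rw [h]
  exact mul_nonneg (by norm_num) (integral_nonneg fun ξ => Finset.sum_nonneg fun i _ => sq_nonneg _)

lemma norm_sandwich_le {F : Type*} [NormedAddCommGroup F] [InnerProductSpace ℝ F]
    [CompleteSpace F] {G C : F →L[ℝ] F} (hG : ∀ x y, ⟪G x, y⟫ = ⟪x, G y⟫) {x : F}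
    (hx : ‖x‖ = 1) : ‖G (C (G x))‖ ^ 2 ≤ (‖G ∘L G‖ * ‖C‖) ^ 2 := by
  have hs : ContinuousLinearMap.adjoint G = G := by
    refine ContinuousLinearMap.ext fun x => ext_inner_right ℝ fun y => ?_
    rw [ContinuousLinearMap.adjoint_inner_left, hG]
  have hn : ‖G ∘L G‖ = ‖G‖ * ‖G‖ := by
    have := ContinuousLinearMap.norm_adjoint_comp_self G
    rwa [hs] at this
  have : ‖G (C (G x))‖ ≤ ‖G‖ * (‖C‖ * (‖G‖ * 1)) := by
    rw [← hx]
    refine (G.le_opNorm _).trans ?_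
    gcongr
    refine (C.le_opNorm _).trans ?_
    gcongr
    exact G.le_opNorm _
  rw [hn]
  calc _ ≤ (‖G‖ * (‖C‖ * (‖G‖ * 1))) ^ 2 := by gcongr
    _ = _ := by ring

/-- The penalty integrand is integrable, with an integral controlled by the condition number of
`Σ_T` and by `‖Σ_N‖²`. -/
lemma penalty_bounds (hU : U ∈ stiefel d k) : ∃ C : ℝ, 0 < C ∧
    ∀ (covT : tangent U →L[ℝ] tangent U) (covN : normal U →L[ℝ] normal U), covT.IsPositive →
      Function.Injective covT → covN.IsPositive → ∀ G : tangent U →L[ℝ] tangent U,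
      (∀ x y, ⟪G x, y⟫ = ⟪x, G y⟫) → G ∘L G = ContinuousLinearMap.inverse covT →
      Integrable (fun ξ => ∑ i,
        ‖G (condCov hU covN ξ (G (stdOrthonormalBasis ℝ (tangent U) i)))‖ ^ 2) (gaussian covT) ∧
      ∫ ξ, ∑ i, ‖G (condCov hU covN ξ (G (stdOrthonormalBasis ℝ (tangent U) i)))‖ ^ 2
        ∂(gaussian covT) ≤
        C * (‖ContinuousLinearMap.inverse covT‖ * ‖covT‖) ^ 2 * ‖covN‖ ^ 2 := by
  obtain ⟨c, hc0, hc⟩ := exists_norm_delta_le hU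
  obtain ⟨D, hD, hmom⟩ := gaussian_moment (F := tangent U) 4
  set n : ℝ := (Module.finrank ℝ (tangent U) : ℝ)
  refine ⟨n * c ^ 4 * D + 1, by positivity, fun covT covN hT hinj hN G hG hGG => ?_⟩
  set J := ‖ContinuousLinearMap.inverse covT‖
  have hb : ∀ ξ, ∑ i, ‖G (condCov hU covN ξ (G (stdOrthonormalBasis ℝ (tangent U) i)))‖ ^ 2 ≤
      n * (J * (c ^ 2 * ‖covN‖)) ^ 2 * ‖ξ‖ ^ 4 := fun ξ => by
    calc _ ≤ ∑ _i : Fin (Module.finrank ℝ (tangent U)),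
          (J * (c ^ 2 * ‖covN‖ * ‖ξ‖ ^ 2)) ^ 2 := by
          refine Finset.sum_le_sum fun i _ => ?_
          refine (norm_sandwich_le hG ((stdOrthonormalBasis ℝ (tangent U)).norm_eq_one i)).trans ?_
          rw [hGG]
          gcongr
          exact norm_condCov_le hU hc covN ξ
      _ = _ := by
          rw [Finset.sum_const, Finset.card_univ, Fintype.card_fin, nsmul_eq_mul]
          ring
  obtain ⟨hi, hm⟩ := hmom covT hT
  have hcont : Continuous fun ξ => ∑ i,
      ‖G (condCov hU covN ξ (G (stdOrthonormalBasis ℝ (tangent U) i)))‖ ^ 2 := by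
    refine continuous_finsetSum _ fun i _ => Continuous.pow (Continuous.norm ?_) 2
    exact G.continuous.comp ((continuous_condCov hU covN).clm_apply continuous_const)
  have hint : Integrable (fun ξ => ∑ i,
        ‖G (condCov hU covN ξ (G (stdOrthonormalBasis ℝ (tangent U) i)))‖ ^ 2) (gaussian covT) := by
    refine (hi.const_mul (n * (J * (c ^ 2 * ‖covN‖)) ^ 2)).mono' hcont.aestronglyMeasurable
      (Eventually.of_forall fun ξ => ?_)
    rw [Real.norm_of_nonneg (Finset.sum_nonneg fun i _ => sq_nonneg _)]
    exact hb ξ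
  refine ⟨hint, ?_⟩
  calc _ ≤ ∫ ξ, n * (J * (c ^ 2 * ‖covN‖)) ^ 2 * ‖ξ‖ ^ 4 ∂(gaussian covT) :=
        integral_mono hint (hi.const_mul _) hb
    _ = n * (J * (c ^ 2 * ‖covN‖)) ^ 2 * ∫ ξ, ‖ξ‖ ^ 4 ∂(gaussian covT) := integral_const_mul _ _
    _ ≤ n * (J * (c ^ 2 * ‖covN‖)) ^ 2 * (D * √‖covT‖ ^ 4) := by gcongr
    _ = n * c ^ 4 * D * (J * ‖covT‖) ^ 2 * ‖covN‖ ^ 2 := by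
        have : √‖covT‖ ^ 4 = ‖covT‖ ^ 2 := by
          rw [show (4 : ℕ) = 2 * 2 by norm_num, pow_mul, Real.sq_sqrt
            (ContinuousLinearMap.opNorm_nonneg _)]
        rw [this]; ring
    _ ≤ _ := by gcongr; linarith

lemma penalty_eq_zero_iff (hkd : k < d) (hU : U ∈ stiefel d k) (hT : covT.IsPositive)
    (hinj : Function.Injective covT) (hN : covN.IsPositive) :
    penalty hU covT covN = 0 ↔ covN = 0 := by
  obtain ⟨G, hG, hGG, h⟩ := exists_penalty_eq hU hT hinj hN
  constructor
  · intro h0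
    obtain ⟨_, _, hb⟩ := penalty_bounds hU
    have hint := (hb covT covN hT hinj hN G hG hGG).1
    have h1 : ∫ ξ, ∑ i, ‖G (condCov hU covN ξ (G (stdOrthonormalBasis ℝ (tangent U) i)))‖ ^ 2
        ∂(gaussian covT) = 0 := by linarith
    rw [integral_eq_zero_iff_of_nonneg
      (fun ξ => Finset.sum_nonneg fun i _ => sq_nonneg _) hint] at h1
    have := isOpenPosMeasure_gaussian hT hinj
    have h2 := congrFun ((Continuous.ae_eq_iff_eq (gaussian covT) (by
      refine continuous_finsetSum _ fun i _ => Continuous.pow (Continuous.norm ?_) 2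
      exact G.continuous.comp ((continuous_condCov hU covN).clm_apply continuous_const))
      continuous_zero).1 h1)
    obtain ⟨Q, hQ⟩ := exists_equiv_of_injective hinj
    have hGinj : Function.Injective G := fun x y hxy => by
      have : (G ∘L G) x = (G ∘L G) y := by simp [hxy]
      rw [hGG, ← hQ, ContinuousLinearMap.inverse_equiv] at this
      exact Q.symm.injective this
    have hGsurj : Function.Surjective G :=
      (LinearMap.injective_iff_surjective (f := (G : tangent U →ₗ[ℝ] tangent U))).1 hGinj
    refine eq_zero_of_inner_condCov hkd hU hN fun ξ v => ?_
    have h3 := h2 ξ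
    rw [Pi.zero_apply, Finset.sum_eq_zero_iff_of_nonneg fun i _ => sq_nonneg _] at h3
    have h4 : ((G ∘L condCov hU covN ξ ∘L G : tangent U →L[ℝ] tangent U) :
        tangent U →ₗ[ℝ] tangent U) = 0 := by
      refine (stdOrthonormalBasis ℝ (tangent U)).toBasis.ext fun i => ?_
      have := h3 i (Finset.mem_univ i)
      simpa using this
    obtain ⟨w, rfl⟩ := hGsurj v
    rw [hG]
    have h5 : G (condCov hU covN ξ (G w)) = 0 := LinearMap.congr_fun h4 w
    rw [h5, inner_zero_right]
  · rintro rfl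
    rw [h]
    simp [condCov]

end Penalty

end StiefelKL

/-! ### Measurability of the polar factor and geometry of the Stiefel manifold -/

namespace StiefelKL
open scoped Matrix.Norms.Frobenius

variable {d k : ℕ}

lemma continuous_gram : Continuous fun W : MatSpace d k => (mat W)ᵀ * mat W :=
  (contDiff_gram (n := 0)).continuous

lemma isOpen_fullRank : IsOpen {W : MatSpace d k | ((mat W)ᵀ * mat W).det ≠ 0} :=
  isOpen_ne_fun continuous_gram.matrix_det continuous_const

lemma polar_of_det_eq_zero {W : MatSpace d k} (hW : ((mat W)ᵀ * mat W).det = 0) :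
    polar W = 0 := by
  rw [polar, Matrix.nonsing_inv_apply_not_isUnit _ (by simp [hW])]
  simp

lemma measurable_polar : Measurable (polar : MatSpace d k → MatSpace d k) := by
  classical
  have h : (polar : MatSpace d k → MatSpace d k) =
      {W : MatSpace d k | ((mat W)ᵀ * mat W).det ≠ 0}.piecewise polar fun _ => 0 := by
    ext1 W
    by_cases hW : ((mat W)ᵀ * mat W).det = 0
    · rw [polar_of_det_eq_zero hW, Set.piecewise_eq_of_notMem _ _ _ (by simpa using hW)]
    · rw [Set.piecewise_eq_of_mem _ _ _ (by simpa using hW)]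
  rw [h]
  refine ContinuousOn.measurable_piecewise (fun W hW => ?_) continuousOn_const
    isOpen_fullRank.measurableSet
  exact (exists_smooth_polar hW).1.continuousAt.continuousWithinAt

/-- Almost every matrix has full rank: on each line `t ↦ W + t U` with `U` on the Stiefel manifold,
the rank drops only at eigenvalues of `-UᵀW`. -/
lemma ae_fullRank {U : MatSpace d k} (hU : U ∈ stiefel d k) :
    ∀ᵐ W : MatSpace d k, ((mat W)ᵀ * mat W).det ≠ 0 := by
  have hU' : (mat U)ᵀ * mat U = 1 := hU
  let L : ℝ →ₗ[ℝ] MatSpace d k := LinearMap.toSpanSingleton ℝ _ U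
  refine ae_mem_of_ae_add_linearMap_mem L volume volume
    (s := {W : MatSpace d k | ((mat W)ᵀ * mat W).det ≠ 0}) isOpen_fullRank.measurableSet ?_
  intro W
  have hfin : ((-((mat U)ᵀ * mat W)).charpoly.rootSet ℝ).Finite := Polynomial.rootSet_finite _ _
  refine (hfin.countable.ae_notMem volume).mono fun t ht h0 => ht ?_
  obtain ⟨v, hv, hv0⟩ := Matrix.exists_mulVec_eq_zero_iff.2 h0
  have hMv : mat (W + L t) *ᵥ v = 0 := by
    have := (Matrix.conjTranspose_mul_self_mulVec_eq_zero (mat (W + L t)) v).1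
      (by rwa [conjTranspose_eq_transpose_of_trivial])
    exact this
  rw [Polynomial.mem_rootSet]
  refine ⟨(Matrix.charpoly_monic _).ne_zero, ?_⟩
  rw [Polynomial.coe_aeval_eq_eval, Matrix.eval_charpoly]
  refine Matrix.exists_mulVec_eq_zero_iff.1 ⟨v, hv, ?_⟩
  have h1 : (Matrix.scalar (Fin k)) t - -((mat U)ᵀ * mat W) = (mat U)ᵀ * mat (W + L t) := by
    rw [map_add, Matrix.mul_add, show L t = t • U from rfl, map_smul, Matrix.mul_smul, hU',
      sub_neg_eq_add, add_comm, Matrix.scalar_apply, ← Matrix.smul_one_eq_diagonal]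
  rw [h1, ← Matrix.mulVec_mulVec, hMv, Matrix.mulVec_zero]

instance isProbabilityMeasure_uniformStiefel : IsProbabilityMeasure (uniformStiefel d k) :=
  Measure.isProbabilityMeasure_map measurable_polar.aemeasurable

lemma isClosed_stiefel : IsClosed (stiefel d k) :=
  isClosed_eq continuous_gram continuous_const

lemma norm_of_mem_stiefel {V : MatSpace d k} (hV : V ∈ stiefel d k) : ‖V‖ ^ 2 = k := by
  have hV' : (mat V)ᵀ * mat V = 1 := hV
  rw [← real_inner_self_eq_norm_sq, inner_eq_trace, hV', Matrix.trace_one, Fintype.card_fin]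

lemma isCompact_stiefel : IsCompact (stiefel d k) := by
  refine Metric.isCompact_of_isClosed_isBounded isClosed_stiefel
    ((Metric.isBounded_closedBall (x := 0) (r := (k : ℝ) + 1)).subset fun V hV => ?_)
  have := norm_of_mem_stiefel hV
  rw [mem_closedBall_zero_iff]
  nlinarith [norm_nonneg V]

lemma stdGaussian_absolutelyContinuous : stdGaussian (MatSpace d k) ≪ volume := by
  obtain ⟨c, -, h⟩ := stdGaussian_eq_withDensity (F := MatSpace d k)
  rw [h]
  exact withDensity_absolutelyContinuous _ _

lemma ae_uniformStiefel_mem {U : MatSpace d k} (hU : U ∈ stiefel d k) :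
    ∀ᵐ V ∂uniformStiefel d k, V ∈ stiefel d k := by
  rw [uniformStiefel, ae_map_iff (p := fun V => V ∈ stiefel d k) measurable_polar.aemeasurable
    isClosed_stiefel.measurableSet]
  filter_upwards [stdGaussian_absolutelyContinuous.ae_le (ae_fullRank hU)] with W hW
  obtain ⟨R, -, -, h, -⟩ := exists_polar_decomp hW
  exact h

lemma tangent_iff_skew {U ξ : MatSpace d k} (hξ : ξ ∈ tangent U) :
    (symPart U ξ)ᵀ = - symPart U ξ := by
  have h : (mat U)ᵀ * mat ξ + (mat ξ)ᵀ * mat U = 0 := hξ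
  rw [symPart, transpose_mul, transpose_transpose]
  exact eq_neg_of_add_eq_zero_right h

/-- `U R` is normal for symmetric `R`. -/
lemma mul_symm_mem_normal {U : MatSpace d k} {R : Matrix (Fin k) (Fin k) ℝ} (hR : Rᵀ = R) :
    mat.symm (mat U * R) ∈ normal U := by
  rw [Submodule.mem_orthogonal]
  intro ξ hξ
  have hK := tangent_iff_skew hξ
  rw [symPart, transpose_mul, transpose_transpose] at hK
  rw [inner_eq_trace, LinearEquiv.apply_symm_apply, ← Matrix.mul_assoc]
  have h1 : ((mat ξ)ᵀ * mat U * R).trace = -((mat ξ)ᵀ * mat U * R).trace := by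
    nth_rewrite 1 [← Matrix.trace_transpose]
    rw [transpose_mul, transpose_mul, transpose_transpose, hR, Matrix.trace_mul_comm, ← neg_eq_iff_eq_neg.2 hK]
    simp
  linarith

lemma symPart_mul {U : MatSpace d k} (hU : U ∈ stiefel d k) (R : Matrix (Fin k) (Fin k) ℝ) :
    symPart U (mat.symm (mat U * R)) = R := by
  have hU' : (mat U)ᵀ * mat U = 1 := hU
  rw [symPart, LinearEquiv.apply_symm_apply, ← Matrix.mul_assoc, hU', Matrix.one_mul]

/-- Any point of the Stiefel manifold is carried to any other one by left multiplication with an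
orthogonal matrix. -/
lemma exists_orthogonal_mul_eq {U V : MatSpace d k} (hU : U ∈ stiefel d k) (hV : V ∈ stiefel d k) :
    ∃ Q : Matrix (Fin d) (Fin d) ℝ, Qᵀ * Q = 1 ∧ Q * mat V = mat U := by
  have hkd : k ≤ d := by
    have hU' : (mat U)ᵀ * mat U = 1 := hU
    have h1 := Matrix.rank_mul_le_left (mat U)ᵀ (mat U)
    rw [hU', Matrix.rank_one, Fintype.card_fin] at h1
    exact h1.trans (by simpa using Matrix.rank_le_width (mat U)ᵀ)
  -- extend the columns of a point of the Stiefel manifold to an orthogonal matrix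
  have ext : ∀ W : MatSpace d k, W ∈ stiefel d k → ∃ O : Matrix (Fin d) (Fin d) ℝ,
      Oᵀ * O = 1 ∧ ∀ i j, O i (Fin.castLE hkd j) = mat W i j := by
    intro W hW
    have hW' : (mat W)ᵀ * mat W = 1 := hW
    let v : Fin d → EuclideanSpace ℝ (Fin d) := fun j =>
      if h : (j : ℕ) < k then WithLp.toLp 2 fun i => mat W i ⟨j, h⟩ else 0
    have hv : Orthonormal ℝ (({j : Fin d | (j : ℕ) < k}).domRestrict v) := by
      rw [orthonormal_iff_ite]
      rintro ⟨i, hi⟩ ⟨j, hj⟩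
      have hi' : (i : ℕ) < k := hi
      have hj' : (j : ℕ) < k := hj
      have := congrFun (congrFun hW' ⟨i, hi'⟩) ⟨j, hj'⟩
      rw [Matrix.mul_apply, Matrix.one_apply] at this
      simp only [Set.domRestrict, v, hi', hj', dif_pos, PiLp.inner_apply]
      simp only [transpose_apply] at this
      simp only [RCLike.inner_apply, conj_trivial]
      rw [← Finset.sum_congr rfl fun x _ => mul_comm (mat W x ⟨i, hi'⟩) _, this]
      simp [Fin.ext_iff]
    obtain ⟨b, hb⟩ := hv.exists_orthonormalBasis_extension_of_card_eq (by simp)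
    refine ⟨Matrix.of fun i j => b j i, ?_, fun i j => ?_⟩
    · ext i j
      have := orthonormal_iff_ite.1 b.orthonormal i j
      rw [Matrix.one_apply, ← this, Matrix.mul_apply, PiLp.inner_apply]
      exact Finset.sum_congr rfl fun x _ => by simp [mul_comm]
    · have hj : ((Fin.castLE hkd j : Fin d) : ℕ) < k := j.2
      have := hb (Fin.castLE hkd j) hj
      simp only [Matrix.of_apply, this, v]
      rw [dif_pos hj]
      rfl
  obtain ⟨A, hA, hAU⟩ := ext U hU
  obtain ⟨B, hB, hBV⟩ := ext V hV
  have hA' := mul_eq_one_comm.1 hA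
  have hB' := mul_eq_one_comm.1 hB
  refine ⟨A * Bᵀ, ?_, ?_⟩
  · rw [transpose_mul, transpose_transpose, Matrix.mul_assoc, ← Matrix.mul_assoc _ A, hA,
      Matrix.one_mul, hB']
  · have hc : Bᵀ * mat V = (1 : Matrix (Fin d) (Fin d) ℝ).submatrix id (Fin.castLE hkd) := by
      rw [← hB]
      ext i j
      simp [Matrix.mul_apply, hBV]
    rw [Matrix.mul_assoc, hc]
    ext i j
    rw [← hAU]
    simp [Matrix.mul_apply, Matrix.one_apply]

end StiefelKL

/-! ### The Jacobian of a parametrisation of the Stiefel manifold -/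

namespace StiefelKL
open scoped Matrix.Norms.Frobenius

variable {d k : ℕ}

/-- Right multiplication `(W, R) ↦ W R` as a continuous bilinear map. -/
noncomputable def rmul : MatSpace d k →L[ℝ] Matrix (Fin k) (Fin k) ℝ →L[ℝ] MatSpace d k :=
  LinearMap.mkContinuous₂ (LinearMap.mk₂ ℝ (fun W R => mat.symm (mat W * R))
    (fun _ _ _ => by rw [map_add, Matrix.add_mul, map_add])
    (fun _ _ _ => by rw [map_smul, Matrix.smul_mul, map_smul])
    (fun _ _ _ => by rw [Matrix.mul_add, map_add])
    (fun _ _ _ => by rw [Matrix.mul_smul, map_smul])) 1 fun W R => by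
      rw [one_mul, LinearMap.mk₂_apply, ← norm_mat, LinearEquiv.apply_symm_apply, ← norm_mat W]
      exact Matrix.frobenius_norm_mul _ _

lemma rmul_apply (W : MatSpace d k) (R : Matrix (Fin k) (Fin k) ℝ) :
    rmul W R = mat.symm (mat W * R) := rfl

lemma mat_rmul (W : MatSpace d k) (R : Matrix (Fin k) (Fin k) ℝ) :
    mat (rmul W R) = mat W * R := by rw [rmul_apply, LinearEquiv.apply_symm_apply]

/-- The symmetric matrix `S` of the normal component `U S` of `z`. -/
noncomputable def symNormal (U : MatSpace d k) : MatSpace d k →L[ℝ] Matrix (Fin k) (Fin k) ℝ :=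
  LinearMap.toContinuousLinearMap
    { toFun := fun z => symPart U ((normal U).orthogonalProjectionOnto z)
      map_add' := fun x y => by simp [symPart, Matrix.mul_add]
      map_smul' := fun c x => by simp [symPart] }

lemma symNormal_apply (U z : MatSpace d k) :
    symNormal U z = symPart U ((normal U).orthogonalProjectionOnto z) := rfl

lemma symNormal_add (U : MatSpace d k) (ξ : tangent U) (ν : normal U) :
    symNormal U (ξ + ν) = symPart U ν := by
  rw [symNormal_apply, normalPart_add]

lemma rmul_symNormal {U : MatSpace d k} (hU : U ∈ stiefel d k) (z : MatSpace d k) :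
    rmul U (symNormal U z) = (normal U).orthogonalProjectionOnto z := by
  rw [rmul_apply, symNormal_apply, ← mat_normal hU, LinearEquiv.symm_apply_apply]

lemma tanPart_add_normalPart (U z : MatSpace d k) :
    (tanPart U z : MatSpace d k) + (normal U).orthogonalProjectionOnto z = z :=
  Submodule.starProjection_add_starProjection_orthogonal z

/-- The derivative `h ↦ Dφ(ξ)[h_T] + φ(ξ) S(h)` at `R = 1` of `(ξ, R) ↦ φ(ξ) R`, where `h_T` is the
tangential and `U S(h)` the normal component of `h`. -/
noncomputable def frameDeriv (U : MatSpace d k) (φ : tangent U → MatSpace d k) (ξ : tangent U) :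
    MatSpace d k →L[ℝ] MatSpace d k :=
  fderiv ℝ φ ξ ∘L (tangent U).orthogonalProjectionOnto + rmul (φ ξ) ∘L symNormal U

/-- The Jacobian of a parametrisation `φ : T_U → St(k,d)`. -/
noncomputable def jac (U : MatSpace d k) (φ : tangent U → MatSpace d k) (ξ : tangent U) : ℝ :=
  |(frameDeriv U φ ξ).det|

/-- The linear map `h ↦ h_T R + h_N`. -/
noncomputable def stretch (U : MatSpace d k) (R : Matrix (Fin k) (Fin k) ℝ) :
    MatSpace d k →L[ℝ] MatSpace d k :=
  rmul.flip R ∘L (tangent U).subtypeL ∘L (tangent U).orthogonalProjectionOnto +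
    (normal U).subtypeL ∘L (normal U).orthogonalProjectionOnto

lemma stretch_add (U : MatSpace d k) (R : Matrix (Fin k) (Fin k) ℝ) (ξ : tangent U)
    (ν : normal U) : stretch U R (ξ + ν) = rmul (ξ : MatSpace d k) R + ν := by
  have h1 := tanPart_add ξ ν
  have h2 := normalPart_add ξ ν
  rw [tanPart] at h1
  simp only [stretch, _root_.add_apply, ContinuousLinearMap.comp_apply, h1, h2]
  rfl

lemma fderiv_mem_tangent {E : Type*} [NormedAddCommGroup E] [NormedSpace ℝ E]
    {φ : E → MatSpace d k} (hφ : ∀ x, φ x ∈ stiefel d k) {x : E} (hd : DifferentiableAt ℝ φ x)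
    (h : E) : fderiv ℝ φ x h ∈ tangent (φ x) := by
  have h1 : HasFDerivAt (fun y => mat (φ y)) (matIso.toContinuousLinearEquiv.toContinuousLinearMap ∘L
      fderiv ℝ φ x) x :=
    (matIso (d := d) (k := k)).toContinuousLinearEquiv.toContinuousLinearMap.hasFDerivAt.comp x
      hd.hasFDerivAt
  have h2 : HasFDerivAt (fun y => (mat (φ y))ᵀ) (LinearMap.toContinuousLinearMap
      (Matrix.transposeLinearEquiv (Fin d) (Fin k) ℝ ℝ).toLinearMap ∘L
      (matIso.toContinuousLinearEquiv.toContinuousLinearMap ∘L fderiv ℝ φ x)) x :=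
    (LinearMap.toContinuousLinearMap
      (Matrix.transposeLinearEquiv (Fin d) (Fin k) ℝ ℝ).toLinearMap).hasFDerivAt.comp x h1
  have h3 := ((isBoundedBilinearMap_matrix_mul (l := k) (m := d) (n := k)).hasFDerivAt
    ((mat (φ x))ᵀ, mat (φ x))).comp x (h2.prodMk h1)
  have h4 : HasFDerivAt (fun _ : E => (1 : Matrix (Fin k) (Fin k) ℝ)) _ x :=
    h3.congr_of_eventuallyEq (Eventually.of_forall fun y => (hφ y).symm)
  have h5 := congrArg (fun L => L h) ((hasFDerivAt_const _ x).unique h4)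
  rw [mem_tangent]
  exact h5.symm

/-- The derivative of polar coordinates, up to an orthogonal map carrying `φ(ξ)` to `U`, is the
frame derivative at `ξ` followed by `stretch U R`. Its determinant is thus a factor depending on `ξ`
times a factor depending on `R`. -/
lemma abs_det_factor {U : MatSpace d k} (hU : U ∈ stiefel d k) {φ : tangent U → MatSpace d k}
    (hφ : ∀ ξ, φ ξ ∈ stiefel d k) {ξ : tangent U} (hd : DifferentiableAt ℝ φ ξ)
    (R : Matrix (Fin k) (Fin k) ℝ) :
    |(rmul.flip R ∘L fderiv ℝ φ ξ ∘L (tangent U).orthogonalProjectionOnto +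
      rmul (φ ξ) ∘L symNormal U).det| = |(stretch U R).det| * jac U φ ξ := by
  obtain ⟨Q, hQ, hQU⟩ := exists_orthogonal_mul_eq hU (hφ ξ)
  have lin : ∀ A : Matrix (Fin d) (Fin d) ℝ, ∃ L : MatSpace d k →ₗ[ℝ] MatSpace d k,
      ∀ W, L W = mat.symm (A * mat W) := fun A => ⟨
    { toFun := fun W => mat.symm (A * mat W)
      map_add' := fun x y => by simp [Matrix.mul_add]
      map_smul' := fun c x => by simp }, fun _ => rfl⟩
  obtain ⟨L, hL⟩ := lin Q
  obtain ⟨L', hL'⟩ := lin Qᵀ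
  have hdet : LinearMap.det L ≠ 0 := by
    have h1 : L' ∘ₗ L = LinearMap.id := by
      ext1 W
      simp only [LinearMap.comp_apply, hL, hL', LinearEquiv.apply_symm_apply, LinearMap.id_apply]
      rw [← Matrix.mul_assoc, hQ, Matrix.one_mul, LinearEquiv.symm_apply_apply]
    intro h0
    have := congrArg LinearMap.det h1
    rw [LinearMap.det_comp, h0, mul_zero, LinearMap.det_id] at this
    exact zero_ne_one this
  have hUQ : (mat U)ᵀ * Q = (mat (φ ξ))ᵀ := by
    rw [← hQU, transpose_mul, Matrix.mul_assoc, hQ, Matrix.mul_one]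
  have htan : ∀ η, L (fderiv ℝ φ ξ η) ∈ tangent U := by
    intro η
    have h1 : (mat U)ᵀ * mat (L (fderiv ℝ φ ξ η)) = (mat (φ ξ))ᵀ * mat (fderiv ℝ φ ξ η) := by
      rw [hL, LinearEquiv.apply_symm_apply, ← Matrix.mul_assoc, hUQ]
    have h2 : (mat (L (fderiv ℝ φ ξ η)))ᵀ * mat U = ((mat U)ᵀ * mat (L (fderiv ℝ φ ξ η)))ᵀ := by
      rw [transpose_mul, transpose_transpose]
    rw [mem_tangent, h2, h1, transpose_mul, transpose_transpose]
    exact fderiv_mem_tangent hφ hd η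
  have hnor : ∀ h, L (rmul (φ ξ) (symNormal U h)) = (normal U).orthogonalProjectionOnto h := by
    intro h
    rw [← rmul_symNormal hU, hL, mat_rmul, ← Matrix.mul_assoc, hQU, rmul_apply]
  have key : L ∘ₗ ((rmul.flip R ∘L fderiv ℝ φ ξ ∘L (tangent U).orthogonalProjectionOnto +
      rmul (φ ξ) ∘L symNormal U : MatSpace d k →L[ℝ] MatSpace d k) :
        MatSpace d k →ₗ[ℝ] MatSpace d k) =
      (stretch U R : MatSpace d k →ₗ[ℝ] MatSpace d k) ∘ₗ L ∘ₗ
        (frameDeriv U φ ξ : MatSpace d k →ₗ[ℝ] MatSpace d k) := by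
    ext1 h
    simp only [LinearMap.comp_apply, ContinuousLinearMap.coe_coe, _root_.add_apply, frameDeriv,
      ContinuousLinearMap.comp_apply, map_add, hnor]
    rw [← map_add]
    have := stretch_add U R ⟨_, htan ((tangent U).orthogonalProjectionOnto h)⟩
      ((normal U).orthogonalProjectionOnto h)
    simp only at this
    rw [this]
    congr 1
    change L (rmul (fderiv ℝ φ ξ ((tangent U).orthogonalProjectionOnto h)) R) = _
    rw [rmul_apply, rmul_apply, hL, hL, LinearEquiv.apply_symm_apply,
      LinearEquiv.apply_symm_apply, Matrix.mul_assoc]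
  have := congrArg LinearMap.det key
  rw [LinearMap.det_comp, LinearMap.det_comp, LinearMap.det_comp] at this
  have h2 : LinearMap.det L * _ = LinearMap.det L * _ := this.trans (by
    rw [mul_left_comm])
  have h3 := mul_left_cancel₀ hdet h2
  rw [jac, ← abs_mul]
  exact congrArg abs h3

/-- If `ξ R + ν = 0`, the skew part of `Uᵀξ R` solves a Lyapunov equation, so `ξ` vanishes. -/
lemma det_stretch_ne_zero {U : MatSpace d k} (hU : U ∈ stiefel d k)
    {R : Matrix (Fin k) (Fin k) ℝ} (hR : R.PosDef) : (stretch U R).det ≠ 0 := by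
  have hinj : Function.Injective (stretch U R : MatSpace d k →ₗ[ℝ] MatSpace d k) := by
    rw [← LinearMap.ker_eq_bot, LinearMap.ker_eq_bot']
    intro z hz
    obtain ⟨ξ, ν, rfl⟩ : ∃ (ξ : tangent U) (ν : normal U), z = ξ + ν :=
      ⟨_, _, (tanPart_add_normalPart U z).symm⟩
    have hU' : (mat U)ᵀ * mat U = 1 := hU
    have h1 : rmul (ξ : MatSpace d k) R + ν = 0 := (stretch_add U R ξ ν).symm.trans hz
    have h2 := congrArg mat h1
    rw [map_add, mat_rmul, mat_normal hU, map_zero] at h2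
    have hS := symPart_isSymm hU ν
    have hK := tangent_iff_skew ξ.2
    have h3 : symPart U ξ * R + symPart U ν = 0 := by
      have := congrArg (fun X => (mat U)ᵀ * X) h2
      simp only [Matrix.mul_add, ← Matrix.mul_assoc, hU', Matrix.one_mul, Matrix.mul_zero] at this
      exact this
    have h4 : symPart U ξ = 0 := by
      refine lyapunov_injective hR ?_
      have h5 := congrArg transpose h3
      rw [transpose_add, transpose_mul, hS, hK, posDef_transpose hR, transpose_zero,
        Matrix.mul_neg] at h5
      have : R * symPart U ξ + symPart U ξ * R =
        (symPart U ξ * R + symPart U ν) - (-(R * symPart U ξ) + symPart U ν) := by abel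
      rw [this, h3, h5, sub_zero]
    rw [h4, Matrix.zero_mul, zero_add] at h3
    rw [h3, Matrix.mul_zero, add_zero] at h2
    have h6 : mat (ξ : MatSpace d k) = 0 := by
      rw [← Matrix.mul_one (mat (ξ : MatSpace d k)), ← posDef_mul_inv hR, ← Matrix.mul_assoc, h2,
        Matrix.zero_mul]
    have h7 : (ξ : MatSpace d k) = 0 := mat.map_eq_zero_iff.1 h6
    have h8 : (ν : MatSpace d k) = 0 := by
      apply mat.map_eq_zero_iff.1
      rw [mat_normal hU, h3, Matrix.mul_zero]
    rw [h7, h8, add_zero]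
  intro h0
  have := LinearMap.bot_lt_ker_of_det_eq_zero h0
  rw [LinearMap.ker_eq_bot.2 hinj] at this
  exact lt_irrefl _ this

lemma symNormal_transpose {U : MatSpace d k} (hU : U ∈ stiefel d k) (z : MatSpace d k) :
    (symNormal U z)ᵀ = symNormal U z := symPart_isSymm hU _

lemma isOpen_posDef {U : MatSpace d k} (hU : U ∈ stiefel d k) :
    IsOpen {z : MatSpace d k | (symNormal U z).PosDef} := by
  rw [isOpen_iff_mem_nhds]
  intro z hz
  filter_upwards [(symNormal U).continuous.continuousAt.eventually (eventually_posDef hz)] with y hy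
  exact hy (symNormal_transpose hU y)

lemma norm_rmul_of_mem {V : MatSpace d k} (hV : V ∈ stiefel d k) (R : Matrix (Fin k) (Fin k) ℝ) :
    ‖rmul V R‖ ^ 2 = (Rᵀ * R).trace := by
  have hV' : (mat V)ᵀ * mat V = 1 := hV
  rw [← real_inner_self_eq_norm_sq, inner_eq_trace, mat_rmul, transpose_mul, Matrix.mul_assoc,
    ← Matrix.mul_assoc _ (mat V), hV', Matrix.one_mul]

/-- A linear equivalence between a product and a Euclidean space preserves Lebesgue measure up to a
constant. -/
lemma exists_volume_eq_smul_map_prod {E F G : Type*}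
    [NormedAddCommGroup E] [InnerProductSpace ℝ E] [FiniteDimensional ℝ E] [MeasurableSpace E]
    [BorelSpace E] [NormedAddCommGroup F] [InnerProductSpace ℝ F] [FiniteDimensional ℝ F]
    [MeasurableSpace F] [BorelSpace F] [NormedAddCommGroup G] [InnerProductSpace ℝ G]
    [FiniteDimensional ℝ G] [MeasurableSpace G] [BorelSpace G] (e : (E × F) ≃L[ℝ] G) :
    ∃ a : ℝ≥0∞, a ≠ 0 ∧ a ≠ ⊤ ∧
      (volume : Measure G) = a • ((volume : Measure E).prod (volume : Measure F)).map e := by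
  have : (((volume : Measure E).prod (volume : Measure F)).map e).IsAddHaarMeasure :=
    e.isAddHaarMeasure_map _
  refine ⟨Measure.addHaarScalarFactor volume (((volume : Measure E).prod volume).map e), ?_, ?_,
    Measure.isAddLeftInvariant_eq_smul volume _⟩
  · exact_mod_cast (Measure.addHaarScalarFactor_pos_of_isAddHaarMeasure _ _).ne'
  · simp

/-- Lebesgue measure on the matrix space is, up to a constant, the image of the product of Lebesgue
measures on tangent and normal space. -/
lemma exists_volume_eq (U : MatSpace d k) : ∃ a : ℝ≥0∞, a ≠ 0 ∧ a ≠ ⊤ ∧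
    (volume : Measure (MatSpace d k)) = a • ((volume : Measure (tangent U)).prod
      (volume : Measure (normal U))).map fun z => (z.1 : MatSpace d k) + z.2 :=
  exists_volume_eq_smul_map_prod (E := tangent U) (F := normal U)
    (Submodule.prodEquivOfIsCompl (tangent U) (normal U)
      (Submodule.isCompl_orthogonal _)).toContinuousLinearEquiv

end StiefelKL

/-! ### Polar coordinates and the change of variables for the uniform distribution -/

namespace StiefelKL
open scoped Matrix.Norms.Frobenius

variable {d k : ℕ}

/-- Polar coordinates `z ↦ φ(z_T) S(z)` on the matrix space attached to a parametrisation `φ` of the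
Stiefel manifold. -/
noncomputable def polarChart (U : MatSpace d k) (φ : tangent U → MatSpace d k) (z : MatSpace d k) :
    MatSpace d k := rmul (φ (tanPart U z)) (symNormal U z)

lemma hasFDerivAt_polarChart (U : MatSpace d k) {φ : tangent U → MatSpace d k}
    (hφ : Differentiable ℝ φ) (z : MatSpace d k) :
    HasFDerivAt (polarChart U φ)
      (rmul.flip (symNormal U z) ∘L fderiv ℝ φ (tanPart U z) ∘L
        (tangent U).orthogonalProjectionOnto + rmul (φ (tanPart U z)) ∘L symNormal U) z := by
  have h1 : HasFDerivAt (fun z => φ (tanPart U z))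
      (fderiv ℝ φ (tanPart U z) ∘L (tangent U).orthogonalProjectionOnto) z :=
    (hφ (tanPart U z)).hasFDerivAt.comp z
      ((tangent U).orthogonalProjectionOnto).hasFDerivAt
  have h2 := rmul.hasFDerivAt_of_bilinear h1 (symNormal U).hasFDerivAt
  refine h2.congr_fderiv ?_
  ext1 h
  exact add_comm _ _

lemma tangent_normal_ext {U : MatSpace d k} (hU : U ∈ stiefel d k) {z w : MatSpace d k}
    (h1 : tanPart U z = tanPart U w) (h2 : symNormal U z = symNormal U w) : z = w := by
  rw [← tanPart_add_normalPart U z, ← tanPart_add_normalPart U w, h1, ← rmul_symNormal hU,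
    ← rmul_symNormal hU, h2]

lemma polar_polarChart {U : MatSpace d k} {φ : tangent U → MatSpace d k}
    (hφ : ∀ ξ, φ ξ ∈ stiefel d k) {z : MatSpace d k} (hz : (symNormal U z).PosDef) :
    polar (polarChart U φ z) = φ (tanPart U z) :=
  polar_eq (hφ _) hz (mat_rmul _ _)

lemma injOn_polarChart {U : MatSpace d k} (hU : U ∈ stiefel d k) {φ : tangent U → MatSpace d k}
    (hφ : ∀ ξ, φ ξ ∈ stiefel d k) {B : Set (tangent U)} (hB : B.InjOn φ) :
    {z | tanPart U z ∈ B ∧ (symNormal U z).PosDef}.InjOn (polarChart U φ) := by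
  rintro z ⟨hz1, hz2⟩ w ⟨hw1, hw2⟩ h
  have h1 : φ (tanPart U z) = φ (tanPart U w) := by
    rw [← polar_polarChart hφ hz2, ← polar_polarChart hφ hw2, h]
  have h2 := hB hz1 hw1 h1
  refine tangent_normal_ext hU h2 ?_
  have h3 := congrArg mat h
  rw [polarChart, polarChart, mat_rmul, mat_rmul, ← h2] at h3
  have h4 : (mat (φ (tanPart U z)))ᵀ * mat (φ (tanPart U z)) = 1 := hφ _
  have h5 := congrArg (fun X => (mat (φ (tanPart U z)))ᵀ * X) h3
  simpa only [← Matrix.mul_assoc, h4, Matrix.one_mul] using h5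

lemma image_polarChart {U : MatSpace d k} (hU : U ∈ stiefel d k) {φ : tangent U → MatSpace d k}
    (hφ : ∀ ξ, φ ξ ∈ stiefel d k) (B : Set (tangent U)) {W : MatSpace d k}
    (hW : ((mat W)ᵀ * mat W).det ≠ 0) :
    W ∈ polarChart U φ '' {z | tanPart U z ∈ B ∧ (symNormal U z).PosDef} ↔ polar W ∈ φ '' B := by
  constructor
  · rintro ⟨z, ⟨hz1, hz2⟩, rfl⟩
    exact ⟨_, hz1, (polar_polarChart hφ hz2).symm⟩
  · rintro ⟨ξ, hξ, hp⟩
    obtain ⟨R, hR, -, -, hWR⟩ := exists_polar_decomp hW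
    let ν : normal U := ⟨mat.symm (mat U * R), mul_symm_mem_normal (posDef_transpose hR)⟩
    have h1 : symNormal U ((ξ : MatSpace d k) + ν) = R := by
      rw [symNormal_add]; exact symPart_mul hU R
    refine ⟨(ξ : MatSpace d k) + ν, ⟨?_, ?_⟩, ?_⟩
    · rwa [tanPart_add]
    · rwa [h1]
    · rw [polarChart, h1, tanPart_add, rmul_apply, hp, ← hWR, LinearEquiv.symm_apply_apply]

lemma continuous_frameDeriv {U : MatSpace d k} {φ : tangent U → MatSpace d k}
    (hφ : ContDiff ℝ 1 φ) : Continuous (frameDeriv U φ) := by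
  have h1 : Continuous (fderiv ℝ φ) := hφ.continuous_fderiv one_ne_zero
  have h2 : Continuous fun ξ => rmul (φ ξ) := rmul.continuous.comp hφ.continuous
  exact (h1.clm_comp continuous_const).add (h2.clm_comp continuous_const)

lemma continuous_jac {U : MatSpace d k} {φ : tangent U → MatSpace d k} (hφ : ContDiff ℝ 1 φ) :
    Continuous (jac U φ) :=
  (ContinuousLinearMap.continuous_det.comp (continuous_frameDeriv hφ)).abs

lemma continuous_det_stretch (U : MatSpace d k) :
    Continuous fun R => |(stretch U R).det| := by
  have h2 : Continuous fun R => (rmul (d := d) (k := k)).flip R := rmul.flip.continuous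
  exact (ContinuousLinearMap.continuous_det.comp
    ((h2.clm_comp continuous_const).add continuous_const)).abs

/-- Change of variables: a parametrisation `φ` of the Stiefel manifold, injective on `B`, pulls the
uniform distribution on `φ(B)` back to a constant multiple of `jac U φ` times Lebesgue measure, with
a constant which does not depend on the parametrisation. -/
lemma exists_lintegral_image {U : MatSpace d k} (hU : U ∈ stiefel d k) :
    ∃ c : ℝ≥0∞, c ≠ 0 ∧ ∀ φ : tangent U → MatSpace d k, ContDiff ℝ 1 φ → (∀ ξ, φ ξ ∈ stiefel d k) →
      ∀ B : Set (tangent U), MeasurableSet B → B.InjOn φ → ∀ g : MatSpace d k → ℝ≥0∞,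
      Measurable g → ∫⁻ V in φ '' B, g V ∂uniformStiefel d k =
        c * ∫⁻ ξ in B, ENNReal.ofReal (jac U φ ξ) * g (φ ξ) := by
  obtain ⟨c₀, hc₀, hstd⟩ := stdGaussian_eq_withDensity (F := MatSpace d k)
  obtain ⟨a, ha, -, hvol⟩ := exists_volume_eq U
  have htan : Measurable (tanPart U) := ((tangent U).orthogonalProjectionOnto).continuous.measurable
  let w : Matrix (Fin k) (Fin k) ℝ → ℝ≥0∞ := fun R =>
    ENNReal.ofReal (|(stretch U R).det| * (c₀ * Real.exp (-(Rᵀ * R).trace / 2)))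
  have hw : Continuous w := by
    have h1 : Continuous fun R : Matrix (Fin k) (Fin k) ℝ =>
        c₀ * Real.exp (-(Rᵀ * R).trace / 2) := by
      have : Continuous fun R : Matrix (Fin k) (Fin k) ℝ => (Rᵀ * R).trace :=
        (continuous_id.matrix_transpose.matrix_mul continuous_id).matrix_trace
      fun_prop
    exact ENNReal.continuous_ofReal.comp ((continuous_det_stretch U).mul h1)
  let PD : Set (MatSpace d k) := {z | (symNormal U z).PosDef}
  have hPD : MeasurableSet PD := (isOpen_posDef hU).measurableSet
  let N : Set (normal U) := {ν | (symNormal U ν).PosDef}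
  have hNo : IsOpen N := (isOpen_posDef hU).preimage continuous_subtype_val
  have hwN : Measurable fun ν : normal U => w (symNormal U ν) :=
    (hw.comp ((symNormal U).continuous.comp continuous_subtype_val)).measurable
  refine ⟨a * ∫⁻ ν in N, w (symNormal U ν), mul_ne_zero ha ?_, ?_⟩
  · intro h0
    rw [lintegral_eq_zero_iff hwN] at h0
    have h1 : volume N = 0 := by
      rw [← Measure.restrict_apply_self]
      refine measure_mono_null (t := {ν | ¬ w (symNormal U ν) = 0} ∪ Nᶜ) (fun ν hν => ?_) ?_
      · left
        have h3 := det_stretch_ne_zero hU hν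
        simp only [w, Set.mem_ofPred_eq, ENNReal.ofReal_eq_zero, not_le]
        exact mul_pos (abs_pos.2 h3) (by positivity)
      · rw [measure_union_null_iff]
        exact ⟨h0, by rw [Measure.restrict_apply hNo.measurableSet.compl]; simp⟩
    have h2 : N.Nonempty := by
      refine ⟨⟨mat.symm (mat U * 1), mul_symm_mem_normal transpose_one⟩, ?_⟩
      have := symNormal_add U 0 ⟨mat.symm (mat U * 1), mul_symm_mem_normal transpose_one⟩
      rw [ZeroMemClass.coe_zero, zero_add, symPart_mul hU] at this
      simp only [N, Set.mem_ofPred_eq, this]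
      exact Matrix.PosDef.one
    exact hNo.measure_ne_zero _ h2 h1
  intro φ hφ hst B hB hinj g hg
  set s : Set (MatSpace d k) := {z | tanPart U z ∈ B ∧ (symNormal U z).PosDef} with hs
  have hsm : MeasurableSet s := (htan hB).inter hPD
  have hfd : ∀ z ∈ s, HasFDerivWithinAt (polarChart U φ) _ s z := fun z _ =>
    (hasFDerivAt_polarChart U (hφ.differentiable one_ne_zero) z).hasFDerivWithinAt
  have hinj' := injOn_polarChart hU hst hinj
  have hIm : MeasurableSet (φ '' B) := hB.image_of_continuousOn_injOn hφ.continuous.continuousOn hinj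
  have hIm' : MeasurableSet (polarChart U φ '' s) :=
    hsm.image_of_continuousOn_injOn (fun z hz => (hfd z hz).continuousWithinAt) hinj'
  have hgp : Measurable fun W => g (polar W) := hg.comp measurable_polar
  have hdens : Measurable fun W : MatSpace d k =>
      ENNReal.ofReal (c₀ * Real.exp (-‖W‖ ^ 2 / 2)) := by fun_prop
  -- write the uniform distribution through the standard Gaussian, pass to polar coordinates, and
  -- integrate out the positive definite factor, which contributes a constant
  calc ∫⁻ V in φ '' B, g V ∂uniformStiefel d k
      = ∫⁻ W in polar ⁻¹' (φ '' B), g (polar W) ∂stdGaussian (MatSpace d k) := by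
        rw [uniformStiefel, setLIntegral_map hIm hg measurable_polar]
    _ = ∫⁻ W in polar ⁻¹' (φ '' B),
          ENNReal.ofReal (c₀ * Real.exp (-‖W‖ ^ 2 / 2)) * g (polar W) := by
        rw [hstd, setLIntegral_withDensity_eq_setLIntegral_mul _ hdens hgp
          (measurable_polar hIm)]
        rfl
    _ = ∫⁻ W in polarChart U φ '' s,
          ENNReal.ofReal (c₀ * Real.exp (-‖W‖ ^ 2 / 2)) * g (polar W) := by
        refine setLIntegral_congr ?_
        filter_upwards [ae_fullRank hU] with W hW
        exact propext (image_polarChart hU hst B hW).symm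
    _ = ∫⁻ z in s, (ENNReal.ofReal (jac U φ (tanPart U z)) * g (φ (tanPart U z))) *
          w (symNormal U z) := by
        rw [lintegral_image_eq_lintegral_abs_det_fderiv_mul volume hsm hfd hinj']
        refine setLIntegral_congr_fun hsm fun z hz => ?_
        simp only
        rw [abs_det_factor hU hst (hφ.differentiable one_ne_zero _), polar_polarChart hst hz.2,
          ENNReal.ofReal_mul (abs_nonneg _), polarChart, norm_rmul_of_mem (hst _)]
        simp only [w]
        rw [ENNReal.ofReal_mul (abs_nonneg _)]
        ring
    _ = ∫⁻ z, B.indicator (fun ξ => ENNReal.ofReal (jac U φ ξ) * g (φ ξ)) (tanPart U z) *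
          N.indicator (fun ν => w (symNormal U ν)) ((normal U).orthogonalProjectionOnto z) := by
        rw [← lintegral_indicator hsm]
        refine lintegral_congr fun z => ?_
        have h1 : symNormal U ((normal U).orthogonalProjectionOnto z) = symNormal U z := by
          have := symNormal_add U 0 ((normal U).orthogonalProjectionOnto z)
          rwa [ZeroMemClass.coe_zero, zero_add] at this
        have h4 : N.indicator (fun ν => w (symNormal U ν))
            ((normal U).orthogonalProjectionOnto z) = PD.indicator (fun z => w (symNormal U z)) z := by
          classical
          simp only [Set.indicator_apply, N, PD, Set.mem_ofPred_eq, h1]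
        rw [h4]
        by_cases h2 : tanPart U z ∈ B <;> by_cases h3 : (symNormal U z).PosDef <;>
          simp [s, PD, h2, h3]
    _ = _ := by
        have hm1 : Measurable (B.indicator fun ξ => ENNReal.ofReal (jac U φ ξ) * g (φ ξ)) :=
          (((continuous_jac hφ).measurable.ennreal_ofReal).mul
            (hg.comp hφ.continuous.measurable)).indicator hB
        have hm2 := hwN.indicator hNo.measurableSet
        have hadd : Measurable fun z : tangent U × normal U => (z.1 : MatSpace d k) + z.2 :=
          (measurable_subtype_coe.comp measurable_fst).add
            (measurable_subtype_coe.comp measurable_snd)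
        have hnp : Measurable fun z : MatSpace d k => (normal U).orthogonalProjectionOnto z :=
          ((normal U).orthogonalProjectionOnto).continuous.measurable
        have hm3 : Measurable fun z : MatSpace d k =>
            B.indicator (fun ξ => ENNReal.ofReal (jac U φ ξ) * g (φ ξ)) (tanPart U z) *
              N.indicator (fun ν => w (symNormal U ν)) ((normal U).orthogonalProjectionOnto z) :=
          (hm1.comp htan).mul (hm2.comp hnp)
        rw [hvol, lintegral_smul_measure, lintegral_map hm3 hadd]
        simp only [tanPart_add, normalPart_add]
        rw [lintegral_prod_mul hm1.aemeasurable hm2.aemeasurable, lintegral_indicator hB,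
          lintegral_indicator hNo.measurableSet, smul_eq_mul]
        ring

end StiefelKL

/-! ### Taylor expansions -/

namespace StiefelKL

section Taylor

variable {E F G : Type*} [NormedAddCommGroup E] [NormedSpace ℝ E] [NormedAddCommGroup F]
  [NormedSpace ℝ F] [NormedAddCommGroup G] [NormedSpace ℝ G]

/-- A `C²` map which is `O(‖x‖³)` has vanishing derivatives of order one and two at the origin. -/
lemma fderiv_eq_zero_of_isBigO {r : E → F} (hr : ContDiff ℝ 2 r)
    (h : r =O[𝓝 0] fun x => ‖x‖ ^ 3) : fderiv ℝ r 0 = 0 ∧ fderiv ℝ (fderiv ℝ r) 0 = 0 := by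
  have h1 : HasFDerivAt r (0 : E →L[ℝ] F) 0 :=
    IsBigO.hasFDerivAt (n := 3) (by simpa using h) (by norm_num)
  have h0 : r 0 = 0 :=
    IsBigO.eq_zero_of_norm_pow (x₀ := (0 : E)) (n := 3) (by simpa using h) (by norm_num)
  refine ⟨h1.fderiv, ?_⟩
  set A := fderiv ℝ (fderiv ℝ r) 0 with hA
  have hsymm : ∀ v w, A v w = A w v := fun v w =>
    (hr.contDiffAt (x := 0)).isSymmSndFDerivAt (by simp) v w
  have hd : Differentiable ℝ (fderiv ℝ r) :=
    (hr.fderiv_right (m := 1) (by norm_num)).differentiable one_ne_zero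
  have hdr : Differentiable ℝ r := hr.differentiable two_ne_zero
  -- `r(t v) = ½ t² A(v,v) + o(t²)` contradicts `r(t v) = O(t³)` unless `A(v,v) = 0`
  have hq : ∀ v, A v v = 0 := by
    intro v
    by_contra hv
    have hvn : 0 < ‖A v v‖ := norm_pos_iff.2 hv
    have hv0 : 0 < ‖v‖ := by
      rw [norm_pos_iff]; rintro rfl; simp at hv
    obtain ⟨C, hC⟩ := h.bound
    have hlo := (hd 0).hasFDerivAt.isLittleO.def (c := ‖A v v‖ / (8 * ‖v‖ ^ 2)) (by positivity)
    rw [h1.fderiv] at hlo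
    obtain ⟨ρ, hρ, hball⟩ := Metric.eventually_nhds_iff_ball.1 (hlo.and hC)
    obtain ⟨t, ht0, ht1, ht2⟩ : ∃ t : ℝ, 0 < t ∧ t * ‖v‖ < ρ ∧
        |C| * t * ‖v‖ ^ 3 < ‖A v v‖ / 8 := by
      have e1 : ∀ᶠ t : ℝ in 𝓝 0, t * ‖v‖ < ρ :=
        (by fun_prop : Continuous fun t : ℝ => t * ‖v‖).continuousAt.eventually_lt
          continuousAt_const (by simpa using hρ)
      have e2 : ∀ᶠ t : ℝ in 𝓝 0, |C| * t * ‖v‖ ^ 3 < ‖A v v‖ / 8 :=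
        (by fun_prop : Continuous fun t : ℝ => |C| * t * ‖v‖ ^ 3).continuousAt.eventually_lt
          continuousAt_const (by simpa using by positivity)
      have e3 : ∀ᶠ t : ℝ in 𝓝[>] 0, 0 < t := self_mem_nhdsWithin
      obtain ⟨t, h1, h2, h3⟩ := (e3.and ((e1.and e2).filter_mono nhdsWithin_le_nhds)).exists
      exact ⟨t, h1, h2, h3⟩
    have hnt : ‖t • v‖ = t * ‖v‖ := by rw [norm_smul, Real.norm_of_nonneg ht0.le]
    -- `r - ½ A(x,x)` is `o(‖x‖²)` by the mean value inequality, as its derivative is `o(‖x‖)`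
    have hs : ∀ x, HasFDerivAt (fun x => r x - (1 / 2 : ℝ) • A x x) (fderiv ℝ r x - A x) x := by
      intro x
      have e1 : HasFDerivAt (fun x => A x x) _ x :=
        A.hasFDerivAt_of_bilinear (hasFDerivAt_id x) (hasFDerivAt_id x)
      refine ((hdr x).hasFDerivAt.sub (e1.const_smul (1 / 2 : ℝ))).congr_fderiv ?_
      ext w
      change fderiv ℝ r x w - (1 / 2 : ℝ) • (A x w + A w x) = fderiv ℝ r x w - A x w
      rw [hsymm w x]
      module
    have hmv := (convex_closedBall (0 : E) (t * ‖v‖)).norm_image_sub_le_of_norm_hasFDerivWithin_le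
      (C := ‖A v v‖ / (8 * ‖v‖ ^ 2) * (t * ‖v‖)) (fun x _ => (hs x).hasFDerivWithinAt)
      (fun x hx => ?_) (x := 0) (y := t • v) (by simp; positivity) (by simp [hnt])
    · simp only [h0, map_zero, smul_zero, sub_zero, hnt] at hmv
      have hC' := (hball (t • v) (by rw [mem_ball_zero_iff, hnt]; exact ht1)).2
      rw [norm_pow, norm_norm, hnt] at hC'
      have hC2 : ‖r (t • v)‖ ≤ |C| * (t * ‖v‖) ^ 3 :=
        hC'.trans (by gcongr; exact le_abs_self C)
      have hAt : A (t • v) (t • v) = (t ^ 2) • A v v := by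
        rw [map_smul, map_smul, _root_.smul_apply, smul_smul, sq]
      have e4 : ‖(1 / 2 : ℝ) • A (t • v) (t • v)‖ = t ^ 2 / 2 * ‖A v v‖ := by
        rw [hAt, smul_smul, norm_smul, Real.norm_of_nonneg (by positivity)]; ring
      have e5 : ‖(1 / 2 : ℝ) • A (t • v) (t • v)‖ ≤
          ‖r (t • v)‖ + ‖r (t • v) - (1 / 2 : ℝ) • A (t • v) (t • v)‖ := by
        simpa only [sub_sub_cancel] using
          norm_sub_le (r (t • v)) (r (t • v) - (1 / 2 : ℝ) • A (t • v) (t • v))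
      have e6 : ‖A v v‖ / (8 * ‖v‖ ^ 2) * (t * ‖v‖) * (t * ‖v‖) = t ^ 2 * (‖A v v‖ / 8) := by
        field_simp
      rw [e6] at hmv
      rw [e4] at e5
      have e7 : |C| * (t * ‖v‖) ^ 3 = t ^ 2 * (|C| * t * ‖v‖ ^ 3) := by ring
      rw [e7] at hC2
      have e8 : t ^ 2 * (|C| * t * ‖v‖ ^ 3) < t ^ 2 * (‖A v v‖ / 8) := by gcongr
      nlinarith [mul_pos (pow_pos ht0 2) hvn]
    · have hx' : ‖x‖ ≤ t * ‖v‖ := by simpa using hx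
      have := (hball x (by rw [mem_ball_zero_iff]; exact hx'.trans_lt ht1)).1
      simp only [sub_zero] at this
      exact this.trans (by gcongr)
  ext v w
  -- polarisation
  have h2 := hq (v + w)
  simp only [map_add, _root_.add_apply, hq, hsymm w v, zero_add, add_zero] at h2
  rw [← two_smul ℝ, smul_eq_zero] at h2
  simpa using h2

/-- First and second derivative at the origin of a map with a given second-order expansion. -/
lemma fderiv_of_expansion {f : E → F} (hf : ContDiff ℝ 2 f) (c : F) (L : E →L[ℝ] F)
    (B : E →L[ℝ] E →L[ℝ] F)
    (h : (fun x => f x - (c + L x - (1 / 2 : ℝ) • B x x)) =O[𝓝 0] fun x => ‖x‖ ^ 3) :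
    fderiv ℝ f 0 = L ∧
      ∀ v w, fderiv ℝ (fderiv ℝ f) 0 v w = -((1 / 2 : ℝ) • (B v w + B w v)) := by
  have hB : ContDiff ℝ 2 fun x => B x x := B.isBoundedBilinearMap.contDiff.comp
    (contDiff_id.prodMk contDiff_id)
  have hg : ContDiff ℝ 2 fun x => c + L x - (1 / 2 : ℝ) • B x x :=
    (contDiff_const.add L.contDiff).sub (hB.const_smul _)
  obtain ⟨h1, h2⟩ := fderiv_eq_zero_of_isBigO (hf.sub hg) h
  have hgd : ∀ x, HasFDerivAt (fun x => c + L x - (1 / 2 : ℝ) • B x x)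
      (L - (1 / 2 : ℝ) • (B x + B.flip x)) x := by
    intro x
    have e1 : HasFDerivAt (fun x => B x x) _ x :=
      B.hasFDerivAt_of_bilinear (hasFDerivAt_id x) (hasFDerivAt_id x)
    refine ((L.hasFDerivAt.const_add c).sub (e1.const_smul (1 / 2 : ℝ))).congr_fderiv ?_
    ext w
    simp
  have hfd : ∀ x, fderiv ℝ f x = fderiv ℝ (fun x => f x - (c + L x - (1 / 2 : ℝ) • B x x)) x +
      (L - (1 / 2 : ℝ) • (B x + B.flip x)) := by
    intro x
    have := ((hf.differentiable two_ne_zero x).hasFDerivAt.sub (hgd x)).fderiv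
    rw [show fderiv ℝ (fun x => f x - (c + L x - (1 / 2 : ℝ) • B x x)) x = _ from this,
      sub_add_cancel]
  have hr2 : Differentiable ℝ (fderiv ℝ (fun x => f x - (c + L x - (1 / 2 : ℝ) • B x x))) :=
    ((hf.sub hg).fderiv_right (m := 1) (by norm_num)).differentiable one_ne_zero
  refine ⟨by rw [hfd 0, h1]; simp, fun v w => ?_⟩
  have h3 : HasFDerivAt (fderiv ℝ f) (0 + (0 - (1 / 2 : ℝ) • (B + B.flip))) 0 := by
    rw [funext hfd]
    refine HasFDerivAt.add ?_ ?_
    · rw [← h2]; exact (hr2 0).hasFDerivAt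
    · exact (hasFDerivAt_const L _).sub ((1 / 2 : ℝ) • (B + B.flip)).hasFDerivAt
  rw [h3.fderiv]
  simp

/-- Second derivative of a composition. -/
lemma fderiv_fderiv_comp {g : F → ℝ} {f : E → F} (hg : ContDiff ℝ 2 g) (hf : ContDiff ℝ 2 f)
    (x v w : E) : fderiv ℝ (fderiv ℝ (g ∘ f)) x v w =
      fderiv ℝ (fderiv ℝ g) (f x) (fderiv ℝ f x v) (fderiv ℝ f x w) +
        fderiv ℝ g (f x) (fderiv ℝ (fderiv ℝ f) x v w) := by
  have h1 : fderiv ℝ (g ∘ f) = fun x => (fderiv ℝ g (f x)).comp (fderiv ℝ f x) := by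
    ext1 x
    exact fderiv_comp x (hg.differentiable two_ne_zero _) (hf.differentiable two_ne_zero _)
  have h2 : HasFDerivAt (fun x => fderiv ℝ g (f x)) _ x :=
    ((hg.fderiv_right (m := 1) (by norm_num)).differentiable one_ne_zero (f x)).hasFDerivAt.comp x
      (hf.differentiable two_ne_zero x).hasFDerivAt
  have h3 := ((hf.fderiv_right (m := 1) (by norm_num)).differentiable one_ne_zero x).hasFDerivAt
  rw [h1, (h2.clm_comp h3).fderiv]
  simp [add_comm]

/-- Taylor's formula of first order for a function with Lipschitz gradient. -/
lemma taylor_first_order {g : E → ℝ} {s : Set E} (hs : Convex ℝ s)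
    (hg : ∀ x ∈ s, DifferentiableAt ℝ g x) {K : ℝ} {x w : E} (hx : x ∈ s) (hw : w ∈ s) (hK0 : 0 ≤ K)
    (hK : ∀ y ∈ s, ‖y - x‖ ≤ ‖w - x‖ → ‖y‖ ≤ max ‖x‖ ‖w‖ →
      ‖fderiv ℝ g y - fderiv ℝ g x‖ ≤ K * ‖y - x‖) :
    |g w - g x - fderiv ℝ g x (w - x)| ≤ K * ‖w - x‖ ^ 2 := by
  have hseg : segment ℝ x w ⊆ s := hs.segment_subset hx hw
  have h1 : ∀ y ∈ segment ℝ x w, ‖fderiv ℝ g y - fderiv ℝ g x‖ ≤ K * ‖w - x‖ := by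
    intro y hy
    have h2 : ‖y - x‖ ≤ ‖w - x‖ := by
      rw [← dist_eq_norm, ← dist_eq_norm, dist_comm y x, dist_comm w x]
      have := dist_add_dist_of_mem_segment hy
      linarith [dist_nonneg (x := y) (y := w)]
    have h3 : ‖y‖ ≤ max ‖x‖ ‖w‖ := by
      have := (convex_closedBall (0 : E) (max ‖x‖ ‖w‖)).segment_subset (x := x) (y := w)
        (by simp) (by simp) hy
      simpa using this
    exact (hK y (hseg hy) h2 h3).trans (by gcongr)
  have h2 := (convex_segment x w).norm_image_sub_le_of_norm_fderiv_le'
    (fun z hz => hg z (hseg hz)) h1 (left_mem_segment ℝ x w) (right_mem_segment ℝ x w)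
  rw [Real.norm_eq_abs] at h2
  refine h2.trans (le_of_eq (by ring))

/-- A function which is `C²` at the origin is bounded near the origin, with bounded derivative and
a quadratic bound for the error of its first-order Taylor expansions. -/
lemma exists_taylor_bounds {g : E → ℝ} (hg : ContDiffAt ℝ 2 g 0) :
    ∃ ρ K : ℝ, 0 < ρ ∧ 0 < K ∧ ∀ x, ‖x‖ < ρ → |g x| ≤ K ∧ ‖fderiv ℝ g x‖ ≤ K ∧
      ∀ w, ‖w‖ < ρ → |g w - g x - fderiv ℝ g x (w - x)| ≤ K * ‖w - x‖ ^ 2 := by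
  have h5 : ContDiffAt ℝ 1 (fderiv ℝ g) 0 := hg.fderiv_right (m := 1) (by norm_num)
  obtain ⟨L, s, hs, hL⟩ := h5.exists_lipschitzOnWith
  have c1 := (h5.continuousAt.norm).eventually_lt continuousAt_const (lt_add_one _)
  have c2 := (hg.continuousAt.norm).eventually_lt continuousAt_const (lt_add_one _)
  have c4 := hg.eventually (by simp)
  have c5 : ∀ᶠ x in 𝓝 (0 : E), x ∈ s := hs
  obtain ⟨ρ, hρ, hb⟩ := Metric.eventually_nhds_iff_ball.1 (c1.and (c2.and (c4.and c5)))
  have n0 : 0 ≤ ‖g 0‖ := norm_nonneg _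
  have n1 : 0 ≤ ‖fderiv ℝ g 0‖ := norm_nonneg _
  refine ⟨ρ, ‖g 0‖ + ‖fderiv ℝ g 0‖ + L + 1, hρ, by positivity, fun x hx => ?_⟩
  obtain ⟨b1, b2, -, b4⟩ := hb x (by simpa using hx)
  have hL0 : (0 : ℝ) ≤ L := L.2
  refine ⟨?_, by linarith, fun w hw => ?_⟩
  · rw [← Real.norm_eq_abs]; linarith
  · refine taylor_first_order (convex_ball 0 ρ)
      (fun y hy => (hb y hy).2.2.1.differentiableAt (by norm_num)) (by simpa using hx)
      (by simpa using hw) (by positivity) fun y hy _ _ => ?_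
    have := hL.dist_le_mul y (hb y hy).2.2.2 x b4
    rw [dist_eq_norm, dist_eq_norm] at this
    refine this.trans ?_
    gcongr
    linarith

end Taylor

end StiefelKL

/-! ### The retraction as a local chart -/

namespace StiefelKL
open scoped Matrix.Norms.Frobenius

variable {d k : ℕ}

/-- The bilinear map `(v, w) ↦ U vᵀ w`. -/
noncomputable def gramForm (U : MatSpace d k) :
    MatSpace d k →L[ℝ] MatSpace d k →L[ℝ] MatSpace d k :=
  LinearMap.mkContinuous₂ (LinearMap.mk₂ ℝ (fun v w => mat.symm (mat U * ((mat v)ᵀ * mat w)))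
    (fun _ _ _ => by rw [map_add, transpose_add, Matrix.add_mul, Matrix.mul_add, map_add])
    (fun _ _ _ => by
      rw [map_smul, transpose_smul, Matrix.smul_mul, Matrix.mul_smul, map_smul])
    (fun _ _ _ => by rw [map_add, Matrix.mul_add, Matrix.mul_add, map_add])
    (fun _ _ _ => by rw [map_smul, Matrix.mul_smul, Matrix.mul_smul, map_smul])) ‖U‖ fun v w => by
      rw [LinearMap.mk₂_apply, ← norm_mat, LinearEquiv.apply_symm_apply, ← norm_mat U,
        ← norm_mat v, ← norm_mat w, mul_assoc, ← norm_transpose (mat v)]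
      refine (Matrix.frobenius_norm_mul _ _).trans ?_
      gcongr
      exact Matrix.frobenius_norm_mul _ _

lemma gramForm_apply (U v w : MatSpace d k) :
    gramForm U v w = mat.symm (mat U * ((mat v)ᵀ * mat w)) := rfl

lemma secondOrder_eq (U ξ : MatSpace d k) :
    secondOrder U ξ = U + ξ - (1 / 2 : ℝ) • gramForm U ξ ξ := rfl

/-- The bilinear map `(W, z) ↦ W S`, where `U S` is the normal component of `z`. -/
noncomputable def normalMul (U : MatSpace d k) :
    MatSpace d k →L[ℝ] MatSpace d k →L[ℝ] MatSpace d k :=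
  LinearMap.toContinuousLinearMap
    { toFun := fun W => rmul W ∘L symNormal U
      map_add' := fun V W => by ext1 z; simp
      map_smul' := fun c W => by ext1 z; simp }


section Retraction

variable {U : MatSpace d k} {φ : tangent U → MatSpace d k}

lemma IsSecondOrderRetraction.contDiff_two (hφ : IsSecondOrderRetraction U φ) :
    ContDiff ℝ 2 φ := hφ.smooth.of_le (by norm_cast)

lemma IsSecondOrderRetraction.contDiff_one (hφ : IsSecondOrderRetraction U φ) :
    ContDiff ℝ 1 φ := hφ.smooth.of_le (by norm_cast)

lemma IsSecondOrderRetraction.map_zero (hφ : IsSecondOrderRetraction U φ) : φ 0 = U := by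
  have := IsBigO.eq_zero_of_norm_pow (x₀ := (0 : tangent U)) (n := 3)
    (by simpa using hφ.expansion) (by norm_num)
  rw [sub_eq_zero] at this
  rw [this, secondOrder_eq]
  simp

/-- The bilinear map `gramForm` restricted to the tangent space. -/
noncomputable def tangentGramForm (U : MatSpace d k) :
    tangent U →L[ℝ] tangent U →L[ℝ] MatSpace d k :=
  (gramForm U).bilinearComp (tangent U).subtypeL (tangent U).subtypeL

lemma IsSecondOrderRetraction.fderiv_zero (hφ : IsSecondOrderRetraction U φ) :
    fderiv ℝ φ 0 = (tangent U).subtypeL ∧ ∀ v w, fderiv ℝ (fderiv ℝ φ) 0 v w =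
      -((1 / 2 : ℝ) • (gramForm U v w + gramForm U w v)) :=
  fderiv_of_expansion (E := tangent U) hφ.contDiff_two U (tangent U).subtypeL (tangentGramForm U)
    hφ.expansion

/-- The Riemannian Hessian at `U` is the ordinary Hessian at `0` of the potential read in a
second-order retraction. -/
lemma IsSecondOrderRetraction.hessian_eq (hφ : IsSecondOrderRetraction U φ) {ℓ : MatSpace d k → ℝ}
    (hℓ : ContDiff ℝ 2 ℓ) (v w : tangent U) :
    fderiv ℝ (fderiv ℝ (ℓ ∘ φ)) 0 v w = riemHess ℓ U v w := by
  obtain ⟨h1, h2⟩ := hφ.fderiv_zero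
  rw [fderiv_fderiv_comp (E := tangent U) hℓ hφ.contDiff_two, hφ.map_zero, h1, h2, riemHess,
    iteratedFDeriv_two_apply, _root_.map_neg, ← sub_eq_add_neg, gramForm_apply, gramForm_apply,
    ← map_add, ← Matrix.mul_add]
  rfl

lemma frameDeriv_zero (hU : U ∈ stiefel d k) (hφ : IsSecondOrderRetraction U φ) :
    frameDeriv U φ 0 = ContinuousLinearMap.id ℝ _ := by
  ext1 h
  simp only [frameDeriv, _root_.add_apply, ContinuousLinearMap.comp_apply, hφ.fderiv_zero.1,
    hφ.map_zero, rmul_symNormal hU]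
  exact tanPart_add_normalPart U h

lemma jac_zero (hU : U ∈ stiefel d k) (hφ : IsSecondOrderRetraction U φ) : jac U φ 0 = 1 := by
  rw [jac, frameDeriv_zero hU hφ]
  simp [ContinuousLinearMap.det]

lemma contDiff_clm_det {E : Type*} [NormedAddCommGroup E] [NormedSpace ℝ E]
    [FiniteDimensional ℝ E] {n : ℕ∞ω} : ContDiff ℝ n fun A : E →L[ℝ] E => A.det := by
  let b := Module.finBasis ℝ E
  have h : (fun A : E →L[ℝ] E => A.det) =
      fun A : E →L[ℝ] E => (LinearMap.toMatrix b b (A : E →ₗ[ℝ] E)).det := by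
    ext1 A
    rw [LinearMap.det_toMatrix]
  rw [h]
  simp only [Matrix.det_apply]
  refine ContDiff.sum fun σ _ => ContDiff.const_smul _ (contDiff_prod fun i _ => ?_)
  let L : (E →L[ℝ] E) →ₗ[ℝ] ℝ :=
    { toFun := fun A => LinearMap.toMatrix b b (A : E →ₗ[ℝ] E) (σ i) i
      map_add' := fun A B => by simp
      map_smul' := fun c A => by simp }
  exact (LinearMap.toContinuousLinearMap L).contDiff

/-- Near the origin the Jacobian is positive and its logarithm is smooth. -/
lemma exists_log_jac_bounds (hU : U ∈ stiefel d k) (hφ : IsSecondOrderRetraction U φ) :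
    ∃ ρ K : ℝ, 0 < ρ ∧ 0 < K ∧ ∀ x : tangent U, ‖x‖ < ρ → 0 < jac U φ x ∧
      |Real.log (jac U φ x)| ≤ K ∧ ‖fderiv ℝ (fun ξ => Real.log (jac U φ ξ)) x‖ ≤ K ∧
      ∀ w : tangent U, ‖w‖ < ρ → |Real.log (jac U φ w) - Real.log (jac U φ x) -
        fderiv ℝ (fun ξ => Real.log (jac U φ ξ)) x (w - x)| ≤ K * ‖w - x‖ ^ 2 := by
  have h1 : ContDiff ℝ 2 (frameDeriv U φ) := by
    have e1 : ContDiff ℝ 2 (fderiv ℝ φ) := (hφ.smooth.of_le (m := 3) (by norm_cast)).fderiv_right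
      (m := 2) (by norm_num)
    exact (e1.clm_comp contDiff_const).add ((normalMul U).contDiff.comp hφ.contDiff_two)
  have h2 : ContDiff ℝ 2 fun ξ => (frameDeriv U φ ξ).det := contDiff_clm_det.comp h1
  have h3 : (frameDeriv U φ 0).det = 1 := by
    rw [frameDeriv_zero hU hφ]; simp [ContinuousLinearMap.det]
  have h4 : ContDiffAt ℝ 2 (fun ξ => Real.log (jac U φ ξ)) 0 := by
    have : ContDiffAt ℝ 2 (fun ξ => Real.log ((frameDeriv U φ ξ).det)) 0 :=
      h2.contDiffAt.log (by rw [h3]; exact one_ne_zero)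
    refine this.congr_of_eventuallyEq (Eventually.of_forall fun ξ => ?_)
    simp only [jac, Real.log_abs]
  have c3 : ∀ᶠ ξ in 𝓝 0, 0 < jac U φ ξ :=
    continuousAt_const.eventually_lt (continuous_jac hφ.contDiff_one).continuousAt (by
      rw [jac_zero hU hφ]; exact one_pos)
  obtain ⟨ρ₁, hρ₁, hb⟩ := Metric.eventually_nhds_iff_ball.1 c3
  obtain ⟨ρ₂, K, hρ₂, hK, hb₂⟩ := exists_taylor_bounds (E := tangent U) h4
  refine ⟨min ρ₁ ρ₂, K, lt_min hρ₁ hρ₂, hK, fun x hx => ?_⟩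
  obtain ⟨b1, b2, b3⟩ := hb₂ x (hx.trans_le (min_le_right _ _))
  exact ⟨hb x (by simpa using hx.trans_le (min_le_left _ _)), b1, b2,
    fun w hw => b3 w (hw.trans_le (min_le_right _ _))⟩

lemma self_mem_normal (hU : U ∈ stiefel d k) :
    U ∈ normal U ∧ symNormal U U = 1 ∧ tanPart U U = 0 := by
  have hnU : (U : MatSpace d k) ∈ normal U := by
    have := mul_symm_mem_normal (U := U) (R := (1 : Matrix (Fin k) (Fin k) ℝ)) transpose_one
    rwa [Matrix.mul_one, LinearEquiv.symm_apply_apply] at this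
  refine ⟨hnU, ?_, ?_⟩
  · have := symNormal_add U 0 ⟨U, hnU⟩
    rw [ZeroMemClass.coe_zero, zero_add] at this
    exact this.trans hU
  · have := tanPart_add (U := U) 0 ⟨U, hnU⟩
    rwa [ZeroMemClass.coe_zero, zero_add] at this

lemma contDiff_polarChart (hφ : IsSecondOrderRetraction U φ) : ContDiff ℝ 1 (polarChart U φ) := by
  have h1 : ContDiff ℝ 1 fun z : MatSpace d k => φ (tanPart U z) :=
    hφ.contDiff_one.comp ((tangent U).orthogonalProjectionOnto).contDiff
  have h2 : ContDiff ℝ 1 fun z : MatSpace d k => normalMul U (φ (tanPart U z)) :=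
    (normalMul U).contDiff.comp h1
  have h3 : ContDiff ℝ 1 fun z : MatSpace d k => normalMul U (φ (tanPart U z)) z :=
    h2.clm_apply contDiff_id
  exact h3

lemma hasFDerivAt_polarChart_self (hU : U ∈ stiefel d k) (hφ : IsSecondOrderRetraction U φ) :
    HasFDerivAt (polarChart U φ) (ContinuousLinearMap.id ℝ (MatSpace d k)) U := by
  obtain ⟨-, hst, htU⟩ := self_mem_normal hU
  rw [← frameDeriv_zero hU hφ]
  refine (hasFDerivAt_polarChart U (hφ.contDiff_one.differentiable one_ne_zero) U).congr_fderiv ?_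
  ext1 h
  rw [htU, hst]
  change rmul (fderiv ℝ φ 0 _) 1 + _ = fderiv ℝ φ 0 _ + _
  rw [rmul_apply, Matrix.mul_one, LinearEquiv.symm_apply_apply]

/-- Polar coordinates are a local diffeomorphism at `U`, with derivative the identity. -/
lemma polarChart_smooth (hU : U ∈ stiefel d k) (hφ : IsSecondOrderRetraction U φ) :
    ContDiff ℝ 1 (polarChart U φ) ∧
      HasFDerivAt (polarChart U φ) ((ContinuousLinearEquiv.refl ℝ (MatSpace d k) :
        MatSpace d k ≃L[ℝ] MatSpace d k) : MatSpace d k →L[ℝ] MatSpace d k) U := by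
  refine ⟨contDiff_polarChart hφ, ?_⟩
  rw [ContinuousLinearEquiv.coe_refl]
  exact hasFDerivAt_polarChart_self hU hφ

/-- A retraction has a Lipschitz local inverse `θ` near `U`, which is a chart of the Stiefel
manifold. -/
lemma exists_chart (hU : U ∈ stiefel d k) (hφ : IsSecondOrderRetraction U φ) :
    ∃ (θ : MatSpace d k → tangent U) (ρ K : ℝ), 0 < ρ ∧ 0 < K ∧ Measurable θ ∧
      (∀ ξ, ‖ξ‖ < ρ → θ (φ ξ) = ξ) ∧
      (∀ V ∈ stiefel d k, ‖V - U‖ < ρ → φ (θ V) = V) ∧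
      (∀ V W, ‖V - U‖ < ρ → ‖W - U‖ < ρ → ‖θ V - θ W‖ ≤ K * ‖V - W‖) := by
  set f := polarChart U φ with hf
  obtain ⟨hnU, hst, htU⟩ := self_mem_normal hU
  -- the local inverse of polar coordinates at `U`, followed by the tangential part, inverts `φ`
  have hfφ : ∀ ξ : tangent U, f ((ξ : MatSpace d k) + U) = φ ξ := by
    intro ξ
    have h1 := symNormal_add U ξ ⟨U, hnU⟩
    have h2 := tanPart_add ξ ⟨U, hnU⟩
    simp only at h1 h2
    have h3 : symPart U U = 1 := hU
    rw [hf, polarChart, h1, h2, h3, rmul_apply, Matrix.mul_one, LinearEquiv.symm_apply_apply]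
  have hfU : f U = U := by
    have := hfφ 0
    rwa [ZeroMemClass.coe_zero, zero_add, hφ.map_zero] at this
  obtain ⟨hfs, hfd⟩ := polarChart_smooth hU hφ
  rw [← hf] at hfs hfd
  have hsd : HasStrictFDerivAt f _ U := hfs.contDiffAt.hasStrictFDerivAt' hfd one_ne_zero
  set g := hfs.contDiffAt.localInverse hfd one_ne_zero
  have hgU : g (f U) = U := hfs.contDiffAt.localInverse_apply_image hfd one_ne_zero
  have hgs : ContDiffAt ℝ 1 g (f U) := hfs.contDiffAt.to_localInverse hfd one_ne_zero
  have hleft : ∀ᶠ z in 𝓝 U, g (f z) = z := hsd.eventually_left_inverse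
  have hright : ∀ᶠ V in 𝓝 (f U), f (g V) = V := hsd.eventually_right_inverse
  rw [hfU] at hgU hgs hright
  obtain ⟨L, s, hs, hL⟩ := hgs.exists_lipschitzOnWith
  have e1 : ∀ᶠ ξ : tangent U in 𝓝 0, g (f ((ξ : MatSpace d k) + U)) = ξ + U := by
    have hc : Tendsto (fun ξ : tangent U => (ξ : MatSpace d k) + U) (𝓝 0) (𝓝 U) := by
      have : Continuous fun ξ : tangent U => (ξ : MatSpace d k) + U := by fun_prop
      simpa using this.tendsto 0
    exact hc.eventually hleft
  have e2 : ∀ᶠ ξ : tangent U in 𝓝 0, φ ξ ∈ s := by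
    have hc := hφ.contDiff_one.continuous.tendsto 0
    rw [hφ.map_zero] at hc
    exact hc.eventually hs
  have e3 : ∀ᶠ V in 𝓝 U, (symNormal U (g V)).PosDef := by
    have hc : Tendsto (fun V => symNormal U (g V)) (𝓝 U) (𝓝 1) := by
      have := ((symNormal U).continuous.tendsto U).comp
        (show Tendsto g (𝓝 U) (𝓝 U) by simpa only [hgU] using hgs.continuousAt.tendsto)
      rwa [hst] at this
    filter_upwards [hc.eventually (eventually_posDef Matrix.PosDef.one)] with V hV
    exact hV (symNormal_transpose hU _)
  obtain ⟨ρ₂, hρ₂, hb₂⟩ := Metric.eventually_nhds_iff_ball.1 (hright.and (e3.and hs))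
  have e4 : ∀ᶠ ξ : tangent U in 𝓝 0, φ ξ ∈ Metric.ball U ρ₂ := by
    have hc := hφ.contDiff_one.continuous.tendsto 0
    rw [hφ.map_zero] at hc
    exact hc.eventually (Metric.ball_mem_nhds U hρ₂)
  obtain ⟨ρ₁, hρ₁, hb₁⟩ := Metric.eventually_nhds_iff_ball.1 (e1.and e4)
  have hlip : ∀ V W, V ∈ Metric.ball U ρ₂ → W ∈ Metric.ball U ρ₂ →
      ‖tanPart U (g V) - tanPart U (g W)‖ ≤ (L + 1) * ‖V - W‖ := by
    intro V W hV hW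
    have h1 := hL.dist_le_mul V (hb₂ V hV).2.2 W (hb₂ W hW).2.2
    rw [dist_eq_norm, dist_eq_norm] at h1
    rw [tanPart, tanPart, ← map_sub]
    refine (Submodule.norm_orthogonalProjectionOnto_apply_le _ _).trans (h1.trans ?_)
    gcongr
    linarith
  classical
  refine ⟨(Metric.ball U ρ₂).piecewise (fun V => tanPart U (g V)) 0, min ρ₁ ρ₂, L + 1,
    lt_min hρ₁ hρ₂, by positivity, ?_, ?_, ?_, ?_⟩
  · refine ContinuousOn.measurable_piecewise ?_ continuousOn_const Metric.isOpen_ball.measurableSet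
    have : LipschitzOnWith (L + 1) (fun V => tanPart U (g V)) (Metric.ball U ρ₂) :=
      LipschitzOnWith.of_dist_le_mul fun V hV W hW => by
        rw [dist_eq_norm, dist_eq_norm]; exact hlip V W hV hW
    exact this.continuousOn
  · intro ξ hξ
    obtain ⟨h1, h2⟩ := hb₁ ξ (by simpa using hξ.trans_le (min_le_left _ _))
    rw [Set.piecewise_eq_of_mem _ _ _ h2, ← hfφ, h1]
    exact tanPart_add ξ ⟨U, hnU⟩
  · intro V hV hVU
    have hVb : V ∈ Metric.ball U ρ₂ := by
      rw [Metric.mem_ball, dist_eq_norm]; exact hVU.trans_le (min_le_right _ _)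
    obtain ⟨h1, h2, -⟩ := hb₂ V hVb
    rw [Set.piecewise_eq_of_mem _ _ _ hVb, ← polar_polarChart hφ.mem_stiefel h2, ← hf, h1,
      polar_of_mem hV]
  · intro V W hV hW
    have hVb : V ∈ Metric.ball U ρ₂ := by
      rw [Metric.mem_ball, dist_eq_norm]; exact hV.trans_le (min_le_right _ _)
    have hWb : W ∈ Metric.ball U ρ₂ := by
      rw [Metric.mem_ball, dist_eq_norm]; exact hW.trans_le (min_le_right _ _)
    rw [Set.piecewise_eq_of_mem _ _ _ hVb, Set.piecewise_eq_of_mem _ _ _ hWb]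
    exact hlip V W hVb hWb

end Retraction

end StiefelKL

/-! ### The posterior potential in the chart -/

namespace StiefelKL

section Generic

variable {E F H : Type*} [NormedAddCommGroup E] [NormedSpace ℝ E] [NormedAddCommGroup F]
  [NormedSpace ℝ F] [NormedAddCommGroup H] [NormedSpace ℝ H]

lemma norm_sub_le_of_iteratedFDeriv_one {f : E → H} (hf : ContDiff ℝ 1 f) {s : Set E}
    (hs : Convex ℝ s) {K : ℝ} (hK : ∀ x ∈ s, ‖iteratedFDeriv ℝ 1 f x‖ ≤ K) {x y : E} (hx : x ∈ s)
    (hy : y ∈ s) : ‖f y - f x‖ ≤ K * ‖y - x‖ :=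
  hs.norm_image_sub_le_of_norm_fderiv_le (fun z _ => hf.differentiable one_ne_zero z)
    (fun z hz => by rw [← norm_iteratedFDeriv_one]; exact hK z hz) hx hy

/-- Bounds for the error of the second-order Taylor polynomial at a critical point, and its
derivative, in terms of a bound for the third derivative. -/
lemma taylor_second_order {g : E → ℝ} (hg : ContDiff ℝ 3 g) (h0 : fderiv ℝ g 0 = 0) {ρ K : ℝ}
    (hρ : 0 < ρ) (hK : ∀ x ∈ Metric.ball 0 ρ, ‖iteratedFDeriv ℝ 3 g x‖ ≤ K) {e : E → ℝ}
    (he : ∀ x, e x = g x - g 0 - 1 / 2 * fderiv ℝ (fderiv ℝ g) 0 x x) {x : E} (hx : ‖x‖ < ρ) :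
    |e x| ≤ K * ‖x‖ ^ 3 ∧ ‖fderiv ℝ e x‖ ≤ K * ‖x‖ ^ 2 ∧ ∀ w, ‖w‖ < ρ →
      |e w - e x - fderiv ℝ e x (w - x)| ≤ K * max ‖x‖ ‖w‖ * ‖w - x‖ ^ 2 := by
  have hK0 : 0 ≤ K := (norm_nonneg _).trans (hK 0 (by simpa using hρ))
  set A := fderiv ℝ (fderiv ℝ g) 0 with hA
  have hsymm : ∀ v w, A v w = A w v := fun v w =>
    (hg.contDiffAt (x := 0)).isSymmSndFDerivAt (by simp; norm_cast) v w
  have hg1 : ContDiff ℝ 2 (fderiv ℝ g) := hg.fderiv_right (by norm_num)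
  have hg2 : ContDiff ℝ 1 (fderiv ℝ (fderiv ℝ g)) := hg1.fderiv_right (by norm_num)
  have hgd : Differentiable ℝ g := hg.differentiable (by norm_num)
  have hed : ∀ x, HasFDerivAt e (fderiv ℝ g x - A x) x := by
    intro x
    rw [funext he]
    have e1 : HasFDerivAt (fun x => A x x) _ x :=
      A.hasFDerivAt_of_bilinear (hasFDerivAt_id x) (hasFDerivAt_id x)
    refine (((hgd x).hasFDerivAt.sub_const (g 0)).sub (e1.const_smul (1 / 2 : ℝ))).congr_fderiv ?_
    ext w
    change fderiv ℝ g x w - (1 / 2 : ℝ) • (A x w + A w x) = fderiv ℝ g x w - A x w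
    rw [hsymm w x, smul_eq_mul]
    ring
  have hA' : ∀ y ∈ Metric.ball (0 : E) ρ, ‖fderiv ℝ (fderiv ℝ g) y - A‖ ≤ K * ‖y‖ := by
    intro y hy
    have := norm_sub_le_of_iteratedFDeriv_one hg2 (convex_ball 0 ρ) (K := K) (fun x hx => by
      rw [norm_iteratedFDeriv_fderiv, norm_iteratedFDeriv_fderiv]; exact hK x hx)
      (Metric.mem_ball_self hρ) hy
    rwa [sub_zero] at this
  -- the gradient of the error is Lipschitz, with a constant proportional to the distance from `0`
  have hlip : ∀ x ∈ Metric.ball (0 : E) ρ, ∀ y ∈ Metric.ball (0 : E) ρ, ∀ m, ‖x‖ ≤ m → ‖y‖ ≤ m →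
      ‖fderiv ℝ e y - fderiv ℝ e x‖ ≤ K * m * ‖y - x‖ := by
    intro x hx y hy m hxm hym
    rw [(hed y).fderiv, (hed x).fderiv]
    have hsub : ∀ z ∈ segment ℝ x y, z ∈ Metric.ball (0 : E) ρ ∧ ‖z‖ ≤ m := fun z hz =>
      ⟨(convex_ball 0 ρ).segment_subset hx hy hz, by
        simpa using (convex_closedBall (0 : E) m).segment_subset (x := x) (y := y)
          (by simpa using hxm) (by simpa using hym) hz⟩
    have := (convex_segment x y).norm_image_sub_le_of_norm_fderiv_le' (f := fderiv ℝ g) (φ := A)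
      (C := K * m) (fun z _ => hg1.differentiable two_ne_zero z)
      (fun z hz => (hA' z (hsub z hz).1).trans (by gcongr; exact (hsub z hz).2))
      (left_mem_segment ℝ x y) (right_mem_segment ℝ x y)
    rw [map_sub] at this
    have e2 : fderiv ℝ g y - A y - (fderiv ℝ g x - A x) =
        fderiv ℝ g y - fderiv ℝ g x - (A y - A x) := by abel
    rwa [e2]
  have hx' : x ∈ Metric.ball (0 : E) ρ := by simpa using hx
  have h00 : (0 : E) ∈ Metric.ball (0 : E) ρ := Metric.mem_ball_self hρ
  have he0 : e 0 = 0 := by rw [he]; simp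
  have hDe0 : fderiv ℝ e 0 = 0 := by rw [(hed 0).fderiv, h0]; simp
  have htay : ∀ x ∈ Metric.ball (0 : E) ρ, ∀ w ∈ Metric.ball (0 : E) ρ,
      |e w - e x - fderiv ℝ e x (w - x)| ≤ K * max ‖x‖ ‖w‖ * ‖w - x‖ ^ 2 := fun x hx w hw =>
    taylor_first_order (convex_ball 0 ρ) (fun z _ => (hed z).differentiableAt) hx hw
      (mul_nonneg hK0 ((norm_nonneg x).trans (le_max_left _ _)))
      fun y hy _ hym => hlip x hx y hy _ (le_max_left _ _) hym
  refine ⟨?_, ?_, fun w hw => htay x hx' w (by simpa using hw)⟩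
  · have := htay 0 h00 x hx'
    rw [he0, hDe0, norm_zero, max_eq_right (norm_nonneg x), sub_zero, sub_zero] at this
    simp only [_root_.zero_apply, sub_zero] at this
    exact this.trans (le_of_eq (by ring))
  · have := hlip 0 h00 x hx' ‖x‖ (by simp) le_rfl
    rw [hDe0, sub_zero, sub_zero] at this
    exact this.trans (le_of_eq (by ring))

/-- Derivatives of `ℓ ∘ φ` near the origin are bounded uniformly over potentials `ℓ` with bounded
derivatives on the range of `φ`. -/
lemma exists_iteratedFDeriv_comp_bound [FiniteDimensional ℝ E] {φ : E → F} (hφ : ContDiff ℝ 3 φ)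
    (M : ℝ) : ∃ K : ℝ, 0 < K ∧ ∀ ℓ : F → ℝ, ContDiff ℝ 3 ℓ →
      (∀ x, ∀ j ∈ Finset.Icc 1 3, ‖iteratedFDeriv ℝ j ℓ (φ x)‖ ≤ M) →
      ∀ x, ‖x‖ ≤ 1 → ∀ j ∈ Finset.Icc 1 3, ‖iteratedFDeriv ℝ j (ℓ ∘ φ) x‖ ≤ K := by
  have : ProperSpace E := FiniteDimensional.proper ℝ E
  have hb : ∀ j : ℕ, ∃ D : ℝ, j ≤ 3 → ∀ x : E, ‖x‖ ≤ 1 → ‖iteratedFDeriv ℝ j φ x‖ ≤ D := by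
    intro j
    by_cases hj : j ≤ 3
    · have hc : Continuous (iteratedFDeriv ℝ j φ) := hφ.continuous_iteratedFDeriv (by exact_mod_cast hj)
      obtain ⟨D, hD⟩ := (isCompact_closedBall (0 : E) 1).exists_bound_of_continuousOn hc.continuousOn
      exact ⟨D, fun _ x hx => hD x (by simpa using hx)⟩
    · exact ⟨0, fun h => absurd h hj⟩
  choose D hD using hb
  set B : ℝ := 1 + |D 1| + |D 2| + |D 3| with hB
  have hB1 : 1 ≤ B := by
    have := abs_nonneg (D 1); have := abs_nonneg (D 2); have := abs_nonneg (D 3); linarith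
  refine ⟨6 * |M| * B ^ 3 + 1, by positivity, fun ℓ hℓ hM x hx j hj => ?_⟩
  have hj' : 1 ≤ j ∧ j ≤ 3 := Finset.mem_Icc.1 hj
  -- the Faà di Bruno bound involves the value of the outer function, which is not bounded: subtract
  -- it
  have hg : ContDiff ℝ 3 fun y => ℓ y - ℓ (φ x) := hℓ.sub contDiff_const
  have hsub : ∀ (f : E → ℝ) (c : ℝ), ContDiff ℝ 3 f →
      iteratedFDeriv ℝ j (fun y => f y - c) x = iteratedFDeriv ℝ j f x := by
    intro f c hf
    have := iteratedFDeriv_sub_apply (𝕜 := ℝ) (i := j) (x := x) (f := f) (g := fun _ => c)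
      (hf.contDiffAt.of_le (by exact_mod_cast hj'.2)) contDiffAt_const
    rw [iteratedFDeriv_const_of_ne (by omega)] at this
    exact this.trans (sub_zero _)
  have h1 := norm_iteratedFDeriv_comp_le hg hφ (n := j) (by exact_mod_cast hj'.2) x (C := |M|) (D := B)
    (fun i hi => ?_) (fun i hi1 hi => ?_)
  · have h2 : ((fun y => ℓ y - ℓ (φ x)) ∘ φ) = fun y => (ℓ ∘ φ) y - ℓ (φ x) := rfl
    rw [h2, hsub _ _ (hℓ.comp hφ)] at h1
    refine h1.trans ?_
    have h3 : (j.factorial : ℝ) ≤ 6 := by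
      have := Nat.factorial_le hj'.2
      exact_mod_cast this
    have h4 : B ^ j ≤ B ^ 3 := pow_le_pow_right₀ hB1 hj'.2
    have : (j.factorial : ℝ) * |M| * B ^ j ≤ 6 * |M| * B ^ 3 := by gcongr
    linarith
  · rcases Nat.eq_zero_or_pos i with rfl | hi0
    · simp
    · have := iteratedFDeriv_sub_apply (𝕜 := ℝ) (i := i) (x := φ x) (f := ℓ)
        (g := fun _ => ℓ (φ x)) (hℓ.contDiffAt.of_le (by exact_mod_cast hi.trans hj'.2))
        contDiffAt_const
      rw [iteratedFDeriv_const_of_ne (by omega)] at this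
      have h5 : iteratedFDeriv ℝ i (fun y => ℓ y - ℓ (φ x)) (φ x) = iteratedFDeriv ℝ i ℓ (φ x) := by
        exact this.trans (sub_zero _)
      rw [h5]
      exact (hM x i (Finset.mem_Icc.2 ⟨hi0, hi.trans hj'.2⟩)).trans (le_abs_self M)
  · refine (hD i (hi.trans hj'.2) x hx).trans (le_trans ?_ (le_self_pow₀ hB1 (by omega)))
    have := abs_nonneg (D 1); have := abs_nonneg (D 2); have := abs_nonneg (D 3)
    have hi3 := hi.trans hj'.2
    interval_cases i
    · linarith [le_abs_self (D 1)]
    · linarith [le_abs_self (D 2)]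
    · linarith [le_abs_self (D 3)]

end Generic

section Potential

variable {d k : ℕ} {U : MatSpace d k} {φ : tangent U → MatSpace d k}

lemma IsSecondOrderRetraction.exists_bound (hφ : IsSecondOrderRetraction U φ) :
    ∃ ρ C : ℝ, 0 < ρ ∧ 0 < C ∧ ∀ ξ : tangent U, ‖ξ‖ < ρ → ‖φ ξ - secondOrder U ξ‖ ≤ C * ‖ξ‖ ^ 3 ∧
      ‖φ ξ - U - (ξ : MatSpace d k)‖ ≤ C * ‖ξ‖ ^ 2 := by
  obtain ⟨C, hC⟩ := hφ.expansion.bound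
  obtain ⟨ρ, hρ, hb⟩ := Metric.eventually_nhds_iff_ball.1 hC
  have hg0 : 0 ≤ ‖gramForm U‖ := ContinuousLinearMap.opNorm_nonneg _
  refine ⟨min ρ 1, |C| + ‖gramForm U‖ + 1, lt_min hρ one_pos, by positivity, fun ξ hξ => ?_⟩
  have h1 := hb ξ (by simpa using hξ.trans_le (min_le_left _ _))
  have hξ1 : ‖ξ‖ ≤ 1 := (hξ.trans_le (min_le_right _ _)).le
  rw [norm_pow, norm_norm] at h1
  have h2 : ‖φ ξ - secondOrder U ξ‖ ≤ |C| * ‖ξ‖ ^ 3 := h1.trans (by gcongr; exact le_abs_self C)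
  have hn : ‖(ξ : MatSpace d k)‖ = ‖ξ‖ := rfl
  refine ⟨h2.trans (by gcongr; linarith), ?_⟩
  have h3 : φ ξ - U - (ξ : MatSpace d k) = (φ ξ - secondOrder U ξ) -
      (1 / 2 : ℝ) • gramForm U ξ ξ := by
    rw [secondOrder_eq]; abel
  have h4 : ‖gramForm U ξ ξ‖ ≤ ‖gramForm U‖ * ‖ξ‖ * ‖ξ‖ :=
    ContinuousLinearMap.le_opNorm₂ _ _ _
  rw [h3]
  refine (norm_sub_le _ _).trans ?_
  rw [norm_smul, Real.norm_of_nonneg (by norm_num : (0 : ℝ) ≤ 1 / 2)]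
  have h5 : ‖ξ‖ ^ 3 ≤ ‖ξ‖ ^ 2 := pow_le_pow_of_le_one (norm_nonneg _) hξ1 (by norm_num)
  have h6 : |C| * ‖ξ‖ ^ 3 ≤ |C| * ‖ξ‖ ^ 2 := by gcongr
  nlinarith [sq_nonneg ‖ξ‖, mul_nonneg hg0 (sq_nonneg ‖ξ‖)]

/-- The error of the quadratic approximation of a potential at its mode, read in `φ`. -/
noncomputable def quadError (U : MatSpace d k) (φ : tangent U → MatSpace d k) (ℓ : MatSpace d k → ℝ)
    (ξ : tangent U) : ℝ := ℓ (φ ξ) - ℓ U - 1 / 2 * riemHess ℓ U ξ ξ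

/-- Uniform estimates for the quadratic approximation of potentials at their mode. -/
lemma exists_potential_bounds (hφ : IsSecondOrderRetraction U φ) {a : ℝ}
    (ha : 0 < a) (M : ℝ) :
    ∃ K : ℝ, 0 < K ∧ ∀ ℓ : MatSpace d k → ℝ, IsConcentratedPotential a M U ℓ →
      (∀ v w : tangent U, riemHess ℓ U v w = riemHess ℓ U w v) ∧
      (∀ v : tangent U, 2 * a * ‖v‖ ^ 2 ≤ riemHess ℓ U v v) ∧
      (∀ v w : tangent U, |riemHess ℓ U v w| ≤ K * ‖v‖ * ‖w‖) ∧
      ∀ x : tangent U, ‖x‖ < 1 → |quadError U φ ℓ x| ≤ K * ‖x‖ ^ 3 ∧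
        ‖fderiv ℝ (quadError U φ ℓ) x‖ ≤ K * ‖x‖ ^ 2 ∧ ∀ w : tangent U, ‖w‖ < 1 →
        |quadError U φ ℓ w - quadError U φ ℓ x - fderiv ℝ (quadError U φ ℓ) x (w - x)| ≤
          K * max ‖x‖ ‖w‖ * ‖w - x‖ ^ 2 := by
  have hφ3 : ContDiff ℝ 3 φ := hφ.smooth.of_le (by norm_cast)
  obtain ⟨K, hK, hKb⟩ := exists_iteratedFDeriv_comp_bound (E := tangent U) hφ3 M
  obtain ⟨ρ, C, hρ, hC, hb⟩ := hφ.exists_bound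
  refine ⟨K, hK, fun ℓ hℓ => ?_⟩
  have hℓ2 : ContDiff ℝ 2 ℓ := hℓ.contDiff.of_le (by norm_num)
  have hg : ContDiff ℝ 3 (ℓ ∘ φ) := hℓ.contDiff.comp hφ3
  have hKb' := hKb ℓ hℓ.contDiff fun x j hj => hℓ.bound _ (hφ.mem_stiefel x) j hj
  have hmin : fderiv ℝ (ℓ ∘ φ) 0 = 0 := by
    refine IsLocalMin.fderiv_eq_zero (Eventually.of_forall fun x => ?_)
    have := hℓ.growth _ (hφ.mem_stiefel x)
    simp only [Function.comp_apply, hφ.map_zero]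
    nlinarith [sq_nonneg ‖φ x - U‖]
  have hess := fun v w => hφ.hessian_eq hℓ2 v w
  have herr := fun x hx => taylor_second_order (E := tangent U) hg hmin one_pos (K := K)
    (fun x hx => hKb' x (by simpa using (mem_ball_zero_iff.1 hx).le) 3 (by simp))
    (e := quadError U φ ℓ) (fun x => by
      rw [hess, Function.comp_apply, Function.comp_apply, hφ.map_zero]; rfl) (x := x) hx
  refine ⟨fun v w => ?_, fun v => ?_, fun v w => ?_, herr⟩
  · rw [← hess, ← hess]
    exact (hg.contDiffAt (x := 0)).isSymmSndFDerivAt (by simp; norm_cast) v w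
  · rcases eq_or_ne v 0 with rfl | hv
    · have : riemHess ℓ U ((0 : tangent U) : MatSpace d k) ((0 : tangent U) : MatSpace d k) = 0 := by
        rw [← hess]; simp
      rw [this]; simp
    have hv0 : 0 < ‖v‖ := norm_pos_iff.2 hv
    have hsc : ∀ t : ℝ, riemHess ℓ U ((t • v : tangent U) : MatSpace d k) ((t • v : tangent U) :
        MatSpace d k) = t ^ 2 * riemHess ℓ U v v := by
      intro t
      rw [← hess, ← hess, map_smul, map_smul, _root_.smul_apply, smul_smul, smul_eq_mul, sq]
    -- compare the growth condition at `φ(t v)` with the quadratic approximation, for small `t`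
    refine le_of_forall_pos_le_add fun η hη => ?_
    obtain ⟨t, ht0, ht1, ht2, ht3⟩ : ∃ t : ℝ, 0 < t ∧ t * ‖v‖ < ρ ∧ t * ‖v‖ < 1 ∧
        2 * (K + 2 * a * C) * t * ‖v‖ ^ 3 < η := by
      have e1 : ∀ᶠ t : ℝ in 𝓝 0, t * ‖v‖ < ρ :=
        (by fun_prop : Continuous fun t : ℝ => t * ‖v‖).continuousAt.eventually_lt
          continuousAt_const (by simpa using hρ)
      have e1' : ∀ᶠ t : ℝ in 𝓝 0, t * ‖v‖ < 1 :=
        (by fun_prop : Continuous fun t : ℝ => t * ‖v‖).continuousAt.eventually_lt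
          continuousAt_const (by simp)
      have e2 : ∀ᶠ t : ℝ in 𝓝 0, 2 * (K + 2 * a * C) * t * ‖v‖ ^ 3 < η :=
        (by fun_prop : Continuous fun t : ℝ =>
          2 * (K + 2 * a * C) * t * ‖v‖ ^ 3).continuousAt.eventually_lt
          continuousAt_const (by simpa using hη)
      have e3 : ∀ᶠ t : ℝ in 𝓝[>] 0, 0 < t := self_mem_nhdsWithin
      obtain ⟨t, h1, h2, h3, h4⟩ := (e3.and ((e1.and (e1'.and e2)).filter_mono
        nhdsWithin_le_nhds)).exists
      exact ⟨t, h1, h2, h3, h4⟩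
    have hnt : ‖t • v‖ = t * ‖v‖ := by rw [norm_smul, Real.norm_of_nonneg ht0.le]
    have h1 := (herr (t • v) (by rw [hnt]; exact ht2)).1
    have h2 := (hb (t • v) (by rw [hnt]; exact ht1)).2
    have h3 := hℓ.growth _ (hφ.mem_stiefel (t • v))
    rw [quadError, hsc, hnt] at h1
    rw [hnt] at h2
    have h4 : t * ‖v‖ - C * (t * ‖v‖) ^ 2 ≤ ‖φ (t • v) - U‖ := by
      have := norm_sub_norm_le ((t • v : tangent U) : MatSpace d k)
        (-(φ (t • v) - U - ((t • v : tangent U) : MatSpace d k)))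
      have e : ((t • v : tangent U) : MatSpace d k) -
        -(φ (t • v) - U - ((t • v : tangent U) : MatSpace d k)) = φ (t • v) - U := by abel
      rw [e, norm_neg] at this
      have hn : ‖((t • v : tangent U) : MatSpace d k)‖ = t * ‖v‖ := hnt
      rw [hn] at this
      linarith
    have h5 : (t * ‖v‖) ^ 2 - 2 * C * (t * ‖v‖) ^ 3 ≤ ‖φ (t • v) - U‖ ^ 2 := by
      set τ := t * ‖v‖
      have hτ : 0 < τ := by positivity
      by_cases hc : 0 ≤ τ - C * τ ^ 2
      · have := pow_le_pow_left₀ hc h4 2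
        nlinarith [sq_nonneg (C * τ ^ 2)]
      · have : τ ^ 2 - 2 * C * τ ^ 3 ≤ 0 := by
          have h6 : τ < C * τ ^ 2 := by linarith
          have h7 : τ * τ < C * τ ^ 2 * τ := mul_lt_mul_of_pos_right h6 hτ
          nlinarith
        exact this.trans (sq_nonneg _)
    have h6 := (abs_le.1 h1).2
    have h7 : a * ((t * ‖v‖) ^ 2 - 2 * C * (t * ‖v‖) ^ 3) ≤ a * ‖φ (t • v) - U‖ ^ 2 := by gcongr
    have h8 : t ^ 2 * (2 * a * ‖v‖ ^ 2) ≤ t ^ 2 * (riemHess ℓ U v v +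
        2 * (K + 2 * a * C) * t * ‖v‖ ^ 3) := by nlinarith
    have h9 := le_of_mul_le_mul_left h8 (by positivity)
    linarith
  · rw [← hess]
    have h1 := (iteratedFDeriv ℝ 2 (ℓ ∘ φ) 0).le_opNorm ![v, w]
    rw [iteratedFDeriv_two_apply, Real.norm_eq_abs] at h1
    simp only [Matrix.cons_val_zero, Matrix.cons_val_one, Fin.prod_univ_two] at h1
    refine h1.trans ?_
    rw [mul_assoc]
    have := hKb' 0 (by simp) 2 (by simp)
    gcongr

end Potential

end StiefelKL

/-! ### Bounds for the Kullback-Leibler divergence, and oscillation of potentials -/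

namespace StiefelKL

section KL

variable {X : Type*} [MeasurableSpace X]

/-- The lower bound in the Donsker-Varadhan variational formula, for bounded test functions. -/
lemma ofReal_le_klDiv {p q : Measure X} [IsProbabilityMeasure p] [IsProbabilityMeasure q]
    {f : X → ℝ} (hf : Measurable f) {K : ℝ} (hK : ∀ x, |f x| ≤ K) :
    ENNReal.ofReal (∫ x, f x ∂q - Real.log (∫ x, Real.exp (f x) ∂p)) ≤ klDiv q p := by
  by_cases h : klDiv q p = ⊤
  · rw [h]; exact le_top
  obtain ⟨hac, hint⟩ := klDiv_ne_top_iff.1 h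
  have hfi : Integrable f q := Integrable.of_bound hf.aestronglyMeasurable K
    (Eventually.of_forall hK)
  have hei : Integrable (fun x => Real.exp (f x)) p :=
    Integrable.of_bound (Real.measurable_exp.comp hf).aestronglyMeasurable (Real.exp K)
      (Eventually.of_forall fun x => by
        rw [Real.norm_of_nonneg (Real.exp_nonneg _), Real.exp_le_exp]
        exact (abs_le.1 (hK x)).2)
  have := isProbabilityMeasure_tilted hei
  have h1 := integral_llr_tilted_right hac hfi hei hint
  rw [← toReal_klDiv_of_measure_eq (hac.trans (absolutelyContinuous_tilted hei)) (by simp),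
    ← toReal_klDiv_of_measure_eq hac (by simp)] at h1
  refine ENNReal.ofReal_le_of_le_toReal ?_
  linarith [ENNReal.toReal_nonneg (a := klDiv q (p.tilted f))]

/-- The cost of a perturbation `b` of a bounded density `a`: linear in `b` up to a logarithm. -/
lemma klFun_add_le {a b A : ℝ} (ha : 0 ≤ a) (hA : 1 ≤ A) (haA : a ≤ A) (hb : 0 ≤ b) :
    klFun (a + b) ≤ klFun a + b * (Real.log (2 * A) + Real.posLog b) := by
  rcases hb.eq_or_lt with rfl | hb0
  · simp
  have h1 : a * Real.log (a + b) ≤ a * Real.log a + b := by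
    rcases ha.eq_or_lt with rfl | ha0
    · simp [hb]
    have e : a + b = a * (1 + b / a) := by field_simp
    have h2 : Real.log (1 + b / a) ≤ b / a := by
      have := Real.log_le_sub_one_of_pos (show 0 < 1 + b / a by positivity)
      linarith
    rw [e, Real.log_mul ha0.ne' (by positivity), mul_add]
    have : a * Real.log (1 + b / a) ≤ a * (b / a) := by gcongr
    rw [mul_div_cancel₀ _ ha0.ne'] at this
    linarith
  have h3 : Real.log (a + b) ≤ Real.log (2 * A) + Real.posLog b := by
    rw [Real.posLog_eq_log_max_one hb, ← Real.log_mul (by positivity) (by positivity)]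
    refine Real.log_le_log (by positivity) ?_
    have h4 : A ≤ A * max 1 b := le_mul_of_one_le_right (by linarith) (le_max_left _ _)
    have h5 : b ≤ A * max 1 b := by
      have h6 : 0 ≤ max 1 b := le_trans zero_le_one (le_max_left _ _)
      exact (le_max_right 1 b).trans (le_mul_of_one_le_left h6 hA)
    linarith
  rw [klFun_apply, klFun_apply]
  nlinarith [mul_le_mul_of_nonneg_left h3 hb]

/-- Upper bound for the divergence of a measure which, relative to `p`, is the sum of a bounded
density and a remainder dominated by a density `D`. -/
lemma klDiv_le_of_decomp {p q q₂ : Measure X} [IsProbabilityMeasure p] [IsProbabilityMeasure q]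
    [IsFiniteMeasure q₂] {h₁ : X → ℝ} (hm : Measurable h₁) (h0 : ∀ x, 0 ≤ h₁ x) {A : ℝ} (hA : 1 ≤ A)
    (hle : ∀ x, h₁ x ≤ A) {D : X → ℝ≥0∞} (hD : Measurable D) (hDtop : ∀ᵐ x ∂p, D x ≠ ⊤)
    (hq₂ : q₂ ≤ p.withDensity D)
    (hq : q = p.withDensity (fun x => ENNReal.ofReal (h₁ x)) + q₂) :
    klDiv q p ≤ ∫⁻ x, ENNReal.ofReal (klFun (h₁ x)) ∂p +
      ∫⁻ x, ENNReal.ofReal (Real.log (2 * A) + Real.posLog (D x).toReal) ∂q₂ := by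
  have hac₂ : q₂ ≪ p := (Measure.absolutelyContinuous_of_le hq₂).trans
    (withDensity_absolutelyContinuous _ _)
  set h₂ := q₂.rnDeriv p with hh₂
  have hm₂ : Measurable h₂ := Measure.measurable_rnDeriv _ _
  have hw₂ : p.withDensity h₂ = q₂ := Measure.withDensity_rnDeriv_eq _ _ hac₂
  have hm₁ : Measurable fun x => ENNReal.ofReal (h₁ x) := hm.ennreal_ofReal
  have hqd : q = p.withDensity ((fun x => ENNReal.ofReal (h₁ x)) + h₂) := by
    rw [withDensity_add_left hm₁, hw₂, hq]
  have hac : q ≪ p := by rw [hqd]; exact withDensity_absolutelyContinuous _ _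
  have hrn : q.rnDeriv p =ᵐ[p] (fun x => ENNReal.ofReal (h₁ x)) + h₂ := by
    rw [hqd]; exact Measure.rnDeriv_withDensity _ (hm₁.add hm₂)
  have hleD : h₂ ≤ᵐ[p] D := by
    refine ae_le_of_forall_setLIntegral_le_of_sigmaFinite hm₂ fun s hs _ => ?_
    rw [← withDensity_apply _ hs, ← withDensity_apply _ hs, hw₂]
    exact hq₂ s
  have hmL : Measurable fun x => ENNReal.ofReal (Real.log (2 * A) + Real.posLog (D x).toReal) :=
    (measurable_const.add (Real.continuous_posLog.measurable.comp hD.ennreal_toReal)).ennreal_ofReal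
  rw [klDiv_eq_lintegral_klFun_of_ac hac]
  calc ∫⁻ x, ENNReal.ofReal (klFun (q.rnDeriv p x).toReal) ∂p
      ≤ ∫⁻ x, ENNReal.ofReal (klFun (h₁ x)) +
          h₂ x * ENNReal.ofReal (Real.log (2 * A) + Real.posLog (D x).toReal) ∂p := by
        refine lintegral_mono_ae ?_
        filter_upwards [hrn, hleD, hDtop] with x hx hxD hxt
        have hx2 : h₂ x ≠ ⊤ := ne_top_of_le_ne_top hxt hxD
        rw [hx, Pi.add_apply, ENNReal.toReal_add ENNReal.ofReal_ne_top hx2,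
          ENNReal.toReal_ofReal (h0 x)]
        have hb : 0 ≤ (h₂ x).toReal := ENNReal.toReal_nonneg
        have hbD : (h₂ x).toReal ≤ (D x).toReal := ENNReal.toReal_mono hxt hxD
        have h5 := klFun_add_le (h0 x) hA (hle x) hb
        have hlog : 0 ≤ Real.log (2 * A) := Real.log_nonneg (by linarith)
        have h6 : Real.posLog (h₂ x).toReal ≤ Real.posLog (D x).toReal :=
          Real.posLog_le_posLog hb hbD
        calc _ ≤ ENNReal.ofReal (klFun (h₁ x) + (h₂ x).toReal *
              (Real.log (2 * A) + Real.posLog (D x).toReal)) :=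
              ENNReal.ofReal_le_ofReal (h5.trans (by gcongr))
          _ ≤ _ := ENNReal.ofReal_add_le
          _ = _ := by rw [ENNReal.ofReal_mul hb, ENNReal.ofReal_toReal hx2]
    _ = _ := by
        have hmk : Measurable fun x => ENNReal.ofReal (klFun (h₁ x)) :=
          (measurable_klFun.comp hm).ennreal_ofReal
        rw [lintegral_add_left hmk]
        congr 1
        conv_rhs => rw [← hw₂]
        rw [lintegral_withDensity_eq_lintegral_mul _ hm₂ hmL]
        rfl

end KL

section Oscillation

variable {d k : ℕ}

/-- The polar projection turns a derivative bound on the Stiefel manifold into a local oscillation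
bound. -/
lemma exists_local_oscillation {V : MatSpace d k} (hV : V ∈ stiefel d k) (M : ℝ) :
    ∃ r : ℝ, 0 < r ∧ ∀ ℓ : MatSpace d k → ℝ, ContDiff ℝ 1 ℓ →
      (∀ W ∈ stiefel d k, ‖fderiv ℝ ℓ W‖ ≤ M) →
      ∀ W ∈ stiefel d k, W ∈ Metric.ball V r → |ℓ W - ℓ V| ≤ |M| := by
  obtain ⟨h1, P, -, h2⟩ := exists_smooth_polar (det_gram_of_mem hV)
  have h3 : ContDiffAt ℝ 1 (polar : MatSpace d k → MatSpace d k) V := h1.of_le (by norm_cast)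
  have h4 : ContDiffAt ℝ 0 (fderiv ℝ (polar : MatSpace d k → MatSpace d k)) V :=
    h3.fderiv_right (m := 0) (by norm_num)
  have h5 := (h4.continuousAt.norm).eventually_lt continuousAt_const (lt_add_one _)
  have h6 := h3.eventually (by simp)
  obtain ⟨r, hr, hb⟩ := Metric.eventually_nhds_iff_ball.1 (h2.and (h5.and h6))
  set B := ‖fderiv ℝ (polar : MatSpace d k → MatSpace d k) V‖ + 1
  have hB : 0 < B := by positivity
  refine ⟨min r (1 / B), by positivity, fun ℓ hℓ hM W hW hWV => ?_⟩
  have h7 := (convex_ball V r).norm_image_sub_le_of_norm_fderiv_le (𝕜 := ℝ)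
    (f := ℓ ∘ polar) (C := |M| * B) (x := V) (y := W) (fun x hx => ?_) (fun x hx => ?_)
    (Metric.mem_ball_self hr) (Metric.ball_subset_ball (min_le_left _ _) hWV)
  · rw [Function.comp_apply, Function.comp_apply, polar_of_mem hV, polar_of_mem hW,
      Real.norm_eq_abs] at h7
    have h8 : ‖W - V‖ < 1 / B := by
      rw [← dist_eq_norm]; exact (Metric.mem_ball.1 hWV).trans_le (min_le_right _ _)
    calc _ ≤ |M| * B * ‖W - V‖ := h7
      _ ≤ |M| * B * (1 / B) := by gcongr
      _ = |M| := by field_simp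
  · exact (hℓ.differentiable one_ne_zero _).comp x ((hb x hx).2.2.differentiableAt one_ne_zero)
  · rw [fderiv_comp x (hℓ.differentiable one_ne_zero _)
      ((hb x hx).2.2.differentiableAt one_ne_zero)]
    refine (ContinuousLinearMap.opNorm_comp_le _ _).trans ?_
    gcongr
    · exact (hM _ (hb x hx).1.2.2.1).trans (le_abs_self M)
    · exact (hb x hx).2.1.le

/-- The oscillation of a potential along a path in the Stiefel manifold is bounded in terms of the
bound for its derivative: the manifold is covered by finitely many sets of small oscillation. -/
lemma exists_path_oscillation (M : ℝ) : ∃ L : ℝ, 0 ≤ L ∧ ∀ ℓ : MatSpace d k → ℝ, ContDiff ℝ 1 ℓ →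
    (∀ W ∈ stiefel d k, ‖fderiv ℝ ℓ W‖ ≤ M) → ∀ γ : ℝ → MatSpace d k, Continuous γ →
    (∀ t, γ t ∈ stiefel d k) → |ℓ (γ 1) - ℓ (γ 0)| ≤ L := by
  have hloc : ∀ V : MatSpace d k, ∃ r : ℝ, V ∈ stiefel d k → 0 < r ∧
      ∀ ℓ : MatSpace d k → ℝ, ContDiff ℝ 1 ℓ → (∀ W ∈ stiefel d k, ‖fderiv ℝ ℓ W‖ ≤ M) →
      ∀ W ∈ stiefel d k, W ∈ Metric.ball V r → |ℓ W - ℓ V| ≤ |M| := by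
    intro V
    by_cases hV : V ∈ stiefel d k
    · obtain ⟨r, h⟩ := exists_local_oscillation hV M
      exact ⟨r, fun _ => h⟩
    · exact ⟨0, fun h => absurd h hV⟩
  choose r hr using hloc
  obtain ⟨t, hts, ht⟩ := isCompact_stiefel.elim_nhds_subcover (fun V => Metric.ball V (r V))
    fun V hV => Metric.ball_mem_nhds V (hr V hV).1
  refine ⟨t.card * (2 * |M|), by positivity, fun ℓ hℓ hM γ hγ hγs => ?_⟩
  -- the values along the path fill the interval between the end values, and they are covered by
  -- finitely many intervals of length `2 |M|`
  have hsub : Set.uIcc (ℓ (γ 0)) (ℓ (γ 1)) ⊆ ⋃ V ∈ t, Set.Icc (ℓ V - |M|) (ℓ V + |M|) := by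
    intro y hy
    obtain ⟨s, -, rfl⟩ := intermediate_value_uIcc (hℓ.continuous.comp hγ).continuousOn hy
    obtain ⟨V, hVt, hV⟩ := Set.mem_iUnion₂.1 (ht (hγs s))
    have := abs_le.1 ((hr V (hts V hVt)).2 ℓ hℓ hM _ (hγs s) hV)
    exact Set.mem_iUnion₂.2 ⟨V, hVt, by constructor <;> simp only [Function.comp_apply] <;> linarith⟩
  have h1 := (measure_mono hsub).trans (measure_biUnion_finset_le (μ := (volume : Measure ℝ)) t _)
  rw [Real.volume_interval] at h1
  have h2 : ∑ V ∈ t, (volume : Measure ℝ) (Set.Icc (ℓ V - |M|) (ℓ V + |M|)) =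
      ENNReal.ofReal (t.card * (2 * |M|)) := by
    have : ∀ V ∈ t, (volume : Measure ℝ) (Set.Icc (ℓ V - |M|) (ℓ V + |M|)) =
        ENNReal.ofReal (2 * |M|) := fun V _ => by rw [Real.volume_Icc]; congr 1; ring
    rw [Finset.sum_congr rfl this, Finset.sum_const, nsmul_eq_mul,
      ENNReal.ofReal_mul (Nat.cast_nonneg _), ENNReal.ofReal_natCast]
  rw [h2] at h1
  exact (ENNReal.ofReal_le_ofReal_iff (by positivity)).1 h1

end Oscillation

end StiefelKL

/-! ### Gaussians whose covariance is a scaled inverse of a form -/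

namespace StiefelKL

section InverseForm

variable {E : Type*} [NormedAddCommGroup E] [InnerProductSpace ℝ E]

/-- `A` is `ε` times the inverse of the symmetric form `H`, which lies between the multiples `2a`
and `K` of the inner product. -/
structure IsScaledInverse (a K ε : ℝ) (H : E → E → ℝ) (A : E →L[ℝ] E) : Prop where
  symm : ∀ v w, H v w = H w v
  lower : ∀ v, 2 * a * ‖v‖ ^ 2 ≤ H v v
  upper : ∀ v w, |H v w| ≤ K * ‖v‖ * ‖w‖
  inv : ∀ v w, H (A v) w = ε * ⟪v, w⟫

namespace IsScaledInverse

variable {a K ε : ℝ} {H : E → E → ℝ} {A : E →L[ℝ] E}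

lemma isPositive (h : IsScaledInverse a K ε H A) (ha : 0 < a) (hε : 0 < ε) : A.IsPositive := by
  refine ⟨fun x y => ?_, fun x => ?_⟩
  · have h1 := h.inv x (A y)
    rw [h.symm, h.inv, real_inner_comm] at h1
    exact mul_left_cancel₀ hε.ne' h1
  · have h1 := h.inv x (A x)
    have h2 := h.lower (A x)
    have h3 : 0 ≤ ε * ⟪x, A x⟫ := by rw [← h1]; exact le_trans (by positivity) h2
    have h4 := nonneg_of_mul_nonneg_right h3 hε
    rw [real_inner_comm] at h4
    simpa [ContinuousLinearMap.reApplyInnerSelf] using h4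

lemma injective (h : IsScaledInverse a K ε H A) (hε : 0 < ε) : Function.Injective A := by
  refine (injective_iff_map_eq_zero A).2 fun x hx => ?_
  have h1 := h.inv x x
  have h2 := h.upper (A x) x
  rw [h1, hx, norm_zero, mul_zero, zero_mul] at h2
  have h3 : ε * ⟪x, x⟫ = 0 := abs_nonpos_iff.1 h2
  exact inner_self_eq_zero.1 ((mul_eq_zero.1 h3).resolve_left hε.ne')

lemma norm_le (h : IsScaledInverse a K ε H A) (ha : 0 < a) (hε : 0 < ε) :
    ‖A‖ ≤ ε / (2 * a) := by
  refine A.opNorm_le_bound (by positivity) fun x => ?_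
  have h1 := h.lower (A x)
  rw [h.inv] at h1
  have h2 : ⟪x, A x⟫ ≤ ‖x‖ * ‖A x‖ := real_inner_le_norm _ _
  rw [div_mul_eq_mul_div, le_div_iff₀ (by positivity)]
  rcases (norm_nonneg (A x)).eq_or_lt with h0 | h0
  · rw [← h0]; simp; positivity
  · refine le_of_mul_le_mul_right ?_ h0
    nlinarith [mul_le_mul_of_nonneg_left h2 hε.le]

lemma le_norm_apply (h : IsScaledInverse a K ε H A) (x : E) : ε * ‖x‖ ≤ K * ‖A x‖ := by
  rcases (norm_nonneg x).eq_or_lt with h0 | h0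
  · have h3 : x = 0 := norm_eq_zero.1 h0.symm
    rw [h3]; simp
  refine le_of_mul_le_mul_right ?_ h0
  have h1 := (le_abs_self _).trans (h.upper (A x) x)
  rw [h.inv, real_inner_self_eq_norm_sq] at h1
  linarith

lemma le_norm [Nontrivial E] (h : IsScaledInverse a K ε H A) (hK : 0 ≤ K) : ε ≤ K * ‖A‖ := by
  obtain ⟨x, hx⟩ := exists_norm_eq E zero_le_one
  have h1 := h.le_norm_apply x
  have h2 := A.le_opNorm x
  rw [hx, mul_one] at *
  exact h1.trans (by gcongr)

variable [FiniteDimensional ℝ E]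

lemma exists_inverse (h : IsScaledInverse a K ε H A) (hε : 0 < ε) :
    ∃ Q : E ≃L[ℝ] E, (Q : E →L[ℝ] E) = A := exists_equiv_of_injective (h.injective hε)

lemma norm_inverse_le (h : IsScaledInverse a K ε H A) (hK : 0 ≤ K) (hε : 0 < ε) :
    ‖ContinuousLinearMap.inverse A‖ ≤ K / ε := by
  obtain ⟨Q, rfl⟩ := h.exists_inverse hε
  rw [ContinuousLinearMap.inverse_equiv]
  refine ContinuousLinearMap.opNorm_le_bound _ (by positivity) fun x => ?_
  have h1 := h.le_norm_apply (Q.symm x)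
  simp only [ContinuousLinearEquiv.coe_coe, ContinuousLinearEquiv.apply_symm_apply] at h1 ⊢
  rw [div_mul_eq_mul_div, le_div_iff₀ hε]
  linarith

lemma continuous_diag (h : IsScaledInverse a K ε H A) (hε : 0 < ε) :
    Continuous fun x => H x x := by
  obtain ⟨Q, rfl⟩ := h.exists_inverse hε
  have : (fun x => H x x) = fun x => ε * ⟪Q.symm x, x⟫ := by
    ext x
    rw [← h.inv]
    simp
  rw [this]
  fun_prop

variable [MeasurableSpace E] [BorelSpace E]

lemma gaussian_eq (h : IsScaledInverse a K ε H A) (ha : 0 < a) (hε : 0 < ε) :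
    ∃ c : ℝ, 0 < c ∧ gaussian A =
      volume.withDensity fun x => ENNReal.ofReal (c * Real.exp (-(H x x / ε) / 2)) :=
  gaussian_eq_withDensity (h.isPositive ha hε) (h.injective hε)
    ((h.continuous_diag hε).div_const ε) fun x => by
      rw [h.inv]; field_simp

end IsScaledInverse

end InverseForm

section Tail

variable {E : Type*} [NormedAddCommGroup E] [InnerProductSpace ℝ E] [FiniteDimensional ℝ E]
  [MeasurableSpace E] [BorelSpace E]

lemma gaussian_smul_id (σ : ℝ) : (stdGaussian E).map (fun x => σ • x) =
    gaussian ((σ ^ 2) • ContinuousLinearMap.id ℝ E) := by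
  have hpos : ((σ ^ 2) • ContinuousLinearMap.id ℝ E).IsPositive := by
    refine ⟨fun x y => by simp [inner_smul_left, inner_smul_right], fun x => ?_⟩
    have : (0 : ℝ) ≤ σ ^ 2 * ‖x‖ ^ 2 := by positivity
    simpa [ContinuousLinearMap.reApplyInnerSelf, inner_smul_left] using this
  have : IsProbabilityMeasure ((stdGaussian E).map (fun x => σ • x)) :=
    Measure.isProbabilityMeasure_map (by fun_prop)
  refine Measure.ext_of_charFun ?_
  ext t
  rw [charFun_gaussian hpos, charFun_map_smul, charFun_stdGaussian]
  congr 1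
  simp only [_root_.smul_apply, ContinuousLinearMap.id_apply, inner_smul_right,
    real_inner_self_eq_norm_sq, norm_smul]
  push_cast
  rw [Real.norm_eq_abs, mul_pow, ← Complex.ofReal_pow, sq_abs]
  push_cast
  ring

/-- Exponential smallness in `u⁻²` beats every power of `u`. -/
lemma exp_neg_div_sq_le {b u : ℝ} (hb : 0 < b) (hu : 0 < u) (m : ℕ) :
    Real.exp (-(b / u ^ 2)) ≤ m.factorial / b ^ m * u ^ (2 * m) := by
  have h1 := Real.pow_div_factorial_le_exp (b / u ^ 2) (by positivity) m
  rw [Real.exp_neg, inv_le_comm₀ (Real.exp_pos _) (by positivity)]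
  refine le_trans (le_of_eq ?_) h1
  rw [pow_mul, div_pow]
  field_simp

/-- The normalising constant of a Gaussian with covariance of order `u⁶` is `O(u^{-3n})`. -/
lemma exists_normalization_le {a K : ℝ} (hK : 0 < K) : ∃ C : ℝ, 0 < C ∧
    ∀ (u : ℝ) (H : E → E → ℝ) (A : E →L[ℝ] E) (c : ℝ), 0 < u → IsScaledInverse a K (u ^ 6) H A →
      0 < c → gaussian A =
        volume.withDensity (fun x => ENNReal.ofReal (c * Real.exp (-(H x x / u ^ 6) / 2))) →
      c * u ^ (3 * Module.finrank ℝ E) ≤ C := by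
  have hv : volume (Metric.ball (0 : E) 1) ≠ ⊤ := measure_ball_lt_top.ne
  have hv0 : 0 < (volume (Metric.ball (0 : E) 1)).toReal :=
    ENNReal.toReal_pos (Metric.measure_ball_pos _ _ one_pos).ne' hv
  refine ⟨Real.exp (K / 2) / (volume (Metric.ball (0 : E) 1)).toReal, by positivity, ?_⟩
  intro u H A c hu h hc hA
  have hle : ENNReal.ofReal (c * Real.exp (-(K / 2))) * volume (Metric.ball (0 : E) (u ^ 3)) ≤ 1 := by
    calc _ = ∫⁻ x in Metric.ball (0 : E) (u ^ 3), ENNReal.ofReal (c * Real.exp (-(K / 2))) := by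
          rw [setLIntegral_const]
      _ ≤ ∫⁻ x in Metric.ball (0 : E) (u ^ 3),
            ENNReal.ofReal (c * Real.exp (-(H x x / u ^ 6) / 2)) := by
          refine setLIntegral_mono' measurableSet_ball fun x hx => ?_
          refine ENNReal.ofReal_le_ofReal ?_
          gcongr
          rw [neg_div, neg_le_neg_iff]
          gcongr
          rw [div_le_iff₀ (by positivity)]
          have hx' : ‖x‖ ≤ u ^ 3 := (mem_ball_zero_iff.1 hx).le
          calc H x x ≤ K * ‖x‖ * ‖x‖ := (le_abs_self _).trans (h.upper x x)
            _ ≤ K * u ^ 3 * u ^ 3 := by gcongr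
            _ = K * u ^ 6 := by ring
      _ = gaussian A (Metric.ball (0 : E) (u ^ 3)) := by
          rw [hA, withDensity_apply _ measurableSet_ball]
      _ ≤ 1 := prob_le_one
  rw [Measure.addHaar_ball_of_pos _ _ (by positivity), ← pow_mul, ← ENNReal.ofReal_toReal hv,
    ← mul_assoc, ← ENNReal.ofReal_mul (by positivity), ← ENNReal.ofReal_mul (by positivity),
    ENNReal.ofReal_le_one, Real.exp_neg] at hle
  rw [le_div_iff₀ hv0]
  have := mul_le_mul_of_nonneg_right hle (Real.exp_pos (K / 2)).le
  calc _ = c * (Real.exp (K / 2))⁻¹ * u ^ (3 * Module.finrank ℝ E) *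
        (volume (Metric.ball (0 : E) 1)).toReal * Real.exp (K / 2) := by field_simp
    _ ≤ _ := by simpa using this

/-- Outside the ball of radius `u²` a Gaussian with covariance of order `u⁶` is dominated by a small
multiple of a Gaussian with a fixed covariance. -/
lemma gaussian_tail_le {a K : ℝ} (ha : 0 < a) (hK : 0 < K) {σ : ℝ} (hσ : 0 < σ) :
    ∃ C δ : ℝ, 0 < C ∧ 0 < δ ∧ ∀ (u : ℝ) (H : E → E → ℝ) (A : E →L[ℝ] E), 0 < u → u ≤ δ →
      IsScaledInverse a K (u ^ 6) H A →
      (gaussian A).restrict (Metric.ball 0 (u ^ 2))ᶜ ≤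
        ENNReal.ofReal (C * u ^ 18) • (stdGaussian E).map (fun x => σ • x) := by
  obtain ⟨C₁, hC₁, hC⟩ := exists_normalization_le (E := E) (a := a) hK
  have hpos : ((σ ^ 2) • ContinuousLinearMap.id ℝ E).IsPositive := by
    refine ⟨fun x y => by simp [inner_smul_left, inner_smul_right], fun x => ?_⟩
    have : (0 : ℝ) ≤ σ ^ 2 * ‖x‖ ^ 2 := by positivity
    simpa [ContinuousLinearMap.reApplyInnerSelf, inner_smul_left] using this
  obtain ⟨cσ, hcσ, hσd⟩ := gaussian_eq_withDensity hpos
    (fun x y hxy => by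
      simp only [_root_.smul_apply, ContinuousLinearMap.id_apply] at hxy
      exact smul_right_injective E (by positivity) hxy)
    (q := fun x => ‖x‖ ^ 2 / σ ^ 2) (by fun_prop)
    (fun x => by
      simp only [_root_.smul_apply, ContinuousLinearMap.id_apply, norm_smul,
        inner_smul_right, real_inner_self_eq_norm_sq, Real.norm_eq_abs, abs_of_pos (pow_pos hσ 2)]
      field_simp)
  rw [gaussian_smul_id, hσd]
  set n := Module.finrank ℝ E with hn
  -- the Gaussian factor yields any power `u ^ (2 * m)`; it has to absorb the normalising constant,
  -- of order `u ^ (-3 * n)`, and to leave `u ^ 18`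
  set m := 9 + 2 * n with hm
  refine ⟨C₁ * (m.factorial / (a / 2) ^ m) / cσ, min 1 (min a (a * σ ^ 2)), by positivity,
    by positivity, ?_⟩
  intro u H A hu huδ h
  have hu1 : u ≤ 1 := huδ.trans (min_le_left _ _)
  have hu2 : u ^ 6 ≤ a * σ ^ 2 :=
    (pow_le_of_le_one hu.le hu1 (by norm_num)).trans
      (huδ.trans ((min_le_right _ _).trans (min_le_right _ _)))
  obtain ⟨c, hc, hA⟩ := h.gaussian_eq ha (pow_pos hu 6)
  have hcC := hC u H A c hu h hc hA
  have hme : Measurable fun x : E => ENNReal.ofReal (cσ * Real.exp (-(‖x‖ ^ 2 / σ ^ 2) / 2)) := by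
    fun_prop
  rw [hA, restrict_withDensity measurableSet_ball.compl,
    ← withDensity_indicator measurableSet_ball.compl, ← withDensity_smul _ hme]
  refine withDensity_mono (Eventually.of_forall fun x => ?_)
  by_cases hx : x ∈ (Metric.ball (0 : E) (u ^ 2))ᶜ
  swap
  · rw [Set.indicator_of_notMem hx]; exact zero_le
  rw [Set.indicator_of_mem hx, Pi.smul_apply, smul_eq_mul, ← ENNReal.ofReal_mul (by positivity)]
  refine ENNReal.ofReal_le_ofReal ?_
  have hx' : u ^ 2 ≤ ‖x‖ := by
    simpa [mem_ball_zero_iff] using hx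
  -- split the exponent: half of it is small because `‖x‖ ≥ u²`, the other half is Gaussian in `x`
  have hex : Real.exp (-(H x x / u ^ 6) / 2) ≤
      Real.exp (-((a / 2) / u ^ 2)) * Real.exp (-(‖x‖ ^ 2 / σ ^ 2) / 2) := by
    rw [← Real.exp_add, Real.exp_le_exp]
    have h1 : a * ‖x‖ ^ 2 / u ^ 6 ≤ H x x / u ^ 6 / 2 := by
      rw [div_div, mul_comm (u ^ 6), ← div_div]
      gcongr
      linarith [h.lower x]
    have h2 : a / 2 / u ^ 2 ≤ a * ‖x‖ ^ 2 / u ^ 6 / 2 := by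
      rw [div_div, div_div, div_le_div_iff₀ (by positivity) (by positivity)]
      have : (u ^ 2) ^ 2 ≤ ‖x‖ ^ 2 := by gcongr
      nlinarith [mul_le_mul_of_nonneg_left this (by positivity : 0 ≤ a * u ^ 2 * 2)]
    have h3 : ‖x‖ ^ 2 / σ ^ 2 ≤ a * ‖x‖ ^ 2 / u ^ 6 := by
      rw [div_le_div_iff₀ (by positivity) (by positivity)]
      nlinarith [mul_le_mul_of_nonneg_right hu2 (sq_nonneg ‖x‖)]
    linarith
  have hexp := exp_neg_div_sq_le (by positivity : 0 < a / 2) hu m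
  have hpow : u ^ (2 * m) ≤ u ^ (3 * n) * u ^ 18 := by
    rw [← pow_add]
    exact pow_le_pow_of_le_one hu.le hu1 (by omega)
  calc c * Real.exp (-(H x x / u ^ 6) / 2)
      ≤ c * (m.factorial / (a / 2) ^ m * (u ^ (3 * n) * u ^ 18) *
          Real.exp (-(‖x‖ ^ 2 / σ ^ 2) / 2)) := by
        gcongr
        refine hex.trans ?_
        gcongr
        exact hexp.trans (by gcongr)
    _ = (c * u ^ (3 * n)) * (m.factorial / (a / 2) ^ m * u ^ 18 *
          Real.exp (-(‖x‖ ^ 2 / σ ^ 2) / 2)) := by ring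
    _ ≤ C₁ * (m.factorial / (a / 2) ^ m * u ^ 18 *
          Real.exp (-(‖x‖ ^ 2 / σ ^ 2) / 2)) := by gcongr
    _ = _ := by field_simp

end Tail

end StiefelKL

/-! ### The density of the retracted Gaussian relative to the posterior -/

namespace StiefelKL

lemma measurable_fderiv_apply {E : Type*} [NormedAddCommGroup E] [InnerProductSpace ℝ E]
    [FiniteDimensional ℝ E] [MeasurableSpace E] [BorelSpace E] (f : E → ℝ) :
    Measurable fun z : E × E => fderiv ℝ f z.1 z.2 := by
  have : (fun z : E × E => fderiv ℝ f z.1 z.2) = fun z => ∑ i,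
      ⟪stdOrthonormalBasis ℝ E i, z.2⟫ * fderiv ℝ f z.1 (stdOrthonormalBasis ℝ E i) := by
    ext z
    conv_lhs => rw [← (stdOrthonormalBasis ℝ E).sum_repr' z.2]
    simp
  rw [this]
  refine Finset.measurable_sum _ fun i _ => Measurable.mul (by fun_prop) ?_
  exact (measurable_fderiv_apply_const ℝ f _).comp measurable_fst

section LocalDensity

variable {d k : ℕ} {U : MatSpace d k} {φ : tangent U → MatSpace d k}

/-- The change of variables with a finite constant. -/
lemma IsSecondOrderRetraction.exists_volume_chart (hU : U ∈ stiefel d k)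
    (hφ : IsSecondOrderRetraction U φ) :
    ∃ c : ℝ, 0 < c ∧ ∀ B : Set (tangent U), MeasurableSet B → B.InjOn φ →
      ∀ g : MatSpace d k → ℝ≥0∞, Measurable g → ∫⁻ V in φ '' B, g V ∂uniformStiefel d k =
        ENNReal.ofReal c * ∫⁻ ξ in B, ENNReal.ofReal (jac U φ ξ) * g (φ ξ) := by
  obtain ⟨c, hc0, hc⟩ := exists_lintegral_image hU
  obtain ⟨θ, ρ, -, hρ, -, -, hθ, -, -⟩ := exists_chart hU hφ
  obtain ⟨ρ', K, hρ', -, hJ⟩ := exists_log_jac_bounds hU hφ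
  have hinj : (Metric.ball (0 : tangent U) (min ρ ρ')).InjOn φ := by
    intro x hx y hy hxy
    rw [mem_ball_zero_iff] at hx hy
    rw [← hθ x (hx.trans_le (min_le_left _ _)), hxy, hθ y (hy.trans_le (min_le_left _ _))]
  have h1 := hc φ hφ.contDiff_one hφ.mem_stiefel _ measurableSet_ball hinj (fun _ => 1)
    measurable_const
  have h2 : ENNReal.ofReal (Real.exp (-K)) * volume (Metric.ball (0 : tangent U) (min ρ ρ')) ≤
      ∫⁻ ξ in Metric.ball (0 : tangent U) (min ρ ρ'), ENNReal.ofReal (jac U φ ξ) * 1 := by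
    rw [← setLIntegral_const]
    refine setLIntegral_mono' measurableSet_ball fun x hx => ?_
    rw [mul_one]
    refine ENNReal.ofReal_le_ofReal ?_
    obtain ⟨h3, h4, -⟩ := hJ x ((mem_ball_zero_iff.1 hx).trans_le (min_le_right _ _))
    rw [← Real.exp_log h3, Real.exp_le_exp]
    exact (abs_le.1 h4).1
  have hctop : c ≠ ⊤ := by
    rintro rfl
    have h5 : ∫⁻ ξ in Metric.ball (0 : tangent U) (min ρ ρ'), ENNReal.ofReal (jac U φ ξ) * 1 ≠ 0 := by
      refine (lt_of_lt_of_le ?_ h2).ne'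
      exact ENNReal.mul_pos (by simp [Real.exp_pos])
        (Metric.measure_ball_pos _ _ (lt_min hρ hρ')).ne'
    rw [ENNReal.top_mul h5, setLIntegral_one] at h1
    exact measure_ne_top _ _ h1
  refine ⟨c.toReal, ENNReal.toReal_pos hc0 hctop, fun B hB hBi g hg => ?_⟩
  rw [ENNReal.ofReal_toReal hctop]
  exact hc φ hφ.contDiff_one hφ.mem_stiefel B hB hBi g hg

/-- The posterior, with its density normalised relative to the value at the mode. -/
lemma exists_posterior_eq (hU : U ∈ stiefel d k) {a M : ℝ} (ha : 0 ≤ a) {ℓ : MatSpace d k → ℝ}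
    (hℓ : IsConcentratedPotential a M U ℓ) {ε : ℝ} (hε : 0 < ε) :
    ∃ W : ℝ, 0 < W ∧ W ≤ 1 ∧
      ENNReal.ofReal W = ∫⁻ V, ENNReal.ofReal (Real.exp (-(ℓ V - ℓ U) / ε)) ∂uniformStiefel d k ∧
      posterior ℓ ε = (uniformStiefel d k).withDensity
        (fun V => ENNReal.ofReal (Real.exp (-(ℓ V - ℓ U) / ε) / W)) ∧
      IsProbabilityMeasure (posterior ℓ ε) := by
  have hc : Continuous ℓ := hℓ.contDiff.continuous
  have hle : ∀ᵐ V ∂uniformStiefel d k, Real.exp (-(ℓ V - ℓ U) / ε) ≤ 1 := by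
    filter_upwards [ae_uniformStiefel_mem hU] with V hV
    rw [Real.exp_le_one_iff]
    have := hℓ.growth V hV
    have h2 : 0 ≤ a * ‖V - U‖ ^ 2 := by positivity
    exact div_nonpos_of_nonpos_of_nonneg (by linarith) hε.le
  have hi : Integrable (fun V => Real.exp (-(ℓ V - ℓ U) / ε)) (uniformStiefel d k) := by
    refine Integrable.of_bound (by fun_prop) 1 ?_
    filter_upwards [hle] with V hV
    rwa [Real.norm_of_nonneg (Real.exp_nonneg _)]
  have hmul : ∀ V, Real.exp (-(ℓ V) / ε) =
      Real.exp (-(ℓ U) / ε) * Real.exp (-(ℓ V - ℓ U) / ε) := fun V => by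
    rw [← Real.exp_add]; congr 1; ring
  have hi' : Integrable (fun V => Real.exp (-(ℓ V) / ε)) (uniformStiefel d k) := by
    rw [funext hmul]; exact hi.const_mul _
  have hW := integral_exp_pos hi
  refine ⟨∫ V, Real.exp (-(ℓ V - ℓ U) / ε) ∂uniformStiefel d k, hW, ?_, ?_, ?_,
    isProbabilityMeasure_tilted hi'⟩
  · calc _ ≤ ∫ V, (1 : ℝ) ∂uniformStiefel d k := integral_mono_ae hi (integrable_const _) hle
      _ = 1 := by simp
  · exact ofReal_integral_eq_lintegral_ofReal hi (Eventually.of_forall fun V => Real.exp_nonneg _)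
  · rw [posterior, Measure.tilted]
    congr 1
    ext V
    congr 1
    rw [funext hmul, hmul V, integral_const_mul, mul_div_mul_left _ _ (Real.exp_ne_zero _)]

lemma IsInverseHessian.isScaledInverse {a K ε : ℝ} {ℓ : MatSpace d k → ℝ}
    {covT : tangent U →L[ℝ] tangent U} (h : IsInverseHessian ℓ ε U covT) (hε : 0 < ε)
    (h1 : ∀ v w : tangent U, riemHess ℓ U v w = riemHess ℓ U w v)
    (h2 : ∀ v : tangent U, 2 * a * ‖v‖ ^ 2 ≤ riemHess ℓ U v v)
    (h3 : ∀ v w : tangent U, |riemHess ℓ U v w| ≤ K * ‖v‖ * ‖w‖) :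
    IsScaledInverse a K ε (fun v w : tangent U => riemHess ℓ U v w) covT :=
  ⟨h1, h2, h3, fun v w => by
    have := h v w
    rw [div_eq_iff hε.ne'] at this
    rw [this, mul_comm]⟩

/-- The law of `φ` under the restriction of `N` to the ball of radius `r` has density
`exp (F ∘ θ)` with respect to `p` on its image, where `θ` inverts `φ` on that ball. The function
`F` is bounded, and `D` is its derivative, with the size dictated by the cubic remainder of a
potential of order `1/ε`. -/
structure IsLocalDensity (φ : tangent U → MatSpace d k) (θ : MatSpace d k → tangent U)
    (N : Measure (tangent U)) (p : Measure (MatSpace d k)) (ε r K : ℝ) (F : tangent U → ℝ)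
    (D : tangent U → tangent U → ℝ) : Prop where
  measurable : Measurable F
  measurable_deriv : Measurable fun z : tangent U × tangent U => D z.1 z.2
  deriv_add : ∀ x v w, D x (v + w) = D x v + D x w
  bound : ∀ x, ‖x‖ < r → |F x| ≤ K
  deriv_bound : ∀ x, ‖x‖ < r → ∀ v, |D x v| ≤ K * (‖x‖ ^ 2 / ε + 1) * ‖v‖
  taylor : ∀ x w, ‖x‖ < r → ‖w‖ < r →
    |F w - F x - D x (w - x)| ≤ K * (max ‖x‖ ‖w‖ / ε + 1) * ‖w - x‖ ^ 2
  map_eq : (N.restrict (Metric.ball 0 r)).map φ = p.withDensity fun V =>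
    ENNReal.ofReal ((φ '' Metric.ball 0 r).indicator (fun V => Real.exp (F (θ V))) V)

lemma measurableSet_image {B : Set (tangent U)} (hφ : IsSecondOrderRetraction U φ)
    (hB : MeasurableSet B) (hBi : B.InjOn φ) : MeasurableSet (φ '' B) :=
  hB.image_of_continuousOn_injOn hφ.smooth.continuous.continuousOn hBi

/-- The density of the retracted Gaussian relative to the posterior, near the mode. -/
lemma map_restrict_gaussian_eq {a M ε W c cG : ℝ} (hφ : IsSecondOrderRetraction U φ)
    {ℓ : MatSpace d k → ℝ} (hℓ : IsConcentratedPotential a M U ℓ) (hW : 0 < W) (hc : 0 < c)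
    (hcG : 0 < cG)
    (hp : posterior ℓ ε = (uniformStiefel d k).withDensity
      (fun V => ENNReal.ofReal (Real.exp (-(ℓ V - ℓ U) / ε) / W)))
    {N : Measure (tangent U)} (hN : N = volume.withDensity fun x : tangent U =>
      ENNReal.ofReal (cG * Real.exp (-(riemHess ℓ U x x / ε) / 2)))
    (hvol : ∀ B : Set (tangent U), MeasurableSet B → B.InjOn φ →
      ∀ g : MatSpace d k → ℝ≥0∞, Measurable g → ∫⁻ V in φ '' B, g V ∂uniformStiefel d k =
        ENNReal.ofReal c * ∫⁻ ξ in B, ENNReal.ofReal (jac U φ ξ) * g (φ ξ))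
    {θ : MatSpace d k → tangent U} (hθm : Measurable θ) {B : Set (tangent U)}
    (hB : MeasurableSet B) (hθ : ∀ x ∈ B, θ (φ x) = x) (hJ : ∀ x ∈ B, 0 < jac U φ x)
    {F : tangent U → ℝ} (hFm : Measurable F) (hF : ∀ x, F x = Real.log (cG * W / c) +
      quadError U φ ℓ x / ε - Real.log (jac U φ x)) :
    (N.restrict B).map φ = (posterior ℓ ε).withDensity fun V =>
      ENNReal.ofReal ((φ '' B).indicator (fun V => Real.exp (F (θ V))) V) := by
  have hBi : B.InjOn φ := fun x hx y hy hxy => by rw [← hθ x hx, hxy, hθ y hy]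
  have hφm : Measurable φ := hφ.smooth.continuous.measurable
  have hℓm : Measurable ℓ := hℓ.contDiff.continuous.measurable
  have hm1 : Measurable fun V => ENNReal.ofReal (Real.exp (-(ℓ V - ℓ U) / ε) / W) := by fun_prop
  have hm2 : Measurable fun V => ENNReal.ofReal (Real.exp (F (θ V))) := by fun_prop
  have himg := measurableSet_image hφ hB hBi
  ext S hS
  have hind : (fun V => ENNReal.ofReal ((φ '' B).indicator (fun V => Real.exp (F (θ V))) V)) =
      (φ '' B).indicator fun V => ENNReal.ofReal (Real.exp (F (θ V))) := by
    ext V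
    by_cases hV : V ∈ φ '' B
    · rw [Set.indicator_of_mem hV, Set.indicator_of_mem hV]
    · rw [Set.indicator_of_notMem hV, Set.indicator_of_notMem hV, ENNReal.ofReal_zero]
  rw [Measure.map_apply hφm hS, Measure.restrict_apply (hφm hS), hN,
    withDensity_apply _ ((hφm hS).inter hB), hind, withDensity_indicator himg,
    ← restrict_withDensity himg, Measure.restrict_apply hS, withDensity_apply _ (hS.inter himg), hp,
    restrict_withDensity (hS.inter himg), lintegral_withDensity_eq_lintegral_mul _ hm1 hm2]
  have e1 : S ∩ φ '' B = φ '' (φ ⁻¹' S ∩ B) := by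
    rw [Set.inter_comm, Set.inter_comm (φ ⁻¹' S), Set.image_inter_preimage]
  rw [e1, hvol _ ((hφm hS).inter hB) (hBi.mono Set.inter_subset_right) _ (hm1.mul hm2),
    ← lintegral_const_mul _ (by
      have := (continuous_jac hφ.contDiff_one).measurable
      have := (hm1.mul hm2).comp hφm
      fun_prop)]
  refine setLIntegral_congr_fun ((hφm hS).inter hB) fun x hx => ?_
  have hJx := hJ x hx.2
  rw [Pi.mul_apply, hθ x hx.2, ← ENNReal.ofReal_mul (by positivity), ← ENNReal.ofReal_mul hJx.le,
    ← ENNReal.ofReal_mul hc.le]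
  congr 1
  have e2 : Real.exp (F x) = cG * W / c * Real.exp (quadError U φ ℓ x / ε) / jac U φ x := by
    rw [hF, Real.exp_sub, Real.exp_add, Real.exp_log (by positivity), Real.exp_log hJx]
  have e3 : Real.exp (-(riemHess ℓ U x x / ε) / 2) =
      Real.exp (-(ℓ (φ x) - ℓ U) / ε) * Real.exp (quadError U φ ℓ x / ε) := by
    rw [← Real.exp_add, quadError]
    congr 1
    ring
  rw [e2, e3]
  field_simp

end LocalDensity

end StiefelKL

/-! ### Concentration of the posterior and estimates for the local density -/

namespace StiefelKL

section LocalDensity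

variable {d k : ℕ} {U : MatSpace d k} {φ : tangent U → MatSpace d k}

/-- The normalising constant of the posterior is at least of order `ε^{n/2}`, where `ε = u⁶`. -/
lemma exists_le_normalization (hU : U ∈ stiefel d k) (hφ : IsSecondOrderRetraction U φ) {a : ℝ}
    (ha : 0 < a) (M : ℝ) : ∃ c δ : ℝ, 0 < c ∧ 0 < δ ∧ ∀ (ℓ : MatSpace d k → ℝ) (u W : ℝ),
      IsConcentratedPotential a M U ℓ → 0 < u → u ≤ δ → 0 ≤ W →
      ENNReal.ofReal W = ∫⁻ V, ENNReal.ofReal (Real.exp (-(ℓ V - ℓ U) / u ^ 6))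
        ∂uniformStiefel d k →
      c * u ^ (3 * Module.finrank ℝ (tangent U)) ≤ W := by
  obtain ⟨c, hc, hvol⟩ := hφ.exists_volume_chart hU
  obtain ⟨θ, ρ, -, hρ, -, -, hθ, -, -⟩ := exists_chart hU hφ
  obtain ⟨ρ', Kj, hρ', -, hJ⟩ := exists_log_jac_bounds hU hφ
  obtain ⟨Kp, hKp, hpot⟩ := exists_potential_bounds hφ ha M
  have hv : volume (Metric.ball (0 : tangent U) 1) ≠ ⊤ := measure_ball_lt_top.ne
  have hv0 : 0 < (volume (Metric.ball (0 : tangent U) 1)).toReal :=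
    ENNReal.toReal_pos (Metric.measure_ball_pos _ _ one_pos).ne' hv
  refine ⟨c * (Real.exp (-Kj) * Real.exp (-(2 * Kp)) *
    (volume (Metric.ball (0 : tangent U) 1)).toReal), min 1 (min ρ ρ'), by positivity,
    by positivity, ?_⟩
  intro ℓ u W hℓ hu huδ hW0 hW
  have hu1 : u ≤ 1 := huδ.trans (min_le_left _ _)
  have hu3 : u ^ 3 ≤ u := pow_le_of_le_one hu.le hu1 (by norm_num)
  obtain ⟨-, -, h3, h4⟩ := hpot ℓ hℓ
  have hinj : (Metric.ball (0 : tangent U) (u ^ 3)).InjOn φ := by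
    intro x hx y hy hxy
    rw [mem_ball_zero_iff] at hx hy
    have : u ^ 3 ≤ ρ := hu3.trans (huδ.trans ((min_le_right _ _).trans (min_le_left _ _)))
    rw [← hθ x (hx.trans_le this), hxy, hθ y (hy.trans_le this)]
  have hℓm : Measurable ℓ := hℓ.contDiff.continuous.measurable
  have h5 := hvol _ measurableSet_ball hinj
    (fun V => ENNReal.ofReal (Real.exp (-(ℓ V - ℓ U) / u ^ 6))) (by fun_prop)
  have h6 : ENNReal.ofReal c * (ENNReal.ofReal (Real.exp (-Kj) * Real.exp (-(2 * Kp))) *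
      volume (Metric.ball (0 : tangent U) (u ^ 3))) ≤ ENNReal.ofReal W := by
    rw [hW]
    refine le_trans ?_ (setLIntegral_le_lintegral (φ '' Metric.ball (0 : tangent U) (u ^ 3)) _)
    rw [h5, ← setLIntegral_const]
    refine mul_le_mul' le_rfl ?_
    refine setLIntegral_mono' measurableSet_ball fun x hx => ?_
    have hx' := mem_ball_zero_iff.1 hx
    obtain ⟨h7, h8, -⟩ := hJ x (hx'.trans_le
      (hu3.trans (huδ.trans ((min_le_right _ _).trans (min_le_right _ _)))))
    rw [← ENNReal.ofReal_mul h7.le]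
    refine ENNReal.ofReal_le_ofReal ?_
    have h9 : Real.exp (-Kj) ≤ jac U φ x := by
      rw [← Real.exp_log h7, Real.exp_le_exp]; exact (abs_le.1 h8).1
    gcongr
    rw [neg_div, neg_le_neg_iff, div_le_iff₀ (by positivity)]
    have hx1 : ‖x‖ < 1 := hx'.trans_le (hu3.trans hu1)
    have h10 := (abs_le.1 (h4 x hx1).1).2
    have h11 := (abs_le.1 (h3 x x)).2
    rw [quadError] at h10
    have h12 : Kp * ‖x‖ ^ 3 ≤ Kp * ‖x‖ ^ 2 := by
      gcongr 1
      exact pow_le_pow_of_le_one (norm_nonneg _) hx1.le (by norm_num)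
    have h13 : ‖x‖ ^ 2 ≤ (u ^ 3) ^ 2 := by gcongr
    nlinarith [mul_le_mul_of_nonneg_left h13 hKp.le]
  rw [Measure.addHaar_ball_of_pos _ _ (by positivity), ← pow_mul, ← ENNReal.ofReal_toReal hv,
    ← ENNReal.ofReal_mul (by positivity), ← ENNReal.ofReal_mul (by positivity),
    ← ENNReal.ofReal_mul (by positivity)] at h6
  refine le_trans (le_of_eq ?_) ((ENNReal.ofReal_le_ofReal_iff hW0).1 h6)
  ring

/-- The posterior gives mass at least one half to the image of the ball of radius `ε^{1/3}`. -/
lemma exists_posterior_image_compl_le (hU : U ∈ stiefel d k) (hφ : IsSecondOrderRetraction U φ)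
    {a : ℝ} (ha : 0 < a) (M : ℝ) : ∃ δ : ℝ, 0 < δ ∧ ∀ (ℓ : MatSpace d k → ℝ) (u : ℝ),
      IsConcentratedPotential a M U ℓ → 0 < u → u ≤ δ →
      posterior ℓ (u ^ 6) (φ '' Metric.ball 0 (u ^ 2))ᶜ ≤ ENNReal.ofReal (1 / 2) := by
  obtain ⟨c, δ₀, hc, hδ₀, hZ⟩ := exists_le_normalization hU hφ ha M
  obtain ⟨θ, ρ, K, hρ, hK, -, hθ, hθ', hlip⟩ := exists_chart hU hφ
  set n := Module.finrank ℝ (tangent U)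
  set b := a / K ^ 2 with hb
  have hb0 : 0 < b := by positivity
  set m := 2 * n + 1 with hm
  refine ⟨min (min 1 δ₀) (min (min ρ (ρ * K)) (c * b ^ m / (2 * m.factorial))), by positivity, ?_⟩
  intro ℓ u hℓ hu huδ
  have hu1 : u ≤ 1 := huδ.trans ((min_le_left _ _).trans (min_le_left _ _))
  have huδ₀ : u ≤ δ₀ := huδ.trans ((min_le_left _ _).trans (min_le_right _ _))
  have huρ : u ≤ ρ * K :=
    huδ.trans ((min_le_right _ _).trans ((min_le_left _ _).trans (min_le_right _ _)))
  have huρ' : u ≤ ρ :=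
    huδ.trans ((min_le_right _ _).trans ((min_le_left _ _).trans (min_le_left _ _)))
  have huc : u ≤ c * b ^ m / (2 * m.factorial) :=
    huδ.trans ((min_le_right _ _).trans (min_le_right _ _))
  have hu2 : u ^ 2 ≤ u := pow_le_of_le_one hu.le hu1 (by norm_num)
  obtain ⟨W, hW, -, hWi, hp, -⟩ := exists_posterior_eq hU ha.le hℓ (pow_pos hu 6)
  have hcW := hZ ℓ u W hℓ hu huδ₀ hW.le hWi
  -- the Lipschitz chart shows that points outside the image are at distance at least `u² / K` from
  -- `U`
  have hfar : ∀ V ∈ stiefel d k, V ∉ φ '' Metric.ball 0 (u ^ 2) → u ^ 2 / K ≤ ‖V - U‖ := by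
    intro V hV hVB
    by_contra! hlt
    have h1 : ‖V - U‖ < ρ := hlt.trans_le (by
      rw [div_le_iff₀ hK]; exact hu2.trans huρ)
    have h2 := hlip V U h1 (by simpa using hρ)
    have h3 : θ U = 0 := by
      have h4 := hθ 0 (by simpa using hρ)
      rwa [hφ.map_zero] at h4
    rw [h3, sub_zero] at h2
    refine hVB ⟨θ V, ?_, hθ' V hV h1⟩
    rw [mem_ball_zero_iff]
    rw [lt_div_iff₀ hK] at hlt
    linarith
  rw [hp]
  have hpt : ∀ᵐ V ∂(uniformStiefel d k).restrict (φ '' Metric.ball 0 (u ^ 2))ᶜ,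
      ENNReal.ofReal (Real.exp (-(ℓ V - ℓ U) / u ^ 6) / W) ≤ ENNReal.ofReal (1 / 2) := by
    rw [ae_restrict_iff'₀]
    · filter_upwards [ae_uniformStiefel_mem hU] with V hV hVB
      refine ENNReal.ofReal_le_ofReal ?_
      have h1 := hfar V hV hVB
      have h2 := hℓ.growth V hV
      have h3 : Real.exp (-(ℓ V - ℓ U) / u ^ 6) ≤ Real.exp (-(b / u ^ 2)) := by
        rw [Real.exp_le_exp, neg_div, neg_le_neg_iff, div_le_div_iff₀ (by positivity)
          (by positivity)]
        have h4 : (u ^ 2 / K) ^ 2 ≤ ‖V - U‖ ^ 2 := by gcongr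
        have h5 : b * u ^ 4 ≤ ℓ V - ℓ U := by
          have h6 : b * u ^ 4 = a * (u ^ 2 / K) ^ 2 := by rw [hb]; field_simp
          rw [h6]
          linarith [mul_le_mul_of_nonneg_left h4 ha.le]
        nlinarith [mul_le_mul_of_nonneg_right h5 (sq_nonneg u)]
      have h7 := exp_neg_div_sq_le hb0 hu m
      rw [div_le_iff₀ hW]
      refine (h3.trans h7).trans (le_trans ?_ (mul_le_mul_of_nonneg_left hcW (by norm_num)))
      have h8 : u ^ (2 * m) ≤ u ^ (3 * n) * u := by
        rw [← pow_succ]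
        exact pow_le_pow_of_le_one hu.le hu1 (by omega)
      calc m.factorial / b ^ m * u ^ (2 * m)
          ≤ m.factorial / b ^ m * (u ^ (3 * n) * (c * b ^ m / (2 * m.factorial))) := by
            gcongr
            exact h8.trans (by gcongr)
        _ = 1 / 2 * (c * u ^ (3 * n)) := by
            have : (m.factorial : ℝ) ≠ 0 := by positivity
            field_simp
    · refine (measurableSet_image hφ measurableSet_ball ?_).compl.nullMeasurableSet
      intro x hx y hy hxy
      rw [mem_ball_zero_iff] at hx hy
      have : u ^ 2 ≤ ρ := hu2.trans huρ'
      rw [← hθ x (hx.trans_le this), hxy, hθ y (hy.trans_le this)]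
  rw [withDensity_apply']
  refine (lintegral_mono_ae hpt).trans ?_
  rw [lintegral_const, Measure.restrict_apply_univ]
  exact mul_le_of_le_one_right' prob_le_one

/-- For small `ε` the retracted Gaussian has a local density relative to the posterior, with bounds
that do not depend on the potential. -/
lemma IsSecondOrderRetraction.exists_isLocalDensity (hU : U ∈ stiefel d k)
    (hφ : IsSecondOrderRetraction U φ) {a : ℝ} (ha : 0 < a) (M : ℝ) :
    ∃ (θ : MatSpace d k → tangent U) (ρ K δ : ℝ), 0 < ρ ∧ 0 < K ∧ 0 < δ ∧ Measurable θ ∧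
      (∀ ξ, ‖ξ‖ < ρ → θ (φ ξ) = ξ) ∧
      (∀ V ∈ stiefel d k, ‖V - U‖ < ρ → φ (θ V) = V) ∧
      (∀ V W, ‖V - U‖ < ρ → ‖W - U‖ < ρ → ‖θ V - θ W‖ ≤ K * ‖V - W‖) ∧
      ∀ (ℓ : MatSpace d k → ℝ) (u : ℝ) (covT : tangent U →L[ℝ] tangent U),
        IsConcentratedPotential a M U ℓ → 0 < u → u ≤ δ → IsInverseHessian ℓ (u ^ 6) U covT →
        ∃ F D, IsLocalDensity φ θ (gaussian covT) (posterior ℓ (u ^ 6)) (u ^ 6) (u ^ 2) K F D := by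
  obtain ⟨c, hc, hvol⟩ := hφ.exists_volume_chart hU
  obtain ⟨θ, ρ, Kθ, hρ, hKθ, hθm, hθ, hθ', hlip⟩ := exists_chart hU hφ
  obtain ⟨ρ', Kj, hρ', hKj, hJ⟩ := exists_log_jac_bounds hU hφ
  obtain ⟨Kp, hKp, hpot⟩ := exists_potential_bounds hφ ha M
  obtain ⟨δ₁, hδ₁, himg⟩ := exists_posterior_image_compl_le hU hφ ha M
  obtain ⟨Ct, δ₂, hCt, hδ₂, htail⟩ := gaussian_tail_le (E := tangent U) ha hKp one_pos
  refine ⟨θ, ρ, Kθ + (2 * (Kp + Kj) + 1),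
    min (min (min 1 (1 / 2)) (min ρ ρ')) (min (min δ₁ δ₂) (1 / (2 * Ct))), hρ, by positivity,
    by positivity, hθm, hθ, hθ', fun V W hV hW => (hlip V W hV hW).trans ?_, ?_⟩
  · gcongr
    linarith
  intro ℓ u covT hℓ hu huδ hinv
  simp only [le_min_iff] at huδ
  obtain ⟨⟨⟨hu1, hu12⟩, huρ, huρ'⟩, ⟨huδ₁, huδ₂⟩, huC⟩ := huδ
  have hu2 : u ^ 2 ≤ u := pow_le_of_le_one hu.le hu1 (by norm_num)
  have hu6 : 0 < u ^ 6 := by positivity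
  obtain ⟨h1, h2, h3, h4⟩ := hpot ℓ hℓ
  have hsc := hinv.isScaledInverse hu6 h1 h2 h3
  obtain ⟨W, hW, -, -, hp, hprob⟩ := exists_posterior_eq hU ha.le hℓ hu6
  obtain ⟨cG, hcG, hN⟩ := hsc.gaussian_eq ha hu6
  -- `exp κ` is the ratio of the normalising constants of the Gaussian and of the posterior
  set κ := Real.log (cG * W / c) with hκ
  set B := Metric.ball (0 : tangent U) (u ^ 2) with hB
  set F : tangent U → ℝ := fun x => κ + quadError U φ ℓ x / u ^ 6 - Real.log (jac U φ x) with hF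
  have hφm : Measurable φ := hφ.smooth.continuous.measurable
  have hℓm : Measurable ℓ := hℓ.contDiff.continuous.measurable
  have hqm : Measurable (quadError U φ ℓ) := by
    have := (hsc.continuous_diag hu6).measurable
    have h5 : Measurable fun x => ℓ (φ x) := hℓm.comp hφm
    exact (h5.sub_const _).sub (this.const_mul _)
  have hJm : Measurable fun x => Real.log (jac U φ x) :=
    Real.measurable_log.comp (continuous_jac hφ.contDiff_one).measurable
  have hFm : Measurable F := ((hqm.div_const _).const_add _).sub hJm
  have hBρ : ∀ x : tangent U, ‖x‖ < u ^ 2 → ‖x‖ < ρ ∧ ‖x‖ < ρ' ∧ ‖x‖ < 1 := fun x hx =>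
    ⟨hx.trans_le (hu2.trans huρ), hx.trans_le (hu2.trans huρ'), hx.trans_le (hu2.trans hu1)⟩
  have hmap := map_restrict_gaussian_eq hφ hℓ hW hc hcG hp hN hvol hθm (B := B) measurableSet_ball
    (fun x hx => hθ x (hBρ x (mem_ball_zero_iff.1 hx)).1)
    (fun x hx => (hJ x (hBρ x (mem_ball_zero_iff.1 hx)).2.1).1) hFm (fun x => rfl)
  have hBi : B.InjOn φ := by
    intro x hx y hy hxy
    rw [hB, mem_ball_zero_iff] at hx hy
    rw [← hθ x (hBρ x hx).1, hxy, hθ y (hBρ y hy).1]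
  have hFκ : ∀ x : tangent U, ‖x‖ < u ^ 2 → |F x - κ| ≤ Kp + Kj := by
    intro x hx
    obtain ⟨hx1, hx2, hx3⟩ := hBρ x hx
    have h5 : |quadError U φ ℓ x / u ^ 6| ≤ Kp := by
      rw [abs_div, abs_of_pos hu6, div_le_iff₀ hu6]
      refine (h4 x hx3).1.trans ?_
      have : ‖x‖ ^ 3 ≤ (u ^ 2) ^ 3 := by gcongr
      rw [← pow_mul] at this
      exact mul_le_mul_of_nonneg_left this hKp.le
    have h6 := (hJ x hx2).2.1
    have e : F x - κ = quadError U φ ℓ x / u ^ 6 - Real.log (jac U φ x) := by rw [hF]; ring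
    rw [e]
    exact (abs_sub _ _).trans (add_le_add h5 h6)
  -- the constant `κ` is bounded because both measures give the ball mass between `1/2` and `1`
  have hmass : gaussian covT B = ∫⁻ V in φ '' B, ENNReal.ofReal (Real.exp (F (θ V)))
      ∂posterior ℓ (u ^ 6) := by
    have h5 := congrArg (fun μ : Measure (MatSpace d k) => μ Set.univ) hmap
    simp only [Measure.map_apply hφm MeasurableSet.univ, Set.preimage_univ,
      Measure.restrict_apply_univ, withDensity_apply _ MeasurableSet.univ,
      Measure.restrict_univ] at h5
    rw [h5, ← lintegral_indicator (measurableSet_image hφ measurableSet_ball hBi)]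
    refine lintegral_congr fun V => ?_
    by_cases hV : V ∈ φ '' B
    · rw [Set.indicator_of_mem hV, Set.indicator_of_mem hV]
    · rw [Set.indicator_of_notMem hV, Set.indicator_of_notMem hV, ENNReal.ofReal_zero]
  have hthB : ∀ V ∈ φ '' B, ‖θ V‖ < u ^ 2 := by
    rintro V ⟨x, hx, rfl⟩
    rw [hB, mem_ball_zero_iff] at hx
    rwa [hθ x (hBρ x hx).1]
  have hNB : ENNReal.ofReal (1 / 2) ≤ gaussian covT B := by
    have h5 : gaussian covT Bᶜ ≤ ENNReal.ofReal (1 / 2) := by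
      have h6 := htail u _ covT hu huδ₂ hsc Bᶜ
      rw [Measure.restrict_apply_self] at h6
      refine h6.trans ?_
      rw [Measure.smul_apply, smul_eq_mul]
      have : IsProbabilityMeasure ((stdGaussian (tangent U)).map fun x => (1 : ℝ) • x) :=
        Measure.isProbabilityMeasure_map (by fun_prop)
      refine (mul_le_of_le_one_right' prob_le_one).trans (ENNReal.ofReal_le_ofReal ?_)
      have h7 : u ^ 18 ≤ u := pow_le_of_le_one hu.le hu1 (by norm_num)
      calc Ct * u ^ 18 ≤ Ct * (1 / (2 * Ct)) := by gcongr; exact h7.trans huC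
        _ = 1 / 2 := by field_simp
    have h6 := prob_add_prob_compl (μ := gaussian covT) (s := B) measurableSet_ball
    have h7 : (1 : ℝ≥0∞) = ENNReal.ofReal (1 / 2) + ENNReal.ofReal (1 / 2) := by
      rw [← ENNReal.ofReal_add (by norm_num) (by norm_num)]; norm_num
    by_contra! hlt
    have h8 := ENNReal.add_lt_add_of_lt_of_le (ne_top_of_le_ne_top ENNReal.ofReal_ne_top h5) hlt h5
    rw [h6, ← h7] at h8
    exact lt_irrefl _ h8
  have hpB : ENNReal.ofReal (1 / 2) ≤ posterior ℓ (u ^ 6) (φ '' B) := by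
    have h5 := himg ℓ u hℓ hu huδ₁
    have h6 := prob_add_prob_compl (μ := posterior ℓ (u ^ 6)) (s := φ '' B)
      (measurableSet_image hφ measurableSet_ball hBi)
    have h7 : (1 : ℝ≥0∞) = ENNReal.ofReal (1 / 2) + ENNReal.ofReal (1 / 2) := by
      rw [← ENNReal.ofReal_add (by norm_num) (by norm_num)]; norm_num
    by_contra! hlt
    have h8 := ENNReal.add_lt_add_of_lt_of_le (ne_top_of_le_ne_top ENNReal.ofReal_ne_top h5) hlt h5
    rw [h6, ← h7] at h8
    exact lt_irrefl _ h8
  have hκ1 : κ ≤ Kp + Kj + 1 := by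
    have h5 : ENNReal.ofReal (Real.exp (κ - (Kp + Kj))) * ENNReal.ofReal (1 / 2) ≤ 1 :=
      calc _ ≤ ENNReal.ofReal (Real.exp (κ - (Kp + Kj))) * posterior ℓ (u ^ 6) (φ '' B) := by gcongr
        _ = ∫⁻ V in φ '' B, ENNReal.ofReal (Real.exp (κ - (Kp + Kj))) ∂posterior ℓ (u ^ 6) := by
          rw [setLIntegral_const]
        _ ≤ _ := by
          refine setLIntegral_mono' (measurableSet_image hφ measurableSet_ball hBi) fun V hV => ?_
          refine ENNReal.ofReal_le_ofReal (Real.exp_le_exp.2 ?_)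
          linarith [(abs_le.1 (hFκ _ (hthB V hV))).1]
        _ = gaussian covT B := hmass.symm
        _ ≤ 1 := prob_le_one
    rw [← ENNReal.ofReal_mul (Real.exp_nonneg _), ENNReal.ofReal_le_one] at h5
    have h6 := Real.add_one_le_exp (κ - (Kp + Kj))
    linarith
  have hκ2 : -(Kp + Kj + 1) ≤ κ := by
    have h5 : ENNReal.ofReal (1 / 2) ≤ ENNReal.ofReal (Real.exp (κ + (Kp + Kj))) :=
      calc _ ≤ gaussian covT B := hNB
        _ ≤ ∫⁻ V in φ '' B, ENNReal.ofReal (Real.exp (κ + (Kp + Kj))) ∂posterior ℓ (u ^ 6) := by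
          rw [hmass]
          refine setLIntegral_mono' (measurableSet_image hφ measurableSet_ball hBi) fun V hV => ?_
          refine ENNReal.ofReal_le_ofReal (Real.exp_le_exp.2 ?_)
          linarith [(abs_le.1 (hFκ _ (hthB V hV))).2]
        _ ≤ _ := by rw [setLIntegral_const]; exact mul_le_of_le_one_right' prob_le_one
    rw [ENNReal.ofReal_le_ofReal_iff (Real.exp_nonneg _)] at h5
    by_contra! hlt
    have h6 : Real.exp (κ + (Kp + Kj)) < Real.exp (-1) := Real.exp_lt_exp.2 (by linarith)
    have h7 : Real.exp (-1) ≤ 1 / 2 := by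
      rw [Real.exp_neg, inv_le_comm₀ (Real.exp_pos _) (by norm_num)]
      linarith [Real.add_one_le_exp (1 : ℝ)]
    linarith
  refine ⟨F, fun x v => fderiv ℝ (quadError U φ ℓ) x v / u ^ 6 -
    fderiv ℝ (fun ξ => Real.log (jac U φ ξ)) x v, hFm, ?_, ?_, ?_, ?_, ?_, hmap⟩
  · exact ((measurable_fderiv_apply (E := tangent U) (quadError U φ ℓ)).div_const _).sub
      (measurable_fderiv_apply (E := tangent U) _)
  · intro x v w
    rw [map_add, map_add]
    ring
  · intro x hx
    have h5 := abs_le.1 (hFκ x hx)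
    rw [abs_le]
    constructor <;> linarith
  · intro x hx v
    obtain ⟨hx1, hx2, hx3⟩ := hBρ x hx
    have h5 := ContinuousLinearMap.le_of_opNorm_le _ (h4 x hx3).2.1 v
    have h6 := ContinuousLinearMap.le_of_opNorm_le _ (hJ x hx2).2.2.1 v
    rw [Real.norm_eq_abs] at h5 h6
    refine (abs_sub _ _).trans ?_
    rw [abs_div, abs_of_pos hu6]
    have h7 : |fderiv ℝ (quadError U φ ℓ) x v| / u ^ 6 ≤ Kp * ‖x‖ ^ 2 * ‖v‖ / u ^ 6 := by gcongr
    refine (add_le_add h7 h6).trans ?_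
    have e : Kp * ‖x‖ ^ 2 * ‖v‖ / u ^ 6 + Kj * ‖v‖ = (Kp * (‖x‖ ^ 2 / u ^ 6) + Kj * 1) * ‖v‖ := by
      ring
    rw [e, mul_add]
    have hKle1 : Kp ≤ Kθ + (2 * (Kp + Kj) + 1) := by linarith
    have hKle2 : Kj ≤ Kθ + (2 * (Kp + Kj) + 1) := by linarith
    gcongr
  · intro x w hx hw
    obtain ⟨hx1, hx2, hx3⟩ := hBρ x hx
    obtain ⟨hw1, hw2, hw3⟩ := hBρ w hw
    have h5 := (h4 x hx3).2.2 w hw3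
    have h6 := (hJ x hx2).2.2.2 w hw2
    have e : F w - F x - (fderiv ℝ (quadError U φ ℓ) x (w - x) / u ^ 6 -
        fderiv ℝ (fun ξ => Real.log (jac U φ ξ)) x (w - x)) =
        (quadError U φ ℓ w - quadError U φ ℓ x - fderiv ℝ (quadError U φ ℓ) x (w - x)) / u ^ 6 -
        (Real.log (jac U φ w) - Real.log (jac U φ x) -
          fderiv ℝ (fun ξ => Real.log (jac U φ ξ)) x (w - x)) := by rw [hF]; ring
    rw [e]
    refine (abs_sub _ _).trans ?_
    rw [abs_div, abs_of_pos hu6]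
    refine (add_le_add (div_le_div_of_nonneg_right h5 hu6.le) h6).trans ?_
    have e : Kp * max ‖x‖ ‖w‖ * ‖w - x‖ ^ 2 / u ^ 6 + Kj * ‖w - x‖ ^ 2 =
        (Kp * (max ‖x‖ ‖w‖ / u ^ 6) + Kj * 1) * ‖w - x‖ ^ 2 := by ring
    rw [e, mul_add]
    have hKle1 : Kp ≤ Kθ + (2 * (Kp + Kj) + 1) := by linarith
    have hKle2 : Kj ≤ Kθ + (2 * (Kp + Kj) + 1) := by linarith
    gcongr

end LocalDensity

end StiefelKL

/-! ### Upper bound for the divergence of the retracted Gaussian -/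

namespace StiefelKL

section UpperBound

variable {d k : ℕ} {U : MatSpace d k} {φ : tangent U → MatSpace d k}
  {θ : MatSpace d k → tangent U} {N : Measure (tangent U)} {p : Measure (MatSpace d k)}
  {ε r K : ℝ} {F : tangent U → ℝ} {D : tangent U → tangent U → ℝ}

/-- The density in `IsLocalDensity`. -/
noncomputable def localDensity (φ : tangent U → MatSpace d k) (θ : MatSpace d k → tangent U)
    (r : ℝ) (F : tangent U → ℝ) (V : MatSpace d k) : ℝ :=
  (φ '' Metric.ball 0 r).indicator (fun V => Real.exp (F (θ V))) V

lemma localDensity_nonneg (V : MatSpace d k) : 0 ≤ localDensity φ θ r F V :=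
  Set.indicator_nonneg (fun _ _ => Real.exp_nonneg _) V

lemma localDensity_apply (hθ : ∀ x, ‖x‖ < r → θ (φ x) = x) {x : tangent U} (hx : ‖x‖ < r) :
    localDensity φ θ r F (φ x) = Real.exp (F x) := by
  rw [localDensity, Set.indicator_of_mem (Set.mem_image_of_mem φ (mem_ball_zero_iff.2 hx)), hθ x hx]

lemma injOn_ball (hθ : ∀ x, ‖x‖ < r → θ (φ x) = x) : (Metric.ball (0 : tangent U) r).InjOn φ := by
  intro x hx y hy hxy
  rw [mem_ball_zero_iff] at hx hy
  rw [← hθ x hx, hxy, hθ y hy]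

namespace IsLocalDensity

lemma measurable_localDensity (h : IsLocalDensity φ θ N p ε r K F D)
    (hφ : IsSecondOrderRetraction U φ)
    (hθm : Measurable θ) (hθ : ∀ x, ‖x‖ < r → θ (φ x) = x) :
     Measurable (localDensity φ θ r F) := by
  have := h.measurable
  exact Measurable.indicator (by fun_prop) (measurableSet_image hφ measurableSet_ball (injOn_ball hθ))

lemma localDensity_le (h : IsLocalDensity φ θ N p ε r K F D)
    (hθ : ∀ x, ‖x‖ < r → θ (φ x) = x) (V : MatSpace d k) : localDensity φ θ r F V ≤ Real.exp K := by
  by_cases hV : V ∈ φ '' Metric.ball 0 r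
  · obtain ⟨x, hx, rfl⟩ := hV
    rw [mem_ball_zero_iff] at hx
    rw [localDensity_apply hθ hx, Real.exp_le_exp]
    exact (abs_le.1 (h.bound x hx)).2
  · rw [localDensity, Set.indicator_of_notMem hV]; exact Real.exp_nonneg _

lemma integral_localDensity_mul (h : IsLocalDensity φ θ N p ε r K F D)
    (hφ : IsSecondOrderRetraction U φ)
    (hθm : Measurable θ) (hθ : ∀ x, ‖x‖ < r → θ (φ x) = x)
    {g : MatSpace d k → ℝ} (hg : Measurable g) :
    ∫ V, localDensity φ θ r F V * g V ∂p = ∫ x in Metric.ball 0 r, g (φ x) ∂N := by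
  have hφm : Measurable φ := hφ.smooth.continuous.measurable
  have hm := h.measurable_localDensity hφ hθm hθ
  rw [← integral_map hφm.aemeasurable hg.aestronglyMeasurable, h.map_eq]
  change _ = ∫ y, g y ∂p.withDensity fun V => ENNReal.ofReal (localDensity φ θ r F V)
  rw [integral_withDensity_eq_integral_toReal_smul hm.ennreal_ofReal (by simp)]
  refine integral_congr_ae (Eventually.of_forall fun V => ?_)
  simp only [ENNReal.toReal_ofReal (localDensity_nonneg V), smul_eq_mul]

/-- The divergence functional of the local density, in which only `∫ F` over the ball and the mass
of its complement appear. -/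
lemma lintegral_klFun [IsProbabilityMeasure N] [IsProbabilityMeasure p]
    (h : IsLocalDensity φ θ N p ε r K F D)
    (hφ : IsSecondOrderRetraction U φ)
    (hθm : Measurable θ) (hθ : ∀ x, ‖x‖ < r → θ (φ x) = x) :
    0 ≤ ∫ x in Metric.ball 0 r, F x ∂N + N.real (Metric.ball 0 r)ᶜ ∧
    ∫⁻ V, ENNReal.ofReal (klFun (localDensity φ θ r F V)) ∂p =
      ENNReal.ofReal (∫ x in Metric.ball 0 r, F x ∂N + N.real (Metric.ball 0 r)ᶜ) := by
  have hm := h.measurable_localDensity hφ hθm hθ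
  have hb : ∀ V, |localDensity φ θ r F V| ≤ Real.exp K := fun V => by
    rw [abs_of_nonneg (localDensity_nonneg V)]; exact h.localDensity_le hθ V
  have hbl : ∀ V, |localDensity φ θ r F V * Real.log (localDensity φ θ r F V)| ≤
      Real.exp K * |K| := by
    intro V
    by_cases hV : V ∈ φ '' Metric.ball 0 r
    · obtain ⟨x, hx, rfl⟩ := hV
      rw [mem_ball_zero_iff] at hx
      rw [abs_mul]
      refine mul_le_mul (hb _) ?_ (abs_nonneg _) (Real.exp_nonneg _)
      rw [localDensity_apply hθ hx, Real.log_exp]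
      exact (h.bound x hx).trans (le_abs_self K)
    · rw [localDensity, Set.indicator_of_notMem hV, zero_mul, abs_zero]; positivity
  have hi1 : Integrable (localDensity φ θ r F) p :=
    Integrable.of_bound hm.aestronglyMeasurable _ (Eventually.of_forall hb)
  have hi2 : Integrable (fun V => localDensity φ θ r F V * Real.log (localDensity φ θ r F V)) p :=
    Integrable.of_bound (hm.mul (Real.measurable_log.comp hm)).aestronglyMeasurable _
      (Eventually.of_forall hbl)
  have hik : Integrable (fun V => klFun (localDensity φ θ r F V)) p := by
    simp only [klFun_apply]
    exact (hi2.add (integrable_const 1)).sub hi1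
  have e1 : ∫ V, localDensity φ θ r F V ∂p = N.real (Metric.ball 0 r) := by
    have := h.integral_localDensity_mul hφ hθm hθ (g := fun _ => 1) measurable_const
    simpa using this
  have e2 : ∫ V, localDensity φ θ r F V * Real.log (localDensity φ θ r F V) ∂p =
      ∫ x in Metric.ball 0 r, F x ∂N := by
    refine (h.integral_localDensity_mul hφ hθm hθ (Real.measurable_log.comp hm)).trans ?_
    refine setIntegral_congr_fun measurableSet_ball fun x hx => ?_
    rw [mem_ball_zero_iff] at hx
    simp only [Function.comp_apply]
    rw [localDensity_apply hθ hx, Real.log_exp]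
  have e3 : ∫ V, klFun (localDensity φ θ r F V) ∂p =
      ∫ x in Metric.ball 0 r, F x ∂N + N.real (Metric.ball 0 r)ᶜ := by
    simp only [klFun_apply]
    have hi3 : Integrable (fun V => localDensity φ θ r F V * Real.log (localDensity φ θ r F V) + 1)
      p := hi2.add (integrable_const 1)
    rw [integral_sub hi3 hi1, integral_add hi2 (integrable_const 1), e1, e2, probReal_compl_eq_one_sub measurableSet_ball]
    simp only [integral_const, probReal_univ, one_smul]
    ring
  have hnn : ∀ V, 0 ≤ klFun (localDensity φ θ r F V) := fun V =>
    klFun_nonneg (localDensity_nonneg V)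
  refine ⟨?_, ?_⟩
  · rw [← e3]; exact integral_nonneg hnn
  · rw [← e3, ofReal_integral_eq_lintegral_ofReal hik (Eventually.of_forall hnn)]

end IsLocalDensity

/-- The positive part of the log-density of a measure of finite divergence is integrable. -/
lemma lintegral_posLog_rnDeriv_ne_top {X : Type*} [MeasurableSpace X] {μ ν : Measure X}
    [IsFiniteMeasure μ] [IsFiniteMeasure ν] (h : klDiv μ ν ≠ ⊤) :
    ∫⁻ x, ENNReal.ofReal (Real.posLog (μ.rnDeriv ν x).toReal) ∂μ ≠ ⊤ := by
  obtain ⟨-, hi⟩ := klDiv_ne_top_iff.1 h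
  have h1 := hi.pos_part
  have h2 := (hasFiniteIntegral_iff_ofReal (Eventually.of_forall fun x => le_max_right _ _)).1
    h1.hasFiniteIntegral
  refine (lt_of_le_of_lt (le_of_eq ?_) h2).ne
  refine lintegral_congr fun x => ?_
  rw [Real.posLog_def, max_comm]
  rfl

lemma posLog_mul_exp_le {c x t L : ℝ} (hc0 : 0 ≤ c) (hc : c ≤ 1) (hx : 0 ≤ x) (ht : t ≤ L)
    (hL : 0 ≤ L) : Real.posLog (c * x * Real.exp t) ≤ Real.posLog x + L := by
  calc Real.posLog (c * x * Real.exp t) ≤ Real.posLog (x * Real.exp L) := by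
        refine Real.posLog_le_posLog (by positivity) ?_
        have : c * x ≤ x := mul_le_of_le_one_left hx hc
        gcongr
    _ ≤ Real.posLog x + Real.posLog (Real.exp L) := Real.posLog_mul
    _ = _ := by
        rw [Real.posLog_eq_log_max_one (Real.exp_nonneg L), max_eq_right (Real.one_le_exp hL),
          Real.log_exp]

/-- Upper bound for the divergence of the retracted Gaussian from the posterior. The part outside
the ball of radius `ε^{1/3}`, `ε = u⁶`, is dominated by a small multiple of the retraction of a
fixed Gaussian. -/
lemma exists_klDiv_qTang_le (hU : U ∈ stiefel d k) (hφ : IsSecondOrderRetraction U φ)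
    (hfin : ∃ σ : ℝ, 0 < σ ∧ klDiv ((stdGaussian (tangent U)).map fun ξ => φ (σ • ξ))
      (uniformStiefel d k) ≠ ⊤) {a : ℝ} (ha : 0 < a) (M K : ℝ) :
    ∃ C δ : ℝ, 0 < C ∧ 0 < δ ∧ ∀ (ℓ : MatSpace d k → ℝ) (u : ℝ)
      (covT : tangent U →L[ℝ] tangent U) (θ : MatSpace d k → tangent U) (F : tangent U → ℝ)
      (D : tangent U → tangent U → ℝ), IsConcentratedPotential a M U ℓ → 0 < u → u ≤ δ →
      IsInverseHessian ℓ (u ^ 6) U covT → Measurable θ → (∀ x, ‖x‖ < u ^ 2 → θ (φ x) = x) →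
      IsLocalDensity φ θ (gaussian covT) (posterior ℓ (u ^ 6)) (u ^ 6) (u ^ 2) K F D →
      klDiv (qTang φ covT) (posterior ℓ (u ^ 6)) ≤
        ENNReal.ofReal (∫ x in Metric.ball 0 (u ^ 2), F x ∂gaussian covT + C * u ^ 12) := by
  obtain ⟨σ, hσ, hfin⟩ := hfin
  obtain ⟨Kp, hKp, hpot⟩ := exists_potential_bounds hφ ha M
  obtain ⟨Ct, δ₁, hCt, hδ₁, htail⟩ := gaussian_tail_le (E := tangent U) ha hKp hσ
  obtain ⟨L, hL, hosc⟩ := exists_path_oscillation (d := d) (k := k) M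
  have hφm : Measurable φ := hφ.smooth.continuous.measurable
  have hμeq : (stdGaussian (tangent U)).map (fun ξ => φ (σ • ξ)) =
      ((stdGaussian (tangent U)).map (fun ξ => σ • ξ)).map φ :=
    (Measure.map_map hφm (by fun_prop)).symm
  rw [hμeq] at hfin
  set μ₀ := (stdGaussian (tangent U)).map (fun ξ => σ • ξ) with hμ₀
  have : IsProbabilityMeasure μ₀ := Measure.isProbabilityMeasure_map (by fun_prop)
  have : IsProbabilityMeasure (μ₀.map φ) := Measure.isProbabilityMeasure_map (by fun_prop)
  set f := (μ₀.map φ).rnDeriv (uniformStiefel d k) with hf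
  have hfm : Measurable f := Measure.measurable_rnDeriv _ _
  have hfint := lintegral_posLog_rnDeriv_ne_top hfin
  have hfac := (klDiv_ne_top_iff.1 hfin).1
  have hdc : (μ₀.map φ).HaveLebesgueDecomposition (uniformStiefel d k) :=
    Measure.haveLebesgueDecomposition_of_sigmaFinite _ _
  have hwd : (uniformStiefel d k).withDensity f = μ₀.map φ :=
    Measure.withDensity_rnDeriv_eq _ _ hfac
  set I := (∫⁻ x, ENNReal.ofReal (Real.posLog (f x).toReal) ∂μ₀.map φ).toReal with hI
  set A := Real.exp |K| with hA
  have hA1 : 1 ≤ A := Real.one_le_exp (abs_nonneg K)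
  have hlogA : 0 ≤ Real.log (2 * A) := Real.log_nonneg (by linarith)
  have hI0 : 0 ≤ I := ENNReal.toReal_nonneg
  refine ⟨Ct * (1 + (Real.log (2 * A) + L + I)), min (min 1 δ₁) (1 / Ct), by positivity,
    by positivity, ?_⟩
  intro ℓ u covT θ F D hℓ hu huδ hinv hθm hθ h
  simp only [le_min_iff] at huδ
  obtain ⟨⟨hu1, huδ₁⟩, huC⟩ := huδ
  have hu6 : 0 < u ^ 6 := by positivity
  obtain ⟨h1, h2, h3, -⟩ := hpot ℓ hℓ
  have hsc := hinv.isScaledInverse hu6 h1 h2 h3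
  obtain ⟨W, hW, hW1, -, hp, hprob⟩ := exists_posterior_eq hU ha.le hℓ hu6
  have hdom := htail u _ covT hu huδ₁ hsc
  set κ := Ct * u ^ 18 with hκ
  have hκ0 : 0 < κ := by positivity
  have hκ1 : κ ≤ 1 := by
    have : u ^ 18 ≤ u := pow_le_of_le_one hu.le hu1 (by norm_num)
    calc κ ≤ Ct * (1 / Ct) := by rw [hκ]; gcongr; exact this.trans huC
      _ = 1 := by field_simp
  set p := posterior ℓ (u ^ 6) with hpdef
  set B := Metric.ball (0 : tangent U) (u ^ 2) with hB
  set q₂ := ((gaussian covT).restrict Bᶜ).map φ with hq₂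
  have hℓm : Measurable ℓ := hℓ.contDiff.continuous.measurable
  -- the density, relative to the posterior, of the dominating multiple of the fixed retracted
  -- Gaussian
  set Dn : MatSpace d k → ℝ≥0∞ := fun V => ENNReal.ofReal κ * f V *
    ENNReal.ofReal (W * Real.exp ((ℓ V - ℓ U) / u ^ 6)) with hDn
  have hDm : Measurable Dn := by
    have h5 : Measurable fun V => ENNReal.ofReal (W * Real.exp ((ℓ V - ℓ U) / u ^ 6)) := by fun_prop
    exact (hfm.const_mul _).mul h5
  have hpD : p.withDensity Dn = ENNReal.ofReal κ • μ₀.map φ := by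
    rw [hp, ← withDensity_mul _ (by fun_prop) hDm, ← hwd,
      ← withDensity_smul _ hfm]
    congr 1
    ext V
    simp only [Pi.mul_apply, hDn, Pi.smul_apply, smul_eq_mul]
    rw [mul_comm, mul_assoc, ← ENNReal.ofReal_mul (by positivity)]
    have : W * Real.exp ((ℓ V - ℓ U) / u ^ 6) * (Real.exp (-(ℓ V - ℓ U) / u ^ 6) / W) = 1 := by
      rw [neg_div, Real.exp_neg]
      field_simp
    rw [this, ENNReal.ofReal_one, mul_one]
  have hq₂le : q₂ ≤ ENNReal.ofReal κ • μ₀.map φ := by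
    rw [← Measure.map_smul]
    exact Measure.map_mono hdom hφm
  have hac : p ≪ uniformStiefel d k := by rw [hp]; exact withDensity_absolutelyContinuous _ _
  have hDtop : ∀ᵐ V ∂p, Dn V ≠ ⊤ := by
    filter_upwards [hac.ae_le (Measure.rnDeriv_lt_top (μ₀.map φ) (uniformStiefel d k))] with V hV
    exact ENNReal.mul_ne_top (ENNReal.mul_ne_top ENNReal.ofReal_ne_top hV.ne) ENNReal.ofReal_ne_top
  have hqprob : IsProbabilityMeasure (qTang φ covT) := Measure.isProbabilityMeasure_map hφm.aemeasurable
  have hdec : qTang φ covT = p.withDensity (fun V => ENNReal.ofReal (localDensity φ θ (u ^ 2) F V)) +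
      q₂ := by
    change _ = p.withDensity (fun V => ENNReal.ofReal
      ((φ '' Metric.ball 0 (u ^ 2)).indicator (fun V => Real.exp (F (θ V))) V)) + q₂
    rw [← h.map_eq, hq₂, ← Measure.map_add _ _ hφm,
      Measure.restrict_add_restrict_compl measurableSet_ball]
    rfl
  have hkl := klDiv_le_of_decomp (h.measurable_localDensity hφ hθm hθ)
    localDensity_nonneg hA1 (fun V => (h.localDensity_le hθ V).trans
      (Real.exp_le_exp.2 (le_abs_self K))) hDm hDtop (hq₂le.trans_eq hpD.symm) hdec
  obtain ⟨hnn, hkf⟩ := h.lintegral_klFun hφ hθm hθ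
  rw [hkf] at hkl
  have hgm : Measurable fun V => ENNReal.ofReal (Real.log (2 * A) + Real.posLog (Dn V).toReal) :=
    (measurable_const.add
      (Real.continuous_posLog.measurable.comp hDm.ennreal_toReal)).ennreal_ofReal
  have hrem : ∫⁻ V, ENNReal.ofReal (Real.log (2 * A) + Real.posLog (Dn V).toReal) ∂q₂ ≤
      ENNReal.ofReal (κ * (Real.log (2 * A) + L / u ^ 6 + I)) := by
    refine (lintegral_mono' hq₂le le_rfl).trans ?_
    rw [lintegral_smul_measure, ENNReal.ofReal_mul hκ0.le, smul_eq_mul]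
    refine mul_le_mul' le_rfl ?_
    have hpm : Measurable fun V => ENNReal.ofReal (Real.posLog (f V).toReal) :=
      (Real.continuous_posLog.measurable.comp hfm.ennreal_toReal).ennreal_ofReal
    rw [lintegral_map hgm hφm, ENNReal.ofReal_add (by positivity) hI0, hI,
      ENNReal.ofReal_toReal hfint, lintegral_map hpm hφm]
    calc _ ≤ ∫⁻ x, ENNReal.ofReal (Real.log (2 * A) + L / u ^ 6) +
          ENNReal.ofReal (Real.posLog (f (φ x)).toReal) ∂μ₀ := by
          refine lintegral_mono fun x => ?_
          rw [← ENNReal.ofReal_add (by positivity) Real.posLog_nonneg]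
          refine ENNReal.ofReal_le_ofReal ?_
          -- the path `t ↦ φ(t x)` joins `U` to `φ(x)` in the manifold, which bounds the potential
          -- even if the Stiefel manifold is not connected
          have hpath := hosc ℓ (hℓ.contDiff.of_le (by norm_num)) (fun V hV => by
            rw [← norm_iteratedFDeriv_one]; exact hℓ.bound V hV 1 (by simp))
            (fun t => φ (t • x)) (hφ.smooth.continuous.comp (by fun_prop))
            (fun t => hφ.mem_stiefel _)
          rw [one_smul, zero_smul, hφ.map_zero] at hpath
          have h5 : (ℓ (φ x) - ℓ U) / u ^ 6 ≤ L / u ^ 6 := by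
            gcongr; exact (le_abs_self _).trans hpath
          have h6 : (Dn (φ x)).toReal =
              (κ * W) * (f (φ x)).toReal * Real.exp ((ℓ (φ x) - ℓ U) / u ^ 6) := by
            simp only [hDn, ENNReal.toReal_mul, ENNReal.toReal_ofReal hκ0.le]
            rw [ENNReal.toReal_ofReal (by positivity)]
            ring
          have h7 := posLog_mul_exp_le (by positivity : 0 ≤ κ * W)
            (mul_le_one₀ hκ1 hW.le hW1) (ENNReal.toReal_nonneg (a := f (φ x))) h5 (by positivity)
          rw [h6]
          linarith
      _ = _ := by
          rw [lintegral_add_left measurable_const, lintegral_const, measure_univ, mul_one]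
  have hcompl : (gaussian covT).real Bᶜ ≤ κ := by
    have h6 := hdom Bᶜ
    rw [Measure.restrict_apply_self, Measure.smul_apply, smul_eq_mul] at h6
    exact ENNReal.toReal_le_of_le_ofReal hκ0.le (h6.trans (mul_le_of_le_one_right' prob_le_one))
  refine hkl.trans ((add_le_add le_rfl hrem).trans ?_)
  rw [← ENNReal.ofReal_add hnn (by positivity)]
  refine ENNReal.ofReal_le_ofReal ?_
  rw [add_assoc]
  gcongr
  -- the tail mass is `O(u¹⁸)`, and the log-density there costs at most `O(u⁻⁶)`
  have h8 : u ^ 18 ≤ u ^ 12 := pow_le_pow_of_le_one hu.le hu1 (by norm_num)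
  have h9 : κ * (L / u ^ 6) = Ct * (L * u ^ 12) := by rw [hκ]; field_simp
  calc (gaussian covT).real Bᶜ + κ * (Real.log (2 * A) + L / u ^ 6 + I)
      ≤ κ + κ * (Real.log (2 * A) + L / u ^ 6 + I) := by gcongr
    _ = Ct * (u ^ 18 + (Real.log (2 * A) + I) * u ^ 18) + κ * (L / u ^ 6) := by rw [hκ]; ring
    _ ≤ Ct * (u ^ 12 + (Real.log (2 * A) + I) * u ^ 12) + κ * (L / u ^ 6) := by gcongr
    _ = _ := by rw [h9]; ring

end UpperBound

end StiefelKL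

/-! ### Gaussian moments of error terms -/

namespace StiefelKL

section Moments

variable {E F : Type*} [NormedAddCommGroup E] [InnerProductSpace ℝ E] [FiniteDimensional ℝ E]
  [MeasurableSpace E] [BorelSpace E] [NormedAddCommGroup F] [InnerProductSpace ℝ F]
  [FiniteDimensional ℝ F] [MeasurableSpace F] [BorelSpace F]

/-- With `Σ_T` of order `ε = u⁶`, a factor `‖x‖² / ε` is of order one, so that the error terms are
of the third order in the scale `s`. -/
lemma exists_integral_cubic_le {k₁ : ℝ} (hk₁ : 0 < k₁) :
    ∃ C : ℝ, 0 < C ∧ ∀ (A : E →L[ℝ] E) (B : F →L[ℝ] F) (u s : ℝ), A.IsPositive → B.IsPositive →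
      0 < u → 0 < s → √‖A‖ ≤ k₁ * u ^ 3 → √‖A‖ ≤ s → √‖B‖ ≤ s →
      Integrable (fun z : E × F => (‖z.1‖ ^ 3 / u ^ 6 + ‖z.1‖) * (‖z.1‖ ^ 2 + ‖z.2‖ ^ 2))
        ((gaussian A).prod (gaussian B)) ∧
      ∫ z, (‖z.1‖ ^ 3 / u ^ 6 + ‖z.1‖) * (‖z.1‖ ^ 2 + ‖z.2‖ ^ 2)
        ∂((gaussian A).prod (gaussian B)) ≤ C * s ^ 3 := by
  obtain ⟨C50, h50, H50⟩ := gaussian_prod_moment (E := E) (F := F) 5 0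
  obtain ⟨C32, h32, H32⟩ := gaussian_prod_moment (E := E) (F := F) 3 2
  obtain ⟨C30, h30, H30⟩ := gaussian_prod_moment (E := E) (F := F) 3 0
  obtain ⟨C12, h12, H12⟩ := gaussian_prod_moment (E := E) (F := F) 1 2
  refine ⟨C50 * k₁ ^ 2 + C32 * k₁ ^ 2 + C30 + C12, by positivity, ?_⟩
  intro A B u s hA hB hu hs hAu hAs hBs
  set μ := (gaussian A).prod (gaussian B) with hμ
  obtain ⟨i50, I50⟩ := H50 A B hA hB
  obtain ⟨i32, I32⟩ := H32 A B hA hB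
  obtain ⟨i30, I30⟩ := H30 A B hA hB
  obtain ⟨i12, I12⟩ := H12 A B hA hB
  rw [← hμ] at i50 I50 i32 I32 i30 I30 i12 I12
  have hR : (fun z : E × F => (‖z.1‖ ^ 3 / u ^ 6 + ‖z.1‖) * (‖z.1‖ ^ 2 + ‖z.2‖ ^ 2)) =
      fun z => (u ^ 6)⁻¹ * (‖z.1‖ ^ 5 * ‖z.2‖ ^ 0) + (u ^ 6)⁻¹ * (‖z.1‖ ^ 3 * ‖z.2‖ ^ 2) +
        ‖z.1‖ ^ 3 * ‖z.2‖ ^ 0 + ‖z.1‖ ^ 1 * ‖z.2‖ ^ 2 := by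
    ext z
    field_simp
    ring
  rw [hR]
  have k1 := (i50.const_mul (u ^ 6)⁻¹).add (i32.const_mul (u ^ 6)⁻¹)
  refine ⟨(k1.add i30).add i12, ?_⟩
  have : ∫ z, ((u ^ 6)⁻¹ * (‖z.1‖ ^ 5 * ‖z.2‖ ^ 0) + (u ^ 6)⁻¹ * (‖z.1‖ ^ 3 * ‖z.2‖ ^ 2) +
        ‖z.1‖ ^ 3 * ‖z.2‖ ^ 0 + ‖z.1‖ ^ 1 * ‖z.2‖ ^ 2) ∂μ =
      (u ^ 6)⁻¹ * ∫ z, ‖z.1‖ ^ 5 * ‖z.2‖ ^ 0 ∂μ +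
      (u ^ 6)⁻¹ * ∫ z, ‖z.1‖ ^ 3 * ‖z.2‖ ^ 2 ∂μ + ∫ z, ‖z.1‖ ^ 3 * ‖z.2‖ ^ 0 ∂μ +
      ∫ z, ‖z.1‖ ^ 1 * ‖z.2‖ ^ 2 ∂μ := by
    refine (integral_add (k1.add i30) i12).trans ?_
    refine congrArg₂ _ ((integral_add k1 i30).trans ?_) rfl
    refine congrArg₂ _ ((integral_add (i50.const_mul _) (i32.const_mul _)).trans ?_) rfl
    rw [integral_const_mul, integral_const_mul]
  rw [this]
  have m50 : (u ^ 6)⁻¹ * ∫ z, ‖z.1‖ ^ 5 * ‖z.2‖ ^ 0 ∂μ ≤ C50 * k₁ ^ 2 * s ^ 3 := by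
    rw [inv_mul_le_iff₀ (by positivity)]
    calc _ ≤ C50 * (√‖A‖ ^ 5 * √‖B‖ ^ 0) := I50
      _ = C50 * (√‖A‖ ^ 2 * √‖A‖ ^ 3) := by ring
      _ ≤ C50 * ((k₁ * u ^ 3) ^ 2 * s ^ 3) := by gcongr
      _ = _ := by ring
  have m32 : (u ^ 6)⁻¹ * ∫ z, ‖z.1‖ ^ 3 * ‖z.2‖ ^ 2 ∂μ ≤ C32 * k₁ ^ 2 * s ^ 3 := by
    rw [inv_mul_le_iff₀ (by positivity)]
    calc _ ≤ C32 * (√‖A‖ ^ 3 * √‖B‖ ^ 2) := I32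
      _ = C32 * (√‖A‖ ^ 2 * √‖A‖ * √‖B‖ ^ 2) := by ring
      _ ≤ C32 * ((k₁ * u ^ 3) ^ 2 * s * s ^ 2) := by gcongr
      _ = _ := by ring
  have m30 : ∫ z, ‖z.1‖ ^ 3 * ‖z.2‖ ^ 0 ∂μ ≤ C30 * s ^ 3 := by
    calc _ ≤ C30 * (√‖A‖ ^ 3 * √‖B‖ ^ 0) := I30
      _ ≤ C30 * (s ^ 3 * √‖B‖ ^ 0) := by gcongr
      _ = _ := by ring
  have m12 : ∫ z, ‖z.1‖ ^ 1 * ‖z.2‖ ^ 2 ∂μ ≤ C12 * s ^ 3 := by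
    calc _ ≤ C12 * (√‖A‖ ^ 1 * √‖B‖ ^ 2) := I12
      _ ≤ C12 * (s ^ 1 * s ^ 2) := by gcongr
      _ = _ := by ring
  linarith

/-- Markov bounds for the events `‖x‖ ≥ u²/2` and `‖y‖ ≥ ρ₁`. The exponents are such that both terms
are `O(s⁶)`, which absorbs a test function of size `s⁻³`. -/
lemma exists_integral_tail_le {k₁ ρ₁ : ℝ} (hk₁ : 0 < k₁) (hρ₁ : 0 < ρ₁) :
    ∃ C : ℝ, 0 < C ∧ ∀ (A : E →L[ℝ] E) (B : F →L[ℝ] F) (u s : ℝ), A.IsPositive → B.IsPositive →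
      0 < u → 0 < s → √‖A‖ ≤ k₁ * u ^ 3 → √‖B‖ ≤ s → u ^ 6 ≤ k₁ * s ^ 2 →
      Integrable (fun z : E × F => (2 * ‖z.1‖ / u ^ 2) ^ 18 + (‖z.2‖ / ρ₁) ^ 6)
        ((gaussian A).prod (gaussian B)) ∧
      ∫ z, (2 * ‖z.1‖ / u ^ 2) ^ 18 + (‖z.2‖ / ρ₁) ^ 6
        ∂((gaussian A).prod (gaussian B)) ≤ C * s ^ 6 := by
  obtain ⟨Ca, ha, Ha⟩ := gaussian_prod_moment (E := E) (F := F) 18 0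
  obtain ⟨Cb, hb, Hb⟩ := gaussian_prod_moment (E := E) (F := F) 0 6
  obtain ⟨T, hT⟩ : ∃ T : ℝ, T = 2 ^ 18 := ⟨_, rfl⟩
  have hT0 : 0 < T := by rw [hT]; positivity
  refine ⟨T * Ca * k₁ ^ 18 * k₁ ^ 3 + Cb / ρ₁ ^ 6, by positivity, ?_⟩
  intro A B u s hA hB hu hs hAu hBs hus
  set μ := (gaussian A).prod (gaussian B) with hμ
  obtain ⟨ia, Ia⟩ := Ha A B hA hB
  obtain ⟨ib, Ib⟩ := Hb A B hA hB
  rw [← hμ] at ia Ia ib Ib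
  have hR : (fun z : E × F => (2 * ‖z.1‖ / u ^ 2) ^ 18 + (‖z.2‖ / ρ₁) ^ 6) =
      fun z => T * (u ^ 36)⁻¹ * (‖z.1‖ ^ 18 * ‖z.2‖ ^ 0) +
        (ρ₁ ^ 6)⁻¹ * (‖z.1‖ ^ 0 * ‖z.2‖ ^ 6) := by
    ext z
    rw [div_pow, mul_pow, ← hT, div_pow, ← pow_mul, pow_zero, pow_zero, div_eq_mul_inv,
      div_eq_mul_inv]
    ring
  rw [hR]
  refine ⟨(ia.const_mul _).add (ib.const_mul _), ?_⟩
  rw [integral_add (ia.const_mul _) (ib.const_mul _), integral_const_mul, integral_const_mul,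
    add_mul]
  refine add_le_add ?_ ?_
  · have h1 : ∫ z, ‖z.1‖ ^ 18 * ‖z.2‖ ^ 0 ∂μ ≤ Ca * (k₁ ^ 18 * (u ^ 36 * (k₁ * s ^ 2) ^ 3)) := by
      have h2 : √‖A‖ ^ 18 ≤ (k₁ * u ^ 3) ^ 18 := pow_le_pow_left₀ (Real.sqrt_nonneg _) hAu 18
      have h3 : (u ^ 6) ^ 3 ≤ (k₁ * s ^ 2) ^ 3 := pow_le_pow_left₀ (by positivity) hus 3
      rw [pow_zero, mul_one] at Ia
      refine Ia.trans (mul_le_mul_of_nonneg_left (h2.trans ?_) ha.le)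
      have e : (k₁ * u ^ 3) ^ 18 = k₁ ^ 18 * (u ^ 36 * (u ^ 6) ^ 3) := by ring
      rw [e]
      exact mul_le_mul_of_nonneg_left (mul_le_mul_of_nonneg_left h3 (by positivity))
        (by positivity)
    refine (mul_le_mul_of_nonneg_left h1 (by positivity)).trans (le_of_eq ?_)
    have hu36 : (u ^ 36)⁻¹ * u ^ 36 = 1 := inv_mul_cancel₀ (by positivity)
    calc _ = T * Ca * k₁ ^ 18 * k₁ ^ 3 * s ^ 6 * ((u ^ 36)⁻¹ * u ^ 36) := by ring
      _ = _ := by rw [hu36, mul_one]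
  · rw [pow_zero, one_mul] at Ib
    have h2 : √‖B‖ ^ 6 ≤ s ^ 6 := pow_le_pow_left₀ (Real.sqrt_nonneg _) hBs 6
    refine (mul_le_mul_of_nonneg_left (Ib.trans (mul_le_mul_of_nonneg_left h2 hb.le))
      (by positivity)).trans (le_of_eq ?_)
    ring

/-- Integration of a pointwise lower bound with an odd term, a quadratic error of relative size
`‖x‖³ / ε + ‖x‖` with `ε = u⁶`, and a tail term. -/
lemma exists_integral_ge {C₁ K k₁ ρ₁ : ℝ} (hC₁ : 0 ≤ C₁) (hK : 0 ≤ K) (hk₁ : 0 < k₁) (hρ₁ : 0 < ρ₁) :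
    ∃ C : ℝ, 0 < C ∧ ∀ (A : E →L[ℝ] E) (B : F →L[ℝ] F) (u s : ℝ), A.IsPositive → B.IsPositive →
      0 < u → 0 < s → s ≤ 1 → √‖A‖ ≤ k₁ * u ^ 3 → √‖A‖ ≤ s → √‖B‖ ≤ s → u ^ 6 ≤ k₁ * s ^ 2 →
      ∀ (f : E × F → ℝ) (g : E → ℝ) (O : E × F → ℝ),
      Integrable f ((gaussian A).prod (gaussian B)) → Integrable g (gaussian A) →
      Integrable O ((gaussian A).prod (gaussian B)) → (∀ x y, O (x, -y) = -O (x, y)) →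
      (∀ z, g z.1 + O z - C₁ * ((‖z.1‖ ^ 3 / u ^ 6 + ‖z.1‖) * (‖z.1‖ ^ 2 + ‖z.2‖ ^ 2)) -
        2 * (K + (s ^ 3)⁻¹) * ((2 * ‖z.1‖ / u ^ 2) ^ 18 + (‖z.2‖ / ρ₁) ^ 6) ≤ f z) →
      ∫ x, g x ∂gaussian A - C * s ^ 3 ≤ ∫ z, f z ∂((gaussian A).prod (gaussian B)) := by
  obtain ⟨Ca, ha, Ha⟩ := exists_integral_cubic_le (E := E) (F := F) hk₁
  obtain ⟨Cb, hb, Hb⟩ := exists_integral_tail_le (E := E) (F := F) hk₁ hρ₁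
  refine ⟨C₁ * Ca + 2 * (K + 1) * Cb, by positivity, ?_⟩
  intro A B u s hA hB hu hs hs1 hAu hAs hBs hus f g O hf hg hO hodd hle
  set μ := (gaussian A).prod (gaussian B) with hμ
  obtain ⟨j1, J1⟩ := Ha A B u s hA hB hu hs hAu hAs hBs
  obtain ⟨j2, J2⟩ := Hb A B u s hA hB hu hs hAu hBs hus
  rw [← hμ] at j1 J1 j2 J2
  have hg' : Integrable (fun z : E × F => g z.1) μ := hg.comp_fst _
  have e0 : ∫ z, O z ∂μ = 0 := integral_prod_odd hB hodd
  have eg : ∫ z, g z.1 ∂μ = ∫ x, g x ∂gaussian A := by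
    rw [hμ, integral_fun_fst, probReal_univ, one_smul]
  have k1 := hg'.add hO
  have k2 := j1.const_mul C₁
  have k3 := j2.const_mul (2 * (K + (s ^ 3)⁻¹))
  have hmono := integral_mono ((k1.sub k2).sub k3) hf hle
  have hsplit := (integral_sub (k1.sub k2) k3).trans
    (congrArg₂ (· - ·) ((integral_sub k1 k2).trans (congrArg₂ (· - ·) (integral_add hg' hO)
      (integral_const_mul _ _))) (integral_const_mul _ _))
  have hmono' : ∫ z, g z.1 ∂μ + ∫ z, O z ∂μ -
      C₁ * ∫ z, (‖z.1‖ ^ 3 / u ^ 6 + ‖z.1‖) * (‖z.1‖ ^ 2 + ‖z.2‖ ^ 2) ∂μ -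
      2 * (K + (s ^ 3)⁻¹) * ∫ z, (2 * ‖z.1‖ / u ^ 2) ^ 18 + (‖z.2‖ / ρ₁) ^ 6 ∂μ ≤
      ∫ z, f z ∂μ := le_trans (le_of_eq hsplit.symm) hmono
  rw [e0, eg] at hmono'
  have hK1 : K + (s ^ 3)⁻¹ ≤ (K + 1) * (s ^ 3)⁻¹ := by
    have : 1 ≤ (s ^ 3)⁻¹ := (one_le_inv₀ (by positivity)).2 (pow_le_one₀ hs.le hs1)
    nlinarith
  have e1 := mul_le_mul_of_nonneg_left J1 hC₁
  have e2 : 2 * (K + (s ^ 3)⁻¹) * ∫ z, (2 * ‖z.1‖ / u ^ 2) ^ 18 + (‖z.2‖ / ρ₁) ^ 6 ∂μ ≤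
      2 * (K + 1) * Cb * s ^ 3 := by
    refine (mul_le_mul_of_nonneg_left J2 (by positivity)).trans ?_
    have h3 : (s ^ 3)⁻¹ * s ^ 3 = 1 := inv_mul_cancel₀ (by positivity)
    calc 2 * (K + (s ^ 3)⁻¹) * (Cb * s ^ 6) ≤ 2 * ((K + 1) * (s ^ 3)⁻¹) * (Cb * s ^ 6) := by
          gcongr
      _ = 2 * (K + 1) * Cb * s ^ 3 * ((s ^ 3)⁻¹ * s ^ 3) := by ring
      _ = _ := by rw [h3, mul_one]
  linarith

end Moments

end StiefelKL

/-! ### The second-order sample map in the chart -/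

namespace StiefelKL

section LowerBound

variable {d k : ℕ} {U : MatSpace d k} {φ : tangent U → MatSpace d k}

/-- A shift of the argument by `b` is linear in `b` up to a mixed quadratic error. -/
lemma norm_secondOrder_sub_le (U ξ b : MatSpace d k) :
    ‖secondOrder U (ξ + b) - (secondOrder U ξ + b)‖ ≤ ‖gramForm U‖ * (‖ξ‖ * ‖b‖ + ‖b‖ ^ 2) := by
  have e : secondOrder U (ξ + b) - (secondOrder U ξ + b) =
      -((1 / 2 : ℝ) • (gramForm U ξ b + gramForm U b ξ + gramForm U b b)) := by
    simp only [secondOrder_eq, map_add, _root_.add_apply]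
    module
  rw [e, norm_neg, norm_smul, Real.norm_of_nonneg (by norm_num)]
  have h1 := (gramForm U).le_opNorm₂ ξ b
  have h2 := (gramForm U).le_opNorm₂ b ξ
  have h3 := (gramForm U).le_opNorm₂ b b
  have h4 := norm_add₃_le (a := gramForm U ξ b) (b := gramForm U b ξ) (c := gramForm U b b)
  have h5 : 0 ≤ ‖gramForm U‖ * ‖b‖ ^ 2 := by positivity
  nlinarith

/-- In the chart given by a second-order retraction, a sample map with the expansion
`U + ξ - ½ U ξᵀ ξ + b(ξ,ν)` has coordinate `ξ + b(ξ,ν)` up to third order. -/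
lemma IsSecondOrderRetraction.exists_coord_bound (hφ : IsSecondOrderRetraction U φ)
    {θ : MatSpace d k → tangent U} {ρ K : ℝ} (hρ : 0 < ρ) (hK : 0 < K)
    (hθ : ∀ ξ, ‖ξ‖ < ρ → θ (φ ξ) = ξ)
    (hlip : ∀ V W, ‖V - U‖ < ρ → ‖W - U‖ < ρ → ‖θ V - θ W‖ ≤ K * ‖V - W‖)
    {G : tangent U → normal U → MatSpace d k} {b : tangent U → normal U → tangent U}
    {c C₀ ρ₀ : ℝ} (hc : 0 < c) (hC₀ : 0 < C₀) (hρ₀ : 0 < ρ₀)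
    (hb : ∀ ξ ν, ‖b ξ ν‖ ≤ c * ‖ξ‖ * ‖ν‖)
    (hG : ∀ ξ ν, ‖ξ‖ ≤ ρ₀ → ‖ν‖ ≤ ρ₀ → ‖G ξ ν - (secondOrder U ξ + (b ξ ν : MatSpace d k))‖ ≤
      C₀ * (‖ξ‖ * max ‖ξ‖ ‖ν‖ ^ 2)) :
    ∃ C ρ₁ : ℝ, 0 < C ∧ 0 < ρ₁ ∧ ρ₁ ≤ 1 ∧ ρ₁ ≤ ρ₀ ∧ ∀ ξ ν, ‖ξ‖ ≤ ρ₁ → ‖ν‖ ≤ ρ₁ →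
      ‖G ξ ν - U‖ < ρ ∧ ‖θ (G ξ ν) - ξ - b ξ ν‖ ≤ C * (‖ξ‖ * max ‖ξ‖ ‖ν‖ ^ 2) := by
  obtain ⟨ρ₂, Cφ, hρ₂, hCφ, hφb⟩ := hφ.exists_bound
  set g := ‖gramForm U‖ with hg
  have hg0 : 0 ≤ g := ContinuousLinearMap.opNorm_nonneg _
  set C₂ := C₀ + g * (c + c ^ 2) + 8 * Cφ with hC₂
  have hC₂0 : 0 < C₂ := by positivity
  set R := 3 + 4 * Cφ + C₂ with hR
  have hR0 : 0 < R := by positivity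
  refine ⟨K * C₂, min (min 1 (1 / c)) (min (min ρ₀ (ρ₂ / 3)) (ρ / R / 2)), by positivity,
    by positivity, (min_le_left _ _).trans (min_le_left _ _),
    (min_le_right _ _).trans ((min_le_left _ _).trans (min_le_left _ _)), ?_⟩
  intro ξ ν hξ hν
  simp only [le_min_iff] at hξ hν
  obtain ⟨⟨hξ1, hξc⟩, ⟨hξ0, hξ2⟩, hξρ⟩ := hξ
  obtain ⟨⟨hν1, hνc⟩, ⟨hν0, hν2⟩, hνρ⟩ := hν
  set x := ‖ξ‖ with hx
  set m := max x ‖ν‖ with hm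
  have hx0 : 0 ≤ x := norm_nonneg _
  have hxm : x ≤ m := le_max_left _ _
  have hνm : ‖ν‖ ≤ m := le_max_right _ _
  have hm1 : m ≤ 1 := max_le hξ1 hν1
  have hmρ : m ≤ ρ / R / 2 := max_le hξρ hνρ
  have hm0 : 0 ≤ m := hx0.trans hxm
  have hcν : c * ‖ν‖ ≤ 1 := by
    rw [le_div_iff₀ hc] at hνc; linarith
  set η : tangent U := ξ + b ξ ν with hη
  have hbx : ‖b ξ ν‖ ≤ x := (hb ξ ν).trans (by
    calc c * x * ‖ν‖ = c * ‖ν‖ * x := by ring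
      _ ≤ 1 * x := by gcongr
      _ = x := one_mul x)
  have hηx : ‖η‖ ≤ 2 * x := (norm_add_le _ _).trans (by linarith)
  have hηρ₂ : ‖η‖ < ρ₂ := hηx.trans_lt (by linarith)
  obtain ⟨hφ3, hφ2⟩ := hφb η hηρ₂
  have hbn : ‖(b ξ ν : MatSpace d k)‖ ≤ c * x * ‖ν‖ := hb ξ ν
  have h1 := norm_secondOrder_sub_le U (ξ : MatSpace d k) (b ξ ν)
  have hxn : ‖(ξ : MatSpace d k)‖ = x := rfl
  rw [← hg, hxn] at h1
  have h2 : x * ‖(b ξ ν : MatSpace d k)‖ + ‖(b ξ ν : MatSpace d k)‖ ^ 2 ≤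
      (c + c ^ 2) * (x * m ^ 2) := by
    have h3 : x * ‖(b ξ ν : MatSpace d k)‖ ≤ c * (x * m ^ 2) :=
      calc _ ≤ x * (c * x * ‖ν‖) := by gcongr
        _ ≤ x * (c * m * m) := by gcongr
        _ = _ := by ring
    have h4 : ‖(b ξ ν : MatSpace d k)‖ ^ 2 ≤ c ^ 2 * (x * m ^ 2) :=
      calc _ ≤ (c * x * ‖ν‖) ^ 2 := by gcongr
        _ = c ^ 2 * (x * (x * ‖ν‖ ^ 2)) := by ring
        _ ≤ c ^ 2 * (x * (1 * m ^ 2)) := by gcongr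
        _ = _ := by ring
    linarith
  have h5 : Cφ * ‖η‖ ^ 3 ≤ 8 * Cφ * (x * m ^ 2) :=
    calc _ ≤ Cφ * (2 * x) ^ 3 := by gcongr
      _ = 8 * Cφ * (x * x ^ 2) := by ring
      _ ≤ _ := by gcongr
  -- compare `G(ξ, ν)` with `φ(ξ + b(ξ, ν))` through their second-order expansions
  have h6 : ‖G ξ ν - φ η‖ ≤ C₂ * (x * m ^ 2) := by
    have e : G ξ ν - φ η = (G ξ ν - (secondOrder U ξ + (b ξ ν : MatSpace d k))) -
        (secondOrder U ((ξ : MatSpace d k) + b ξ ν) - (secondOrder U ξ + (b ξ ν : MatSpace d k))) -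
        (φ η - secondOrder U η) := by
      rw [hη, Submodule.coe_add]; abel
    rw [e]
    refine (norm_sub_le _ _).trans ?_
    have h7 := norm_sub_le (G ξ ν - (secondOrder U ξ + (b ξ ν : MatSpace d k)))
      (secondOrder U ((ξ : MatSpace d k) + b ξ ν) - (secondOrder U ξ + (b ξ ν : MatSpace d k)))
    have h8 := hG ξ ν hξ0 hν0
    have h9 := mul_le_mul_of_nonneg_left h2 hg0
    rw [hC₂]
    linarith
  have hx1 : x ^ 2 ≤ m := (pow_le_of_le_one hx0 hξ1 two_ne_zero).trans hxm
  have hxm2 : x * m ^ 2 ≤ m :=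
    (mul_le_of_le_one_left (by positivity) hξ1).trans (pow_le_of_le_one hm0 hm1 two_ne_zero)
  have hφU : ‖φ η - U‖ ≤ (2 + 4 * Cφ) * m := by
    have e : φ η - U = (φ η - U - (η : MatSpace d k)) + η := by abel
    rw [e]
    refine (norm_add_le _ _).trans ?_
    have h7 : Cφ * ‖η‖ ^ 2 ≤ Cφ * (2 * x) ^ 2 := by gcongr
    have h8 : ‖(η : MatSpace d k)‖ ≤ 2 * x := hηx
    have h9 := mul_le_mul_of_nonneg_left hx1 hCφ.le
    linarith
  have hRm : R * m < ρ := by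
    have : R * m ≤ R * (ρ / R / 2) := by gcongr
    have e : R * (ρ / R / 2) = ρ / 2 := by field_simp
    linarith
  have hφρ : ‖φ η - U‖ < ρ := hφU.trans_lt (lt_of_le_of_lt (by gcongr; rw [hR]; linarith) hRm)
  have hGρ : ‖G ξ ν - U‖ < ρ := by
    have e : G ξ ν - U = (G ξ ν - φ η) + (φ η - U) := by abel
    rw [e]
    refine (norm_add_le _ _).trans_lt (lt_of_le_of_lt ?_ hRm)
    have : C₂ * (x * m ^ 2) ≤ C₂ * m := by gcongr
    rw [hR]
    linarith
  refine ⟨hGρ, ?_⟩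
  have hηρ : ‖η‖ < ρ := hηx.trans_lt (lt_of_le_of_lt (by
    rw [hR]; linarith [mul_nonneg hCφ.le hm0, mul_nonneg hC₂0.le hm0]) hRm)
  have h10 := hlip _ _ hGρ hφρ
  rw [hθ η hηρ] at h10
  rw [sub_sub]
  calc _ ≤ K * ‖G ξ ν - φ η‖ := h10
    _ ≤ K * (C₂ * (x * m ^ 2)) := by gcongr
    _ = _ := by ring

end LowerBound

end StiefelKL

/-! ### Lower bound by the variational formula -/

namespace StiefelKL

section LowerBound

variable {d k : ℕ} {U : MatSpace d k} {φ : tangent U → MatSpace d k}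
  {θ : MatSpace d k → tangent U} {N : Measure (tangent U)} {p : Measure (MatSpace d k)}
  {ε r K : ℝ} {F : tangent U → ℝ} {D : tangent U → tangent U → ℝ}

/-- Expansion of `F` at a point `w = ξ + b + O(‖ξ‖ m²)`: the error is of the form integrated in
`exists_integral_cubic_le`. -/
lemma IsLocalDensity.apply_ge (h : IsLocalDensity φ θ N p ε r K F D) (hε : 0 < ε) (hK : 0 < K)
    {c C m y : ℝ} (hc : 0 < c) (hC : 0 < C) {ξ b w : tangent U} (hξ : ‖ξ‖ < r / 2)
    (hb : ‖b‖ ≤ c * ‖ξ‖ * y) (hm : m = max ‖ξ‖ y) (hm1 : m ≤ 1)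
    (hcm : (c + C) * m ≤ 1) (hw : ‖w - ξ - b‖ ≤ C * (‖ξ‖ * m ^ 2)) :
    ‖w‖ < r ∧ F ξ + D ξ b - (K * C + 2 * K * (c + C) ^ 2) *
      ((‖ξ‖ ^ 3 / ε + ‖ξ‖) * (‖ξ‖ ^ 2 + y ^ 2)) ≤ F w := by
  set x := ‖ξ‖ with hx
  have hx0 : 0 ≤ x := norm_nonneg _
  have hxm : x ≤ m := by rw [hm]; exact le_max_left _ _
  have hym : y ≤ m := by rw [hm]; exact le_max_right _ _
  have hm0 : 0 ≤ m := hx0.trans hxm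
  have hm2 : m ^ 2 ≤ x ^ 2 + y ^ 2 := by
    rw [hm]
    rcases max_cases x y with ⟨h1, -⟩ | ⟨h1, -⟩ <;> rw [h1] <;> nlinarith
  have hmm : m ^ 2 ≤ m := by nlinarith
  have hwξ : ‖w - ξ‖ ≤ (c + C) * (x * m) := by
    have e : w - ξ = (w - ξ - b) + b := by abel
    rw [e]
    refine (norm_add_le _ _).trans ?_
    have h1 : C * (x * m ^ 2) ≤ C * (x * m) := by gcongr
    have h2 : c * x * y ≤ c * x * m := by gcongr
    linarith
  have hwξ' : ‖w - ξ‖ ≤ x := hwξ.trans (by nlinarith)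
  have hw2 : ‖w‖ ≤ 2 * x := by
    have e : w = (w - ξ) + ξ := by abel
    rw [e]
    exact (norm_add_le _ _).trans (by linarith)
  have hwr : ‖w‖ < r := by linarith
  have hξr : ‖ξ‖ < r := by linarith
  refine ⟨hwr, ?_⟩
  have h1 := (abs_le.1 (h.taylor ξ w hξr hwr)).1
  have hDe := (abs_le.1 (h.deriv_bound ξ hξr (w - ξ - b))).1
  have hD : D ξ (w - ξ) = D ξ b + D ξ (w - ξ - b) := by
    rw [← h.deriv_add]; congr 1; abel
  rw [hD] at h1
  have h2 : K * (x ^ 2 / ε + 1) * ‖w - ξ - b‖ ≤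
      K * C * ((x ^ 3 / ε + x) * (x ^ 2 + y ^ 2)) :=
    calc _ ≤ K * (x ^ 2 / ε + 1) * (C * (x * m ^ 2)) := by gcongr
      _ = K * C * ((x ^ 3 / ε + x) * m ^ 2) := by ring
      _ ≤ _ := by gcongr
  have h3 : K * (max ‖ξ‖ ‖w‖ / ε + 1) * ‖w - ξ‖ ^ 2 ≤
      2 * K * (c + C) ^ 2 * ((x ^ 3 / ε + x) * (x ^ 2 + y ^ 2)) :=
    calc _ ≤ K * (2 * x / ε + 1) * ((c + C) * (x * m)) ^ 2 := by
          have : max ‖ξ‖ ‖w‖ ≤ 2 * x := max_le (by linarith) hw2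
          gcongr
      _ = K * (c + C) ^ 2 * ((2 * (x ^ 3 / ε) + x * x) * m ^ 2) := by ring
      _ ≤ K * (c + C) ^ 2 * ((2 * (x ^ 3 / ε) + 2 * x) * (x ^ 2 + y ^ 2)) := by
          have : x * x ≤ 2 * x := by nlinarith
          gcongr
      _ = _ := by ring
  linarith

/-- Lower bound for the divergence from the posterior of the law of `G(ξ,ν)`, when `G` agrees to
second order with the retraction up to a term `b(ξ,ν)` that is odd in `ν`: the first-order effect
of `b` cancels in the expectation. -/
lemma exists_le_klDiv (hφ : IsSecondOrderRetraction U φ) (hθm : Measurable θ) {ρ : ℝ} (hρ : 0 < ρ)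
    (hK : 0 < K) (hθ : ∀ ξ, ‖ξ‖ < ρ → θ (φ ξ) = ξ)
    (hθ' : ∀ V ∈ stiefel d k, ‖V - U‖ < ρ → φ (θ V) = V)
    (hlip : ∀ V W, ‖V - U‖ < ρ → ‖W - U‖ < ρ → ‖θ V - θ W‖ ≤ K * ‖V - W‖)
    {G : tangent U → normal U → MatSpace d k} {b : tangent U → normal U → tangent U}
    (hGm : Measurable fun z : tangent U × normal U => G z.1 z.2)
    (hbm : Measurable fun z : tangent U × normal U => b z.1 z.2)
    (hbodd : ∀ ξ ν, b ξ (-ν) = -b ξ ν)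
    {c C₀ ρ₀ k₁ : ℝ} (hc : 0 < c) (hC₀ : 0 < C₀) (hρ₀ : 0 < ρ₀) (hk₁ : 0 < k₁)
    (hb : ∀ ξ ν, ‖b ξ ν‖ ≤ c * ‖ξ‖ * ‖ν‖)
    (hG : ∀ ξ ν, ‖ξ‖ ≤ ρ₀ → ‖ν‖ ≤ ρ₀ → G ξ ν ∈ stiefel d k ∧
      ‖G ξ ν - (secondOrder U ξ + (b ξ ν : MatSpace d k))‖ ≤ C₀ * (‖ξ‖ * max ‖ξ‖ ‖ν‖ ^ 2)) :
    ∃ C δ : ℝ, 0 < C ∧ 0 < δ ∧ ∀ (p : Measure (MatSpace d k)) (u s : ℝ)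
      (covT : tangent U →L[ℝ] tangent U) (covN : normal U →L[ℝ] normal U) (F : tangent U → ℝ)
      (D : tangent U → tangent U → ℝ), IsProbabilityMeasure p → 0 < u → u ≤ δ → 0 < s → s ≤ 1 →
      covT.IsPositive → covN.IsPositive → √‖covT‖ ≤ k₁ * u ^ 3 → √‖covT‖ ≤ s → √‖covN‖ ≤ s →
      u ^ 6 ≤ k₁ * s ^ 2 → IsLocalDensity φ θ (gaussian covT) p (u ^ 6) (u ^ 2) K F D →
      ENNReal.ofReal (∫ ξ in Metric.ball 0 (u ^ 2), F ξ ∂gaussian covT - C * s ^ 3) ≤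
        klDiv (((gaussian covT).prod (gaussian covN)).map fun z => G z.1 z.2) p := by
  classical
  obtain ⟨C₁, ρ₁, hC₁, hρ₁, hρ₁1, hρ₁0, hcoord⟩ := hφ.exists_coord_bound hρ hK hθ hlip hc hC₀ hρ₀ hb
    fun ξ ν h1 h2 => (hG ξ ν h1 h2).2
  set ρ₂ := min ρ₁ (1 / (c + C₁)) with hρ₂
  have hρ₂0 : 0 < ρ₂ := by positivity
  set C₂ := K * C₁ + 2 * K * (c + C₁) ^ 2 with hC₂
  obtain ⟨C₃, hC₃, hint⟩ := exists_integral_ge (E := tangent U) (F := normal U)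
    (C₁ := C₂) (by positivity) hK.le hk₁ hρ₂0
  refine ⟨C₃ + 1, min 1 (min ρ ρ₂), by positivity, by positivity, ?_⟩
  intro p u s covT covN F D hp hu huδ hs hs1 hT hN hTu hTs hNs hus h
  simp only [le_min_iff] at huδ
  obtain ⟨hu1, huρ, huρ₂⟩ := huδ
  have hu2 : u ^ 2 ≤ u := pow_le_of_le_one hu.le hu1 (by norm_num)
  set B := Metric.ball (0 : tangent U) (u ^ 2) with hB
  have hθB : ∀ x : tangent U, ‖x‖ < u ^ 2 → θ (φ x) = x := fun x hx =>
    hθ x (hx.trans_le (hu2.trans huρ))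
  set K₀ := K + (s ^ 3)⁻¹ with hK₀
  have hs3 : 0 < (s ^ 3)⁻¹ := by positivity
  have hK₀0 : 0 < K₀ := by positivity
  have himg := measurableSet_image hφ (measurableSet_ball (x := (0 : tangent U)) (ε := u ^ 2))
    (injOn_ball hθB)
  -- the test function; its value outside the image makes `exp f` negligible there, at a cost `s⁻³`
  -- that the tail probabilities absorb
  set f : MatSpace d k → ℝ := fun V => if V ∈ φ '' B then F (θ V) else -K₀ with hf
  have hfm : Measurable f := Measurable.ite himg (h.measurable.comp hθm) measurable_const
  have hfin : ∀ w : tangent U, ‖w‖ < u ^ 2 → f (φ w) = F w := fun w hw => by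
    simp only [hf]
    rw [if_pos (Set.mem_image_of_mem φ (mem_ball_zero_iff.2 hw)), hθB w hw]
  have hfb : ∀ V, |f V| ≤ K₀ := by
    intro V
    by_cases hV : V ∈ φ '' B
    · obtain ⟨x, hx, rfl⟩ := hV
      rw [hB, mem_ball_zero_iff] at hx
      rw [hfin x hx]
      exact (h.bound x hx).trans (by linarith)
    · simp only [hf]
      rw [if_neg hV, abs_neg, abs_of_pos hK₀0]
  -- the normalising term in the variational formula
  have hlog : Real.log (∫ V, Real.exp (f V) ∂p) ≤ s ^ 3 := by
    have hm := h.measurable_localDensity hφ hθm hθB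
    have hei : Integrable (fun V => Real.exp (f V)) p :=
      Integrable.of_bound (Real.measurable_exp.comp hfm).aestronglyMeasurable (Real.exp K₀)
        (Eventually.of_forall fun V => by
          rw [Real.norm_of_nonneg (Real.exp_nonneg _), Real.exp_le_exp]
          exact (abs_le.1 (hfb V)).2)
    have hli : Integrable (localDensity φ θ (u ^ 2) F) p :=
      Integrable.of_bound hm.aestronglyMeasurable (Real.exp K) (Eventually.of_forall fun V => by
        rw [Real.norm_of_nonneg (localDensity_nonneg V)]; exact h.localDensity_le hθB V)
    have h1 : ∫ V, Real.exp (f V) ∂p ≤ 1 + Real.exp (-K₀) :=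
      calc _ ≤ ∫ V, (localDensity φ θ (u ^ 2) F V + Real.exp (-K₀)) ∂p := by
            refine integral_mono hei (hli.add (integrable_const _)) fun V => ?_
            by_cases hV : V ∈ φ '' B
            · obtain ⟨x, hx, rfl⟩ := hV
              rw [hB, mem_ball_zero_iff] at hx
              simp only [hfin x hx, localDensity_apply hθB hx]
              linarith [Real.exp_pos (-K₀)]
            · simp only [hf]
              rw [if_neg hV]
              linarith [localDensity_nonneg (φ := φ) (θ := θ) (r := u ^ 2) (F := F) V]
        _ = (gaussian covT).real B + Real.exp (-K₀) := by
            have h2 := h.integral_localDensity_mul hφ hθm hθB (g := fun _ => 1) measurable_const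
            simp only [mul_one] at h2
            rw [integral_add hli (integrable_const _), h2]
            simp [hB]
        _ ≤ _ := by gcongr; exact measureReal_le_one
    have h2 : Real.exp (-K₀) ≤ s ^ 3 := by
      rw [Real.exp_neg, inv_le_comm₀ (Real.exp_pos _) (by positivity)]
      linarith [Real.add_one_le_exp K₀]
    have h3 := integral_exp_pos hei
    linarith [Real.log_le_sub_one_of_pos h3]
  have hμ : IsProbabilityMeasure ((gaussian covT).prod (gaussian covN)) := inferInstance
  have hq : IsProbabilityMeasure
      (((gaussian covT).prod (gaussian covN)).map fun z => G z.1 z.2) :=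
    Measure.isProbabilityMeasure_map hGm.aemeasurable
  refine le_trans (ENNReal.ofReal_le_ofReal ?_) (ofReal_le_klDiv hfm hfb)
  rw [integral_map hGm.aemeasurable hfm.aestronglyMeasurable]
  -- on this event `G(ξ, ν)` lies in the image of the ball and the expansion of `F` holds
  set good : Set (tangent U × normal U) := {z | ‖z.1‖ < u ^ 2 / 2 ∧ ‖z.2‖ ≤ ρ₂} with hgood
  have hgm : MeasurableSet good :=
    (measurableSet_lt measurable_fst.norm measurable_const).inter
      (measurableSet_le measurable_snd.norm measurable_const)
  set O : tangent U × normal U → ℝ := good.indicator fun z => D z.1 (b z.1 z.2) with hO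
  have hD0 : ∀ x, D x 0 = 0 := fun x => by
    have := h.deriv_add x 0 0
    rw [add_zero] at this
    linarith
  have hDneg : ∀ x v, D x (-v) = -D x v := fun x v => by
    have := h.deriv_add x v (-v)
    rw [add_neg_cancel, hD0] at this
    linarith
  have hOm : Measurable O :=
    (h.measurable_deriv.comp (measurable_fst.prodMk hbm)).indicator hgm
  have hOi : Integrable O ((gaussian covT).prod (gaussian covN)) := by
    refine Integrable.of_bound hOm.aestronglyMeasurable
      (K * ((u ^ 2) ^ 2 / u ^ 6 + 1) * (c * u ^ 2 * ρ₂)) (Eventually.of_forall fun z => ?_)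
    by_cases hz : z ∈ good
    · obtain ⟨h1, h2⟩ := hz
      have h3 : ‖z.1‖ < u ^ 2 := h1.trans (by linarith [pow_pos hu 2])
      rw [hO, Set.indicator_of_mem (show z ∈ good from ⟨h1, h2⟩), Real.norm_eq_abs]
      refine (h.deriv_bound _ h3 _).trans ?_
      have h4 : ‖b z.1 z.2‖ ≤ c * u ^ 2 * ρ₂ := (hb _ _).trans (by gcongr)
      gcongr
    · rw [hO, Set.indicator_of_notMem hz, norm_zero]; positivity
  have hOodd : ∀ x y, O (x, -y) = -O (x, y) := by
    intro x y
    by_cases hz : (x, y) ∈ good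
    · have hz' : (x, -y) ∈ good := ⟨hz.1, by simpa using hz.2⟩
      rw [hO, Set.indicator_of_mem hz, Set.indicator_of_mem hz']
      simp only [hbodd, hDneg]
    · have hz' : (x, -y) ∉ good := fun h' => hz ⟨h'.1, by simpa using h'.2⟩
      rw [hO, Set.indicator_of_notMem hz, Set.indicator_of_notMem hz', neg_zero]
  have hgi : Integrable (B.indicator F) (gaussian covT) := by
    refine Integrable.of_bound (h.measurable.indicator measurableSet_ball).aestronglyMeasurable K
      (Eventually.of_forall fun x => ?_)
    by_cases hx : x ∈ B
    · rw [Set.indicator_of_mem hx]; exact h.bound x (mem_ball_zero_iff.1 hx)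
    · rw [Set.indicator_of_notMem hx, norm_zero]; exact hK.le
  have hfi : Integrable (fun z : tangent U × normal U => f (G z.1 z.2))
      ((gaussian covT).prod (gaussian covN)) :=
    Integrable.of_bound (hfm.comp hGm).aestronglyMeasurable K₀
      (Eventually.of_forall fun z => hfb _)
  have key := hint covT covN u s hT hN hu hs hs1 hTu hTs hNs hus _ (B.indicator F) O hfi hgi hOi
    hOodd ?_
  · rw [integral_indicator measurableSet_ball] at key
    linarith
  rintro ⟨ξ, ν⟩
  simp only
  have hpos1 : 0 ≤ C₂ * ((‖ξ‖ ^ 3 / u ^ 6 + ‖ξ‖) * (‖ξ‖ ^ 2 + ‖ν‖ ^ 2)) := by positivity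
  have hpos2 : 0 ≤ 2 * (K + (s ^ 3)⁻¹) * ((2 * ‖ξ‖ / u ^ 2) ^ 18 + (‖ν‖ / ρ₂) ^ 6) := by positivity
  by_cases hz : (ξ, ν) ∈ good
  · obtain ⟨h1, h2⟩ := hz
    simp only at h1 h2
    have hu20 : 0 < u ^ 2 := by positivity
    have h3 : ‖ξ‖ < u ^ 2 := by linarith
    have h4 : ‖ξ‖ ≤ ρ₂ := by linarith
    have h5 : ‖ξ‖ ≤ ρ₁ := h4.trans (min_le_left _ _)
    have h6 : ‖ν‖ ≤ ρ₁ := h2.trans (min_le_left _ _)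
    obtain ⟨hGU, hw⟩ := hcoord ξ ν h5 h6
    obtain ⟨hwr, hFw⟩ := h.apply_ge (by positivity) hK hc hC₁ h1 (hb ξ ν) rfl
      ((max_le h5 h6).trans hρ₁1) (by
        have h7 : max ‖ξ‖ ‖ν‖ ≤ 1 / (c + C₁) :=
          max_le (h4.trans (min_le_right _ _)) (h2.trans (min_le_right _ _))
        rw [le_div_iff₀ (by positivity)] at h7
        linarith) hw
    have hGe : f (G ξ ν) = F (θ (G ξ ν)) := by
      rw [← hfin _ hwr, hθ' _ (hG ξ ν (h5.trans hρ₁0) (h6.trans hρ₁0)).1 hGU]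
    rw [hGe, hO, Set.indicator_of_mem (show (ξ, ν) ∈ good from ⟨h1, h2⟩),
      Set.indicator_of_mem (mem_ball_zero_iff.2 h3)]
    linarith
  · -- off the event the tail term of the lower bound is at least twice the bound of the test
    -- function
    have hbr : 1 ≤ (2 * ‖ξ‖ / u ^ 2) ^ 18 + (‖ν‖ / ρ₂) ^ 6 := by
      by_cases h1 : ‖ξ‖ < u ^ 2 / 2
      · have h2 : ρ₂ < ‖ν‖ := by
          by_contra! h2
          exact hz ⟨h1, h2⟩
        have h3 : 1 ≤ ‖ν‖ / ρ₂ := by rw [one_le_div hρ₂0]; exact h2.le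
        have h4 : 0 ≤ (2 * ‖ξ‖ / u ^ 2) ^ 18 := by positivity
        linarith [one_le_pow₀ h3 (n := 6)]
      · have h3 : 1 ≤ 2 * ‖ξ‖ / u ^ 2 := by
          rw [one_le_div (by positivity)]; linarith
        have h4 : 0 ≤ (‖ν‖ / ρ₂) ^ 6 := by positivity
        linarith [one_le_pow₀ h3 (n := 18)]
    have h1 := (abs_le.1 (hfb (G ξ ν))).1
    have h2 : B.indicator F ξ ≤ K := by
      by_cases hx : ξ ∈ B
      · rw [Set.indicator_of_mem hx]
        exact (abs_le.1 (h.bound ξ (mem_ball_zero_iff.1 hx))).2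
      · rw [Set.indicator_of_notMem hx]; exact hK.le
    have h3 := mul_le_mul_of_nonneg_left hbr (by positivity : 0 ≤ 2 * (K + (s ^ 3)⁻¹))
    rw [hO, Set.indicator_of_notMem hz]
    linarith

end LowerBound

end StiefelKL

/-! ### Lipschitz inverse of the polar retraction -/

namespace StiefelKL
open scoped Matrix.Norms.Frobenius

section PolarRetraction

variable {d k : ℕ} {U : MatSpace d k}

lemma norm_sq_eq_trace {l m : ℕ} (A : Matrix (Fin l) (Fin m) ℝ) : ‖A‖ ^ 2 = (Aᵀ * A).trace := by
  have h := inner_eq_trace (mat.symm A) (mat.symm A)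
  rw [real_inner_self_eq_norm_sq, ← norm_mat, LinearEquiv.apply_symm_apply] at h
  exact h

lemma abs_trace_transpose_mul_le {l m : ℕ} (A B : Matrix (Fin l) (Fin m) ℝ) :
    |(Aᵀ * B).trace| ≤ ‖A‖ * ‖B‖ := by
  have h := abs_real_inner_le_norm (mat.symm A) (mat.symm B)
  rw [inner_eq_trace, ← norm_mat, ← norm_mat, LinearEquiv.apply_symm_apply,
    LinearEquiv.apply_symm_apply] at h
  exact h

lemma gram_tangent (hU : U ∈ stiefel d k) (ξ : tangent U) :
    (mat (U + (ξ : MatSpace d k)))ᵀ * mat (U + (ξ : MatSpace d k)) =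
      1 + (mat (ξ : MatSpace d k))ᵀ * mat (ξ : MatSpace d k) := by
  have h1 : (mat U)ᵀ * mat U = 1 := hU
  have h2 : (mat U)ᵀ * mat (ξ : MatSpace d k) + (mat (ξ : MatSpace d k))ᵀ * mat U = 0 := ξ.2
  rw [map_add, transpose_add, Matrix.add_mul, Matrix.mul_add, Matrix.mul_add, h1]
  rw [show (1 + (mat U)ᵀ * mat (ξ : MatSpace d k) + ((mat (ξ : MatSpace d k))ᵀ * mat U +
      (mat (ξ : MatSpace d k))ᵀ * mat (ξ : MatSpace d k))) =
      1 + ((mat U)ᵀ * mat (ξ : MatSpace d k) + (mat (ξ : MatSpace d k))ᵀ * mat U) +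
      (mat (ξ : MatSpace d k))ᵀ * mat (ξ : MatSpace d k) by abel, h2, add_zero]

lemma det_gram_tangent (hU : U ∈ stiefel d k) (ξ : tangent U) :
    ((mat (U + (ξ : MatSpace d k)))ᵀ * mat (U + (ξ : MatSpace d k))).det ≠ 0 := by
  rw [gram_tangent hU]
  have h : (1 + (mat (ξ : MatSpace d k))ᵀ * mat (ξ : MatSpace d k)).PosDef := by
    rw [← conjTranspose_eq_transpose_of_trivial]
    exact Matrix.PosDef.one.add_posSemidef (Matrix.posSemidef_conjTranspose_mul_self _)
  exact h.det_pos.ne'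

/-- A positive definite matrix whose square is at least the identity is at least the identity. -/
lemma posSemidef_sub_one {Q : Matrix (Fin k) (Fin k) ℝ} (hQ : Q.PosDef)
    {A : Matrix (Fin d) (Fin k) ℝ} (h : Q * Q = 1 + Aᵀ * A) : (Q - 1).PosSemidef := by
  have hH : (Q - 1).IsHermitian := hQ.isHermitian.sub Matrix.isHermitian_one
  rw [hH.posSemidef_iff_eigenvalues_nonneg]
  intro i
  rw [Pi.zero_apply]
  set v : Fin k → ℝ := (hH.eigenvectorBasis i).ofLp with hv
  set μ := hH.eigenvalues i with hμ
  have hv0 : v ≠ 0 := fun h0 => (hH.eigenvectorBasis.orthonormal.ne_zero i) (by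
    ext j; exact congrFun h0 j)
  have h1 : (Q - 1) *ᵥ v = μ • v := hH.mulVec_eigenvectorBasis i
  have h2 : Q *ᵥ v = (1 + μ) • v := by
    rw [Matrix.sub_mulVec, Matrix.one_mulVec, sub_eq_iff_eq_add] at h1
    rw [h1, add_smul, one_smul, add_comm]
  have hvv : 0 < v ⬝ᵥ v := by
    have := Matrix.dotProduct_star_self_pos_iff.2 hv0
    simpa using this
  have h3 : 0 < 1 + μ := by
    have h4 := hQ.dotProduct_mulVec_pos hv0
    rw [h2, dotProduct_smul, star_trivial, smul_eq_mul] at h4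
    exact pos_of_mul_pos_left h4 hvv.le
  have h5 : (1 + μ) ^ 2 * (v ⬝ᵥ v) = v ⬝ᵥ v + (A *ᵥ v) ⬝ᵥ (A *ᵥ v) := by
    have h6 : (Q * Q) *ᵥ v = ((1 + μ) ^ 2) • v := by
      rw [← Matrix.mulVec_mulVec, h2, Matrix.mulVec_smul, h2, smul_smul, sq]
    have h7 : v ⬝ᵥ ((Q * Q) *ᵥ v) = (1 + μ) ^ 2 * (v ⬝ᵥ v) := by
      rw [h6, dotProduct_smul, smul_eq_mul]
    rw [← h7, h, Matrix.add_mulVec, Matrix.one_mulVec, dotProduct_add, ← Matrix.mulVec_mulVec,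
      Matrix.dotProduct_mulVec, Matrix.vecMul_transpose]
  have h8 : 0 ≤ (A *ᵥ v) ⬝ᵥ (A *ᵥ v) := by
    have := dotProduct_star_self_nonneg (A *ᵥ v)
    simpa using this
  -- an eigenvalue `1 + μ` of `Q` is positive with square at least one
  have h9 : 1 ≤ (1 + μ) ^ 2 := by
    by_contra! hlt
    nlinarith
  nlinarith

/-- If `A + x = V P` and `A + y = W Q` are polar decompositions, with `x`, `y` tangent at `A` and
`Q ≥ 1`, then `x - y` is controlled by `V - W`: the difference `P - Q` solves a Lyapunov equation,
coercive because `Q ≥ 1`. -/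
lemma norm_sub_le_of_polar_factors {A x y V W : Matrix (Fin d) (Fin k) ℝ}
    {P Q : Matrix (Fin k) (Fin k) ℝ} (hUU : Aᵀ * A = 1) (hxT : Aᵀ * x + xᵀ * A = 0)
    (hyT : Aᵀ * y + yᵀ * A = 0) (hP : P.PosDef) (hQ : Q.PosDef) (hQ1 : (Q - 1).PosSemidef)
    (hVP : A + x = V * P) (hWQ : A + y = W * Q) :
    ‖x - y‖ ≤ ‖P‖ * (1 + ‖A‖ * ‖W‖ * ‖Q‖ ^ 2) * ‖V - W‖ := by
  have hPt := posDef_transpose hP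
  have hQt := posDef_transpose hQ
  set τ := V - W with hτ
  set X := P - Q with hX
  have hXt : Xᵀ = X := by rw [hX, transpose_sub, hPt, hQt]
  have hxy : x - y = τ * P + W * X := by
    have : x - y = (A + x) - (A + y) := by abel
    rw [this, hVP, hWQ, hτ, hX, Matrix.sub_mul, Matrix.mul_sub]
    abel
  set Z := Q⁻¹ * X * Q⁻¹ with hZ
  have hQi : (Q⁻¹)ᵀ = Q⁻¹ := by rw [Matrix.transpose_nonsing_inv, hQt]
  have hZt : Zᵀ = Z := by
    rw [hZ, transpose_mul, transpose_mul, hQi, hXt, Matrix.mul_assoc]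
  have hXZ : X = Q * Z * Q := by
    rw [hZ]
    calc X = (Q * Q⁻¹) * X * (Q⁻¹ * Q) := by
          rw [posDef_mul_inv hQ, posDef_inv_mul hQ, Matrix.one_mul, Matrix.mul_one]
      _ = _ := by simp only [Matrix.mul_assoc]
  set T := Aᵀ * τ * P with hT
  set S := Aᵀ * y with hS
  have hSt : Sᵀ = -S := by
    rw [hS, transpose_mul, transpose_transpose]
    exact eq_neg_of_add_eq_zero_right hyT
  have hMQ : Aᵀ * W * Q = 1 + S := by
    rw [Matrix.mul_assoc, ← hWQ, Matrix.mul_add, hUU]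
  clear_value Z T S
  -- `Aᵀ(x - y)` is skew, which gives the equation for `Z = Q⁻¹ (P - Q) Q⁻¹`
  have hlyap : T + Tᵀ + ((1 + S) * Z * Q + Q * Z * (1 - S)) = 0 := by
    have h1 : Aᵀ * (x - y) = T + (1 + S) * Z * Q := by
      rw [hxy, Matrix.mul_add, hT, Matrix.mul_assoc Aᵀ τ P, hXZ, ← hMQ]
      simp only [Matrix.mul_assoc]
    have h2 : Aᵀ * (x - y) + (Aᵀ * (x - y))ᵀ = 0 := by
      rw [transpose_mul, transpose_transpose, transpose_sub, Matrix.mul_sub, Matrix.sub_mul]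
      have h3 := congrArg₂ (· - ·) hxT hyT
      simp only [sub_zero] at h3
      rw [← h3, hS]; abel
    rw [h1, transpose_add, transpose_mul, transpose_mul, hQt, hZt, transpose_add, transpose_one,
      hSt, ← sub_eq_add_neg] at h2
    rw [← h2, Matrix.mul_assoc Q Z]; abel
  -- testing with `Z`, the contributions of the skew matrix `S` cancel
  have htr : (Z * T).trace + (Z * T).trace + 2 * (Z * Q * Z).trace = 0 := by
    have h1 := congrArg (fun Y => (Z * Y).trace) hlyap
    simp only [Matrix.mul_add, Matrix.mul_zero, Matrix.trace_add, Matrix.trace_zero] at h1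
    have h2 : (Z * Tᵀ).trace = (Z * T).trace := by
      rw [← Matrix.trace_transpose, transpose_mul, transpose_transpose, hZt, Matrix.trace_mul_comm]
    have h3 : (Z * ((1 + S) * Z * Q)).trace = (Z * Q * Z).trace + (Z * Q * Z * S).trace := by
      rw [show Z * ((1 + S) * Z * Q) = Z * Z * Q + Z * S * (Z * Q) by
        simp only [Matrix.add_mul, Matrix.mul_add, Matrix.one_mul, Matrix.mul_assoc],
        Matrix.trace_add]
      congr 1
      · rw [Matrix.mul_assoc, Matrix.trace_mul_comm]
      · rw [Matrix.trace_mul_comm, ← Matrix.mul_assoc]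
    have h4 : (Z * (Q * Z * (1 - S))).trace = (Z * Q * Z).trace - (Z * Q * Z * S).trace := by
      rw [← Matrix.trace_sub]
      congr 1
      simp only [Matrix.mul_sub, Matrix.mul_one, Matrix.mul_assoc]
    rw [h2, h3, h4] at h1
    linarith
  have hcoer : ‖Z‖ ^ 2 ≤ (Z * Q * Z).trace := by
    have h1 := (hQ1.conjTranspose_mul_mul_same Z).trace_nonneg
    rw [conjTranspose_eq_transpose_of_trivial, hZt, Matrix.mul_sub, Matrix.sub_mul,
      Matrix.trace_sub, Matrix.mul_one] at h1
    rw [norm_sq_eq_trace, hZt]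
    linarith
  have hZn : ‖Z‖ ≤ ‖T‖ := by
    have h1 := (abs_le.1 (abs_trace_transpose_mul_le Z T)).1
    rw [hZt] at h1
    by_contra! hlt
    nlinarith [norm_nonneg T, norm_nonneg Z]
  have hnT : ‖T‖ ≤ ‖A‖ * ‖τ‖ * ‖P‖ := by
    rw [hT]
    refine (Matrix.frobenius_norm_mul _ _).trans ?_
    have := Matrix.frobenius_norm_mul Aᵀ τ
    rw [norm_transpose] at this
    gcongr
  have hnX : ‖X‖ ≤ ‖Q‖ ^ 2 * ‖Z‖ := by
    rw [hXZ]
    refine (Matrix.frobenius_norm_mul _ _).trans ?_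
    have := Matrix.frobenius_norm_mul Q Z
    calc ‖Q * Z‖ * ‖Q‖ ≤ ‖Q‖ * ‖Z‖ * ‖Q‖ := by gcongr
      _ = _ := by ring
  have h1 := Matrix.frobenius_norm_mul τ P
  have h2 := Matrix.frobenius_norm_mul W X
  have h3 : ‖X‖ ≤ ‖Q‖ ^ 2 * (‖A‖ * ‖τ‖ * ‖P‖) :=
    hnX.trans (mul_le_mul_of_nonneg_left (hZn.trans hnT) (by positivity))
  rw [hxy]
  calc ‖τ * P + W * X‖ ≤ ‖τ‖ * ‖P‖ + ‖W‖ * (‖Q‖ ^ 2 * (‖A‖ * ‖τ‖ * ‖P‖)) :=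
        (norm_add_le _ _).trans (add_le_add h1
          (h2.trans (mul_le_mul_of_nonneg_left h3 (norm_nonneg _))))
    _ = _ := by ring

/-- The inverse of the polar retraction `ξ ↦ π(U + ξ)` is Lipschitz, with a constant of polynomial
growth. -/
lemma norm_sub_le_polar_sub (hU : U ∈ stiefel d k) (ξ η : tangent U) :
    ‖ξ - η‖ ≤ ‖U + (ξ : MatSpace d k)‖ * (1 + k * ‖U + (η : MatSpace d k)‖ ^ 2) *
      ‖polar (U + (ξ : MatSpace d k)) - polar (U + (η : MatSpace d k))‖ := by
  obtain ⟨P, hP, hPP, hV, hVP⟩ := exists_polar_decomp (det_gram_tangent hU ξ)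
  obtain ⟨Q, hQ, hQQ, hW, hWQ⟩ := exists_polar_decomp (det_gram_tangent hU η)
  have hQ1 : (Q - 1).PosSemidef := posSemidef_sub_one hQ (hQQ.trans (gram_tangent hU η))
  have hnP : ‖P‖ = ‖U + (ξ : MatSpace d k)‖ := by
    rw [← norm_mat, ← sq_eq_sq₀ (norm_nonneg _) (norm_nonneg _), norm_sq_eq_trace,
      norm_sq_eq_trace, posDef_transpose hP, hPP]
  have hnQ : ‖Q‖ = ‖U + (η : MatSpace d k)‖ := by
    rw [← norm_mat, ← sq_eq_sq₀ (norm_nonneg _) (norm_nonneg _), norm_sq_eq_trace,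
      norm_sq_eq_trace, posDef_transpose hQ, hQQ]
  have hnA : ‖mat U‖ ^ 2 = k := by rw [norm_mat]; exact norm_of_mem_stiefel hU
  have hnW : ‖mat (polar (U + (η : MatSpace d k)))‖ = ‖mat U‖ := by
    rw [← sq_eq_sq₀ (norm_nonneg _) (norm_nonneg _), hnA, norm_mat]; exact norm_of_mem_stiefel hW
  rw [map_add] at hVP hWQ
  have h := norm_sub_le_of_polar_factors hU ξ.2 η.2 hP hQ hQ1 hVP hWQ
  rw [hnW, ← sq ‖mat U‖, hnA, hnP, hnQ, ← map_sub, ← map_sub, norm_mat, norm_mat] at h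
  exact h

end PolarRetraction

end StiefelKL

/-! ### The polar projection as a retraction of finite divergence -/

namespace StiefelKL
open scoped Matrix.Norms.Frobenius

/-- A linear map bounded below by `Λ⁻¹` maps the unit ball onto a set containing the ball of radius
`Λ⁻¹`, which bounds its determinant from below. -/
lemma inv_pow_finrank_le_abs_det {E : Type*} [NormedAddCommGroup E] [InnerProductSpace ℝ E]
    [FiniteDimensional ℝ E] [MeasurableSpace E] [BorelSpace E] {L : E →L[ℝ] E} {Λ : ℝ} (hΛ : 0 < Λ)
    (h : ∀ z, ‖z‖ ≤ Λ * ‖L z‖) : Λ⁻¹ ^ Module.finrank ℝ E ≤ |L.det| := by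
  have hinj : Function.Injective L := (injective_iff_map_eq_zero L).2 fun x hx => by
    have := h x
    rw [hx, norm_zero, mul_zero] at this
    exact norm_le_zero_iff.1 this
  have hsurj : Function.Surjective L :=
    (LinearMap.injective_iff_surjective (f := (L : E →ₗ[ℝ] E))).1 hinj
  have hsub : Metric.ball (0 : E) Λ⁻¹ ⊆ L '' Metric.ball 0 1 := by
    intro w hw
    obtain ⟨z, rfl⟩ := hsurj w
    refine ⟨z, ?_, rfl⟩
    rw [mem_ball_zero_iff] at hw ⊢
    refine (h z).trans_lt ?_
    calc Λ * ‖L z‖ < Λ * Λ⁻¹ := by gcongr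
      _ = 1 := mul_inv_cancel₀ hΛ.ne'
  have hv : volume (Metric.ball (0 : E) 1) ≠ ⊤ := measure_ball_lt_top.ne
  have hv0 : volume (Metric.ball (0 : E) 1) ≠ 0 := (Metric.measure_ball_pos _ _ one_pos).ne'
  have h1 := measure_mono (μ := (volume : Measure E)) hsub
  rw [Measure.addHaar_ball_of_pos _ _ (by positivity),
    Measure.addHaar_image_continuousLinearMap] at h1
  have h2 := (ENNReal.mul_le_mul_iff_left hv0 hv).1 h1
  exact (ENNReal.ofReal_le_ofReal_iff (abs_nonneg _)).1 h2

section PolarRetraction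

variable {d k : ℕ} {U : MatSpace d k}

/-- The polar projection restricted to the affine tangent space is a second-order retraction. -/
lemma isSecondOrderRetraction_polar (hU : U ∈ stiefel d k) :
    IsSecondOrderRetraction U fun ξ : tangent U => polar (U + (ξ : MatSpace d k)) where
  smooth := contDiff_iff_contDiffAt.2 fun ξ =>
    ContDiffAt.comp (g := polar) (f := fun ξ : tangent U => U + (ξ : MatSpace d k)) ξ
      (exists_smooth_polar (det_gram_tangent hU ξ)).1
      (contDiff_const.add (tangent U).subtypeL.contDiff).contDiffAt
  mem_stiefel := fun ξ => by
    obtain ⟨-, -, -, h, -⟩ := exists_polar_decomp (det_gram_tangent hU ξ)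
    exact h
  expansion := by
    obtain ⟨C, ρ, -, hρ, h⟩ := polar_expansion hU
    refine IsBigO.of_bound C ?_
    filter_upwards [Metric.closedBall_mem_nhds (0 : tangent U) hρ] with ξ hξ
    have h1 := (h ξ 0 (by simpa using hξ) (by simpa using hρ.le)).2
    rw [map_zero, norm_zero, max_eq_left (norm_nonneg _)] at h1
    simp only [Submodule.coe_zero, add_zero] at h1
    rw [norm_pow, norm_norm]
    exact h1.trans (le_of_eq (by ring))

lemma injective_polar (hU : U ∈ stiefel d k) :
    Function.Injective fun ξ : tangent U => polar (U + (ξ : MatSpace d k)) := by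
  intro ξ η h
  have h1 := norm_sub_le_polar_sub hU ξ η
  simp only at h
  rw [h, sub_self, norm_zero, mul_zero] at h1
  exact sub_eq_zero.1 (norm_le_zero_iff.1 h1)

/-- Infinitesimal form of `norm_sub_le_polar_sub`. -/
lemma norm_le_fderiv_polar (hU : U ∈ stiefel d k) (η h : tangent U) :
    ‖h‖ ≤ ‖U + (η : MatSpace d k)‖ * (1 + k * ‖U + (η : MatSpace d k)‖ ^ 2) *
      ‖fderiv ℝ (fun ξ : tangent U => polar (U + (ξ : MatSpace d k))) η h‖ := by
  set ψ := fun ξ : tangent U => polar (U + (ξ : MatSpace d k)) with hψ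
  have hd : DifferentiableAt ℝ ψ η :=
    (isSecondOrderRetraction_polar hU).contDiff_one.differentiable one_ne_zero η
  have h1 := (hd.hasFDerivAt.hasLineDerivAt h).tendsto_slope_zero
  have h2 : Tendsto (fun t : ℝ => ‖U + ((η + t • h : tangent U) : MatSpace d k)‖) (𝓝[≠] 0)
      (𝓝 ‖U + (η : MatSpace d k)‖) := by
    have : Continuous fun t : ℝ => ‖U + ((η + t • h : tangent U) : MatSpace d k)‖ := by fun_prop
    have h3 := this.tendsto 0
    simp only [zero_smul, add_zero] at h3
    exact h3.mono_left nhdsWithin_le_nhds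
  have h4 := (h2.mul_const (1 + k * ‖U + (η : MatSpace d k)‖ ^ 2)).mul h1.norm
  refine ge_of_tendsto h4 ?_
  filter_upwards [self_mem_nhdsWithin] with t ht
  have ht0 : 0 < |t| := abs_pos.2 ht
  have h5 := norm_sub_le_polar_sub hU (η + t • h) η
  rw [add_sub_cancel_left, norm_smul, Real.norm_eq_abs] at h5
  rw [norm_smul, norm_inv, Real.norm_eq_abs]
  refine le_of_mul_le_mul_left (h5.trans (le_of_eq ?_)) ht0
  simp only [hψ]
  field_simp

/-- The frame derivative of the polar retraction is bounded below: its tangential and normal parts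
are orthogonal, the first is bounded below by the Lipschitz bound for the inverse, and the second is
isometric. -/
lemma norm_le_frameDeriv_polar (hU : U ∈ stiefel d k) (η : tangent U) (z : MatSpace d k) :
    ‖z‖ ≤ (1 + ‖U + (η : MatSpace d k)‖ * (1 + k * ‖U + (η : MatSpace d k)‖ ^ 2)) *
      ‖frameDeriv U (fun ξ : tangent U => polar (U + (ξ : MatSpace d k))) η z‖ := by
  have hret := isSecondOrderRetraction_polar hU
  set ψ := fun ξ : tangent U => polar (U + (ξ : MatSpace d k)) with hψ
  have hd : DifferentiableAt ℝ ψ η := hret.contDiff_one.differentiable one_ne_zero η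
  set Λ := ‖U + (η : MatSpace d k)‖ * (1 + k * ‖U + (η : MatSpace d k)‖ ^ 2) with hΛ
  have hΛ0 : 0 ≤ Λ := by positivity
  set v : MatSpace d k := fderiv ℝ ψ η (tanPart U z) with hv
  set S := symNormal U z with hS
  have hSt : Sᵀ = S := symNormal_transpose hU z
  have hvT : v ∈ tangent (ψ η) := fderiv_mem_tangent hret.mem_stiefel hd _
  have hN : rmul (ψ η) S ∈ normal (ψ η) := mul_symm_mem_normal hSt
  have horth : ⟪v, rmul (ψ η) S⟫ = 0 := (Submodule.mem_orthogonal _ _).1 hN _ hvT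
  have hfr : frameDeriv U ψ η z = v + rmul (ψ η) S := rfl
  have hnS : ‖rmul (ψ η) S‖ = ‖(normal U).orthogonalProjectionOnto z‖ := by
    have h1 := norm_rmul_of_mem (hret.mem_stiefel η) S
    have h2 := norm_rmul_of_mem hU S
    rw [hS, rmul_symNormal hU z, ← hS] at h2
    rw [← sq_eq_sq₀ (norm_nonneg _) (norm_nonneg _), h1]
    exact h2.symm
  have hsq : ‖frameDeriv U ψ η z‖ ^ 2 =
      ‖v‖ ^ 2 + ‖(normal U).orthogonalProjectionOnto z‖ ^ 2 := by
    rw [hfr, ← hnS, norm_add_sq_real, horth]; ring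
  have hz : ‖z‖ ^ 2 = ‖tanPart U z‖ ^ 2 + ‖(normal U).orthogonalProjectionOnto z‖ ^ 2 := by
    have h1 : ⟪(tanPart U z : MatSpace d k),
        ((normal U).orthogonalProjectionOnto z : MatSpace d k)⟫ = 0 :=
      (Submodule.mem_orthogonal _ _).1 ((normal U).orthogonalProjectionOnto z).2 _ (tanPart U z).2
    conv_lhs => rw [← tanPart_add_normalPart U z]
    rw [norm_add_sq_real, h1]
    simp
  have hv1 : ‖tanPart U z‖ ≤ Λ * ‖v‖ := norm_le_fderiv_polar hU η _
  have hv2 : ‖tanPart U z‖ ^ 2 ≤ Λ ^ 2 * ‖v‖ ^ 2 := by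
    rw [← mul_pow]; gcongr
  refine le_of_sq_le_sq ?_ (by positivity)
  rw [mul_pow, hsq, hz]
  have h3 : 0 ≤ ‖v‖ ^ 2 := sq_nonneg _
  have h4 : 0 ≤ ‖(normal U).orthogonalProjectionOnto z‖ ^ 2 := sq_nonneg _
  have h5 : Λ ^ 2 ≤ (1 + Λ) ^ 2 := by gcongr; linarith
  have h6 : 1 ≤ (1 + Λ) ^ 2 := one_le_pow₀ (by linarith)
  nlinarith [mul_le_mul_of_nonneg_right h5 h3, mul_le_mul_of_nonneg_right h6 h4]

/-- The Jacobian of the polar retraction decays at most polynomially, hence slower than a Gaussian.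
-/
lemma exists_gaussian_le_jac_polar (hU : U ∈ stiefel d k) : ∃ C : ℝ, 0 < C ∧ ∀ x : tangent U,
    Real.exp (-‖x‖ ^ 2 / 2) ≤
      C * jac U (fun ξ : tangent U => polar (U + (ξ : MatSpace d k))) x := by
  set n := Module.finrank ℝ (MatSpace d k) with hn
  set m := 3 * n with hm
  refine ⟨((2 + k) * (1 + ‖U‖) ^ 3) ^ n * (m.factorial * Real.exp (3 / 2)), by positivity,
    fun x => ?_⟩
  set y := ‖x‖ with hy
  have hy0 : 0 ≤ y := norm_nonneg _
  set Λ := 1 + ‖U + (x : MatSpace d k)‖ * (1 + k * ‖U + (x : MatSpace d k)‖ ^ 2) with hΛ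
  have hΛ0 : 0 < Λ := by positivity
  have hJ := inv_pow_finrank_le_abs_det hΛ0 (norm_le_frameDeriv_polar hU x)
  rw [← hn, inv_pow] at hJ
  have hΛle : Λ ≤ (2 + k) * (1 + ‖U‖) ^ 3 * (1 + y) ^ 3 := by
    have h1 : ‖U + (x : MatSpace d k)‖ ≤ (1 + ‖U‖) * (1 + y) := by
      have h2 : ‖(x : MatSpace d k)‖ = y := rfl
      have := norm_add_le U (x : MatSpace d k)
      rw [h2] at this
      nlinarith [mul_nonneg (norm_nonneg U) hy0]
    have h3 : 1 ≤ (1 + ‖U‖) * (1 + y) :=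
      one_le_mul_of_one_le_of_one_le (by linarith [norm_nonneg U]) (by linarith)
    set w := (1 + ‖U‖) * (1 + y) with hw
    have h4 : w ≤ w ^ 3 := le_self_pow₀ h3 (by norm_num)
    have h5 : 1 ≤ w ^ 3 := one_le_pow₀ h3
    calc Λ ≤ 1 + w * (1 + k * w ^ 2) := by rw [hΛ]; gcongr
      _ = 1 + w + k * w ^ 3 := by ring
      _ ≤ w ^ 3 + w ^ 3 + k * w ^ 3 := by gcongr
      _ = _ := by rw [hw]; ring
  have hpow : Λ ^ n ≤ ((2 + k) * (1 + ‖U‖) ^ 3) ^ n * (1 + y) ^ m := by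
    rw [hm, pow_mul, ← mul_pow]; gcongr
  have hfac : (1 + y) ^ m ≤ m.factorial * Real.exp (1 + y) := by
    have := Real.pow_div_factorial_le_exp (1 + y) (by positivity) m
    rw [div_le_iff₀ (by positivity)] at this
    linarith
  have hexp : Real.exp (-y ^ 2 / 2) * Real.exp (1 + y) ≤ Real.exp (3 / 2) := by
    rw [← Real.exp_add, Real.exp_le_exp]
    nlinarith [sq_nonneg (y - 1)]
  have h1 : Real.exp (-y ^ 2 / 2) * Λ ^ n ≤
      ((2 + k) * (1 + ‖U‖) ^ 3) ^ n * (m.factorial * Real.exp (3 / 2)) :=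
    calc _ ≤ Real.exp (-y ^ 2 / 2) * (((2 + k) * (1 + ‖U‖) ^ 3) ^ n *
          (m.factorial * Real.exp (1 + y))) := by gcongr; exact hpow.trans (by gcongr)
      _ = ((2 + k) * (1 + ‖U‖) ^ 3) ^ n * (m.factorial *
          (Real.exp (-y ^ 2 / 2) * Real.exp (1 + y))) := by ring
      _ ≤ _ := by gcongr
  calc Real.exp (-y ^ 2 / 2) = Real.exp (-y ^ 2 / 2) * Λ ^ n * (Λ ^ n)⁻¹ := by field_simp
    _ ≤ _ := by
      refine mul_le_mul h1 hJ (by positivity) (by positivity)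

/-- The standard Gaussian pushed forward under the polar retraction has a bounded density with
respect to the uniform distribution, hence finite divergence. -/
lemma klDiv_polar_ne_top (hU : U ∈ stiefel d k) : ∃ σ : ℝ, 0 < σ ∧
    klDiv ((stdGaussian (tangent U)).map fun ξ : tangent U =>
      polar (U + ((σ • ξ : tangent U) : MatSpace d k))) (uniformStiefel d k) ≠ ⊤ := by
  refine ⟨1, one_pos, ?_⟩
  simp only [one_smul]
  have hret := isSecondOrderRetraction_polar hU
  obtain ⟨c, hc, hvol⟩ := hret.exists_volume_chart hU
  obtain ⟨C, hC, hJ⟩ := exists_gaussian_le_jac_polar hU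
  obtain ⟨c₀, hc₀, hstd⟩ := stdGaussian_eq_withDensity (F := tangent U)
  set ψ := fun ξ : tangent U => polar (U + (ξ : MatSpace d k)) with hψ
  have hψm : Measurable ψ := hret.smooth.continuous.measurable
  have hprob : IsProbabilityMeasure ((stdGaussian (tangent U)).map ψ) :=
    Measure.isProbabilityMeasure_map hψm.aemeasurable
  have hle : (stdGaussian (tangent U)).map ψ ≤
      (uniformStiefel d k).withDensity fun _ => ENNReal.ofReal (c₀ * C / c) := by
    refine Measure.le_iff.2 fun S hS => ?_
    have h1 := hvol (ψ ⁻¹' S) (hψm hS) (injective_polar hU).injOn (fun _ => 1) measurable_const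
    simp only [setLIntegral_one, mul_one] at h1
    have hJm : Measurable fun ξ => ENNReal.ofReal (jac U ψ ξ) :=
      (continuous_jac hret.contDiff_one).measurable.ennreal_ofReal
    rw [Measure.map_apply hψm hS, hstd, withDensity_apply _ (hψm hS), withDensity_const,
      Measure.smul_apply, smul_eq_mul]
    calc ∫⁻ x in ψ ⁻¹' S, ENNReal.ofReal (c₀ * Real.exp (-‖x‖ ^ 2 / 2))
        ≤ ∫⁻ x in ψ ⁻¹' S, ENNReal.ofReal (c₀ * C / c) *
            (ENNReal.ofReal c * ENNReal.ofReal (jac U ψ x)) := by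
          refine lintegral_mono fun x => ?_
          rw [← mul_assoc, ← ENNReal.ofReal_mul (by positivity), ← ENNReal.ofReal_mul
            (by positivity)]
          refine ENNReal.ofReal_le_ofReal ?_
          calc c₀ * Real.exp (-‖x‖ ^ 2 / 2) ≤ c₀ * (C * jac U ψ x) := by gcongr; exact hJ x
            _ = _ := by field_simp
      _ = ENNReal.ofReal (c₀ * C / c) * uniformStiefel d k (ψ '' (ψ ⁻¹' S)) := by
          rw [lintegral_const_mul _ (hJm.const_mul _), lintegral_const_mul _ hJm, h1]
      _ ≤ _ := by gcongr; exact Set.image_preimage_subset _ _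
  -- a measure dominated by a constant multiple of `p`, without a bounded part
  have h := klDiv_le_of_decomp (p := uniformStiefel d k) (q := (stdGaussian (tangent U)).map ψ)
    (h₁ := fun _ => 0) measurable_const (fun _ => le_rfl) le_rfl (fun _ => zero_le_one)
    (D := fun _ => ENNReal.ofReal (c₀ * C / c)) measurable_const (by simp) hle (by simp)
  refine ne_top_of_le_ne_top ?_ h
  simp only [lintegral_const, measure_univ, mul_one]
  exact ENNReal.add_ne_top.2 ⟨ENNReal.ofReal_ne_top, ENNReal.ofReal_ne_top⟩

end PolarRetraction

end StiefelKL

/-! ### Comparison of sampling schemes -/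

namespace StiefelKL

lemma gaussian_zero {F : Type*} [NormedAddCommGroup F] [InnerProductSpace ℝ F]
    [FiniteDimensional ℝ F] [MeasurableSpace F] [BorelSpace F] :
    gaussian (0 : F →L[ℝ] F) = Measure.dirac 0 := by
  refine Measure.ext_of_charFun ?_
  ext t
  rw [charFun_gaussian ContinuousLinearMap.isPositive_zero, charFun_dirac]
  simp

section Comparison

variable {d k : ℕ} {U : MatSpace d k}

/-- `q_proj` in terms of the independent tangential and normal Gaussians. -/
lemma qProj_eq_map {covT : tangent U →L[ℝ] tangent U} {covN : normal U →L[ℝ] normal U}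
    (hT : covT.IsPositive) (hN : covN.IsPositive) :
    qProj U covT covN = ((gaussian covT).prod (gaussian covN)).map fun z =>
      polar (U + (z.1 : MatSpace d k) + (z.2 : MatSpace d k)) := by
  have h1 : Measurable fun ζ : MatSpace d k => polar (U + ζ) :=
    measurable_polar.comp (measurable_const_add U)
  rw [qProj, gaussian_ambientCov hT hN, Measure.map_map h1 (by fun_prop)]
  congr 1
  ext z : 1
  simp only [Function.comp_apply, add_assoc]

lemma measurable_delta (hU : U ∈ stiefel d k) :
    Measurable fun z : tangent U × normal U => delta hU z.1 z.2 := by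
  have hcd : Continuous fun z : tangent U × normal U => delta hU z.1 z.2 :=
    ((continuous_delta hU).comp continuous_fst).clm_apply continuous_snd
  exact hcd.measurable

lemma map_prod_fst_eq_qTang {φ : tangent U → MatSpace d k} (hφm : Measurable φ)
    (covT : tangent U →L[ℝ] tangent U) (covN : normal U →L[ℝ] normal U) :
    ((gaussian covT).prod (gaussian covN)).map (fun z => φ z.1) = qTang φ covT := by
  have h := Measure.map_map (μ := (gaussian covT).prod (gaussian covN)) hφm measurable_fst
  rw [← Measure.fst, Measure.fst_prod] at h
  exact h.symm

/-- Without a normal part, `q_proj` is the tangential law of the retraction `ξ ↦ π(U + ξ)`. -/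
lemma qProj_zero {covT : tangent U →L[ℝ] tangent U} (hT : covT.IsPositive) :
    qProj U covT 0 = qTang (fun ξ : tangent U => polar (U + (ξ : MatSpace d k))) covT := by
  have hm : Measurable fun ξ : tangent U => polar (U + (ξ : MatSpace d k)) :=
    measurable_polar.comp (measurable_subtype_coe.const_add U)
  rw [qProj_eq_map hT ContinuousLinearMap.isPositive_zero, ← map_prod_fst_eq_qTang hm covT 0]
  refine Measure.map_congr ?_
  have h : ∀ᵐ y : normal U ∂gaussian 0, y = 0 := by
    rw [gaussian_zero, ae_dirac_eq]; rfl
  have h2 := Measure.quasiMeasurePreserving_snd (μ := gaussian covT)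
    (ν := gaussian (0 : normal U →L[ℝ] normal U)) |>.ae h
  filter_upwards [h2] with z hz
  rw [hz, Submodule.coe_zero, add_zero]

/-- The penalty is of fourth order in the scale of the perturbation. -/
lemma exists_penalty_le (hU : U ∈ stiefel d k) {a K : ℝ} (ha : 0 < a) (hK : 0 < K) :
    ∃ C : ℝ, 0 < C ∧ ∀ (ε : ℝ) (H : tangent U → tangent U → ℝ)
      (covT : tangent U →L[ℝ] tangent U) (covN : normal U →L[ℝ] normal U), 0 < ε →
      IsScaledInverse a K ε H covT → covN.IsPositive → penalty hU covT covN ≤ C * ‖covN‖ ^ 2 := by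
  obtain ⟨C, hC, h⟩ := penalty_bounds hU
  refine ⟨1 / 4 * (C * (K / (2 * a)) ^ 2), by positivity, fun ε H covT covN hε hs hN => ?_⟩
  have hT := hs.isPositive ha hε
  have hinj := hs.injective hε
  obtain ⟨G, hG, hGG, hpen⟩ := exists_penalty_eq hU hT hinj hN
  have h1 := (h covT covN hT hinj hN G hG hGG).2
  have h2 : ‖ContinuousLinearMap.inverse covT‖ * ‖covT‖ ≤ K / (2 * a) := by
    calc _ ≤ K / ε * (ε / (2 * a)) :=
          mul_le_mul (hs.norm_inverse_le hK.le hε) (hs.norm_le ha hε)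
            (ContinuousLinearMap.opNorm_nonneg _) (by positivity)
      _ = _ := by field_simp
  have h0 : 0 ≤ ‖ContinuousLinearMap.inverse covT‖ * ‖covT‖ :=
    mul_nonneg (ContinuousLinearMap.opNorm_nonneg _) (ContinuousLinearMap.opNorm_nonneg _)
  rw [hpen, mul_assoc]
  refine mul_le_mul_of_nonneg_left (h1.trans ?_) (by norm_num)
  gcongr

/-- The law of the retracted Gaussian is at least as close to the posterior, up to the error term,
as the law of any map `G(ξ,ν)` that agrees with the retraction to second order up to a term odd in
`ν`. -/
lemma exists_klDiv_qTang_le_klDiv_map (hk : 0 < k) (hkd : k < d) (hU : U ∈ stiefel d k)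
    {φ : tangent U → MatSpace d k} (hφ : IsSecondOrderRetraction U φ)
    (hfin : ∃ σ : ℝ, 0 < σ ∧ klDiv ((stdGaussian (tangent U)).map fun ξ => φ (σ • ξ))
      (uniformStiefel d k) ≠ ⊤) {a : ℝ} (ha : 0 < a) (M : ℝ)
    {G : tangent U → normal U → MatSpace d k} {b : tangent U → normal U → tangent U}
    (hGm : Measurable fun z : tangent U × normal U => G z.1 z.2)
    (hbm : Measurable fun z : tangent U × normal U => b z.1 z.2)
    (hbodd : ∀ ξ ν, b ξ (-ν) = -b ξ ν)
    {c C₀ ρ₀ : ℝ} (hc : 0 < c) (hC₀ : 0 < C₀) (hρ₀ : 0 < ρ₀)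
    (hb : ∀ ξ ν, ‖b ξ ν‖ ≤ c * ‖ξ‖ * ‖ν‖)
    (hG : ∀ ξ ν, ‖ξ‖ ≤ ρ₀ → ‖ν‖ ≤ ρ₀ → G ξ ν ∈ stiefel d k ∧
      ‖G ξ ν - (secondOrder U ξ + (b ξ ν : MatSpace d k))‖ ≤ C₀ * (‖ξ‖ * max ‖ξ‖ ‖ν‖ ^ 2)) :
    ∃ C δ : ℝ, 0 < C ∧ 0 < δ ∧ ∀ (ℓ : MatSpace d k → ℝ) (ε : ℝ)
      (covT : tangent U →L[ℝ] tangent U) (covN : normal U →L[ℝ] normal U),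
      IsConcentratedPotential a M U ℓ → 0 < ε → IsInverseHessian ℓ ε U covT → covN.IsPositive →
      ‖ambientCov covT covN‖ ≤ δ →
      covT.IsPositive ∧ klDiv (qTang φ covT) (posterior ℓ ε) ≠ ⊤ ∧
      klDiv (qTang φ covT) (posterior ℓ ε) + ENNReal.ofReal (penalty hU covT covN) ≤
        klDiv (((gaussian covT).prod (gaussian covN)).map fun z => G z.1 z.2) (posterior ℓ ε) +
          ENNReal.ofReal (C * ‖ambientCov covT covN‖ ^ (3 / 2 : ℝ)) := by
  have := tangent_nontrivial hk hkd U
  obtain ⟨Kp, hKp, hpot⟩ := exists_potential_bounds hφ ha M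
  obtain ⟨θ, ρ, K, δ₁, hρ, hK, hδ₁, hθm, hθ, hθ', hlip, hdens⟩ :=
    hφ.exists_isLocalDensity hU ha M
  obtain ⟨C₂, δ₂, hC₂, hδ₂, hupper⟩ := exists_klDiv_qTang_le hU hφ hfin ha M K
  set k₁ := 1 / (2 * a) + Kp + 1 with hk₁
  have hk₁0 : 0 < k₁ := by positivity
  obtain ⟨C₃, δ₃, hC₃, hδ₃, hlower⟩ := exists_le_klDiv hφ hθm hρ hK hθ hθ' hlip hGm hbm hbodd
    hc hC₀ hρ₀ hk₁0 hb hG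
  obtain ⟨C₄, hC₄, hpen⟩ := exists_penalty_le hU ha hKp
  set δ₀ := min (min 1 ρ) (min δ₁ (min δ₂ δ₃)) with hδ₀
  have hδ₀0 : 0 < δ₀ := by positivity
  refine ⟨C₂ * Kp ^ 2 + C₃ + C₄, min 1 (δ₀ ^ 6 / Kp), by positivity, by positivity, ?_⟩
  intro ℓ ε covT covN hℓ hε hinv hN hδ
  obtain ⟨h1, h2, h3, -⟩ := hpot ℓ hℓ
  have hsc := hinv.isScaledInverse hε h1 h2 h3
  have hT := hsc.isPositive ha hε
  set S₀ := ‖ambientCov covT covN‖ with hS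
  have hTS : ‖covT‖ ≤ S₀ := norm_covT_le covT covN
  have hNS : ‖covN‖ ≤ S₀ := norm_covN_le covT covN
  -- the Hessian bound makes `ε` at most a multiple of `‖Σ_T‖`, so smallness of the covariance gives
  -- smallness of `ε`
  have hεS : ε ≤ Kp * S₀ := (hsc.le_norm hKp.le).trans (by gcongr)
  have hS0 : 0 < S₀ := pos_of_mul_pos_right (hε.trans_le hεS) hKp.le
  have hS1 : S₀ ≤ 1 := hδ.trans (min_le_left _ _)
  set s := √S₀ with hs
  have hs0 : 0 < s := Real.sqrt_pos.2 hS0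
  have hs1 : s ≤ 1 := Real.sqrt_le_one.2 hS1
  have hs2 : s ^ 2 = S₀ := Real.sq_sqrt hS0.le
  have hs3 : S₀ ^ (3 / 2 : ℝ) = s ^ 3 := by
    rw [hs, Real.sqrt_eq_rpow, ← Real.rpow_natCast, ← Real.rpow_mul hS0.le]
    norm_num
  have hs43 : s ^ 4 ≤ s ^ 3 := pow_le_pow_of_le_one hs0.le hs1 (by norm_num)
  obtain ⟨u, hu, hu6⟩ : ∃ u : ℝ, 0 < u ∧ u ^ 6 = ε :=
    ⟨ε ^ (1 / 6 : ℝ), Real.rpow_pos_of_pos hε _, by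
      rw [← Real.rpow_natCast, ← Real.rpow_mul hε.le]; norm_num⟩
  subst hu6
  have huδ : u ≤ δ₀ := by
    rw [← pow_le_pow_iff_left₀ hu.le hδ₀0.le (by norm_num : 6 ≠ 0)]
    calc u ^ 6 ≤ Kp * S₀ := hεS
      _ ≤ Kp * (δ₀ ^ 6 / Kp) := by gcongr; exact hδ.trans (min_le_right _ _)
      _ = δ₀ ^ 6 := by field_simp
  simp only [hδ₀, le_min_iff] at huδ
  obtain ⟨⟨hu1, huρ⟩, huδ₁, huδ₂, huδ₃⟩ := huδ
  have hu2 : u ^ 2 ≤ u := pow_le_of_le_one hu.le hu1 (by norm_num)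
  obtain ⟨W, -, -, -, -, hprob⟩ := exists_posterior_eq hU ha.le hℓ hε
  obtain ⟨F, D, hFD⟩ := hdens ℓ u covT hℓ hu huδ₁ hinv
  have hup := hupper ℓ u covT θ F D hℓ hu huδ₂ hinv hθm
    (fun x hx => hθ x (hx.trans_le (hu2.trans huρ))) hFD
  have hTu : √‖covT‖ ≤ k₁ * u ^ 3 := by
    rw [Real.sqrt_le_left (by positivity)]
    refine (hsc.norm_le ha hε).trans ?_
    have hk1 : 1 ≤ k₁ := by
      rw [hk₁]
      have : 0 < 1 / (2 * a) := by positivity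
      linarith
    have hk2 : 1 / (2 * a) ≤ k₁ := by rw [hk₁]; linarith
    have hk3 : k₁ ≤ k₁ ^ 2 := le_self_pow₀ hk1 two_ne_zero
    calc u ^ 6 / (2 * a) = 1 / (2 * a) * u ^ 6 := by ring
      _ ≤ k₁ ^ 2 * u ^ 6 := by gcongr; exact hk2.trans hk3
      _ = _ := by ring
  have hlo := hlower (posterior ℓ (u ^ 6)) u s covT covN F D hprob hu huδ₃ hs0 hs1 hT hN hTu
    (Real.sqrt_le_sqrt hTS) (Real.sqrt_le_sqrt hNS) (by
      rw [hs2]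
      refine hεS.trans ?_
      gcongr
      rw [hk₁]
      have : 0 < 1 / (2 * a) := by positivity
      linarith) hFD
  have hpe := hpen (u ^ 6) _ covT covN hε hsc hN
  have hpe' : penalty hU covT covN ≤ C₄ * s ^ 3 := by
    refine hpe.trans ?_
    have hN0 : 0 ≤ ‖covN‖ := ContinuousLinearMap.opNorm_nonneg _
    have : ‖covN‖ ^ 2 ≤ s ^ 4 :=
      calc ‖covN‖ ^ 2 ≤ S₀ ^ 2 := by gcongr
        _ = s ^ 4 := by rw [← hs2]; ring
    gcongr
    exact this.trans hs43
  have hu12 : u ^ 12 ≤ Kp ^ 2 * s ^ 3 :=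
    calc u ^ 12 = (u ^ 6) ^ 2 := by ring
      _ ≤ (Kp * S₀) ^ 2 := by gcongr
      _ = Kp ^ 2 * s ^ 4 := by rw [← hs2]; ring
      _ ≤ _ := by gcongr
  refine ⟨hT, ne_top_of_le_ne_top ENNReal.ofReal_ne_top hup, ?_⟩
  rw [hs3]
  set I := ∫ x in Metric.ball 0 (u ^ 2), F x ∂gaussian covT
  calc _ ≤ ENNReal.ofReal (I + C₂ * u ^ 12) + ENNReal.ofReal (C₄ * s ^ 3) :=
        add_le_add hup (ENNReal.ofReal_le_ofReal hpe')
    _ ≤ ENNReal.ofReal (I - C₃ * s ^ 3) + ENNReal.ofReal ((C₂ * Kp ^ 2 + C₃) * s ^ 3) +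
          ENNReal.ofReal (C₄ * s ^ 3) := by
        refine add_le_add ((ENNReal.ofReal_le_ofReal ?_).trans ENNReal.ofReal_add_le) le_rfl
        have := mul_le_mul_of_nonneg_left hu12 hC₂.le
        linarith
    _ = ENNReal.ofReal (I - C₃ * s ^ 3) +
          ENNReal.ofReal ((C₂ * Kp ^ 2 + C₃ + C₄) * s ^ 3) := by
        rw [add_assoc, ← ENNReal.ofReal_add (by positivity) (by positivity), ← add_mul]
    _ ≤ _ := add_le_add hlo le_rfl

end Comparison

end StiefelKL

/-! ### Proof of the theorem -/

open StiefelKL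

theorem theorem1 {d k : ℕ} (hk : 0 < k) (hkd : k < d)
    (U : StiefelKL.MatSpace d k) (hU : U ∈ StiefelKL.stiefel d k)
    (φ : StiefelKL.tangent U → StiefelKL.MatSpace d k)
    (hφ : StiefelKL.IsSecondOrderRetraction U φ)
    (hφ_fin : ∃ σ : ℝ, 0 < σ ∧
      klDiv ((stdGaussian (StiefelKL.tangent U)).map fun ξ => φ (σ • ξ))
        (StiefelKL.uniformStiefel d k) ≠ ⊤) :
    -- second-order expansion of the polar projection, with discrepancy `Δ`
    ((fun z : StiefelKL.tangent U × StiefelKL.normal U =>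
        StiefelKL.polar (U + (z.1 : StiefelKL.MatSpace d k) + (z.2 : StiefelKL.MatSpace d k)) -
          (StiefelKL.secondOrder U z.1 + (StiefelKL.delta hU z.1 z.2 : StiefelKL.MatSpace d k)))
      =O[𝓝 0] fun z => ‖z‖ ^ 3) ∧
    -- variance inflation and strict positivity of the penalty
    (∀ (covT : StiefelKL.tangent U →L[ℝ] StiefelKL.tangent U)
        (covN : StiefelKL.normal U →L[ℝ] StiefelKL.normal U),
      covT.IsPositive → Function.Injective covT → covN.IsPositive →
      (∀ v : StiefelKL.tangent U,
        Var[fun ζ => ⟪v, StiefelKL.tanPart U ζ⟫;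
            StiefelKL.gaussian (StiefelKL.ambientCov covT covN)] ≤
          Var[fun ζ => ⟪v, StiefelKL.projCoord hU ζ⟫;
            StiefelKL.gaussian (StiefelKL.ambientCov covT covN)]) ∧
      (covN ≠ 0 → ∃ v : StiefelKL.tangent U,
        Var[fun ζ => ⟪v, StiefelKL.tanPart U ζ⟫;
            StiefelKL.gaussian (StiefelKL.ambientCov covT covN)] <
          Var[fun ζ => ⟪v, StiefelKL.projCoord hU ζ⟫;
            StiefelKL.gaussian (StiefelKL.ambientCov covT covN)]) ∧
      0 ≤ StiefelKL.penalty hU covT covN ∧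
      (StiefelKL.penalty hU covT covN = 0 ↔ covN = 0)) ∧
    -- comparison of the Kullback-Leibler divergences
    (∀ a M : ℝ, 0 < a → ∃ C δ : ℝ, 0 < C ∧ 0 < δ ∧
      ∀ (ℓ : StiefelKL.MatSpace d k → ℝ) (ε : ℝ)
        (covT : StiefelKL.tangent U →L[ℝ] StiefelKL.tangent U)
        (covN : StiefelKL.normal U →L[ℝ] StiefelKL.normal U),
      StiefelKL.IsConcentratedPotential a M U ℓ → 0 < ε →
      StiefelKL.IsInverseHessian ℓ ε U covT → covN.IsPositive →
      ‖StiefelKL.ambientCov covT covN‖ ≤ δ →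
      klDiv (StiefelKL.qTang φ covT) (StiefelKL.posterior ℓ ε) ≠ ⊤ ∧
      klDiv (StiefelKL.qTang φ covT) (StiefelKL.posterior ℓ ε) +
          ENNReal.ofReal (StiefelKL.penalty hU covT covN) ≤
        klDiv (StiefelKL.qProj U covT covN) (StiefelKL.posterior ℓ ε) +
          ENNReal.ofReal (C * ‖StiefelKL.ambientCov covT covN‖ ^ (3 / 2 : ℝ)) ∧
      (covN = 0 →
        klDiv (StiefelKL.qProj U covT covN) (StiefelKL.posterior ℓ ε) ≤
          klDiv (StiefelKL.qTang φ covT) (StiefelKL.posterior ℓ ε) +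
            ENNReal.ofReal (C * ‖StiefelKL.ambientCov covT covN‖ ^ (3 / 2 : ℝ)))) := by
  refine ⟨polar_isBigO hU, fun covT covN hT hinj hN => ⟨fun v => variance_le hU hT hN v,
    fun hN0 => exists_variance_lt hkd hU hT hinj hN hN0, penalty_nonneg hU hT hinj hN,
    penalty_eq_zero_iff hkd hU hT hinj hN⟩, fun a M ha => ?_⟩
  -- the retraction against the polar projection of the ambient Gaussian
  obtain ⟨c, hc0, hc⟩ := exists_norm_delta_le hU
  obtain ⟨C₀, ρ₀, hC₀, hρ₀, hexp⟩ := polar_expansion hU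
  have hpm : Measurable fun z : tangent U × normal U =>
      polar (U + (z.1 : MatSpace d k) + (z.2 : MatSpace d k)) := by
    have : Measurable fun z : tangent U × normal U =>
        U + (z.1 : MatSpace d k) + (z.2 : MatSpace d k) := by fun_prop
    exact measurable_polar.comp this
  obtain ⟨C₁, δ₁, hC₁, hδ₁, h₁⟩ := exists_klDiv_qTang_le_klDiv_map hk hkd hU hφ hφ_fin ha M
    (G := fun ξ ν => polar (U + (ξ : MatSpace d k) + (ν : MatSpace d k)))
    (b := fun ξ ν => delta hU ξ ν) hpm (measurable_delta hU) (fun ξ ν => map_neg _ ν)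
    (c := c + 1) (by positivity) hC₀ hρ₀
    (fun ξ ν => ((delta hU ξ).le_of_opNorm_le (hc ξ) ν).trans (by gcongr; linarith)) hexp
  -- the retraction by polar projection, without a normal part, against `φ`
  obtain ⟨ρ, C, hρ, hC, hb⟩ := hφ.exists_bound
  have hφm : Measurable fun z : tangent U × normal U => φ z.1 :=
    hφ.smooth.continuous.measurable.comp measurable_fst
  obtain ⟨C₂, δ₂, hC₂, hδ₂, h₂⟩ := exists_klDiv_qTang_le_klDiv_map hk hkd hU
    (isSecondOrderRetraction_polar hU) (klDiv_polar_ne_top hU) ha M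
    (G := fun ξ _ => φ ξ) (b := fun _ _ => 0) hφm measurable_const (fun _ _ => neg_zero.symm)
    one_pos hC (half_pos hρ) (fun ξ ν => by rw [norm_zero]; positivity)
    (fun ξ ν hξ _ => ⟨hφ.mem_stiefel ξ, by
      rw [Submodule.coe_zero, add_zero]
      refine (hb ξ (by linarith)).1.trans ?_
      rw [pow_succ']
      gcongr
      exact le_max_left _ _⟩)
  refine ⟨C₁ + C₂, min δ₁ δ₂, by positivity, lt_min hδ₁ hδ₂, ?_⟩
  intro ℓ ε covT covN hℓ hε hinv hN hδ
  obtain ⟨hT, hfin, hle⟩ := h₁ ℓ ε covT covN hℓ hε hinv hN (hδ.trans (min_le_left _ _))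
  refine ⟨hfin, ?_, ?_⟩
  · rw [qProj_eq_map hT hN]
    refine hle.trans ?_
    gcongr
    linarith
  · rintro rfl
    obtain ⟨-, -, hle'⟩ := h₂ ℓ ε covT 0 hℓ hε hinv hN (hδ.trans (min_le_right _ _))
    rw [qProj_zero hT, ← map_prod_fst_eq_qTang hφ.smooth.continuous.measurable covT
      (0 : normal U →L[ℝ] normal U)]
    refine (le_self_add.trans hle').trans ?_
    gcongr
    linarith
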